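/- **Setting.** Let $0<L_0<L$, $l>0$, and let $\rho_j,\beta_j,k_j,\sigma_j,\lambda_j>0$ ($j=1,2$). Put $I_1=(0,L_0)$, $I_2=(L_0,L)$. For $\Phi=(\Phi^1,\Phi^2)$ with $\Phi^1=(\varphi,\psi,\omega)$ on $I_1$ and $\Phi^2=(u,v,w)$ on $I_2$, and for a triple $(\xi,\zeta,\eta)$, put $$Q_j=k_j(\xi_x+\zeta+l\eta),\qquad N_j=\sigma_j(\eta_x-l\xi),\qquad M_j=\lambda_j\zeta_x .$$ Let $R_j=\mathrm{diag}(\rho_j,\beta_j,\rho_j)$, $R=\mathrm{diag}(R_1,R_2)$, and let $(\cdot,\cdot)$ be the $L^2$ inner product. Let $H_v=[L^2(I_1)]^3\times[L^2(I_2)]^3$ with $\|\Phi\|_v^2=(R\Phi,\Phi)$, and $$H_d=\{\Phi\in[H^1(I_1)]^3\times[H^1(I_2)]^3:\ \Phi^1(0)=\Phi^2(L)=0,\ \Phi^1(L_0)=\Phi^2(L_0)\},\qquad \|\Phi\|_d^2=\sum_{j}\big(\|Q_j(\Phi^j)\|^2+\|N_j(\Phi^j)\|^2+\|M_j(\Phi^j)\|^2\big).$$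 The operator $A$ acts on the $j$-th part by $A\Phi=(-\partial_xQ_j-lN_j,\ -\partial_xM_j+Q_j,\ -\partial_xN_j+lQ_j)$, with $D(A)=\{\Phi\in H_d:\ \Phi^j\in [H^2(I_j)]^3,\ Q_1=Q_2,\ N_1=N_2,\ M_1=M_2 \text{ at } x=L_0\}$, and for $\Phi,B\in H_d$ $$a(\Phi,B)=(A^{1/2}\Phi,A^{1/2}B)=\sum_j\Big(\tfrac1{k_j}(Q_j(\Phi^j),Q_j(B^j))+\tfrac1{\sigma_j}(N_j(\Phi^j),N_j(B^j))+\tfrac1{\lambda_j}(M_j(\Phi^j),M_j(B^j))\Big).$$ Given $f_j,g_j,h_j:\mathbb R^3\to\mathbb R$ and $\gamma:\mathbb R\to\mathbb R$, let $F(\Phi)=\big((f_1,h_1,g_1)(\Phi^1),(f_2,h_2,g_2)(\Phi^2)\big)$ and $\Gamma(\Phi_t)=(0,\gamma(\psi_t),0,0,0,0)$. For $T>0$ consider on $[0,T]$ the problem $$R\Phi_{tt}+A\Phi+\Gamma(\Phi_t)+F(\Phi)=P,\qquad \Phi(0)=\Phi_0,\ \Phi_t(0)=\Phi_1. \tag{1}$$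 **Solutions.** Let $\Phi\in C([0,T];H_d)\cap C^1([0,T];H_v)$ with $\Phi(0)=\Phi_0$, $\Phi_t(0)=\Phi_1$. * $\Phi$ is a *strong solution* if $\Phi(t)\in D(A)$ for a.e. $t$; for all $0<a<b<T$, $\Phi$ is absolutely continuous on $[a,b]$ with values in $H_d$ with $\Phi_t\in L^1(a,b;H_d)$, and $\Phi_t$ is absolutely continuous on $[a,b]$ with values in $H_v$ with $\Phi_{tt}\in L^1(a,b;H_v)$; and the equation holds for a.e. $t$. * $\Phi$ is a *generalized solution* if there are strong solutions $\Phi^{(n)}$ on $[0,T]$, with initial data $(\Phi^{(n)}_0,\Phi^{(n)}_1)$ and loads $P^{(n)}\to P$ in $L^2(0,T;H_v)$, such that $\max_{t\in[0,T]}\big(\|\Phi^{(n)}(t)-\Phi(t)\|_d+\|\Phi^{(n)}_t(t)-\Phi_t(t)\|_v\big)\to0$. A function $\Phi\in L^\infty(0,T;H_d)$ with $\Phi_t\in L^\infty(0,T;H_v)$ and $\Phi(0)=\Phi_0$ is a *variational solution* if $\gamma(\psi_t)\in L^1((0,T)\times I_1)$ and $$-\int_0^T(R\Phi_t,B_t)\,dt-(R\Phi_1,B(0))+\int_0^Ta(\Phi,B)\,dt+\int_0^T(\Gamma(\Phi_t),B)\,dt+\int_0^T(F(\Phi),B)\,dt-\int_0^T(P,B)\,dt=0$$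 for every $B\in L^2(0,T;H_d)$ with $B_t\in L^2(0,T;H_v)$ and $B(T)=0$ for which the damping term is an absolutely convergent integral over $(0,T)\times I_1$ (in particular for every such $B$ that is bounded). **Theorem (Well-posedness).** Assume that * (N1) $f_j,g_j,h_j$ are Lipschitz on every ball of $\mathbb R^3$; * (N2) $(f_j,h_j,g_j)=\nabla\mathcal F_j$ for some $\mathcal F_j:\mathbb R^3\to\mathbb R$ with $\mathcal F_j\ge-\delta$ for some $\delta>0$; * (R1) $P\in L^2(0,T;H_v)$; * (D1) $\gamma$ is continuous and non-decreasing with $\gamma(0)=0$. Then for all $\Phi_0\in H_d$, $\Phi_1\in H_v$ and every $T>0$ problem (1) has a unique generalized solution on $[0,T]$. Moreover: * every generalized solution is variational; * $\gamma(\psi_t)\psi_t\in L^1((0,T)\times I_1)$, and for every $t\in[0,T]$ (in particular $t=T$) $$\mathcal E(t)+\int_0^t(\gamma(\psi_t),\psi_t)\,ds\le\mathcal E(0)+\int_0^t(P,\Phi_t)\,ds,\qquad \mathcal E(t)=\tfrac12\big[(R\Phi_t,\Phi_t)+a(\Phi,\Phi)\big]+\int_0^{L_0}\mathcal F_1(\Phi^1)\,dx+\int_{L_0}^{L}\mathcal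 F_2(\Phi^2)\,dx;$$ * if, in addition, $\Phi_0\in D(A)$, $\Phi_1\in H_d$ and (R2) $P_t\in L^2(0,T;H_v)$, then the generalized solution is strong and the energy relation holds with equality for every $t\in[0,T]$. -/

import Mathlib

open MeasureTheory Set Filter Topology

noncomputable section

namespace Bresse

/-- Values of the triples (transversal displacement, shear angle, longitudinal displacement). -/
abbrev E3 := EuclideanSpace ℝ (Fin 3)

/-- Parameters of the composite beam. Index `0` is the damped part `(0, L₀)`, index `1` the
undamped part `(L₀, L)`. -/
structure Params where
  L₀ : ℝ
  L : ℝ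
  l : ℝ
  ρ : Fin 2 → ℝ
  β : Fin 2 → ℝ
  k : Fin 2 → ℝ
  σ : Fin 2 → ℝ
  lam : Fin 2 → ℝ
  L₀_pos : 0 < L₀
  L₀_lt : L₀ < L
  l_pos : 0 < l
  ρ_pos : ∀ j, 0 < ρ j
  β_pos : ∀ j, 0 < β j
  k_pos : ∀ j, 0 < k j
  σ_pos : ∀ j, 0 < σ j
  lam_pos : ∀ j, 0 < lam j

/-- Left end of the `j`-th part. -/
def Params.lo (p : Params) (j : Fin 2) : ℝ := ![0, p.L₀] j

/-- Right end of the `j`-th part. -/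
def Params.hi (p : Params) (j : Fin 2) : ℝ := ![p.L₀, p.L] j

/-- `[L²(a,b)]³`. -/
abbrev L2 (a b : ℝ) := Lp E3 2 (volume.restrict (Ioo a b))

/-- The space `H_v` of pairs `(Φ¹, Φ²)`. Its topology is that of the standard `L²`-norm; the
weighted norm is `normV`. -/
abbrev Hv (p : Params) := PiLp 2 (fun j : Fin 2 => L2 (p.lo j) (p.hi j))

/-- `u ∈ [H¹(a,b)]³` with derivative `g ∈ [L²(a,b)]³`: `w` is the absolutely continuous
representative of `u` on `[a,b]`, i.e. `u = w` almost everywhere and `w` is a primitive of `g`. The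
boundary values of `u` are `w a` and `w b`. -/
def IsH1Rep (a b : ℝ) (u g : L2 a b) (w : ℝ → E3) : Prop :=
  (∀ᵐ x ∂(volume.restrict (Ioo a b)), u x = w x) ∧
    ∀ x ∈ Icc a b, w x = w a + ∫ y in a..x, g y

theorem L2.intervalIntegrable {a b : ℝ} (g : L2 a b) {x : ℝ} (hx : x ∈ Icc a b) :
    IntervalIntegrable (fun y => g y) volume a x := by
  have h : IntegrableOn (fun y => g y) (Ioo a b) :=
    (Lp.memLp g).integrable (by norm_num)
  rw [intervalIntegrable_iff_integrableOn_Ioo_of_le hx.1]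
  exact h.mono_set (Ioo_subset_Ioo_right hx.2)

theorem L2.intervalIntegral_congr {a b : ℝ} {u v : ℝ → E3}
    (h : ∀ᵐ y ∂(volume.restrict (Ioo a b)), u y = v y) {x : ℝ} (hx : x ∈ Icc a b) :
    ∫ y in a..x, u y = ∫ y in a..x, v y := by
  rw [intervalIntegral.integral_of_le hx.1, intervalIntegral.integral_of_le hx.1,
    integral_Ioc_eq_integral_Ioo, integral_Ioc_eq_integral_Ioo]
  exact integral_congr_ae
    (ae_mono (Measure.restrict_mono (Ioo_subset_Ioo_right hx.2) le_rfl) h)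

theorem IsH1Rep.zero (a b : ℝ) : IsH1Rep a b 0 0 0 := by
  refine ⟨?_, fun x hx => ?_⟩
  · filter_upwards [Lp.coeFn_zero E3 2 (volume.restrict (Ioo a b))] with x hx using hx
  · rw [L2.intervalIntegral_congr (Lp.coeFn_zero E3 2 (volume.restrict (Ioo a b))) hx]
    simp

theorem IsH1Rep.add {a b : ℝ} {u g u' g' : L2 a b} {w w' : ℝ → E3}
    (h : IsH1Rep a b u g w) (h' : IsH1Rep a b u' g' w') :
    IsH1Rep a b (u + u') (g + g') (w + w') := by
  refine ⟨?_, fun x hx => ?_⟩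
  · filter_upwards [h.1, h'.1, Lp.coeFn_add u u'] with x h1 h2 h3
    rw [h3, Pi.add_apply, Pi.add_apply, h1, h2]
  · rw [L2.intervalIntegral_congr (Lp.coeFn_add g g') hx]
    simp only [Pi.add_apply]
    rw [intervalIntegral.integral_add (L2.intervalIntegrable g hx)
      (L2.intervalIntegrable g' hx), h.2 x hx, h'.2 x hx]
    abel

theorem IsH1Rep.smul {a b : ℝ} {u g : L2 a b} {w : ℝ → E3} (c : ℝ)
    (h : IsH1Rep a b u g w) : IsH1Rep a b (c • u) (c • g) (c • w) := by
  refine ⟨?_, fun x hx => ?_⟩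
  · filter_upwards [h.1, Lp.coeFn_smul c u] with x h1 h3
    rw [h3, Pi.smul_apply, Pi.smul_apply, h1]
  · rw [L2.intervalIntegral_congr (Lp.coeFn_smul c g) hx]
    simp only [Pi.smul_apply]
    rw [intervalIntegral.integral_smul, h.2 x hx, smul_add]

/-- The space `H_d`, an element `Φ` being stored together with its weak derivative `Φ_x`, so that
the topology is that of the standard `H¹`-norm; the energy-type norm is `normD`. -/
def Hd (p : Params) : Submodule ℝ (WithLp 2 (Hv p × Hv p)) where
  carrier := {z | ∃ w : Fin 2 → ℝ → E3,
    (∀ j, IsH1Rep (p.lo j) (p.hi j) (z.fst j) (z.snd j) (w j)) ∧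
      w 0 0 = 0 ∧ w 1 p.L = 0 ∧ w 0 p.L₀ = w 1 p.L₀}
  zero_mem' := ⟨0, fun j => IsH1Rep.zero _ _, rfl, rfl, rfl⟩
  add_mem' := by
    rintro z z' ⟨w, h, h0, h1, h2⟩ ⟨w', h', h0', h1', h2'⟩
    exact ⟨w + w', fun j => (h j).add (h' j), by simp [h0, h0'], by simp [h1, h1'],
      by simp [h2, h2']⟩
  smul_mem' := by
    rintro c z ⟨w, h, h0, h1, h2⟩
    exact ⟨c • w, fun j => (h j).smul c, by simp [h0], by simp [h1], by simp [h2]⟩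

/-- The embedding `H_d ⊂ H_v`. -/
def toHv {p : Params} (Φ : Hd p) : Hv p := (Φ : WithLp 2 (Hv p × Hv p)).fst

/-- The derivative `Φ_x` of `Φ ∈ H_d`. -/
def dX {p : Params} (Φ : Hd p) : Hv p := (Φ : WithLp 2 (Hv p × Hv p)).snd

/-- Shear force `Q_j = k_j (ξ_x + ζ + l η)` at a point, where `v` is the value of `(ξ, ζ, η)` and `d`
that of its derivative. -/
def Q (p : Params) (j : Fin 2) (v d : E3) : ℝ := p.k j * (d 0 + v 1 + p.l * v 2)

/-- Axial force `N_j = σ_j (η_x - l ξ)`. -/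
def N (p : Params) (j : Fin 2) (v d : E3) : ℝ := p.σ j * (d 2 - p.l * v 0)

/-- Bending moment `M_j = λ_j ζ_x`. -/
def M (p : Params) (j : Fin 2) (_v d : E3) : ℝ := p.lam j * d 1

/-- `R_j v` with `R_j = diag (ρ_j, β_j, ρ_j)`. -/
def Rmul (p : Params) (j : Fin 2) (v : E3) : E3 :=
  !₂[p.ρ j * v 0, p.β j * v 1, p.ρ j * v 2]

/-- The `L²` inner product `(Φ, Ψ)`. -/
def ip {p : Params} (Φ Ψ : Hv p) : ℝ :=
  ∑ j, ∫ x in Ioo (p.lo j) (p.hi j), inner ℝ (Φ j x) (Ψ j x)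

/-- `(R Φ, Ψ)`. -/
def ipR {p : Params} (Φ Ψ : Hv p) : ℝ :=
  ∑ j, ∫ x in Ioo (p.lo j) (p.hi j), inner ℝ (Rmul p j (Φ j x)) (Ψ j x)

/-- `‖Φ‖_v = (∑ ‖√R_j Φ^j‖²)^(1/2)`. -/
def normV {p : Params} (Φ : Hv p) : ℝ := √(ipR Φ Φ)

/-- `‖Φ‖_d = (∑ (‖Q_j‖² + ‖N_j‖² + ‖M_j‖²))^(1/2)`. -/
def normD {p : Params} (Φ : Hd p) : ℝ :=
  √(∑ j, ∫ x in Ioo (p.lo j) (p.hi j),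
    ((Q p j (toHv Φ j x) (dX Φ j x)) ^ 2 + (N p j (toHv Φ j x) (dX Φ j x)) ^ 2 +
      (M p j (toHv Φ j x) (dX Φ j x)) ^ 2))

/-- The bilinear form `(A^{1/2} Φ, A^{1/2} B)` on `H_d`. -/
def formA {p : Params} (Φ B : Hd p) : ℝ :=
  ∑ j, ∫ x in Ioo (p.lo j) (p.hi j),
    (1 / p.k j * (Q p j (toHv Φ j x) (dX Φ j x) * Q p j (toHv B j x) (dX B j x)) +
      1 / p.σ j * (N p j (toHv Φ j x) (dX Φ j x) * N p j (toHv B j x) (dX B j x)) +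
      1 / p.lam j * (M p j (toHv Φ j x) (dX Φ j x) * M p j (toHv B j x) (dX B j x)))

/-- `Φ ∈ D(A)` with second derivative `Φ_xx = S`: both parts of `Φ` are of class `H²` and the forces
match at `L₀`. Here `w` and `g` are the continuous representatives of `Φ` and `Φ_x`. -/
def InDomA {p : Params} (Φ : Hd p) (S : Hv p) : Prop :=
  ∃ w g : Fin 2 → ℝ → E3,
    (∀ j, IsH1Rep (p.lo j) (p.hi j) (toHv Φ j) (dX Φ j) (w j)) ∧
    (∀ j, IsH1Rep (p.lo j) (p.hi j) (dX Φ j) (S j) (g j)) ∧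
    Q p 0 (w 0 p.L₀) (g 0 p.L₀) = Q p 1 (w 1 p.L₀) (g 1 p.L₀) ∧
    N p 0 (w 0 p.L₀) (g 0 p.L₀) = N p 1 (w 1 p.L₀) (g 1 p.L₀) ∧
    M p 0 (w 0 p.L₀) (g 0 p.L₀) = M p 1 (w 1 p.L₀) (g 1 p.L₀)

/-- The `j`-th part `(-∂ₓQ - lN, -∂ₓM + Q, -∂ₓN + lQ)` of `A Φ` at a point, where `v, d, s` are the
values of `Φ, Φ_x, Φ_xx`. Since `Q, N, M` are linear with constant coefficients,
`∂ₓ Q(Φ, Φ_x) = Q(Φ_x, Φ_xx)`, and likewise for `N` and `M`. -/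
def opA (p : Params) (j : Fin 2) (v d s : E3) : E3 :=
  !₂[-(Q p j d s) - p.l * N p j v d,
     -(M p j d s) + Q p j v d,
     -(N p j d s) + p.l * Q p j v d]

/-- The damping `Γ` at a point: it acts on the shear angle of the first part only. -/
def damping (γ : ℝ → ℝ) (j : Fin 2) (v : E3) : E3 :=
  if j = 0 then !₂[0, γ (v 1), 0] else 0

/-- The nonlinear feedback acting on (transversal, shear angle, longitudinal) components. -/
def feedback (f g h : Fin 2 → E3 → ℝ) (j : Fin 2) (a : E3) : E3 := !₂[f j a, h j a, g j a]

/-- Lipschitz on every ball. -/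
def LipOnBalls (f : E3 → ℝ) : Prop :=
  ∀ K : ℝ, ∃ C : ℝ, ∀ a b : E3, ‖a‖ ≤ K → ‖b‖ ≤ K → |f a - f b| ≤ C * ‖a - b‖

/-- Lebesgue measure on the time interval `(0,T)`. -/
def timeMeasure (T : ℝ) : Measure ℝ := volume.restrict (Ioo 0 T)

/-- `u`, a function on `(0,T)` determined up to null sets, is an absolutely continuous function with
derivative `v` and initial value `u₀`. -/
def HasTimeDeriv {p : Params} (T : ℝ) (u v : ℝ → Hv p) (u₀ : Hv p) : Prop :=
  ∀ᵐ t ∂(timeMeasure T), u t = u₀ + ∫ s in (0 : ℝ)..t, v s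

/-- `Φ ∈ C([0,T]; H_d) ∩ C¹([0,T]; H_v)`, `Φ_t = V`, with initial data `(Φ₀, Φ₁)`. -/
structure InSolClass {p : Params} (T : ℝ) (Φ₀ : Hd p) (Φ₁ : Hv p)
    (Φ : ℝ → Hd p) (V : ℝ → Hv p) : Prop where
  cont : ContinuousOn Φ (Icc 0 T)
  cont_vel : ContinuousOn V (Icc 0 T)
  deriv : ∀ t ∈ Icc 0 T, HasDerivWithinAt (fun s => toHv (Φ s)) (V t) (Icc 0 T) t
  init : Φ 0 = Φ₀
  init_vel : V 0 = Φ₁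

/-- Strong solutions. `W` and `Z` are `Φ_t` as an `H_d`-valued function and `Φ_tt`. -/
structure IsStrong (p : Params) (f g h : Fin 2 → E3 → ℝ) (γ : ℝ → ℝ) (T : ℝ) (P : ℝ → Hv p)
    (Φ₀ : Hd p) (Φ₁ : Hv p) (Φ : ℝ → Hd p) (V : ℝ → Hv p) : Prop where
  mem : InSolClass T Φ₀ Φ₁ Φ V
  ac : ∃ W : ℝ → Hd p, ∀ a b : ℝ, 0 < a → a < b → b < T →
    IntervalIntegrable W volume a b ∧ Φ b = Φ a + ∫ t in a..b, W t
  eqn : ∃ Z : ℝ → Hv p,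
    (∀ a b : ℝ, 0 < a → a < b → b < T →
      IntervalIntegrable Z volume a b ∧ V b = V a + ∫ t in a..b, Z t) ∧
    ∀ᵐ t ∂(timeMeasure T), ∃ S : Hv p, InDomA (Φ t) S ∧
      ∀ j, ∀ᵐ x ∂(volume.restrict (Ioo (p.lo j) (p.hi j))),
        Rmul p j (Z t j x) + opA p j (toHv (Φ t) j x) (dX (Φ t) j x) (S j x) +
          damping γ j (V t j x) + feedback f g h j (toHv (Φ t) j x) = P t j x

/-- Generalized solutions: uniform limits on `[0,T]` of strong solutions whose loads converge to `P`
in `L²(0,T;H_v)`. -/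
structure IsGeneralized (p : Params) (f g h : Fin 2 → E3 → ℝ) (γ : ℝ → ℝ) (T : ℝ) (P : ℝ → Hv p)
    (Φ₀ : Hd p) (Φ₁ : Hv p) (Φ : ℝ → Hd p) (V : ℝ → Hv p) : Prop where
  mem : InSolClass T Φ₀ Φ₁ Φ V
  approx : ∃ (Φn : ℕ → ℝ → Hd p) (Vn : ℕ → ℝ → Hv p) (Pn : ℕ → ℝ → Hv p)
      (Φ₀n : ℕ → Hd p) (Φ₁n : ℕ → Hv p),
    (∀ n, MemLp (Pn n) 2 (timeMeasure T)) ∧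
    (∀ n, IsStrong p f g h γ T (Pn n) (Φ₀n n) (Φ₁n n) (Φn n) (Vn n)) ∧
    Tendsto (fun n => eLpNorm (fun t => Pn n t - P t) 2 (timeMeasure T)) atTop (𝓝 0) ∧
    ∀ ε > 0, ∀ᶠ n in atTop, ∀ t ∈ Icc 0 T,
      normD (Φn n t - Φ t) + normV (Vn n t - V t) < ε

/-- `∫₀ᵀ∫₀^{L₀} |γ(ψ_t) b| dx dt < ∞` where `ψ_t` and `b` are the shear angle components of `V` and
`B` on the first part. The iterated integral depends only on the `L²`-classes `V t`, `B t`. -/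
def DampingIntegrable {p : Params} (γ : ℝ → ℝ) (T : ℝ) (V B : ℝ → Hv p) : Prop :=
  ∫⁻ t in Ioo 0 T, ∫⁻ x in Ioo 0 p.L₀, ‖γ (V t 0 x 1) * B t 0 x 1‖ₑ < ⊤

/-- The test space `F_T`: `B ∈ L²(0,T;H_d)`, `B_t ∈ L²(0,T;H_v)`, `B(0) = B₀`, `B(T) = 0`. -/
structure IsTest {p : Params} (T : ℝ) (B : ℝ → Hd p) (Bt : ℝ → Hv p) (B₀ : Hv p) : Prop where
  mem : MemLp B 2 (timeMeasure T)
  mem_deriv : MemLp Bt 2 (timeMeasure T)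
  deriv : HasTimeDeriv T (fun t => toHv (B t)) Bt B₀
  final : B₀ + ∫ s in (0 : ℝ)..T, Bt s = 0

/-- Variational solutions, `V` being `Φ_t`. The identity is required for all test functions for
which the damping term is a convergent integral; `γ(ψ_t)` itself has to be integrable, so that these
include all bounded test functions. -/
structure IsVariational (p : Params) (f g h : Fin 2 → E3 → ℝ) (γ : ℝ → ℝ) (T : ℝ) (P : ℝ → Hv p)
    (Φ₀ : Hd p) (Φ₁ : Hv p) (Φ : ℝ → Hd p) (V : ℝ → Hv p) : Prop where
  mem : MemLp Φ ⊤ (timeMeasure T)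
  mem_vel : MemLp V ⊤ (timeMeasure T)
  deriv : HasTimeDeriv T (fun t => toHv (Φ t)) V (toHv Φ₀)
  damping_int : ∫⁻ t in Ioo 0 T, ∫⁻ x in Ioo 0 p.L₀, ‖γ (V t 0 x 1)‖ₑ < ⊤
  eqn : ∀ (B : ℝ → Hd p) (Bt : ℝ → Hv p) (B₀ : Hv p), IsTest T B Bt B₀ →
    DampingIntegrable γ T V (fun t => toHv (B t)) →
    -(∫ t in (0 : ℝ)..T, ipR (V t) (Bt t)) - ipR Φ₁ B₀ + (∫ t in (0 : ℝ)..T, formA (Φ t) (B t)) +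
      (∫ t in (0 : ℝ)..T, ∑ j, ∫ x in Ioo (p.lo j) (p.hi j),
        inner ℝ (damping γ j (V t j x)) (toHv (B t) j x)) +
      (∫ t in (0 : ℝ)..T, ∑ j, ∫ x in Ioo (p.lo j) (p.hi j),
        inner ℝ (feedback f g h j (toHv (Φ t) j x)) (toHv (B t) j x)) -
      (∫ t in (0 : ℝ)..T, ip (P t) (toHv (B t))) = 0

/-- The energy; `pot j` is the potential of the feedback on the `j`-th part. -/
def energy {p : Params} (pot : Fin 2 → E3 → ℝ) (Φ : Hd p) (V : Hv p) : ℝ :=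
  1 / 2 * (ipR V V + formA Φ Φ) + ∑ j, ∫ x in Ioo (p.lo j) (p.hi j), pot j (toHv Φ j x)

/-- `∫₀ᵗ (γ(ψ_t), ψ_t) ds`. -/
def dissipation {p : Params} (γ : ℝ → ℝ) (V : ℝ → Hv p) (t : ℝ) : ℝ :=
  ∫ s in (0 : ℝ)..t, ∫ x in Ioo 0 p.L₀, γ (V s 0 x 1) * V s 0 x 1

/-- `∫₀ᵗ (P, Φ_t) ds`. -/
def work {p : Params} (P V : ℝ → Hv p) (t : ℝ) : ℝ := ∫ s in (0 : ℝ)..t, ip (P s) (V s)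

end Bresse

end

open MeasureTheory Set Filter Topology

noncomputable section

namespace Bresse

/-! ### Gronwall inequalities in integral form -/

section Gronwall

/-! The proof is nonlinear semigroup theory combined with truncation. For the pair (Φ, Φ_t) in H_d ×
H_v with the energy inner product a(·,·) + (R·,·), the elastic part is skew and the damping is
monotone, so the problem reads u' + 𝒜u + Bu = f with 𝒜 maximal monotone and B the feedback. The
range condition for 𝒜 is a nonlinear elliptic problem, the Euler equation of a uniformly convex
functional that contains the potential of γ (`exists_resolvent`). No growth of γ is assumed: in one
space dimension H_d consists of bounded functions (`exists_sup_bound`). For a globally Lipschitz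
feedback and a continuous load of bounded variation, Yosida approximation gives strong solutions
whenever the initial datum lies in the domain (`exists_strong_evolution`,
`exists_second_order_evolution`).

A locally Lipschitz feedback is first truncated outside a ball. The energy identity and the lower
bound on the potentials bound the solution independently of the truncation (`exists_apriori_bound`),
and a continuation argument (`norm_le_of_forall_lt`) shows that the truncation is never felt
(`exists_isStrong`).

In the difference of two strong solutions the damping has a sign, so a Gronwall argument bounds the
difference by the initial data in the energy norm and by the loads in L¹
(`Assumptions.exists_comparison`). With the density of regular data this yields existence and
uniqueness of generalized solutions. A strong solution is generalized, so uniqueness also shows that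
regular data produce strong solutions.

The remaining claims follow from passing to the limit in strong solutions. Energy and work converge,
while Fatou's lemma gives only lower semicontinuity of the dissipation, hence an energy inequality
(`Assumptions.energy_le`). For the variational identity the delicate term is γ(ψ_t). Since |γ(s)| ≤
γ(s)s/K for |s| ≥ K, bounded dissipation makes γ(ψ_t) uniformly integrable, which suffices for test
functions with bounded shear component (`tendsto_integral_pairing`). Any other admissible test
function B is approximated by K arctan(B/K), taken componentwise; chain rules in x and in t keep it
in the test space, and dominated convergence finishes the proof (`Assumptions.identity`). -/

theorem le_mul_exp_of_le_add_integral {φ : ℝ → ℝ} {a b c L : ℝ} (hL : 0 ≤ L)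
    (hφ : ContinuousOn φ (Icc a b))
    (h : ∀ t ∈ Icc a b, φ t ≤ c + L * ∫ s in a..t, φ s) :
    ∀ t ∈ Icc a b, φ t ≤ c * Real.exp (L * (t - a)) := by
  intro t ht
  have hab : a ≤ b := ht.1.trans ht.2
  -- The constant extension beyond the interval has a primitive that is differentiable at every real
  -- point, endpoints included.
  set ψ : ℝ → ℝ := IccExtend hab ((Icc a b).domRestrict φ) with hψdef
  have hψc : Continuous ψ := by
    rw [hψdef]; exact (continuousOn_iff_continuous_domRestrict.1 hφ).Icc_extend'
  have hψ : ∀ s ∈ Icc a b, ψ s = φ s := fun s hs => by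
    rw [hψdef, IccExtend_of_mem _ _ hs]; rfl
  have hint : ∀ t ∈ Icc a b, ∫ s in a..t, φ s = ∫ s in a..t, ψ s := fun t ht =>
    intervalIntegral.integral_congr fun s hs => by
      rw [uIcc_of_le ht.1] at hs
      exact (hψ s ⟨hs.1, hs.2.trans ht.2⟩).symm
  have hd : ∀ t, HasDerivAt (fun t => c + L * ∫ s in a..t, ψ s) (L * ψ t) t := fun t =>
    ((intervalIntegral.integral_hasDerivAt_right (hψc.intervalIntegrable _ _)
      (hψc.stronglyMeasurableAtFilter _ _) hψc.continuousAt).const_mul L).const_add c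
  -- The differential Gronwall lemma is applied to the right-hand side c + L∫φ, which is
  -- differentiable, and not to φ.
  have key := le_gronwallBound_of_liminf_deriv_right_le (f := fun t => c + L * ∫ s in a..t, ψ s)
    (f' := fun t => L * ψ t) (δ := c) (K := L) (ε := 0) (a := a) (b := b)
    (fun t _ => (hd t).continuousAt.continuousWithinAt)
    (fun x _ r hr => (hd x).hasDerivWithinAt.liminf_right_slope_le hr) (by simp)
    (fun x hx => by
      have := h x ⟨hx.1, hx.2.le⟩
      rw [hint x ⟨hx.1, hx.2.le⟩, ← hψ x ⟨hx.1, hx.2.le⟩] at this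
      rw [add_zero]
      exact mul_le_mul_of_nonneg_left this hL) t ht
  rw [gronwallBound_ε0] at key
  exact (h t ht).trans (by rw [hint t ht]; exact key)

/-- At a maximum point with value M the term 2ψφ is at most 2Mψ, so Gronwall for φ² gives M² ≤ (φ₀²
+ 2M∫ψ)e^{2LT}. Either M ≤ φ₀, or one factor M can be cancelled. The outcome is linear in φ₀ and ∫ψ,
as the energy estimates below require. -/
theorem le_of_sq_le_add_integral {φ ψ : ℝ → ℝ} {T L φ₀ : ℝ} (hL : 0 ≤ L)
    (h0 : 0 ≤ φ₀) (hφ : ContinuousOn φ (Icc 0 T)) (hφ0 : ∀ t ∈ Icc 0 T, 0 ≤ φ t)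
    (hψ : IntervalIntegrable ψ volume 0 T) (hψ0 : ∀ t, 0 ≤ ψ t)
    (h : ∀ t ∈ Icc 0 T, φ t ^ 2 ≤ φ₀ ^ 2 + ∫ s in (0 : ℝ)..t, (2 * L * φ s ^ 2 + 2 * ψ s * φ s)) :
    ∀ t ∈ Icc 0 T, φ t ≤ Real.exp (2 * L * T) * (φ₀ + 2 * ∫ s in (0 : ℝ)..T, ψ s) := by
  intro t ht
  have hT : 0 ≤ T := ht.1.trans ht.2
  obtain ⟨m, hm, hmax⟩ := isCompact_Icc.exists_isMaxOn ⟨t, ht⟩ hφ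
  set M := φ m with hM
  have hM0 : 0 ≤ M := hφ0 m hm
  set I := ∫ s in (0 : ℝ)..T, ψ s with hI
  have hI0 : 0 ≤ I := intervalIntegral.integral_nonneg hT fun s _ => hψ0 s
  have hφ2 : ContinuousOn (fun s => φ s ^ 2) (Icc 0 T) := hφ.pow 2
  have sub : ∀ t ∈ Icc 0 T, uIcc 0 t ⊆ Icc 0 T := fun t ht => by
    rw [uIcc_of_le ht.1]; exact Icc_subset_Icc_right ht.2
  have step : ∀ t ∈ Icc 0 T, φ t ^ 2 ≤ (φ₀ ^ 2 + 2 * M * I) + 2 * L * ∫ s in (0 : ℝ)..t, φ s ^ 2 := by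
    intro t ht
    have hψt : IntervalIntegrable ψ volume 0 t :=
      hψ.mono_set (by rw [uIcc_of_le hT]; exact sub t ht)
    have i1 : IntervalIntegrable (fun s => 2 * L * φ s ^ 2) volume 0 t :=
      ((hφ2.mono (sub t ht)).intervalIntegrable).const_mul _
    have i2 : IntervalIntegrable (fun s => 2 * ψ s * φ s) volume 0 t :=
      (hψt.const_mul 2).mul_continuousOn (hφ.mono (sub t ht))
    have e1 : ∫ s in (0 : ℝ)..t, 2 * ψ s * φ s ≤ ∫ s in (0 : ℝ)..t, 2 * M * ψ s := by
      refine intervalIntegral.integral_mono_on ht.1 i2 (hψt.const_mul _) fun s hs => ?_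
      have : φ s ≤ M := hmax ⟨hs.1, hs.2.trans ht.2⟩
      nlinarith [hψ0 s]
    have e2 : ∫ s in (0 : ℝ)..t, ψ s ≤ I :=
      intervalIntegral.integral_mono_interval le_rfl ht.1 ht.2
        (Eventually.of_forall hψ0) hψ
    have := h t ht
    rw [intervalIntegral.integral_add i1 i2, intervalIntegral.integral_const_mul] at this
    rw [intervalIntegral.integral_const_mul] at e1
    nlinarith
  have g := le_mul_exp_of_le_add_integral (by positivity) hφ2 step m hm
  have he : Real.exp (2 * L * (m - 0)) ≤ Real.exp (2 * L * T) := by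
    apply Real.exp_le_exp.2
    have := hm.2
    nlinarith
  have he1 : 1 ≤ Real.exp (2 * L * T) := Real.one_le_exp (by positivity)
  set e := Real.exp (2 * L * T) with hedef
  refine (hmax ht : φ t ≤ M).trans ?_
  rcases le_or_gt M φ₀ with hle | hlt
  · nlinarith
  · have hMpos : 0 < M := h0.trans_lt hlt
    have : M ^ 2 ≤ (φ₀ ^ 2 + 2 * M * I) * e :=
      g.trans (mul_le_mul_of_nonneg_left he (by positivity))
    have h3 : M * M ≤ M * (e * (φ₀ + 2 * I)) := by
      have : φ₀ ^ 2 ≤ φ₀ * M := by nlinarith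
      nlinarith
    exact le_of_mul_le_mul_left h3 hMpos

end Gronwall

/-! ### Absolutely continuous functions with values in Banach spaces -/

section AbsolutelyContinuous

variable {E F G : Type*} [NormedAddCommGroup E] [NormedSpace ℝ E]
  [NormedAddCommGroup F] [NormedSpace ℝ F] [NormedAddCommGroup G] [NormedSpace ℝ G]

/-- The increments of f over a disjoint family of intervals are dominated by those of the primitive
of m, which is absolutely continuous. -/
theorem absolutelyContinuousOnInterval_of_dist_le {X : Type*} [PseudoMetricSpace X] {f : ℝ → X}
    {m : ℝ → ℝ} {a b : ℝ} (hm : IntervalIntegrable m volume a b)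
    (h : ∀ s ∈ uIcc a b, ∀ t ∈ uIcc a b, dist (f s) (f t) ≤ |∫ r in s..t, m r|) :
    AbsolutelyContinuousOnInterval f a b := by
  have hM := hm.absolutelyContinuousOnInterval_intervalIntegral (c := a) left_mem_uIcc
  refine squeeze_zero' (Eventually.of_forall fun E => Finset.sum_nonneg fun _ _ => dist_nonneg)
    ?_ hM
  have : ∀ᶠ (E : ℕ × (ℕ → ℝ × ℝ)) in AbsolutelyContinuousOnInterval.totalLengthFilter ⊓
      𝓟 (AbsolutelyContinuousOnInterval.disjWithin a b),
      E ∈ AbsolutelyContinuousOnInterval.disjWithin a b :=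
    eventually_inf_principal.mpr (by simp)
  filter_upwards [this] with E hE
  refine Finset.sum_le_sum fun i hi => ?_
  have h1 := (hE.1 i hi).1
  have h2 := (hE.1 i hi).2
  refine (h _ h1 _ h2).trans (le_of_eq ?_)
  rw [dist_comm, Real.dist_eq, intervalIntegral.integral_interval_sub_left]
  · exact hm.mono_set (uIcc_subset_uIcc_left h2)
  · exact hm.mono_set (uIcc_subset_uIcc_left h1)

theorem dist_integral_le {f : ℝ → E} {a b : ℝ} (hf : IntervalIntegrable f volume a b) (c : E)
    {s t : ℝ} (hs : s ∈ uIcc a b) (ht : t ∈ uIcc a b) :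
    dist (c + ∫ r in a..s, f r) (c + ∫ r in a..t, f r) ≤ |∫ r in s..t, ‖f r‖| := by
  rw [dist_add_left, dist_comm, dist_eq_norm, intervalIntegral.integral_interval_sub_left]
  · exact intervalIntegral.norm_integral_le_abs_integral_norm
  · exact hf.mono_set (uIcc_subset_uIcc_left ht)
  · exact hf.mono_set (uIcc_subset_uIcc_left hs)

theorem absolutelyContinuousOnInterval_primitive {f : ℝ → E} {a b : ℝ}
    (hf : IntervalIntegrable f volume a b) (c : E) :
    AbsolutelyContinuousOnInterval (fun t => c + ∫ r in a..t, f r) a b :=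
  absolutelyContinuousOnInterval_of_dist_le hf.norm fun _ hs _ ht => dist_integral_le hf c hs ht

/-- The difference of f and the primitive of f' is absolutely continuous with zero derivative almost
everywhere, hence constant. -/
theorem integral_eq_sub_of_absolutelyContinuous [CompleteSpace F] {f f' : ℝ → F} {a b : ℝ}
    (hf : AbsolutelyContinuousOnInterval f a b) (hf' : IntervalIntegrable f' volume a b)
    (hd : ∀ᵐ x, x ∈ uIcc a b → HasDerivAt f (f' x) x) :
    ∫ x in a..b, f' x = f b - f a := by
  have hp := absolutelyContinuousOnInterval_primitive hf' 0
  have hz : ∀ᵐ x, x ∈ uIcc a b → HasDerivAt (fun t => f t - (0 + ∫ r in a..t, f' r)) 0 x := by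
    filter_upwards [hd, hf'.ae_hasDerivAt_integral] with x h1 h2 hx
    simpa using (h1 hx).fun_sub ((h2 hx a left_mem_uIcc).const_add 0)
  obtain ⟨C, hC⟩ := (hf.fun_sub hp).const_of_ae_hasDerivAt_zero hz
  have ha := hC a left_mem_uIcc
  have hb := hC b right_mem_uIcc
  simp only [intervalIntegral.integral_same, add_zero, sub_zero, zero_add] at ha hb
  rw [ha, ← hb]; abel

/-- Integration by parts for primitives with values in Banach spaces. -/
theorem integral_bilinear_primitive [CompleteSpace E] [CompleteSpace F] [CompleteSpace G]
    (B : E →L[ℝ] F →L[ℝ] G)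
    {u f : ℝ → E} {v g : ℝ → F} {a b : ℝ} (hab : a ≤ b)
    (hf : IntervalIntegrable f volume a b) (hg : IntervalIntegrable g volume a b)
    (hu : ∀ t ∈ Icc a b, u t = u a + ∫ r in a..t, f r)
    (hv : ∀ t ∈ Icc a b, v t = v a + ∫ r in a..t, g r) :
    IntervalIntegrable (fun t => B (f t) (v t) + B (u t) (g t)) volume a b ∧
      ∫ t in a..b, (B (f t) (v t) + B (u t) (g t)) = B (u b) (v b) - B (u a) (v a) := by
  set u' : ℝ → E := fun t => u a + ∫ r in a..t, f r with hu'
  set v' : ℝ → F := fun t => v a + ∫ r in a..t, g r with hv'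
  have au := absolutelyContinuousOnInterval_primitive hf (u a)
  have av := absolutelyContinuousOnInterval_primitive hg (v a)
  have cu : ContinuousOn u' (uIcc a b) := au.continuousOn
  have cv : ContinuousOn v' (uIcc a b) := av.continuousOn
  obtain ⟨Mu, hMu⟩ := au.exists_bound
  obtain ⟨Mv, hMv⟩ := av.exists_bound
  have i1 : ∀ {w : ℝ → F}, ContinuousOn w (uIcc a b) →
      IntervalIntegrable (fun t => B (f t) (w t)) volume a b := by
    intro w hw
    obtain ⟨C, hC⟩ := isCompact_uIcc.exists_bound_of_continuousOn hw
    refine (hf.norm.const_mul (‖B‖ * C)).mono_fun ?_ ?_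
    · exact B.aestronglyMeasurable_comp₂ hf.aestronglyMeasurable_restrict_uIoc
        ((hw.mono uIoc_subset_uIcc).aestronglyMeasurable measurableSet_uIoc)
    · refine (ae_restrict_iff' measurableSet_uIoc).2 (Eventually.of_forall fun t ht => ?_)
      have h1 := hC t (uIoc_subset_uIcc ht)
      have h2 := B.le_opNorm₂ (f t) (w t)
      have : ‖B‖ * ‖f t‖ * ‖w t‖ ≤ ‖B‖ * C * ‖f t‖ := by
        have := mul_le_mul_of_nonneg_left h1 (mul_nonneg (norm_nonneg B) (norm_nonneg (f t)))
        linarith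
      refine (h2.trans this).trans ?_
      simpa using le_abs_self (‖B‖ * C * ‖f t‖)
  have i2 : ∀ {w : ℝ → E}, ContinuousOn w (uIcc a b) →
      IntervalIntegrable (fun t => B (w t) (g t)) volume a b := by
    intro w hw
    obtain ⟨C, hC⟩ := isCompact_uIcc.exists_bound_of_continuousOn hw
    refine (hg.norm.const_mul (‖B‖ * C)).mono_fun ?_ ?_
    · exact B.aestronglyMeasurable_comp₂
        ((hw.mono uIoc_subset_uIcc).aestronglyMeasurable measurableSet_uIoc)
        hg.aestronglyMeasurable_restrict_uIoc
    · refine (ae_restrict_iff' measurableSet_uIoc).2 (Eventually.of_forall fun t ht => ?_)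
      have h1 := hC t (uIoc_subset_uIcc ht)
      have h2 := B.le_opNorm₂ (w t) (g t)
      have : ‖B‖ * ‖w t‖ * ‖g t‖ ≤ ‖B‖ * C * ‖g t‖ := by gcongr
      refine (h2.trans this).trans ?_
      simpa using le_abs_self (‖B‖ * C * ‖g t‖)
  -- The dominating density comes from splitting the increment as B(u(s) − u(t), v(s)) + B(u(t),
  -- v(s) − v(t)), with u and v bounded.
  have hacc : AbsolutelyContinuousOnInterval (fun t => B (u' t) (v' t)) a b := by
    refine absolutelyContinuousOnInterval_of_dist_le
      (m := fun r => ‖B‖ * Mv * ‖f r‖ + ‖B‖ * Mu * ‖g r‖)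
      ((hf.norm.const_mul _).add (hg.norm.const_mul _)) fun s hs t ht => ?_
    have hst : uIcc s t ⊆ uIcc a b := uIcc_subset_uIcc hs ht
    have e : ∫ r in s..t, (‖B‖ * Mv * ‖f r‖ + ‖B‖ * Mu * ‖g r‖) =
        ‖B‖ * Mv * (∫ r in s..t, ‖f r‖) + ‖B‖ * Mu * ∫ r in s..t, ‖g r‖ := by
      rw [intervalIntegral.integral_add ((hf.mono_set hst).norm.const_mul _)
        ((hg.mono_set hst).norm.const_mul _), intervalIntegral.integral_const_mul,
        intervalIntegral.integral_const_mul]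
    have d1 := dist_integral_le hf (u a) hs ht
    have d2 := dist_integral_le hg (v a) hs ht
    have b1 := hMu t ht
    have b2 := hMv s hs
    have hMv0 : 0 ≤ Mv := (norm_nonneg _).trans b2
    have hMu0 : 0 ≤ Mu := (norm_nonneg _).trans b1
    have habs : |∫ r in s..t, (‖B‖ * Mv * ‖f r‖ + ‖B‖ * Mu * ‖g r‖)| =
        ‖B‖ * Mv * |∫ r in s..t, ‖f r‖| + ‖B‖ * Mu * |∫ r in s..t, ‖g r‖| := by
      rw [e]
      rcases le_total s t with h | h
      · have n1 : 0 ≤ ∫ r in s..t, ‖f r‖ := intervalIntegral.integral_nonneg h fun _ _ => norm_nonneg _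
        have n2 : 0 ≤ ∫ r in s..t, ‖g r‖ := intervalIntegral.integral_nonneg h fun _ _ => norm_nonneg _
        rw [abs_of_nonneg n1, abs_of_nonneg n2, abs_of_nonneg (by positivity)]
      · have n1 : 0 ≤ ∫ r in t..s, ‖f r‖ := intervalIntegral.integral_nonneg h fun _ _ => norm_nonneg _
        have n2 : 0 ≤ ∫ r in t..s, ‖g r‖ := intervalIntegral.integral_nonneg h fun _ _ => norm_nonneg _
        rw [intervalIntegral.integral_symm t s, intervalIntegral.integral_symm t s, abs_neg, abs_neg,
          abs_of_nonneg n1, abs_of_nonneg n2, mul_neg, mul_neg, ← neg_add, abs_neg,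
          abs_of_nonneg (by positivity)]
    rw [habs]
    have e2 : B (u' s) (v' s) - B (u' t) (v' t) =
        B (u' s - u' t) (v' s) + B (u' t) (v' s - v' t) := by
      simp only [map_sub, sub_apply]; abel
    rw [dist_eq_norm] at d1 d2 ⊢
    rw [e2]
    calc ‖B (u' s - u' t) (v' s) + B (u' t) (v' s - v' t)‖
        ≤ ‖B‖ * ‖u' s - u' t‖ * ‖v' s‖ + ‖B‖ * ‖u' t‖ * ‖v' s - v' t‖ :=
          (norm_add_le _ _).trans (add_le_add (B.le_opNorm₂ _ _) (B.le_opNorm₂ _ _))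
      _ ≤ ‖B‖ * |∫ r in s..t, ‖f r‖| * Mv + ‖B‖ * Mu * |∫ r in s..t, ‖g r‖| := by
          gcongr
      _ = _ := by ring
  have hd : ∀ᵐ x, x ∈ uIcc a b →
      HasDerivAt (fun t => B (u' t) (v' t)) (B (f x) (v' x) + B (u' x) (g x)) x := by
    filter_upwards [hf.ae_hasDerivAt_integral, hg.ae_hasDerivAt_integral] with x h1 h2 hx
    have d1 : HasDerivAt u' (f x) x := (h1 hx a left_mem_uIcc).const_add _
    have d2 : HasDerivAt v' (g x) x := (h2 hx a left_mem_uIcc).const_add _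
    have := B.hasDerivAt_of_bilinear (fun _ => d1) (fun _ => d2)
    rwa [add_comm] at this
  have hi := (i1 cv).add (i2 cu)
  have key := integral_eq_sub_of_absolutelyContinuous hacc hi hd
  have hcongr : EqOn (fun t => B (f t) (v' t) + B (u' t) (g t))
      (fun t => B (f t) (v t) + B (u t) (g t)) (uIcc a b) := fun t ht => by
    rw [uIcc_of_le hab] at ht
    simp only [hu', hv', ← hu t ht, ← hv t ht]
  refine ⟨hi.congr fun t ht => hcongr (uIoc_subset_uIcc ht), ?_⟩
  rw [← intervalIntegral.integral_congr hcongr, key]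
  simp only [hu', hv', intervalIntegral.integral_same, add_zero,
    ← hu b (right_mem_Icc.2 hab), ← hv b (right_mem_Icc.2 hab)]

/-- Chain rule for a Lipschitz differentiable map along a primitive. -/
theorem integral_comp_primitive [CompleteSpace E] [CompleteSpace F] {j : E → F}
    {j' : E → E →L[ℝ] F} (hj : ∀ x, HasFDerivAt j (j' x) x) {C : NNReal} (hC : LipschitzWith C j)
    {u f : ℝ → E} {a b : ℝ} (hab : a ≤ b) (hf : IntervalIntegrable f volume a b)
    (hu : ∀ t ∈ Icc a b, u t = u a + ∫ r in a..t, f r)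
    (hi : IntervalIntegrable (fun t => j' (u t) (f t)) volume a b) :
    ∫ t in a..b, j' (u t) (f t) = j (u b) - j (u a) := by
  set u' : ℝ → E := fun t => u a + ∫ r in a..t, f r with hu'
  have hac : AbsolutelyContinuousOnInterval (fun t => j (u' t)) a b := by
    refine absolutelyContinuousOnInterval_of_dist_le (m := fun r => C * ‖f r‖)
      (hf.norm.const_mul _) fun s hs t ht => ?_
    rw [intervalIntegral.integral_const_mul, abs_mul, abs_of_nonneg C.coe_nonneg]
    exact (hC.dist_le_mul _ _).trans
      (mul_le_mul_of_nonneg_left (dist_integral_le hf (u a) hs ht) C.coe_nonneg)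
  have hcongr : EqOn (fun t => j' (u t) (f t)) (fun t => j' (u' t) (f t)) (uIcc a b) :=
    fun t ht => by
      rw [uIcc_of_le hab] at ht
      simp only [hu', ← hu t ht]
  have hd : ∀ᵐ x, x ∈ uIcc a b → HasDerivAt (fun t => j (u' t)) (j' (u' x) (f x)) x := by
    filter_upwards [hf.ae_hasDerivAt_integral] with x h1 hx
    have d1 : HasDerivAt u' (f x) x := (h1 hx a left_mem_uIcc).const_add _
    exact (hj (u' x)).comp_hasDerivAt x d1
  rw [intervalIntegral.integral_congr hcongr, integral_eq_sub_of_absolutelyContinuous hac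
    (hi.congr fun t ht => hcongr (uIoc_subset_uIcc ht)) hd]
  simp only [hu', intervalIntegral.integral_same, add_zero, ← hu b (right_mem_Icc.2 hab)]

/-- Two primitives that agree have the same density. -/
theorem ae_eq_of_primitive_eq [CompleteSpace E] {f g : ℝ → E} {T : ℝ}
    (h : ∀ a b : ℝ, 0 < a → a < b → b < T → IntervalIntegrable f volume a b ∧
      IntervalIntegrable g volume a b ∧ ∫ t in a..b, f t = ∫ t in a..b, g t) :
    ∀ᵐ t ∂(volume.restrict (Ioo 0 T)), f t = g t := by
  have key : ∀ a b : ℝ, 0 < a → a < b → b < T → ∀ᵐ t, t ∈ Ioo a b → f t = g t := by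
    intro a b ha hab hb
    obtain ⟨hf, hg, -⟩ := h a b ha hab hb
    filter_upwards [hf.ae_hasDerivAt_integral, hg.ae_hasDerivAt_integral] with x h1 h2 hx
    have hx' : x ∈ uIcc a b := by rw [uIcc_of_le hab.le]; exact Ioo_subset_Icc_self hx
    have d1 := h1 hx' a left_mem_uIcc
    have d2 := h2 hx' a left_mem_uIcc
    refine d1.unique (d2.congr_of_eventuallyEq ?_)
    filter_upwards [isOpen_Ioo.mem_nhds hx] with t ht
    exact (h a t ha ht.1 (ht.2.trans hb)).2.2
  -- The densities are integrable only on compact subintervals of (0,T), so the interval is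
  -- exhausted by countably many of them.
  have : ∀ᵐ t, ∀ n : ℕ, t ∈ Ioo (1 / ((n : ℝ) + 1)) (T - 1 / ((n : ℝ) + 1)) → f t = g t := by
    rw [ae_all_iff]
    intro n
    rcases lt_or_ge (1 / ((n : ℝ) + 1)) (T - 1 / ((n : ℝ) + 1)) with h' | h'
    · exact key _ _ (by positivity) h' (by linarith [show (0 : ℝ) < 1 / ((n : ℝ) + 1) by positivity])
    · exact Eventually.of_forall fun t ht => absurd (ht.1.trans ht.2) (not_lt.2 h')
  rw [ae_restrict_iff' measurableSet_Ioo]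
  filter_upwards [this] with t ht htT
  obtain ⟨n, hn⟩ := exists_nat_one_div_lt (lt_min htT.1 (sub_pos.2 htT.2))
  exact ht n ⟨hn.trans_le (min_le_left _ _), by
    have := hn.trans_le (min_le_right _ _); linarith⟩

end AbsolutelyContinuous

end Bresse

namespace Bresse

/-! ### Lipschitz differential equations in Banach spaces -/

section ODE

variable {E : Type*} [NormedAddCommGroup E] [NormedSpace ℝ E] [CompleteSpace E]

/-- Picard's operator is written for v = e^{−μt}u. In this weighted form it is a contraction on the
whole interval at once, so no short intervals have to be patched together. -/
theorem exists_solution_of_lipschitz {f : ℝ → E} (hf : Continuous f) {g : E → E} {K : NNReal}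
    (hg : LipschitzWith K g) (x₀ : E) {T : ℝ} (hT : 0 ≤ T) :
    ∃ u : ℝ → E, Continuous u ∧ ∀ t ∈ Icc 0 T, u t = x₀ + ∫ s in (0 : ℝ)..t, (f s + g (u s)) := by
  -- The contraction factor is K/μ, which this choice makes at most 1/2; the summand 1 keeps μ
  -- positive when K = 0.
  set μ : ℝ := 2 * K + 1 with hμ
  have hμ0 : 0 < μ := by positivity
  let ext (v : C(Icc 0 T, E)) : ℝ → E := fun s => Real.exp (μ * s) • IccExtend hT v s
  have hext : ∀ v, Continuous (ext v) := fun v =>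
    (Real.continuous_exp.comp (continuous_const.mul continuous_id)).smul v.continuous.Icc_extend'
  have hrhs : ∀ v, Continuous fun s => f s + g (ext v s) := fun v =>
    hf.add (hg.continuous.comp (hext v))
  let S (v : C(Icc 0 T, E)) : ℝ → E := fun t =>
    Real.exp (-(μ * t)) • (x₀ + ∫ s in (0 : ℝ)..t, (f s + g (ext v s)))
  have hS : ∀ v, Continuous (S v) := fun v =>
    (Real.continuous_exp.comp (continuous_const.mul continuous_id).neg).smul
      (continuous_const.add (intervalIntegral.continuous_primitive
        (fun a b => (hrhs v).intervalIntegrable a b) 0))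
  let Λ : C(Icc 0 T, E) → C(Icc 0 T, E) := fun v => ⟨fun t => S v t, (hS v).comp continuous_subtype_val⟩
  have hΛ : ContractingWith (1 / 2) Λ := by
    refine ⟨by norm_num, LipschitzWith.of_dist_le_mul fun v w => ?_⟩
    rw [ContinuousMap.dist_le (by positivity)]
    rintro ⟨t, ht⟩
    change dist (S v t) (S w t) ≤ _
    have e1 : S v t - S w t =
        Real.exp (-(μ * t)) • ∫ s in (0 : ℝ)..t, (g (ext v s) - g (ext w s)) := by
      simp only [S]
      rw [← smul_sub, add_sub_add_left_eq_sub, ← intervalIntegral.integral_sub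
        ((hrhs v).intervalIntegrable _ _) ((hrhs w).intervalIntegrable _ _)]
      simp only [add_sub_add_left_eq_sub]
    have e2 : ‖∫ s in (0 : ℝ)..t, (g (ext v s) - g (ext w s))‖ ≤
        ∫ s in (0 : ℝ)..t, K * dist v w * Real.exp (μ * s) := by
      refine intervalIntegral.norm_integral_le_of_norm_le ht.1 (Eventually.of_forall fun s _ => ?_)
        (Continuous.intervalIntegrable (by fun_prop) _ _)
      rw [← dist_eq_norm]
      refine (hg.dist_le_mul _ _).trans ?_
      rw [mul_assoc]
      refine mul_le_mul_of_nonneg_left ?_ K.coe_nonneg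
      simp only [ext]
      rw [dist_smul₀, Real.norm_eq_abs, abs_of_pos (Real.exp_pos _), mul_comm]
      exact mul_le_mul_of_nonneg_right (ContinuousMap.dist_apply_le_dist _) (Real.exp_pos _).le
    have e3 : ∫ s in (0 : ℝ)..t, K * dist v w * Real.exp (μ * s) =
        K * dist v w * ((Real.exp (μ * t) - 1) / μ) := by
      rw [intervalIntegral.integral_const_mul]
      congr 1
      have := intervalIntegral.integral_eq_sub_of_hasDerivAt (a := 0) (b := t)
        (f := fun s => Real.exp (μ * s) / μ) (f' := fun s => Real.exp (μ * s)) (fun s _ => by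
          have := ((hasDerivAt_id s).const_mul μ).exp.div_const μ
          simpa [hμ0.ne'] using this) (Continuous.intervalIntegrable (by fun_prop) _ _)
      rw [this]; simp; ring
    rw [dist_eq_norm, e1, norm_smul, Real.norm_eq_abs, abs_of_pos (Real.exp_pos _)]
    refine (mul_le_mul_of_nonneg_left (e2.trans_eq e3) (Real.exp_pos _).le).trans ?_
    have e4 : Real.exp (-(μ * t)) * (Real.exp (μ * t) - 1) ≤ 1 := by
      rw [mul_sub, ← Real.exp_add]; simp; positivity
    have e5 : (K : ℝ) / μ ≤ 1 / 2 := by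
      rw [div_le_iff₀ hμ0, hμ]; linarith
    calc Real.exp (-(μ * t)) * (K * dist v w * ((Real.exp (μ * t) - 1) / μ))
        = (K / μ) * dist v w * (Real.exp (-(μ * t)) * (Real.exp (μ * t) - 1)) := by ring
      _ ≤ (K / μ) * dist v w * 1 := by gcongr
      _ ≤ (1 / 2) * dist v w := by rw [mul_one]; gcongr
      _ = _ := by norm_num
  have : Nonempty (Icc 0 T) := ⟨⟨0, le_rfl, hT⟩⟩
  set v := hΛ.fixedPoint Λ
  have hv : Λ v = v := hΛ.fixedPoint_isFixedPt
  refine ⟨ext v, hext v, fun t ht => ?_⟩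
  have h1 : v ⟨t, ht⟩ = S v t := by
    conv_lhs => rw [← hv]
    rfl
  simp only [ext]
  rw [IccExtend_of_mem hT _ ht, h1]
  simp only [S]
  rw [smul_smul, ← Real.exp_add]
  simp [ext]

end ODE

/-! ### Weak limits and energy estimates in Hilbert spaces -/

section Weak

variable {H : Type*} [NormedAddCommGroup H] [InnerProductSpace ℝ H] [CompleteSpace H]

/-- Bounded sequences in a Hilbert space converge weakly along an ultrafilter. -/
theorem exists_weak_limit (w : ℕ → H) {M : ℝ} (h : ∀ n, ‖w n‖ ≤ M) :
    ∃ z : H, ∀ x, Tendsto (fun n => inner ℝ (w n) x) (hyperfilter ℕ : Filter ℕ)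
      (𝓝 (inner ℝ z x)) := by
  have hb : ∀ x n, ‖inner ℝ (w n) x‖ ≤ M * ‖x‖ := fun x n =>
    (norm_inner_le_norm _ _).trans (mul_le_mul_of_nonneg_right (h n) (norm_nonneg _))
  -- Each scalar sequence stays in a compact ball and so converges along the ultrafilter; neither
  -- separability nor a diagonal subsequence is needed.
  have ex : ∀ x, ∃ c : ℝ, Tendsto (fun n => inner ℝ (w n) x) (hyperfilter ℕ : Filter ℕ) (𝓝 c) := by
    intro x
    obtain ⟨c, -, hc⟩ := (isCompact_closedBall (0 : ℝ) (M * ‖x‖)).ultrafilter_le_nhds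
      ((hyperfilter ℕ).map fun n => inner ℝ (w n) x) (by
        rw [le_principal_iff, Ultrafilter.mem_coe, Ultrafilter.mem_map]
        exact Filter.univ_mem' fun n => by simpa using hb x n)
    exact ⟨c, hc⟩
  choose c hc using ex
  let ℓ : H →ₗ[ℝ] ℝ :=
    { toFun := c
      map_add' := fun x y => tendsto_nhds_unique (hc (x + y))
        (by simpa only [inner_add_right] using (hc x).add (hc y))
      map_smul' := fun r x => tendsto_nhds_unique (hc (r • x))
        (by simpa only [inner_smul_right, smul_eq_mul, RingHom.id_apply] using (hc x).const_mul r) }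
  let ℓ' : H →L[ℝ] ℝ := ℓ.mkContinuous M fun x =>
    le_of_tendsto (hc x).norm (Eventually.of_forall fun n => hb x n)
  refine ⟨(InnerProductSpace.toDual ℝ H).symm ℓ', fun x => ?_⟩
  rw [InnerProductSpace.toDual_symm_apply]
  exact hc x

/-- Twice the inner product of e and d is the derivative of ‖d‖², so the hypothesis integrates to
the assumption of `le_of_sq_le_add_integral`. -/
theorem norm_le_of_inner_le {d e : ℝ → H} {ψ : ℝ → ℝ} {T L : ℝ} (hL : 0 ≤ L)
    (he : IntervalIntegrable e volume 0 T)
    (hd : ∀ t ∈ Icc 0 T, d t = d 0 + ∫ s in (0 : ℝ)..t, e s)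
    (hψ : IntervalIntegrable ψ volume 0 T) (hψ0 : ∀ t, 0 ≤ ψ t)
    (h : ∀ t ∈ Icc 0 T, inner ℝ (e t) (d t) ≤ L * ‖d t‖ ^ 2 + ψ t * ‖d t‖) :
    ∀ t ∈ Icc 0 T, ‖d t‖ ≤ Real.exp (2 * L * T) * (‖d 0‖ + 2 * ∫ s in (0 : ℝ)..T, ψ s) := by
  intro t ht
  have hT : 0 ≤ T := ht.1.trans ht.2
  have hc : ContinuousOn d (Icc 0 T) := by
    have := (absolutelyContinuousOnInterval_primitive he (d 0)).continuousOn
    rw [uIcc_of_le hT] at this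
    exact this.congr hd
  refine le_of_sq_le_add_integral (φ := fun t => ‖d t‖) hL (norm_nonneg _) hc.norm
    (fun _ _ => norm_nonneg _) hψ hψ0 (fun t ht => ?_) t ht
  have sub : uIcc 0 t ⊆ uIcc 0 T := by
    rw [uIcc_of_le ht.1, uIcc_of_le hT]; exact Icc_subset_Icc_right ht.2
  have hct : ContinuousOn d (uIcc 0 t) := hc.mono (by rwa [← uIcc_of_le hT])
  obtain ⟨hi, hI⟩ := integral_bilinear_primitive (innerSL ℝ (E := H)) ht.1 (he.mono_set sub)
    (he.mono_set sub) (fun s hs => hd s ⟨hs.1, hs.2.trans ht.2⟩)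
    (fun s hs => hd s ⟨hs.1, hs.2.trans ht.2⟩)
  replace hi : IntervalIntegrable (fun s => inner ℝ (e s) (d s) + inner ℝ (d s) (e s)) volume 0 t :=
    hi
  replace hI : ∫ s in (0 : ℝ)..t, (inner ℝ (e s) (d s) + inner ℝ (d s) (e s)) =
      inner ℝ (d t) (d t) - inner ℝ (d 0) (d 0) := hI
  rw [real_inner_self_eq_norm_sq, real_inner_self_eq_norm_sq] at hI
  have i1 : IntervalIntegrable (fun s => 2 * L * ‖d s‖ ^ 2 + 2 * ψ s * ‖d s‖) volume 0 t :=
    (((hct.norm.pow 2).intervalIntegrable).const_mul _).add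
      (((hψ.mono_set sub).const_mul 2).mul_continuousOn hct.norm)
  have := intervalIntegral.integral_mono_on ht.1 hi i1 (fun s hs => by
    have := h s ⟨hs.1, hs.2.trans ht.2⟩
    rw [real_inner_comm (e s) (d s)]
    linarith)
  rw [hI] at this
  linarith

/-- The same differentiation of ‖d‖² with a constant source and zero initial value. Linearity in c
of the bound on the square turns errors of order r in the Yosida approximation into distances of
order √r. -/
theorem norm_sq_le_of_inner_le {d e : ℝ → H} {T L c : ℝ} (hL : 0 ≤ L) (hc0 : 0 ≤ c)
    (he : IntervalIntegrable e volume 0 T) (h0 : d 0 = 0)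
    (hd : ∀ t ∈ Icc 0 T, d t = d 0 + ∫ s in (0 : ℝ)..t, e s)
    (h : ∀ t ∈ Icc 0 T, inner ℝ (e t) (d t) ≤ L * ‖d t‖ ^ 2 + c) :
    ∀ t ∈ Icc 0 T, ‖d t‖ ^ 2 ≤ 2 * c * T * Real.exp (2 * L * T) := by
  intro t ht
  have hT : 0 ≤ T := ht.1.trans ht.2
  have hc : ContinuousOn d (Icc 0 T) := by
    have := (absolutelyContinuousOnInterval_primitive he (d 0)).continuousOn
    rw [uIcc_of_le hT] at this
    exact this.congr hd
  have key := le_mul_exp_of_le_add_integral (φ := fun t => ‖d t‖ ^ 2) (c := 2 * c * T) (L := 2 * L)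
    (by positivity) (hc.norm.pow 2) (fun t ht => ?_) t ht
  · refine key.trans (mul_le_mul_of_nonneg_left (Real.exp_le_exp.2 ?_) (by positivity))
    rw [sub_zero]
    exact mul_le_mul_of_nonneg_left ht.2 (by positivity)
  have sub : uIcc 0 t ⊆ uIcc 0 T := by
    rw [uIcc_of_le ht.1, uIcc_of_le hT]; exact Icc_subset_Icc_right ht.2
  have hct : ContinuousOn d (uIcc 0 t) := hc.mono (by rwa [← uIcc_of_le hT])
  obtain ⟨hi, hI⟩ := integral_bilinear_primitive (innerSL ℝ (E := H)) ht.1 (he.mono_set sub)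
    (he.mono_set sub) (fun s hs => hd s ⟨hs.1, hs.2.trans ht.2⟩)
    (fun s hs => hd s ⟨hs.1, hs.2.trans ht.2⟩)
  replace hi : IntervalIntegrable (fun s => inner ℝ (e s) (d s) + inner ℝ (d s) (e s)) volume 0 t :=
    hi
  replace hI : ∫ s in (0 : ℝ)..t, (inner ℝ (e s) (d s) + inner ℝ (d s) (e s)) =
      inner ℝ (d t) (d t) - inner ℝ (d 0) (d 0) := hI
  rw [real_inner_self_eq_norm_sq, real_inner_self_eq_norm_sq] at hI
  have i0 : IntervalIntegrable (fun s => 2 * L * ‖d s‖ ^ 2) volume 0 t :=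
    ((hct.norm.pow 2).intervalIntegrable).const_mul _
  have i1 : IntervalIntegrable (fun s => 2 * L * ‖d s‖ ^ 2 + 2 * c) volume 0 t :=
    i0.add intervalIntegrable_const
  have := intervalIntegral.integral_mono_on ht.1 hi i1 (fun s hs => by
    have := h s ⟨hs.1, hs.2.trans ht.2⟩
    rw [real_inner_comm (e s) (d s)]
    linarith)
  rw [hI, intervalIntegral.integral_add i0 intervalIntegrable_const, intervalIntegral.integral_const_mul,
    intervalIntegral.integral_const, h0] at this
  simp only [norm_zero, sub_zero, smul_eq_mul] at this
  have h2 : t * (2 * c) ≤ 2 * c * T := by nlinarith [ht.2]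
  linarith

end Weak

end Bresse

namespace Bresse

/-! ### Monotone graphs and their Yosida approximations -/

section Evolution

variable {H : Type*} [NormedAddCommGroup H] [InnerProductSpace ℝ H]

/-- G x y stands for y ∈ 𝒜x, with 𝒜 possibly multivalued and not everywhere defined. Maximality
enters later only through solvability of x + r y = z. -/
def MonotoneGraph (G : H → H → Prop) : Prop :=
  ∀ ⦃x y x' y'⦄, G x y → G x' y' → 0 ≤ inner ℝ (y - y') (x - x')

/-- Pair z − z' = (x − x') + r(y − y') with y − y' and with x − x'; the mixed terms are
non-negative. Thus the Yosida map z ↦ y is monotone and 1/r-Lipschitz, and the resolvent z ↦ x is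
nonexpansive. -/
theorem MonotoneGraph.resolvent {G : H → H → Prop} (hG : MonotoneGraph G) {r : ℝ} (hr : 0 < r)
    {x y z x' y' z' : H} (h : G x y) (hz : x + r • y = z) (h' : G x' y') (hz' : x' + r • y' = z') :
    0 ≤ inner ℝ (y - y') (z - z') ∧ r * ‖y - y'‖ ≤ ‖z - z'‖ ∧ ‖x - x'‖ ≤ ‖z - z'‖ := by
  have e : z - z' = (x - x') + r • (y - y') := by rw [← hz, ← hz', smul_sub]; abel
  have hm := hG h h'
  have h1 : inner ℝ (y - y') (z - z') = inner ℝ (y - y') (x - x') + r * ‖y - y'‖ ^ 2 := by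
    rw [e, inner_add_right, inner_smul_right, real_inner_self_eq_norm_sq]
  have h2 : inner ℝ (x - x') (z - z') = ‖x - x'‖ ^ 2 + r * inner ℝ (y - y') (x - x') := by
    rw [e, inner_add_right, inner_smul_right, real_inner_self_eq_norm_sq, real_inner_comm]
  have c1 := real_inner_le_norm (y - y') (z - z')
  have c2 := real_inner_le_norm (x - x') (z - z')
  have hrm := mul_nonneg hr.le hm
  refine ⟨by rw [h1]; positivity, ?_, ?_⟩
  · rcases (norm_nonneg (y - y')).eq_or_lt with h0 | h0
    · rw [← h0]; simp
    · exact le_of_mul_le_mul_left (by nlinarith) h0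
  · rcases (norm_nonneg (x - x')).eq_or_lt with h0 | h0
    · rw [← h0]; simp
    · exact le_of_mul_le_mul_left (by nlinarith) h0

variable [CompleteSpace H]

/-- With 𝒜 replaced by its Lipschitz Yosida map the equation is an ODE; the content is the bound M,
which does not depend on r. Monotonicity compares u with its translates, the variation of f controls
the forcing, and G u₀ w₀ controls the initial slope. Hence u' is bounded, and so is v = f − B(u) −
u'. -/
theorem exists_yosida_solution {G : H → H → Prop} (hG : MonotoneGraph G)
    (range : ∀ r : ℝ, 0 < r → ∀ z, ∃ x y, G x y ∧ x + r • y = z)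
    {B : H → H} {L : NNReal} (hB : LipschitzWith L B) {T : ℝ} (hT : 0 < T)
    {f : ℝ → H} (hf : Continuous f) {m : ℝ → ℝ} (hm : Monotone m)
    (hfm : ∀ s t, s ≤ t → ‖f t - f s‖ ≤ m t - m s) {u₀ w₀ : H} (h0 : G u₀ w₀) :
    ∃ M : ℝ, 0 ≤ M ∧ ∀ r : ℝ, 0 < r → ∃ u v : ℝ → H, Continuous u ∧ Continuous v ∧
      (∀ t ∈ Icc 0 T, u t = u₀ + ∫ s in (0 : ℝ)..t, (f s - B (u s) - v s)) ∧
      ∀ t ∈ Icc 0 T, (∃ x, G x (v t) ∧ x + r • v t = u t) ∧ ‖v t‖ ≤ M := by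
  -- The ODE is solved on a longer interval, so that u(t + h) is available for t ≤ T and h ≤ 1.
  set S : ℝ := T + 1 with hS
  have hS0 : 0 < S := by positivity
  set D : ℝ := m S - m 0 with hD
  have hD0 : 0 ≤ D := sub_nonneg.2 (hm hS0.le)
  set C₀ : ℝ := ‖f 0‖ + D + ‖B u₀‖ + ‖w₀‖ with hC₀
  have hC₀0 : 0 ≤ C₀ := by positivity
  set C₁ : ℝ := Real.exp (2 * L * S) * (2 * C₀) with hC₁
  have hC₁0 : 0 ≤ C₁ := by positivity
  set K : ℝ := Real.exp (2 * L * T) * (C₁ + 2 * D) with hK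
  have hK0 : 0 ≤ K := by positivity
  refine ⟨C₀ + L * (C₁ * S) + K, by positivity, fun r hr => ?_⟩
  have hfb : ∀ s ∈ Icc 0 S, ‖f s‖ ≤ ‖f 0‖ + D := fun s hs => by
    have h1 := hfm 0 s hs.1
    have h2 := hm hs.2
    have h3 := norm_le_norm_add_norm_sub' (f s) (f 0)
    linarith
  choose x y hxy hxyz using range r hr
  have hylip : LipschitzWith (Real.toNNReal r⁻¹) y := LipschitzWith.of_dist_le_mul fun z z' => by
    have := (hG.resolvent hr (hxy z) (hxyz z) (hxy z') (hxyz z')).2.1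
    rw [Real.coe_toNNReal _ (inv_nonneg.2 hr.le), dist_eq_norm, dist_eq_norm, inv_mul_eq_div,
      le_div_iff₀ hr]
    linarith
  -- The resolvent displaces u₀ by −r y, so monotonicity against the pair (u₀, w₀) gives ‖y‖² ≤ ⟨w₀,
  -- y⟩.
  have hy0 : ‖y u₀‖ ≤ ‖w₀‖ := by
    have h1 := hG (hxy u₀) h0
    have h2 : x u₀ - u₀ = -(r • y u₀) := by
      have := hxyz u₀
      rw [eq_neg_iff_add_eq_zero, sub_add_eq_add_sub, this, sub_self]
    rw [h2, inner_neg_right, inner_smul_right, inner_sub_left, real_inner_self_eq_norm_sq] at h1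
    have h3 := real_inner_le_norm w₀ (y u₀)
    have h4 : ‖y u₀‖ ^ 2 ≤ ‖w₀‖ * ‖y u₀‖ := by
      by_contra hcon
      push Not at hcon
      have : 0 < r * (‖y u₀‖ ^ 2 - inner ℝ w₀ (y u₀)) := mul_pos hr (by linarith)
      linarith
    rcases (norm_nonneg (y u₀)).eq_or_lt with h5 | h5
    · rw [← h5]; exact norm_nonneg _
    · exact le_of_mul_le_mul_right (by nlinarith) h5
  obtain ⟨u, huc, hu⟩ := exists_solution_of_lipschitz hf (hB.neg.add hylip.neg) u₀ hS0.le
  set ρ : ℝ → H := fun s => f s - B (u s) - y (u s) with hρ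
  have hρc : Continuous ρ := (hf.sub (hB.continuous.comp huc)).sub (hylip.continuous.comp huc)
  have hu' : ∀ t ∈ Icc 0 S, u t = u₀ + ∫ s in (0 : ℝ)..t, ρ s := fun t ht => by
    rw [hu t ht]
    congr 1
    refine intervalIntegral.integral_congr fun s _ => ?_
    simp only [hρ, Pi.neg_apply]; abel
  have hu0 : u 0 = u₀ := by simpa using hu' 0 ⟨le_rfl, hS0.le⟩
  have hymono : ∀ z z', 0 ≤ inner ℝ (y z - y z') (z - z') := fun z z' =>
    (hG.resolvent hr (hxy z) (hxyz z) (hxy z') (hxyz z')).1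
  have hBin : ∀ z z', -(L * ‖z - z'‖ ^ 2) ≤ inner ℝ (B z - B z') (z - z') := fun z z' => by
    have h1 := abs_le.1 (abs_real_inner_le_norm (B z - B z') (z - z'))
    have h2 := hB.dist_le_mul z z'
    rw [dist_eq_norm, dist_eq_norm] at h2
    have h3 := mul_le_mul_of_nonneg_right h2 (norm_nonneg (z - z'))
    nlinarith [h1.1]
  -- Comparison with the constant function u₀, the source f − B(u₀) − y(u₀) being bounded by C₀.
  have stepA : ∀ t ∈ Icc 0 S, ‖u t - u₀‖ ≤ C₁ * t := by
    intro t ht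
    have key := norm_le_of_inner_le (d := fun s => u s - u₀) (e := ρ) (ψ := fun _ => C₀)
      L.coe_nonneg (hρc.intervalIntegrable 0 t) (fun s hs => by
        simp only [hu0, sub_self, zero_add]
        rw [hu' s ⟨hs.1, hs.2.trans ht.2⟩, add_sub_cancel_left]) intervalIntegrable_const
      (fun _ => hC₀0) (fun s hs => by
        have e : ρ s = (f s - B u₀ - y u₀) - (B (u s) - B u₀) - (y (u s) - y u₀) := by
          simp only [hρ]; abel
        rw [e, inner_sub_left, inner_sub_left]
        have h1 := hymono (u s) u₀
        have h2 := hBin (u s) u₀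
        have h3 := real_inner_le_norm (f s - B u₀ - y u₀) (u s - u₀)
        have h4 : ‖f s - B u₀ - y u₀‖ ≤ C₀ := by
          have := hfb s ⟨hs.1, hs.2.trans ht.2⟩
          have h5 := norm_sub_le (f s - B u₀) (y u₀)
          have h6 := norm_sub_le (f s) (B u₀)
          linarith
        have := mul_le_mul_of_nonneg_right h4 (norm_nonneg (u s - u₀))
        linarith) t ⟨ht.1, le_rfl⟩
    simp only [hu0, sub_self, norm_zero, zero_add, intervalIntegral.integral_const, sub_zero,
      smul_eq_mul] at key
    refine key.trans ?_
    have : Real.exp (2 * L * t) ≤ Real.exp (2 * L * S) :=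
      Real.exp_le_exp.2 (mul_le_mul_of_nonneg_left ht.2 (by positivity))
    calc _ ≤ Real.exp (2 * L * S) * (2 * (t * C₀)) :=
          mul_le_mul_of_nonneg_right this (by have := ht.1; positivity)
      _ = C₁ * t := by rw [hC₁]; ring
  -- Comparison with a translate. The initial difference is of order h by `stepA`, and ∫(m(s+h) −
  -- m(s)) ds reduces to two end pieces of length h.
  have stepB : ∀ t ∈ Icc 0 T, ∀ h ∈ Ioc (0 : ℝ) 1, ‖u (t + h) - u t‖ ≤ K * h := by
    intro t ht h hh
    have hint : ∀ a b, IntervalIntegrable ρ volume a b := fun a b => hρc.intervalIntegrable a b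
    have hρs : Continuous fun s => ρ (s + h) := hρc.comp (continuous_id.add continuous_const)
    have hρh : Continuous fun s => ρ (s + h) - ρ s := hρs.sub hρc
    have hmi : ∀ a b, IntervalIntegrable m volume a b := fun a b => hm.intervalIntegrable
    have hmh : ∀ a b, IntervalIntegrable (fun s => m (s + h)) volume a b := fun a b =>
      (Monotone.intervalIntegrable (fun _ _ hab => hm (by linarith)))
    have key := norm_le_of_inner_le (d := fun s => u (s + h) - u s) (e := fun s => ρ (s + h) - ρ s)
      (ψ := fun s => m (s + h) - m s) L.coe_nonneg (hρh.intervalIntegrable 0 T) (fun s hs => by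
        simp only [zero_add]
        rw [intervalIntegral.integral_sub (hρs.intervalIntegrable 0 s) (hint 0 s),
          intervalIntegral.integral_comp_add_right (fun s => ρ s) h, zero_add,
          hu' (s + h) ⟨by linarith [hs.1, hh.1], by linarith [hs.2, hh.2]⟩,
          hu' s ⟨hs.1, by linarith [hs.2]⟩, hu' h ⟨hh.1.le, by linarith [hh.2]⟩, hu0,
          ← intervalIntegral.integral_add_adjacent_intervals (hint 0 h) (hint h (s + h))]
        abel) ((hmh _ _).sub (hmi _ _)) (fun s => sub_nonneg.2 (hm (by linarith [hh.1])))
      (fun s hs => by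
        have e : ρ (s + h) - ρ s = (f (s + h) - f s) - (B (u (s + h)) - B (u s)) -
            (y (u (s + h)) - y (u s)) := by simp only [hρ]; abel
        rw [e, inner_sub_left, inner_sub_left]
        have h1 := hymono (u (s + h)) (u s)
        have h2 := hBin (u (s + h)) (u s)
        have h3 := real_inner_le_norm (f (s + h) - f s) (u (s + h) - u s)
        have h4 := mul_le_mul_of_nonneg_right (hfm s (s + h) (by linarith [hh.1]))
          (norm_nonneg (u (s + h) - u s))
        linarith) t ht
    have hI : ∫ s in (0 : ℝ)..T, (m (s + h) - m s) ≤ D * h := by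
      rw [intervalIntegral.integral_sub (hmh _ _) (hmi _ _),
        intervalIntegral.integral_comp_add_right (fun s => m s) h, zero_add]
      have e1 := intervalIntegral.integral_add_adjacent_intervals (hmi 0 h) (hmi h (T + h))
      have e2 := intervalIntegral.integral_add_adjacent_intervals (hmi 0 T) (hmi T (T + h))
      have e3 : ∫ s in T..(T + h), m s ≤ ∫ s in T..(T + h), m S :=
        intervalIntegral.integral_mono_on (by linarith [hh.1]) (hmi _ _) intervalIntegrable_const
          fun s hs => hm (by linarith [hs.2, hh.2])
      have e4 : ∫ s in (0 : ℝ)..h, m 0 ≤ ∫ s in (0 : ℝ)..h, m s :=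
        intervalIntegral.integral_mono_on hh.1.le intervalIntegrable_const (hmi _ _)
          fun s hs => hm hs.1
      simp only [intervalIntegral.integral_const, smul_eq_mul] at e3 e4
      rw [hD]
      linarith
    simp only [zero_add] at key
    have h1 := stepA h ⟨hh.1.le, by linarith [hh.2]⟩
    rw [hu0] at key
    refine key.trans ?_
    calc _ ≤ Real.exp (2 * L * T) * (C₁ * h + 2 * (D * h)) := by gcongr
      _ = K * h := by rw [hK]; ring
  have stepC : ∀ t ∈ Icc 0 T, ‖ρ t‖ ≤ K := by
    intro t ht
    have hd : HasDerivAt (fun t => u₀ + ∫ s in (0 : ℝ)..t, ρ s) (ρ t) t :=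
      (intervalIntegral.integral_hasDerivAt_right (hρc.intervalIntegrable _ _)
        (hρc.stronglyMeasurableAtFilter _ _) hρc.continuousAt).const_add u₀
    refine le_of_tendsto hd.tendsto_slope_zero_right.norm ?_
    filter_upwards [Ioc_mem_nhdsGT (zero_lt_one' ℝ)] with h hh
    rw [← hu' t ⟨ht.1, by linarith [ht.2]⟩, ← hu' (t + h) ⟨by linarith [ht.1, hh.1],
      by linarith [ht.2, hh.2]⟩, norm_smul, norm_inv, Real.norm_eq_abs, abs_of_pos hh.1,
      inv_mul_le_iff₀ hh.1]
    linarith [stepB t ht h hh]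
  refine ⟨u, fun t => y (u t), huc, hylip.continuous.comp huc,
    fun t ht => hu' t ⟨ht.1, by linarith [ht.2]⟩, fun t ht => ⟨⟨x (u t), hxy _, hxyz _⟩, ?_⟩⟩
  have e : y (u t) = f t - B u₀ - (B (u t) - B u₀) - ρ t := by simp only [hρ]; abel
  have h1 := stepC t ht
  have htS : t ∈ Icc 0 S := ⟨ht.1, by linarith [ht.2]⟩
  have h2 := hfb t htS
  have h3 := hB.dist_le_mul (u t) u₀
  rw [dist_eq_norm, dist_eq_norm] at h3
  have h4 := stepA t htS
  have h5 : (L : ℝ) * ‖u t - u₀‖ ≤ L * (C₁ * S) := by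
    refine mul_le_mul_of_nonneg_left (h4.trans ?_) L.coe_nonneg
    exact mul_le_mul_of_nonneg_left htS.2 hC₁0
  simp only [e]
  have n1 := norm_sub_le (f t - B u₀ - (B (u t) - B u₀)) (ρ t)
  have n2 := norm_sub_le (f t - B u₀) (B (u t) - B u₀)
  have n3 := norm_sub_le (f t) (B u₀)
  have n4 := norm_nonneg w₀
  linarith

end Evolution
end Bresse

namespace Bresse

/-! ### Convergence of the Yosida approximations -/

section Evolution

variable {H : Type*} [NormedAddCommGroup H] [InnerProductSpace ℝ H] [CompleteSpace H]

/-- Strong solvability of `u' + 𝒜 u + B u = f` for a maximal monotone `𝒜` (given by its graph),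
a Lipschitz perturbation `B` and a continuous load `f` of bounded variation. -/
theorem exists_strong_evolution {G : H → H → Prop} (hG : MonotoneGraph G)
    (range : ∀ r : ℝ, 0 < r → ∀ z, ∃ x y, G x y ∧ x + r • y = z)
    {B : H → H} {L : NNReal} (hB : LipschitzWith L B) {T : ℝ} (hT : 0 < T)
    {f : ℝ → H} (hf : Continuous f) {m : ℝ → ℝ} (hm : Monotone m)
    (hfm : ∀ s t, s ≤ t → ‖f t - f s‖ ≤ m t - m s) {u₀ w₀ : H} (h0 : G u₀ w₀) :
    ∃ u w : ℝ → H, ContinuousOn u (Icc 0 T) ∧ MemLp w 2 (volume.restrict (Ioc 0 T)) ∧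
      (∀ t ∈ Icc 0 T, u t = u₀ + ∫ s in (0 : ℝ)..t, (f s - B (u s) - w s)) ∧
      ∀ᵐ t ∂(volume.restrict (Ioc 0 T)), G (u t) (w t) := by
  obtain ⟨M, hM0, hY⟩ := exists_yosida_solution hG range hB hT hf hm hfm h0
  set r : ℕ → ℝ := fun n => 1 / ((n : ℝ) + 1) with hr
  have hr0 : ∀ n, 0 < r n := fun n => by simp only [hr]; positivity
  have hranti : ∀ {n k}, n ≤ k → r k ≤ r n := fun {n k} h => by
    simp only [hr]
    exact one_div_le_one_div_of_le (by positivity) (by exact_mod_cast Nat.succ_le_succ h)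
  have hrlim : Tendsto r atTop (𝓝 0) := tendsto_one_div_add_atTop_nhds_zero_nat
  choose u v huc hvc hu hv using fun n => hY (r n) (hr0 n)
  have hu0 : ∀ n, u n 0 = u₀ := fun n => by simpa using hu n 0 ⟨le_rfl, hT.le⟩
  have hrhs : ∀ n, Continuous fun s => f s - B (u n s) - v n s := fun n =>
    (hf.sub (hB.continuous.comp (huc n))).sub (hvc n)
  have hfB : ∀ n, Continuous fun s => f s - B (u n s) := fun n =>
    hf.sub (hB.continuous.comp (huc n))
  set K : ℝ := 2 * (2 * M ^ 2) * T * Real.exp (2 * L * T) with hK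
  have hK0 : 0 ≤ K := by positivity
  -- Monotonicity holds at the resolvent points u − r v. The error is the pairing of v_n − v_k with
  -- r_n v_n − r_k v_k, at most 2M²(r_n + r_k) in absolute value.
  have cauchy : ∀ n k, ∀ t ∈ Icc 0 T, ‖u n t - u k t‖ ^ 2 ≤ K * (r n + r k) := by
    intro n k t ht
    have key := norm_sq_le_of_inner_le (d := fun t => u n t - u k t)
      (e := fun s => (f s - B (u n s) - v n s) - (f s - B (u k s) - v k s))
      (L := L) (c := 2 * M ^ 2 * (r n + r k)) L.coe_nonneg
      (by have := hr0 n; have := hr0 k; positivity)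
      (((hrhs n).sub (hrhs k)).intervalIntegrable 0 T) (by simp [hu0]) (fun t ht => by
        rw [intervalIntegral.integral_sub ((hrhs n).intervalIntegrable _ _)
          ((hrhs k).intervalIntegrable _ _), hu0, hu0, hu n t ht, hu k t ht]
        abel) (fun s hs => by
        obtain ⟨⟨x, hx, hxu⟩, hvM⟩ := hv n s hs
        obtain ⟨⟨x', hx', hxu'⟩, hvM'⟩ := hv k s hs
        have e : (f s - B (u n s) - v n s) - (f s - B (u k s) - v k s) =
            -(B (u n s) - B (u k s)) - (v n s - v k s) := by abel
        rw [e, inner_sub_left, inner_neg_left]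
        have h1 := (abs_le.1 (abs_real_inner_le_norm (B (u n s) - B (u k s)) (u n s - u k s))).1
        have h2 := hB.dist_le_mul (u n s) (u k s)
        rw [dist_eq_norm, dist_eq_norm] at h2
        have h3 := mul_le_mul_of_nonneg_right h2 (norm_nonneg (u n s - u k s))
        have h4 : inner ℝ (v n s - v k s) (u n s - u k s) =
            inner ℝ (v n s - v k s) (x - x') +
              inner ℝ (v n s - v k s) (r n • v n s - r k • v k s) := by
          rw [← inner_add_right, ← hxu, ← hxu']; congr 1; abel
        have h5 := hG hx hx'
        have h6 := (abs_le.1 (abs_real_inner_le_norm (v n s - v k s)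
          (r n • v n s - r k • v k s))).1
        have h7 : ‖v n s - v k s‖ ≤ 2 * M := (norm_sub_le _ _).trans (by linarith)
        have h8 : ‖r n • v n s - r k • v k s‖ ≤ (r n + r k) * M := by
          refine (norm_sub_le _ _).trans ?_
          rw [norm_smul, norm_smul, Real.norm_eq_abs, Real.norm_eq_abs, abs_of_pos (hr0 n),
            abs_of_pos (hr0 k), add_mul]
          exact add_le_add (mul_le_mul_of_nonneg_left hvM (hr0 n).le)
            (mul_le_mul_of_nonneg_left hvM' (hr0 k).le)
        have h9 := mul_le_mul h7 h8 (norm_nonneg _) (by positivity)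
        nlinarith) t ht
    calc _ ≤ _ := key
      _ = _ := by rw [hK]; ring
  set b : ℕ → ℝ := fun n => √(K * (2 * r n)) with hb
  have hblim : Tendsto b atTop (𝓝 0) := by
    have : Tendsto (fun n => K * (2 * r n)) atTop (𝓝 (K * (2 * 0))) :=
      (hrlim.const_mul 2).const_mul K
    simpa [hb] using this.sqrt
  have hub : ∀ N n k, N ≤ n → N ≤ k → ∀ t ∈ Icc 0 T, dist (u n t) (u k t) ≤ b N := by
    intro N n k hn hk t ht
    rw [dist_eq_norm]
    refine Real.le_sqrt_of_sq_le ((cauchy n k t ht).trans ?_)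
    refine mul_le_mul_of_nonneg_left ?_ hK0
    linarith [hranti hn, hranti hk]
  have hlim : ∀ t, ∃ l, t ∈ Icc 0 T → Tendsto (fun n => u n t) atTop (𝓝 l) := by
    intro t
    by_cases ht : t ∈ Icc 0 T
    · obtain ⟨l, hl⟩ := cauchySeq_tendsto_of_complete
        (cauchySeq_of_le_tendsto_0 (s := fun n => u n t) b
          (fun n k N hn hk => hub N n k hn hk t ht) hblim)
      exact ⟨l, fun _ => hl⟩
    · exact ⟨0, fun h => absurd h ht⟩
  choose U hU using hlim
  have hUb : ∀ n, ∀ t ∈ Icc 0 T, ‖u n t - U t‖ ≤ b n := by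
    intro n t ht
    have h1 : Tendsto (fun k => dist (u n t) (u k t)) atTop (𝓝 (dist (u n t) (U t))) :=
      tendsto_const_nhds.dist (hU t ht)
    rw [← dist_eq_norm]
    refine le_of_tendsto h1 ?_
    filter_upwards [eventually_ge_atTop n] with k hk using hub n n k le_rfl hk t ht
  have hUc : ContinuousOn U (Icc 0 T) := by
    have : TendstoUniformlyOn u U atTop (Icc 0 T) := by
      rw [Metric.tendstoUniformlyOn_iff]
      intro ε hε
      filter_upwards [(tendsto_order.1 hblim).2 ε hε] with n hn t ht
      rw [dist_comm, dist_eq_norm]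
      exact (hUb n t ht).trans_lt hn
    exact this.continuousOn (Eventually.of_forall fun n => (huc n).continuousOn).frequently
  set μ : Measure ℝ := volume.restrict (Ioc 0 T) with hμ
  have hμIcc : ∀ᵐ t ∂μ, t ∈ Icc 0 T := by
    rw [hμ]
    filter_upwards [ae_restrict_mem measurableSet_Ioc] with t ht using Ioc_subset_Icc_self ht
  have hvmem : ∀ n, MemLp (v n) 2 μ := fun n =>
    MemLp.of_bound (hvc n).aestronglyMeasurable M (by
      filter_upwards [hμIcc] with t ht using (hv n t ht).2)
  set vL : ℕ → Lp H 2 μ := fun n => (hvmem n).toLp (v n) with hvL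
  have hvLc : ∀ n, ∀ᵐ t ∂μ, vL n t = v n t := fun n => (hvmem n).coeFn_toLp
  obtain ⟨z, hz⟩ := exists_weak_limit vL (M := (measureUnivNNReal μ : ℝ) ^ (2 : ENNReal).toReal⁻¹ * M)
    fun n => Lp.norm_le_of_ae_bound hM0 (by
      filter_upwards [hμIcc, hvLc n] with t ht h using h ▸ (hv n t ht).2)
  have hhyp : (hyperfilter ℕ : Filter ℕ) ≤ atTop := Nat.hyperfilter_le_atTop
  have hzi : ∀ a b : ℝ, a ∈ Icc 0 T → b ∈ Icc 0 T → IntervalIntegrable (fun t => z t) volume a b := by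
    intro a b ha hb
    have h1 : IntegrableOn (fun t => z t) (Ioc 0 T) := (Lp.memLp z).integrable (by norm_num)
    rw [intervalIntegrable_iff]
    exact h1.mono_set (Ioc_subset_Ioc (le_min ha.1 hb.1) (max_le ha.2 hb.2))
  have hBU : ContinuousOn (fun s => f s - B (U s)) (Icc 0 T) :=
    hf.continuousOn.sub (hB.continuous.comp_continuousOn hUc)
  have h0T : (0 : ℝ) ∈ Icc 0 T := ⟨le_rfl, hT.le⟩
  have sub : ∀ t ∈ Icc 0 T, uIcc 0 t ⊆ Icc 0 T := fun t ht => by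
    rw [uIcc_of_le ht.1]; exact Icc_subset_Icc_right ht.2
  refine ⟨U, fun t => z t, hUc, Lp.memLp z, fun t ht => ?_, ?_⟩
  -- By the integrated equation and the uniform convergence of u_n, the integrals of v_n converge in
  -- norm; weak convergence of v_n identifies the limit as the integral of z.
  · have strong : Tendsto (fun n => ∫ s in (0 : ℝ)..t, v n s) atTop
        (𝓝 (u₀ + (∫ s in (0 : ℝ)..t, (f s - B (U s))) - U t)) := by
      have e : ∀ n, ∫ s in (0 : ℝ)..t, v n s =
          u₀ + (∫ s in (0 : ℝ)..t, (f s - B (u n s))) - u n t := by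
        intro n
        have := hu n t ht
        rw [intervalIntegral.integral_sub ((hfB n).intervalIntegrable _ _)
          ((hvc n).intervalIntegrable _ _)] at this
        rw [this]; abel
      simp_rw [e]
      refine (Tendsto.const_add _ ?_).sub (hU t ht)
      rw [tendsto_iff_norm_sub_tendsto_zero]
      refine squeeze_zero (g := fun n => L * b n * |t - 0|) (fun _ => norm_nonneg _) (fun n => ?_) ?_
      · rw [← intervalIntegral.integral_sub
          ((hfB n).intervalIntegrable _ _)
          ((hBU.mono (sub t ht)).intervalIntegrable)]
        refine intervalIntegral.norm_integral_le_of_norm_le_const fun s hs => ?_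
        have hs' := sub t ht (uIoc_subset_uIcc hs)
        have e2 : f s - B (u n s) - (f s - B (U s)) = -(B (u n s) - B (U s)) := by abel
        rw [e2, norm_neg, ← dist_eq_norm]
        refine (hB.dist_le_mul _ _).trans (mul_le_mul_of_nonneg_left ?_ L.coe_nonneg)
        rw [dist_eq_norm]; exact hUb n s hs'
      · simpa using (hblim.const_mul (L : ℝ)).mul_const |t - 0|
    have weak : ∀ e : H, Tendsto (fun n => inner ℝ e (∫ s in (0 : ℝ)..t, v n s))
        (hyperfilter ℕ : Filter ℕ) (𝓝 (inner ℝ e (∫ s in (0 : ℝ)..t, z s))) := by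
      intro e
      have hfin : μ (Ioc 0 t) ≠ ⊤ := measure_ne_top _ _
      have hres : μ.restrict (Ioc 0 t) = volume.restrict (Ioc 0 t) := by
        rw [hμ, Measure.restrict_restrict measurableSet_Ioc,
          inter_eq_left.2 (Ioc_subset_Ioc_right ht.2)]
      have conv : ∀ g : Lp H 2 μ, inner ℝ g (indicatorConstLp 2 measurableSet_Ioc hfin e) =
          inner ℝ e (∫ s in (0 : ℝ)..t, g s) := by
        intro g
        rw [real_inner_comm, L2.inner_indicatorConstLp_eq_inner_setIntegral,
          intervalIntegral.integral_of_le ht.1, hres]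
      have := hz (indicatorConstLp 2 measurableSet_Ioc hfin e)
      simp_rw [conv] at this
      refine this.congr fun n => ?_
      congr 1
      rw [intervalIntegral.integral_of_le ht.1, intervalIntegral.integral_of_le ht.1]
      refine integral_congr_ae (ae_mono (Measure.restrict_mono (Ioc_subset_Ioc_right ht.2) le_rfl)
        (hvLc n))
    have eq : ∫ s in (0 : ℝ)..t, z s = u₀ + (∫ s in (0 : ℝ)..t, (f s - B (U s))) - U t :=
      ext_inner_left ℝ fun e => tendsto_nhds_unique (weak e)
        ((tendsto_const_nhds.inner strong).mono_left hhyp)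
    rw [intervalIntegral.integral_sub ((hBU.mono (sub t ht)).intervalIntegrable) (hzi 0 t h0T ht), eq]
    abel
  -- Minty's argument: x and y, evaluated at U + z, form a pair of the graph with x + y = U + z. Put
  -- d = U − x, so that y = z + d. Monotonicity against the Yosida pairs gives ⟨z − y, d⟩ ≥ 0 in the
  -- limit, that is −‖d‖² ≥ 0.
  · choose x y hxy hxyz using range 1 one_pos
    have hxlip : LipschitzWith 1 x := LipschitzWith.of_dist_le_mul fun p q => by
      have := (hG.resolvent one_pos (hxy p) (hxyz p) (hxy q) (hxyz q)).2.2
      rw [dist_eq_norm, dist_eq_norm]; simpa using this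
    have hUm : MemLp U 2 μ := by
      obtain ⟨C, hC⟩ := isCompact_Icc.exists_bound_of_continuousOn hUc
      refine MemLp.of_bound ((hUc.mono Ioc_subset_Icc_self).aestronglyMeasurable measurableSet_Ioc) C ?_
      filter_upwards [hμIcc] with t ht using hC t ht
    have ham : MemLp (fun t => U t + z t) 2 μ := hUm.add (Lp.memLp z)
    have hxm : MemLp (fun t => x (U t + z t)) 2 μ := by
      have hc : MemLp (fun _ : ℝ => ‖x 0‖) 2 μ := memLp_const _
      refine (hc.add ham.norm).mono (hxlip.continuous.comp_aestronglyMeasurable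
        ham.aestronglyMeasurable) (Eventually.of_forall fun t => ?_)
      have h1 := hxlip.dist_le_mul (U t + z t) 0
      rw [dist_eq_norm, dist_eq_norm, sub_zero, NNReal.coe_one, one_mul] at h1
      have h2 := norm_le_norm_add_norm_sub' (x (U t + z t)) (x 0)
      simp only [Pi.add_apply]
      refine le_trans ?_ (le_abs_self _)
      linarith
    set d : Lp H 2 μ := (hUm.sub hxm).toLp _ with hd
    have hdc : ∀ᵐ t ∂μ, d t = U t - x (U t + z t) := (hUm.sub hxm).coeFn_toLp
    set C : ℝ := ∫ t, (M + ‖(z + d : Lp H 2 μ) t‖) ∂μ with hC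
    have hCi : Integrable (fun t => M + ‖(z + d : Lp H 2 μ) t‖) μ :=
      (integrable_const _).add ((Lp.memLp (z + d)).integrable (by norm_num)).norm
    have ineq : ∀ n, -((b n + r n * M) * C) ≤ inner ℝ (vL n) d - inner ℝ (z + d) d := by
      intro n
      rw [← inner_sub_left, L2.inner_def, hC, ← integral_const_mul, ← integral_neg]
      refine integral_mono_ae (hCi.const_mul _).neg (L2.integrable_inner _ _) ?_
      filter_upwards [hμIcc, hvLc n, hdc, Lp.coeFn_add z d, Lp.coeFn_sub (vL n) (z + d)]
        with t ht h1 h2 h3 h4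
      rw [h4, Pi.sub_apply, h1]
      obtain ⟨⟨x', hx', hxu⟩, hvM⟩ := hv n t ht
      have hy : y (U t + z t) = (z + d : Lp H 2 μ) t := by
        have := hxyz (U t + z t)
        rw [one_smul] at this
        rw [h3, Pi.add_apply, h2, eq_sub_of_add_eq' this]; abel
      have key := hG hx' (hxy (U t + z t))
      rw [hy] at key
      have e : d t = (x' - x (U t + z t)) - ((u n t - U t) - r n • v n t) := by
        rw [h2, ← hxu]; abel
      rw [e, inner_sub_right]
      have c := (abs_le.1 (abs_real_inner_le_norm (v n t - (z + d : Lp H 2 μ) t)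
        ((u n t - U t) - r n • v n t))).2
      have n1 : ‖v n t - (z + d : Lp H 2 μ) t‖ ≤ M + ‖(z + d : Lp H 2 μ) t‖ :=
        (norm_sub_le _ _).trans (by linarith)
      have n2 : ‖(u n t - U t) - r n • v n t‖ ≤ b n + r n * M := by
        refine (norm_sub_le _ _).trans (add_le_add (hUb n t ht) ?_)
        rw [norm_smul, Real.norm_eq_abs, abs_of_pos (hr0 n)]
        exact mul_le_mul_of_nonneg_left hvM (hr0 n).le
      have n3 := mul_le_mul n1 n2 (norm_nonneg _) (by positivity)
      linarith
    have lim1 : Tendsto (fun n => -((b n + r n * M) * C)) (hyperfilter ℕ : Filter ℕ) (𝓝 0) := by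
      have : Tendsto (fun n => -((b n + r n * M) * C)) atTop (𝓝 (-((0 + 0 * M) * C))) :=
        ((hblim.add (hrlim.mul_const M)).mul_const C).neg
      simpa using this.mono_left hhyp
    have lim2 := (hz d).sub_const (inner ℝ (z + d) d)
    have fin := le_of_tendsto_of_tendsto' lim1 lim2 ineq
    rw [inner_add_left, real_inner_self_eq_norm_sq] at fin
    have hd0 : d = 0 := norm_eq_zero.1 (by nlinarith [norm_nonneg d])
    filter_upwards [hdc, (Lp.eq_zero_iff_ae_eq_zero.1 hd0)] with t h1 h2
    rw [h2, Pi.zero_apply] at h1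
    have hxU : x (U t + z t) = U t := (sub_eq_zero.1 h1.symm).symm
    have := hxyz (U t + z t)
    rw [hxU, one_smul, add_right_inj] at this
    have h := hxy (U t + z t)
    rwa [hxU, this] at h

end Evolution

/-! ### Hilbert space structures given by coercive forms -/

section Form

universe u

variable {E : Type u} [NormedAddCommGroup E] [NormedSpace ℝ E]

/-- The space `E` with the inner product given by a bilinear form. -/
def FormSpace (_b : E →L[ℝ] E →L[ℝ] ℝ) : Type _ := E

instance (b : E →L[ℝ] E →L[ℝ] ℝ) : AddCommGroup (FormSpace b) := inferInstanceAs (AddCommGroup E)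

instance (b : E →L[ℝ] E →L[ℝ] ℝ) : Module ℝ (FormSpace b) := inferInstanceAs (Module ℝ E)

/-- The identity of `E` as a map to `FormSpace b`. -/
def toFormSpace (b : E →L[ℝ] E →L[ℝ] ℝ) : E ≃ₗ[ℝ] FormSpace b := LinearEquiv.refl ℝ E

/-- The wave operator is monotone in the energy inner product, not in the given norm. Boundedness
and coercivity of b make the identity a homeomorphism onto the form space, which is therefore
complete. -/
theorem exists_hilbert_of_form [CompleteSpace E] (b : E →L[ℝ] E →L[ℝ] ℝ)
    (symm : ∀ x y, b x y = b y x) {c : ℝ} (hc : 0 < c) (coer : ∀ x, c * ‖x‖ ^ 2 ≤ b x x) :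
    ∃ (H : Type u) (_ : NormedAddCommGroup H) (_ : InnerProductSpace ℝ H)
      (_ : CompleteSpace H) (e : E ≃L[ℝ] H), ∀ x y, inner ℝ (e x) (e y) = b x y := by
  let e₀ := toFormSpace b
  let core : InnerProductSpace.Core ℝ (FormSpace b) :=
    { inner := fun x y => b (e₀.symm x) (e₀.symm y)
      conj_inner_symm := fun x y => symm _ _
      re_inner_nonneg := fun x =>
        (by positivity : 0 ≤ c * ‖e₀.symm x‖ ^ 2).trans (coer (e₀.symm x))
      add_left := fun x y z => by
        rw [map_add, map_add]; rfl
      smul_left := fun x y r => by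
        rw [map_smul, map_smul]; rfl
      definite := fun x hx => by
        have h1 := coer (e₀.symm x)
        have h2 : b (e₀.symm x) (e₀.symm x) = 0 := hx
        have h3 : ‖e₀.symm x‖ ^ 2 ≤ 0 := by
          by_contra h
          push Not at h
          have := mul_pos hc h
          linarith
        have h4 : ‖e₀.symm x‖ = 0 := by nlinarith [norm_nonneg (e₀.symm x)]
        exact (LinearEquiv.map_eq_zero_iff e₀.symm).1 (norm_eq_zero.1 h4) }
  let i1 : NormedAddCommGroup (FormSpace b) := core.toNormedAddCommGroup
  let i2 : InnerProductSpace ℝ (FormSpace b) := InnerProductSpace.ofCore core.toCore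
  have hin : ∀ x y : E, inner ℝ (e₀ x) (e₀ y) = b x y := fun x y => by
    change b (e₀.symm (e₀ x)) (e₀.symm (e₀ y)) = b x y
    rw [e₀.symm_apply_apply, e₀.symm_apply_apply]
  have hn : ∀ x : E, ‖e₀ x‖ ^ 2 = b x x := fun x => by
    rw [← real_inner_self_eq_norm_sq, hin]
  have hb0 : 0 ≤ ‖b‖ := norm_nonneg b
  let e : E ≃L[ℝ] FormSpace b := e₀.toContinuousLinearEquivOfBounds (√‖b‖) (√c⁻¹)
    (fun x => by
      refine le_of_sq_le_sq ?_ (by positivity)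
      rw [hn, mul_pow, Real.sq_sqrt hb0]
      refine (le_abs_self _).trans ((b.le_opNorm₂ x x).trans_eq (by ring)))
    (fun y => by
      obtain ⟨x, rfl⟩ := e₀.surjective y
      rw [LinearEquiv.symm_apply_apply]
      refine le_of_sq_le_sq ?_ (by positivity)
      rw [mul_pow, hn, Real.sq_sqrt (inv_nonneg.2 hc.le), inv_mul_eq_div, le_div_iff₀ hc]
      linarith [coer x])
  refine ⟨FormSpace b, i1, i2, ?_, e, hin⟩
  exact (completeSpace_congr (e := e.toEquiv) e.isUniformEmbedding).1 inferInstance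

/-- `exists_strong_evolution` is transported through the isomorphism onto the form space. E needs no
inner product of its own, so a product D × H with the maximum norm is allowed. -/
theorem exists_strong_evolution_of_form [CompleteSpace E] (b : E →L[ℝ] E →L[ℝ] ℝ)
    (symm : ∀ x y, b x y = b y x) {c : ℝ} (hc : 0 < c) (coer : ∀ x, c * ‖x‖ ^ 2 ≤ b x x)
    {G : E → E → Prop} (hG : ∀ ⦃x y x' y'⦄, G x y → G x' y' → 0 ≤ b (y - y') (x - x'))
    (range : ∀ r : ℝ, 0 < r → ∀ z, ∃ x y, G x y ∧ x + r • y = z)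
    {B : E → E} {L : NNReal} (hB : LipschitzWith L B) {T : ℝ} (hT : 0 < T)
    {f : ℝ → E} (hf : Continuous f) {m : ℝ → ℝ} (hm : Monotone m)
    (hfm : ∀ s t, s ≤ t → ‖f t - f s‖ ≤ m t - m s) {u₀ w₀ : E} (h0 : G u₀ w₀) :
    ∃ u w : ℝ → E, ContinuousOn u (Icc 0 T) ∧ MemLp w 2 (volume.restrict (Ioc 0 T)) ∧
      (∀ t ∈ Icc 0 T, u t = u₀ + ∫ s in (0 : ℝ)..t, (f s - B (u s) - w s)) ∧
      ∀ᵐ t ∂(volume.restrict (Ioc 0 T)), G (u t) (w t) := by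
  obtain ⟨H, _, _, _, e, he⟩ := exists_hilbert_of_form b symm hc coer
  have hG' : MonotoneGraph fun x y => G (e.symm x) (e.symm y) := by
    intro x y x' y' h h'
    have := hG h h'
    rwa [← he, map_sub, map_sub, e.apply_symm_apply, e.apply_symm_apply, e.apply_symm_apply,
      e.apply_symm_apply] at this
  obtain ⟨u, w, huc, hw, hu, hGu⟩ := exists_strong_evolution hG' (fun r hr z => by
      obtain ⟨x, y, hxy, hz⟩ := range r hr (e.symm z)
      refine ⟨e x, e y, by simpa using hxy, ?_⟩
      rw [← map_smul, ← map_add, hz, e.apply_symm_apply])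
    (B := fun x => e (B (e.symm x)))
    ((e : E →L[ℝ] H).lipschitz.comp (hB.comp (e.symm : H →L[ℝ] E).lipschitz)) hT
    (f := fun t => e (f t)) (e.continuous.comp hf)
    (m := fun t => ‖(e : E →L[ℝ] H)‖ * m t)
    (fun s t h => mul_le_mul_of_nonneg_left (hm h) (norm_nonneg _))
    (fun s t h => by
      rw [← map_sub, ← mul_sub]
      exact ((e : E →L[ℝ] H).le_opNorm _).trans
        (mul_le_mul_of_nonneg_left (hfm s t h) (norm_nonneg _)))
    (u₀ := e u₀) (w₀ := e w₀) (by simpa using h0)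
  refine ⟨fun t => e.symm (u t), fun t => e.symm (w t), e.symm.continuous.comp_continuousOn huc,
    (e.symm : H →L[ℝ] E).comp_memLp' hw, fun t ht => ?_, hGu⟩
  simp only [hu t ht, map_add, e.symm_apply_apply]
  rw [intervalIntegral.integral_of_le ht.1, intervalIntegral.integral_of_le ht.1,
    ← ContinuousLinearEquiv.integral_comp_comm]
  simp only [map_sub, e.symm_apply_apply]

end Form
end Bresse

namespace Bresse

-- Hilbert space structures of `Hv p` and `Hd p`

scoped instance Hv.instNormedAddCommGroup (p : Params) : NormedAddCommGroup (Hv p) :=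
  PiLp.normedAddCommGroup 2 _

scoped instance Hv.instInnerProductSpace (p : Params) : InnerProductSpace ℝ (Hv p) :=
  PiLp.innerProductSpace _

scoped instance Hv.instNormedSpace (p : Params) : NormedSpace ℝ (Hv p) :=
  (Hv.instInnerProductSpace p).toNormedSpace

scoped instance Hv.instModule (p : Params) : Module ℝ (Hv p) :=
  (Hv.instNormedSpace p).toModule

scoped instance Hv.instAddCommGroup (p : Params) : AddCommGroup (Hv p) :=
  (Hv.instNormedAddCommGroup p).toAddCommGroup

scoped instance Hv.instAddCommMonoid (p : Params) : AddCommMonoid (Hv p) :=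
  (Hv.instAddCommGroup p).toAddCommMonoid

scoped instance Hv.instTopologicalSpace (p : Params) : TopologicalSpace (Hv p) :=
  (Hv.instNormedAddCommGroup p).toMetricSpace.toPseudoMetricSpace.toUniformSpace.toTopologicalSpace

scoped instance Hd.instNormedAddCommGroup (p : Params) : NormedAddCommGroup (Hd p) :=
  Submodule.normedAddCommGroup (Hd p)

scoped instance Hd.instInnerProductSpace (p : Params) : InnerProductSpace ℝ (Hd p) :=
  Submodule.innerProductSpace (Hd p)

scoped instance Hd.instNormedSpace (p : Params) : NormedSpace ℝ (Hd p) :=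
  (Hd.instInnerProductSpace p).toNormedSpace

scoped instance Hd.instModule (p : Params) : Module ℝ (Hd p) :=
  (Hd.instNormedSpace p).toModule

scoped instance Hd.instAddCommGroup (p : Params) : AddCommGroup (Hd p) :=
  (Hd.instNormedAddCommGroup p).toAddCommGroup

scoped instance Hd.instAddCommMonoid (p : Params) : AddCommMonoid (Hd p) :=
  (Hd.instAddCommGroup p).toAddCommMonoid

scoped instance Hd.instTopologicalSpace (p : Params) : TopologicalSpace (Hd p) :=
  (Hd.instNormedAddCommGroup p).toMetricSpace.toPseudoMetricSpace.toUniformSpace.toTopologicalSpace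

/-! ### Calculus in H_v: superposition with matrices, primitives, total integrals -/

section Spaces

variable {p : Params}

/-- Lebesgue measure on the `j`-th part. -/
abbrev Params.vol (p : Params) (j : Fin 2) : Measure ℝ := volume.restrict (Ioo (p.lo j) (p.hi j))

theorem Params.lo_lt_hi (p : Params) (j : Fin 2) : p.lo j < p.hi j := by
  fin_cases j
  · exact p.L₀_pos
  · exact p.L₀_lt

theorem Params.hi_mem (p : Params) (j : Fin 2) : p.hi j ∈ Icc (p.lo j) (p.hi j) :=
  right_mem_Icc.2 (p.lo_lt_hi j).le

theorem Hv.ext_ae {Φ Ψ : Hv p} (h : ∀ j, ∀ᵐ x ∂(p.vol j), Φ j x = Ψ j x) : Φ = Ψ :=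
  PiLp.ext fun j => Lp.ext (h j)

theorem Hv.add_ae (Φ Ψ : Hv p) (j : Fin 2) :
    ∀ᵐ x ∂(p.vol j), (Φ + Ψ) j x = Φ j x + Ψ j x := Lp.coeFn_add (Φ j) (Ψ j)

theorem Hv.sub_ae (Φ Ψ : Hv p) (j : Fin 2) :
    ∀ᵐ x ∂(p.vol j), (Φ - Ψ) j x = Φ j x - Ψ j x := Lp.coeFn_sub (Φ j) (Ψ j)

theorem Hv.neg_ae (Φ : Hv p) (j : Fin 2) :
    ∀ᵐ x ∂(p.vol j), (-Φ) j x = -Φ j x := Lp.coeFn_neg (Φ j)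

theorem Hv.smul_ae (c : ℝ) (Φ : Hv p) (j : Fin 2) :
    ∀ᵐ x ∂(p.vol j), (c • Φ) j x = c • Φ j x := Lp.coeFn_smul c (Φ j)

theorem Hv.zero_ae (j : Fin 2) :
    ∀ᵐ x ∂(p.vol j), (0 : Hv p) j x = 0 := Lp.coeFn_zero E3 2 (p.vol j)

theorem ip_eq_inner (Φ Ψ : Hv p) : ip Φ Ψ = inner ℝ Φ Ψ := by
  rw [PiLp.inner_apply]
  simp only [ip, L2.inner_def]

theorem Hv.norm_le_sum (Φ : Hv p) : ‖Φ‖ ≤ ‖Φ 0‖ + ‖Φ 1‖ := by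
  have h := PiLp.norm_sq_eq_of_L2 _ Φ
  rw [Fin.sum_univ_two] at h
  refine le_of_sq_le_sq ?_ (by positivity)
  rw [h]
  nlinarith [norm_nonneg (Φ 0), norm_nonneg (Φ 1)]

theorem Hv.norm_sq_eq (Φ : Hv p) : ‖Φ‖ ^ 2 = ∑ j, ∫ x in Ioo (p.lo j) (p.hi j), ‖Φ j x‖ ^ 2 := by
  rw [← real_inner_self_eq_norm_sq, ← ip_eq_inner]
  simp only [ip, real_inner_self_eq_norm_sq]

theorem exists_norm_le_of_bound (p : Params) : ∃ K : ℝ, 0 ≤ K ∧ ∀ (Φ : Hv p) (C : ℝ), 0 ≤ C →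
    (∀ j, ∀ᵐ x ∂(p.vol j), ‖Φ j x‖ ≤ C) → ‖Φ‖ ≤ K * C := by
  refine ⟨(measureUnivNNReal (p.vol 0) : ℝ) ^ (2 : ENNReal).toReal⁻¹ +
    (measureUnivNNReal (p.vol 1) : ℝ) ^ (2 : ENNReal).toReal⁻¹, by positivity, fun Φ C hC h => ?_⟩
  rw [add_mul]
  exact (Hv.norm_le_sum Φ).trans (add_le_add (Lp.norm_le_of_ae_bound hC (h 0))
    (Lp.norm_le_of_ae_bound hC (h 1)))

/-- Pointwise application of a matrix. -/
def mulOp (A : Fin 2 → E3 →L[ℝ] E3) : Hv p →L[ℝ] Hv p :=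
  ((PiLp.continuousLinearEquiv 2 ℝ (fun j : Fin 2 => L2 (p.lo j) (p.hi j))).symm :
    (∀ j : Fin 2, L2 (p.lo j) (p.hi j)) →L[ℝ] Hv p).comp
    (ContinuousLinearMap.pi fun j => ((A j).compLpL 2 (p.vol j)).comp (PiLp.proj 2 _ j))

theorem mulOp_ae (A : Fin 2 → E3 →L[ℝ] E3) (Φ : Hv p) (j : Fin 2) :
    ∀ᵐ x ∂(p.vol j), mulOp A Φ j x = A j (Φ j x) :=
  (A j).coeFn_compLpL (Φ j)

theorem L2.integrable {a b : ℝ} (g : L2 a b) : IntegrableOn (fun y => g y) (Ioo a b) :=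
  (Lp.memLp g).integrable (by norm_num)

theorem exists_integral_norm_le (p : Params) : ∃ C : ℝ, 0 ≤ C ∧ ∀ (g : Hv p) (j : Fin 2),
    ∫ x in Ioo (p.lo j) (p.hi j), ‖g j x‖ ≤ C * ‖g‖ := by
  have key : ∀ j : Fin 2, ∃ C : ℝ, 0 ≤ C ∧ ∀ g : Hv p,
      ∫ x in Ioo (p.lo j) (p.hi j), ‖g j x‖ ≤ C * ‖g‖ := by
    intro j
    refine ⟨(p.vol j univ ^ (1 / (1 : ENNReal).toReal - 1 / (2 : ENNReal).toReal)).toReal,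
      ENNReal.toReal_nonneg, fun g => ?_⟩
    have h1 := eLpNorm_le_eLpNorm_mul_rpow_measure_univ (p := 1) (q := 2) (by norm_num)
      (Lp.memLp (g j)).aestronglyMeasurable
    have h2 : eLpNorm (g j) 2 (p.vol j) *
        p.vol j univ ^ (1 / (1 : ENNReal).toReal - 1 / (2 : ENNReal).toReal) ≠ ⊤ :=
      ENNReal.mul_ne_top (Lp.memLp (g j)).2.ne
        (ENNReal.rpow_ne_top_of_nonneg (by norm_num) (measure_ne_top _ _))
    have h3 := ENNReal.toReal_mono h2 h1
    rw [ENNReal.toReal_mul, ← Lp.norm_def] at h3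
    rw [integral_norm_eq_lintegral_enorm (Lp.memLp (g j)).aestronglyMeasurable,
      ← eLpNorm_one_eq_lintegral_enorm]
    refine h3.trans ?_
    rw [mul_comm]
    exact mul_le_mul_of_nonneg_left (PiLp.norm_apply_le g j) ENNReal.toReal_nonneg
  choose C hC0 hC using key
  refine ⟨C 0 + C 1, add_nonneg (hC0 0) (hC0 1), fun g j => (hC j g).trans ?_⟩
  refine mul_le_mul_of_nonneg_right ?_ (norm_nonneg g)
  fin_cases j
  · simpa using hC0 1
  · simpa using hC0 0

/-- The integral over the `j`-th part. -/
def partInt (p : Params) (j : Fin 2) : Hv p →L[ℝ] E3 :=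
  LinearMap.mkContinuousOfExistsBound
    { toFun := fun g => ∫ x in Ioo (p.lo j) (p.hi j), g j x
      map_add' := fun g h => by
        rw [integral_congr_ae (Hv.add_ae g h j)]
        exact integral_add (L2.integrable _) (L2.integrable _)
      map_smul' := fun c g => by
        rw [integral_congr_ae (Hv.smul_ae c g j)]
        exact integral_smul c _ }
    (by
      obtain ⟨C, -, hC⟩ := exists_integral_norm_le p
      exact ⟨C, fun g => (norm_integral_le_integral_norm _).trans (hC g j)⟩)

theorem partInt_apply (j : Fin 2) (g : Hv p) :
    partInt p j g = ∫ x in Ioo (p.lo j) (p.hi j), g j x := rfl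

/-- The integral over the whole beam. -/
def tot (p : Params) : Hv p →L[ℝ] E3 := partInt p 0 + partInt p 1

/-- The primitive of `g` that vanishes at `0` and is continuous at `L₀`. -/
def primFun (g : Hv p) (j : Fin 2) (x : ℝ) : E3 :=
  (if j = 0 then 0 else partInt p 0 g) + ∫ y in p.lo j..x, g j y

theorem primFun_eq (g : Hv p) (j : Fin 2) (x : ℝ) :
    primFun g j x = primFun g j (p.lo j) + ∫ y in p.lo j..x, g j y := by
  simp [primFun]

theorem primFun_zero (g : Hv p) : primFun g 0 (p.lo 0) = 0 := by
  simp [primFun]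

theorem partInt_eq_interval (g : Hv p) (j : Fin 2) :
    partInt p j g = ∫ y in p.lo j..p.hi j, g j y := by
  rw [partInt_apply, intervalIntegral.integral_of_le (p.lo_lt_hi j).le, integral_Ioc_eq_integral_Ioo]

theorem primFun_interface (g : Hv p) : primFun g 0 (p.hi 0) = primFun g 1 (p.lo 1) := by
  simp [primFun, partInt_eq_interval]

theorem primFun_end (g : Hv p) : primFun g 1 (p.hi 1) = tot p g := by
  simp [primFun, tot, partInt_eq_interval]

theorem intervalIntegrable_part (g : Hv p) (j : Fin 2) :
    IntervalIntegrable (fun y => g j y) volume (p.lo j) (p.hi j) :=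
  L2.intervalIntegrable (g j) (p.hi_mem j)

theorem continuousOn_primFun (g : Hv p) (j : Fin 2) :
    ContinuousOn (primFun g j) (Icc (p.lo j) (p.hi j)) := by
  have := (absolutelyContinuousOnInterval_primitive (intervalIntegrable_part g j)
    (if j = 0 then 0 else partInt p 0 g)).continuousOn
  rwa [uIcc_of_le (p.lo_lt_hi j).le] at this

theorem exists_norm_primFun_le (p : Params) : ∃ C : ℝ, 0 ≤ C ∧ ∀ (g : Hv p) (j : Fin 2),
    ∀ x ∈ Icc (p.lo j) (p.hi j), ‖primFun g j x‖ ≤ C * ‖g‖ := by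
  obtain ⟨C, hC0, hC⟩ := exists_integral_norm_le p
  refine ⟨C + C, by positivity, fun g j x hx => ?_⟩
  rw [add_mul]
  refine (norm_add_le _ _).trans (add_le_add ?_ ?_)
  · split_ifs
    · rw [norm_zero]; positivity
    · exact (norm_integral_le_integral_norm _).trans (hC g 0)
  · rw [intervalIntegral.integral_of_le hx.1]
    refine (norm_integral_le_integral_norm _).trans (le_trans ?_ (hC g j))
    rw [integral_Ioc_eq_integral_Ioo]
    exact setIntegral_mono_set (L2.integrable _).norm (Eventually.of_forall fun _ => norm_nonneg _)
      (Ioo_subset_Ioo_right hx.2).eventuallyLE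

theorem primFun_add (g h : Hv p) (j : Fin 2) {x : ℝ} (hx : x ∈ Icc (p.lo j) (p.hi j)) :
    primFun (g + h) j x = primFun g j x + primFun h j x := by
  simp only [primFun]
  rw [L2.intervalIntegral_congr (Hv.add_ae g h j) hx, intervalIntegral.integral_add
    (L2.intervalIntegrable _ hx) (L2.intervalIntegrable _ hx), map_add]
  split_ifs
  · abel
  · abel

theorem primFun_smul (c : ℝ) (g : Hv p) (j : Fin 2) {x : ℝ} (hx : x ∈ Icc (p.lo j) (p.hi j)) :
    primFun (c • g) j x = c • primFun g j x := by
  simp only [primFun]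
  rw [L2.intervalIntegral_congr (Hv.smul_ae c g j) hx, intervalIntegral.integral_smul, map_smul,
    smul_add]
  split_ifs
  · simp
  · rfl

theorem memLp_of_continuousOn {w : ℝ → E3} {j : Fin 2} (hw : ContinuousOn w (Icc (p.lo j) (p.hi j))) :
    MemLp w 2 (p.vol j) := by
  obtain ⟨C, hC⟩ := isCompact_Icc.exists_bound_of_continuousOn hw
  refine MemLp.of_bound ((hw.mono Ioo_subset_Icc_self).aestronglyMeasurable measurableSet_Ioo) C ?_
  filter_upwards [ae_restrict_mem measurableSet_Ioo] with x hx using hC x (Ioo_subset_Icc_self hx)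

theorem ae_mem_Icc (p : Params) (j : Fin 2) : ∀ᵐ x ∂(p.vol j), x ∈ Icc (p.lo j) (p.hi j) := by
  filter_upwards [ae_restrict_mem measurableSet_Ioo] with x hx using Ioo_subset_Icc_self hx

/-- The element of `H_v` given by a pair of square integrable functions. -/
def mkHv (w : Fin 2 → ℝ → E3) (hw : ∀ j, MemLp (w j) 2 (p.vol j)) : Hv p :=
  WithLp.toLp 2 fun j => (hw j).toLp (w j)

theorem mkHv_ae (w : Fin 2 → ℝ → E3) (hw : ∀ j, MemLp (w j) 2 (p.vol j)) (j : Fin 2) :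
    ∀ᵐ x ∂(p.vol j), mkHv w hw j x = w j x := (hw j).coeFn_toLp

/-- The primitive as an operator on `H_v`. -/
def prim (p : Params) : Hv p →L[ℝ] Hv p :=
  LinearMap.mkContinuousOfExistsBound
    { toFun := fun g => mkHv (primFun g) fun j => memLp_of_continuousOn (continuousOn_primFun g j)
      map_add' := fun g h => Hv.ext_ae fun j => by
        filter_upwards [ae_mem_Icc p j, mkHv_ae (p := p) (primFun (g + h)) (fun j =>
            memLp_of_continuousOn (continuousOn_primFun _ j)) j,
          mkHv_ae (p := p) (primFun g) (fun j => memLp_of_continuousOn (continuousOn_primFun _ j)) j,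
          mkHv_ae (p := p) (primFun h) (fun j => memLp_of_continuousOn (continuousOn_primFun _ j)) j,
          Hv.add_ae (mkHv (p := p) (primFun g) fun j => memLp_of_continuousOn (continuousOn_primFun g j))
            (mkHv (p := p) (primFun h) fun j => memLp_of_continuousOn (continuousOn_primFun h j)) j]
          with x hx h1 h2 h3 h4
        rw [h1, h4, h2, h3, primFun_add g h j hx]
      map_smul' := fun c g => Hv.ext_ae fun j => by
        filter_upwards [ae_mem_Icc p j, mkHv_ae (p := p) (primFun (c • g)) (fun j =>
            memLp_of_continuousOn (continuousOn_primFun _ j)) j,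
          mkHv_ae (p := p) (primFun g) (fun j => memLp_of_continuousOn (continuousOn_primFun _ j)) j,
          Hv.smul_ae c (mkHv (p := p) (primFun g) fun j =>
            memLp_of_continuousOn (continuousOn_primFun g j)) j]
          with x hx h1 h2 h4
        rw [h1, RingHom.id_apply, h4, h2, primFun_smul c g j hx] }
    (by
      obtain ⟨C, hC0, hC⟩ := exists_norm_primFun_le p
      obtain ⟨K, hK0, hK⟩ := exists_norm_le_of_bound p
      refine ⟨K * C, fun g => ?_⟩
      rw [mul_assoc]
      refine hK _ _ (by positivity) fun j => ?_
      filter_upwards [ae_mem_Icc p j, mkHv_ae (p := p) (primFun g) (fun j =>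
        memLp_of_continuousOn (continuousOn_primFun _ j)) j] with x hx h1
      exact h1 ▸ hC g j x hx)

theorem prim_ae (g : Hv p) (j : Fin 2) : ∀ᵐ x ∂(p.vol j), prim p g j x = primFun g j x :=
  mkHv_ae (p := p) (primFun g) (fun j => memLp_of_continuousOn (continuousOn_primFun g j)) j

/-- Constant functions. -/
def cst (p : Params) (c : E3) : Hv p := mkHv (fun _ _ => c) fun _ => memLp_const c

theorem cst_ae (c : E3) (j : Fin 2) : ∀ᵐ x ∂(p.vol j), cst p c j x = c :=
  mkHv_ae (p := p) (fun _ _ => c) (fun _ => memLp_const c) j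

theorem inner_cst (c : E3) (g : Hv p) : inner ℝ (cst p c) g = inner ℝ c (tot p g) := by
  have h : ∀ j : Fin 2, ∫ x in Ioo (p.lo j) (p.hi j), inner ℝ (cst p c j x) (g j x) =
      inner ℝ c (partInt p j g) := by
    intro j
    rw [partInt_apply, ← integral_inner (L2.integrable (g j))]
    refine integral_congr_ae ?_
    filter_upwards [cst_ae (p := p) c j] with x hx
    rw [hx]
  rw [← ip_eq_inner]
  simp only [ip, Fin.sum_univ_two, h, tot, ← inner_add_right]
  rfl

theorem tot_cst (c : E3) : tot p (cst p c) = p.L • c := by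
  have h : ∀ j : Fin 2, partInt p j (cst p c) = (p.hi j - p.lo j) • c := by
    intro j
    rw [partInt_apply, integral_congr_ae (cst_ae c j)]
    simp [(p.lo_lt_hi j).le]
  change partInt p 0 _ + partInt p 1 _ = _
  rw [h, h, ← add_smul]
  congr 1
  simp [Params.lo, Params.hi]

/-- The du Bois-Reymond lemma: s minus its mean is itself an admissible g, and it is also orthogonal
to constants. -/
theorem exists_eq_cst {s : Hv p} (h : ∀ g, tot p g = 0 → inner ℝ s g = 0) : ∃ c, s = cst p c := by
  have hL : p.L ≠ 0 := (p.L₀_pos.trans p.L₀_lt).ne'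
  refine ⟨p.L⁻¹ • tot p s, ?_⟩
  set c := p.L⁻¹ • tot p s
  have h0 : tot p (s - cst p c) = 0 := by
    rw [map_sub, tot_cst, smul_smul, mul_inv_cancel₀ hL, one_smul, sub_self]
  have h1 := h _ h0
  have h2 := inner_cst c (s - cst p c)
  rw [h0, inner_zero_right] at h2
  have : inner ℝ (s - cst p c) (s - cst p c) = 0 := by
    rw [inner_sub_left, h1, h2, sub_zero]
  exact sub_eq_zero.1 (inner_self_eq_zero.1 this)

/-- Integration by parts on each part. The boundary terms at L₀ cancel because the primitives are
continuous there, those at 0 vanish, and only x = L contributes. -/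
theorem inner_prim_add (g h : Hv p) :
    inner ℝ (prim p g) h + inner ℝ g (prim p h) = inner ℝ (tot p g) (tot p h) := by
  have key : ∀ j : Fin 2, (∫ x in Ioo (p.lo j) (p.hi j), inner ℝ (prim p g j x) (h j x)) +
      (∫ x in Ioo (p.lo j) (p.hi j), inner ℝ (g j x) (prim p h j x)) =
      inner ℝ (primFun g j (p.hi j)) (primFun h j (p.hi j)) -
        inner ℝ (primFun g j (p.lo j)) (primFun h j (p.lo j)) := by
    intro j
    obtain ⟨-, hI⟩ := integral_bilinear_primitive (innerSL ℝ (E := E3)) (p.lo_lt_hi j).le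
      (intervalIntegrable_part g j) (intervalIntegrable_part h j)
      (fun x _ => primFun_eq g j x) (fun x _ => primFun_eq h j x)
    replace hI : ∫ x in p.lo j..p.hi j, (inner ℝ (g j x) (primFun h j x) +
        inner ℝ (primFun g j x) (h j x)) = inner ℝ (primFun g j (p.hi j)) (primFun h j (p.hi j)) -
        inner ℝ (primFun g j (p.lo j)) (primFun h j (p.lo j)) := hI
    rw [← hI, intervalIntegral.integral_of_le (p.lo_lt_hi j).le, integral_Ioc_eq_integral_Ioo,
      ← integral_add (L2.integrable_inner (prim p g j) (h j)) (L2.integrable_inner (g j) (prim p h j))]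
    refine integral_congr_ae ?_
    filter_upwards [prim_ae g j, prim_ae h j] with x h1 h2
    rw [h1, h2, add_comm]
  rw [← ip_eq_inner, ← ip_eq_inner]
  simp only [ip, Fin.sum_univ_two]
  have k0 := key 0
  have k1 := key 1
  rw [primFun_zero, inner_zero_left, primFun_interface, primFun_interface] at k0
  rw [primFun_end, primFun_end] at k1
  linarith

/-- The continuous representative is constant on each open part, while its derivative is g almost
everywhere. -/
theorem eq_zero_of_prim_eq_cst {g : Hv p} {c : E3} (h : prim p g = cst p c) : g = 0 := by
  refine Hv.ext_ae fun j => ?_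
  have h1 : ∀ x ∈ Ioo (p.lo j) (p.hi j), primFun g j x = c := by
    have hae : ∀ᵐ x ∂(p.vol j), primFun g j x = c := by
      filter_upwards [prim_ae g j, cst_ae (p := p) c j] with x h2 h3
      rw [← h2, h, h3]
    exact Measure.eqOn_open_of_ae_eq hae isOpen_Ioo
      ((continuousOn_primFun g j).mono Ioo_subset_Icc_self) continuousOn_const
  have hd := (intervalIntegrable_part g j).ae_hasDerivAt_integral
  have : ∀ᵐ x ∂(p.vol j), g j x = 0 := by
    rw [ae_restrict_iff' measurableSet_Ioo]
    filter_upwards [hd] with x hx hxm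
    have hx' : x ∈ uIcc (p.lo j) (p.hi j) := by
      rw [uIcc_of_le (p.lo_lt_hi j).le]; exact Ioo_subset_Icc_self hxm
    have d1 : HasDerivAt (primFun g j) (g j x) x := (hx hx' (p.lo j) left_mem_uIcc).const_add _
    have d2 : HasDerivAt (primFun g j) 0 x := by
      refine (hasDerivAt_const x c).congr_of_eventuallyEq ?_
      filter_upwards [isOpen_Ioo.mem_nhds hxm] with y hy using h1 y hy
    exact d1.unique d2
  filter_upwards [this, Hv.zero_ae (p := p) j] with x h1 h2
  rw [h1, h2]

end Spaces
attribute [irreducible] prim tot partInt mulOp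

end Bresse

namespace Bresse

/-! ### H_d as the space of primitives of functions with zero total integral -/

section SpaceHd

variable {p : Params}

/-- The condition at 0 and the continuity at L₀ fix the constants of integration on both parts. -/
theorem IsH1Rep.eq_primFun {z : WithLp 2 (Hv p × Hv p)} {w : Fin 2 → ℝ → E3}
    (h : ∀ j, IsH1Rep (p.lo j) (p.hi j) (z.fst j) (z.snd j) (w j))
    (h0 : w 0 0 = 0) (h2 : w 0 p.L₀ = w 1 p.L₀) (j : Fin 2) :
    ∀ x ∈ Icc (p.lo j) (p.hi j), w j x = primFun z.snd j x := by
  have h0' : w 0 (p.lo 0) = 0 := h0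
  have h2' : w 0 (p.hi 0) = w 1 (p.lo 1) := h2
  have key0 : ∀ x ∈ Icc (p.lo 0) (p.hi 0), w 0 x = primFun z.snd 0 x := fun x hx => by
    rw [(h 0).2 x hx, h0', primFun_eq, primFun_zero]
  fin_cases j
  · exact key0
  · intro x hx
    change w 1 x = primFun z.snd 1 x
    rw [(h 1).2 x hx, ← h2', key0 _ (p.hi_mem 0), primFun_interface, ← primFun_eq]

/-- The conditions at 0 and L₀ are built into `prim`; the one at x = L says that the derivative has
zero total integral. Membership is thus a closed linear condition, and an element is determined by
its derivative. -/
theorem mem_Hd_iff (z : WithLp 2 (Hv p × Hv p)) :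
    z ∈ Hd p ↔ z.fst = prim p z.snd ∧ tot p z.snd = 0 := by
  constructor
  · rintro ⟨w, h, h0, h1, h2⟩
    have key := IsH1Rep.eq_primFun h h0 h2
    refine ⟨Hv.ext_ae fun j => ?_, ?_⟩
    · filter_upwards [(h j).1, prim_ae z.snd j, ae_mem_Icc p j] with x a b c
      rw [a, b, key j x c]
    · rw [← primFun_end, ← key 1 _ (p.hi_mem 1)]; exact h1
  · rintro ⟨h1, h2⟩
    refine ⟨primFun z.snd, fun j => ⟨?_, fun x _ => primFun_eq _ _ _⟩, primFun_zero _, ?_,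
      primFun_interface _⟩
    · rw [h1]; exact prim_ae z.snd j
    · rw [← h2]; exact primFun_end _

/-- `Φ ↦ Φ` as a bounded operator `H_d → H_v`. -/
def toHvL (p : Params) : Hd p →L[ℝ] Hv p := (WithLp.fstL 2 ℝ (Hv p) (Hv p)).comp (Hd p).subtypeL

/-- `Φ ↦ Φ_x` as a bounded operator `H_d → H_v`. -/
def dXL (p : Params) : Hd p →L[ℝ] Hv p := (WithLp.sndL 2 ℝ (Hv p) (Hv p)).comp (Hd p).subtypeL

theorem toHvL_apply (Φ : Hd p) : toHvL p Φ = toHv Φ := rfl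

theorem dXL_apply (Φ : Hd p) : dXL p Φ = dX Φ := rfl

theorem toHv_add (Φ Ψ : Hd p) : toHv (Φ + Ψ) = toHv Φ + toHv Ψ := rfl

theorem toHv_sub (Φ Ψ : Hd p) : toHv (Φ - Ψ) = toHv Φ - toHv Ψ := rfl

theorem toHv_smul (c : ℝ) (Φ : Hd p) : toHv (c • Φ) = c • toHv Φ := rfl

theorem toHv_eq_prim (Φ : Hd p) : toHv Φ = prim p (dX Φ) := ((mem_Hd_iff _).1 Φ.2).1

theorem tot_dX (Φ : Hd p) : tot p (dX Φ) = 0 := ((mem_Hd_iff _).1 Φ.2).2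

/-- The element of `H_d` with derivative `g`. -/
def mkHd (g : Hv p) (hg : tot p g = 0) : Hd p :=
  ⟨WithLp.toLp 2 (prim p g, g), (mem_Hd_iff _).2 ⟨rfl, hg⟩⟩

theorem dX_mkHd (g : Hv p) (hg : tot p g = 0) : dX (mkHd g hg) = g := rfl

theorem Hd.ext_dX {Φ Ψ : Hd p} (h : dX Φ = dX Ψ) : Φ = Ψ := by
  refine Subtype.ext (WithLp.ofLp_injective 2 (Prod.ext ?_ h))
  change toHv Φ = toHv Ψ
  rw [toHv_eq_prim, toHv_eq_prim, h]

theorem toHv_injective {Φ : Hd p} (h : toHv Φ = 0) : Φ = 0 := by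
  refine Hd.ext_dX ?_
  have h1 : prim p (dX Φ) = cst p 0 := by
    rw [← toHv_eq_prim, h]
    refine Hv.ext_ae fun j => ?_
    filter_upwards [Hv.zero_ae (p := p) j, cst_ae (p := p) 0 j] with x a b
    rw [a, b]
  exact eq_zero_of_prim_eq_cst h1

theorem Hd.norm_sq (Φ : Hd p) : ‖Φ‖ ^ 2 = ‖toHv Φ‖ ^ 2 + ‖dX Φ‖ ^ 2 :=
  WithLp.prod_norm_sq_eq_of_L2 (Φ : WithLp 2 (Hv p × Hv p))

theorem norm_toHv_le (Φ : Hd p) : ‖toHv Φ‖ ≤ ‖Φ‖ :=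
  le_of_sq_le_sq (by rw [Hd.norm_sq]; nlinarith [sq_nonneg ‖dX Φ‖]) (norm_nonneg _)

theorem norm_dX_le (Φ : Hd p) : ‖dX Φ‖ ≤ ‖Φ‖ :=
  le_of_sq_le_sq (by rw [Hd.norm_sq]; nlinarith [sq_nonneg ‖toHv Φ‖]) (norm_nonneg _)

theorem Hd.norm_le (Φ : Hd p) : ‖Φ‖ ≤ ‖toHv Φ‖ + ‖dX Φ‖ := by
  refine le_of_sq_le_sq ?_ (by positivity)
  rw [Hd.norm_sq]; nlinarith [norm_nonneg (toHv Φ), norm_nonneg (dX Φ)]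

instance : CompleteSpace (Hd p) := by
  have hc : IsClosed ((Hd p : Set (WithLp 2 (Hv p × Hv p)))) := by
    have : (Hd p : Set (WithLp 2 (Hv p × Hv p))) =
        {z | z.fst = prim p z.snd} ∩ {z | tot p z.snd = 0} := by
      ext z; exact mem_Hd_iff z
    rw [this]
    have c1 : Continuous fun z : WithLp 2 (Hv p × Hv p) => z.fst :=
      (WithLp.fstL 2 ℝ (Hv p) (Hv p)).continuous
    have c2 : Continuous fun z : WithLp 2 (Hv p × Hv p) => z.snd :=
      (WithLp.sndL 2 ℝ (Hv p) (Hv p)).continuous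
    exact (isClosed_eq c1 ((prim p).continuous.comp c2)).inter
      (isClosed_eq ((tot p).continuous.comp c2) continuous_const)
  exact hc.completeSpace_coe

/-- The continuous representative of `Φ ∈ H_d`. -/
def rep (Φ : Hd p) (j : Fin 2) (x : ℝ) : E3 := primFun (dX Φ) j x

theorem rep_ae (Φ : Hd p) (j : Fin 2) : ∀ᵐ x ∂(p.vol j), toHv Φ j x = rep Φ j x := by
  rw [toHv_eq_prim]; exact prim_ae _ j

theorem continuousOn_rep (Φ : Hd p) (j : Fin 2) : ContinuousOn (rep Φ j) (Icc (p.lo j) (p.hi j)) :=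
  continuousOn_primFun _ j

theorem isH1Rep_rep (Φ : Hd p) (j : Fin 2) :
    IsH1Rep (p.lo j) (p.hi j) (toHv Φ j) (dX Φ j) (rep Φ j) :=
  ⟨rep_ae Φ j, fun _ _ => primFun_eq _ _ _⟩

/-- The one-dimensional Sobolev embedding. It allows locally Lipschitz feedbacks and a γ of
arbitrary growth to act on H_d. -/
theorem exists_sup_bound (p : Params) : ∃ C : ℝ, 0 < C ∧ ∀ (Φ : Hd p) (j : Fin 2),
    (∀ x ∈ Icc (p.lo j) (p.hi j), ‖rep Φ j x‖ ≤ C * ‖Φ‖) ∧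
      ∀ᵐ x ∂(p.vol j), ‖toHv Φ j x‖ ≤ C * ‖Φ‖ := by
  obtain ⟨C, hC0, hC⟩ := exists_norm_primFun_le p
  have key : ∀ (Φ : Hd p) (j : Fin 2), ∀ x ∈ Icc (p.lo j) (p.hi j), ‖rep Φ j x‖ ≤ (C + 1) * ‖Φ‖ :=
    fun Φ j x hx => (hC _ _ x hx).trans (mul_le_mul (by linarith) (norm_dX_le Φ) (norm_nonneg _)
      (by linarith))
  refine ⟨C + 1, by positivity, fun Φ j => ⟨key Φ j, ?_⟩⟩
  filter_upwards [rep_ae Φ j, ae_mem_Icc p j] with x h1 h2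
  rw [h1]; exact key Φ j x h2

end SpaceHd

/-! ### Strain, stress and coercivity of the energy forms -/

section Forms

variable {p : Params}

theorem E3.inner_eq (a b : E3) : inner ℝ a b = a 0 * b 0 + a 1 * b 1 + a 2 * b 2 := by
  simp [PiLp.inner_apply, Fin.sum_univ_three]
  ring

theorem E3.norm_sq_eq (a : E3) : ‖a‖ ^ 2 = a 0 ^ 2 + a 1 ^ 2 + a 2 ^ 2 := by
  rw [EuclideanSpace.real_norm_sq_eq, Fin.sum_univ_three]

theorem E3.abs_apply_le (a : E3) (i : Fin 3) : |a i| ≤ ‖a‖ := PiLp.norm_apply_le a i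

/-- Diagonal matrices. -/
def diag3 (a b c : ℝ) : E3 →L[ℝ] E3 :=
  LinearMap.toContinuousLinearMap
    { toFun := fun v => !₂[a * v 0, b * v 1, c * v 2]
      map_add' := fun v w => by ext i; fin_cases i <;> simp <;> ring
      map_smul' := fun r v => by ext i; fin_cases i <;> simp <;> ring }

theorem diag3_apply (a b c : ℝ) (v : E3) : diag3 a b c v = !₂[a * v 0, b * v 1, c * v 2] := rfl

/-- The zeroth order part of the strain. -/
def strainMat (l : ℝ) : E3 →L[ℝ] E3 :=
  LinearMap.toContinuousLinearMap
    { toFun := fun v => !₂[v 1 + l * v 2, 0, -(l * v 0)]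
      map_add' := fun v w => by ext i; fin_cases i <;> simp <;> ring
      map_smul' := fun r v => by ext i; fin_cases i <;> simp <;> ring }

theorem strainMat_apply (l : ℝ) (v : E3) : strainMat l v = !₂[v 1 + l * v 2, 0, -(l * v 0)] := rfl

/-- The transpose of `strainMat`. -/
def strainMatT (l : ℝ) : E3 →L[ℝ] E3 :=
  LinearMap.toContinuousLinearMap
    { toFun := fun v => !₂[-(l * v 2), v 0, l * v 0]
      map_add' := fun v w => by ext i; fin_cases i <;> simp <;> ring
      map_smul' := fun r v => by ext i; fin_cases i <;> simp <;> ring }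

theorem strainMatT_apply (l : ℝ) (v : E3) : strainMatT l v = !₂[-(l * v 2), v 0, l * v 0] := rfl

theorem inner_strainMat (l : ℝ) (s v : E3) :
    inner ℝ s (strainMat l v) = inner ℝ (strainMatT l s) v := by
  simp [E3.inner_eq, strainMat_apply, strainMatT_apply]; ring

/-- Elastic moduli. -/
def stiff (p : Params) (j : Fin 2) : E3 →L[ℝ] E3 := diag3 (p.k j) (p.lam j) (p.σ j)

def stiffInv (p : Params) (j : Fin 2) : E3 →L[ℝ] E3 := diag3 (p.k j)⁻¹ (p.lam j)⁻¹ (p.σ j)⁻¹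

/-- Densities. -/
def dens (p : Params) (j : Fin 2) : E3 →L[ℝ] E3 := diag3 (p.ρ j) (p.β j) (p.ρ j)

def densInv (p : Params) (j : Fin 2) : E3 →L[ℝ] E3 := diag3 (p.ρ j)⁻¹ (p.β j)⁻¹ (p.ρ j)⁻¹

theorem stiffInv_stiff (j : Fin 2) (v : E3) : stiffInv p j (stiff p j v) = v := by
  have := (p.k_pos j).ne'; have := (p.lam_pos j).ne'; have := (p.σ_pos j).ne'
  ext i; fin_cases i <;> simp [stiff, stiffInv, diag3_apply] <;> field_simp

theorem stiff_stiffInv (j : Fin 2) (v : E3) : stiff p j (stiffInv p j v) = v := by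
  have := (p.k_pos j).ne'; have := (p.lam_pos j).ne'; have := (p.σ_pos j).ne'
  ext i; fin_cases i <;> simp [stiff, stiffInv, diag3_apply] <;> field_simp

theorem dens_densInv (j : Fin 2) (v : E3) : dens p j (densInv p j v) = v := by
  have := (p.ρ_pos j).ne'; have := (p.β_pos j).ne'
  ext i; fin_cases i <;> simp [dens, densInv, diag3_apply] <;> field_simp

theorem Rmul_eq (j : Fin 2) (v : E3) : Rmul p j v = dens p j v := rfl

theorem inner_diag3_ge {a b c m : ℝ} (ha : m ≤ a) (hb : m ≤ b) (hc : m ≤ c) (v : E3) :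
    m * ‖v‖ ^ 2 ≤ inner ℝ (diag3 a b c v) v := by
  rw [E3.norm_sq_eq, E3.inner_eq]
  change _ ≤ a * v 0 * v 0 + b * v 1 * v 1 + c * v 2 * v 2
  nlinarith [mul_le_mul_of_nonneg_right ha (sq_nonneg (v 0)),
    mul_le_mul_of_nonneg_right hb (sq_nonneg (v 1)), mul_le_mul_of_nonneg_right hc (sq_nonneg (v 2))]

theorem diag3_symm (a b c : ℝ) (v w : E3) :
    inner ℝ (diag3 a b c v) w = inner ℝ v (diag3 a b c w) := by
  simp [E3.inner_eq, diag3_apply]; ring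

theorem inner_mulOp (A : Fin 2 → E3 →L[ℝ] E3) (Φ Ψ : Hv p) :
    inner ℝ (mulOp A Φ) Ψ = ∑ j, ∫ x in Ioo (p.lo j) (p.hi j), inner ℝ (A j (Φ j x)) (Ψ j x) := by
  rw [← ip_eq_inner]
  refine Finset.sum_congr rfl fun j _ => integral_congr_ae ?_
  filter_upwards [mulOp_ae A Φ j] with x hx
  rw [hx]

theorem inner_mulOp_adjoint {A A' : Fin 2 → E3 →L[ℝ] E3}
    (h : ∀ j v w, inner ℝ (A j v) w = inner ℝ v (A' j w)) (Φ Ψ : Hv p) :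
    inner ℝ (mulOp A Φ) Ψ = inner ℝ Φ (mulOp A' Ψ) := by
  rw [real_inner_comm (mulOp A' Ψ), inner_mulOp, inner_mulOp]
  simp only [h]
  exact Finset.sum_congr rfl fun j _ => integral_congr_ae (Eventually.of_forall fun x =>
    real_inner_comm _ _)

theorem inner_mulOp_ge {A : Fin 2 → E3 →L[ℝ] E3} {m : ℝ}
    (h : ∀ j v, m * ‖v‖ ^ 2 ≤ inner ℝ (A j v) v) (Φ : Hv p) :
    m * ‖Φ‖ ^ 2 ≤ inner ℝ (mulOp A Φ) Φ := by
  rw [Hv.norm_sq_eq, Finset.mul_sum, ← ip_eq_inner]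
  refine Finset.sum_le_sum fun j _ => ?_
  rw [← integral_const_mul]
  refine integral_mono_ae ((Lp.memLp (Φ j)).integrable_norm_pow (by norm_num)  |>.const_mul m)
    (L2.integrable_inner (mulOp A Φ j) (Φ j)) ?_
  filter_upwards [mulOp_ae A Φ j] with x hx
  rw [hx]
  exact h j _

theorem mulOp_mulOp {A A' : Fin 2 → E3 →L[ℝ] E3} (h : ∀ j v, A j (A' j v) = v) (Φ : Hv p) :
    mulOp A (mulOp A' Φ) = Φ := Hv.ext_ae fun j => by
  filter_upwards [mulOp_ae A (mulOp A' Φ) j, mulOp_ae A' Φ j] with x h1 h2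
  rw [h1, h2, h]

/-- Multiplication by `R`. -/
def Rop (p : Params) : Hv p →L[ℝ] Hv p := mulOp (dens p)

def RopInv (p : Params) : Hv p →L[ℝ] Hv p := mulOp (densInv p)

theorem Rop_RopInv (Φ : Hv p) : Rop p (RopInv p Φ) = Φ := mulOp_mulOp dens_densInv Φ

theorem Rop_ae (Φ : Hv p) (j : Fin 2) : ∀ᵐ x ∂(p.vol j), Rop p Φ j x = Rmul p j (Φ j x) :=
  mulOp_ae _ Φ j

theorem Rop_symm (Φ Ψ : Hv p) : inner ℝ (Rop p Φ) Ψ = inner ℝ (Rop p Ψ) Φ := by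
  rw [real_inner_comm Φ]
  exact inner_mulOp_adjoint (fun j v w => diag3_symm _ _ _ v w) Φ Ψ

theorem ipR_eq (Φ Ψ : Hv p) : ipR Φ Ψ = inner ℝ (Rop p Φ) Ψ := by
  rw [Rop, inner_mulOp]
  simp only [ipR, Rmul_eq]

/-- The strain `(Q / k, M / λ, N / σ)`. -/
def strain (p : Params) : Hd p →L[ℝ] Hv p :=
  dXL p + (mulOp fun _ => strainMat p.l).comp (toHvL p)

theorem strain_apply (Φ : Hd p) : strain p Φ = dX Φ + mulOp (fun _ => strainMat p.l) (toHv Φ) := rfl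

theorem strain_ae (Φ : Hd p) (j : Fin 2) : ∀ᵐ x ∂(p.vol j),
    strain p Φ j x = dX Φ j x + strainMat p.l (toHv Φ j x) := by
  rw [strain_apply]
  filter_upwards [Hv.add_ae (dX Φ) (mulOp (fun _ => strainMat p.l) (toHv Φ)) j,
    mulOp_ae (fun _ => strainMat p.l) (toHv Φ) j] with x h1 h2
  rw [h1, h2]

/-- The stress `(Q, M, N)`. -/
def stress (p : Params) : Hd p →L[ℝ] Hv p := (mulOp (stiff p)).comp (strain p)

theorem stress_ae (Φ : Hd p) (j : Fin 2) : ∀ᵐ x ∂(p.vol j),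
    stress p Φ j x = stiff p j (dX Φ j x + strainMat p.l (toHv Φ j x)) := by
  filter_upwards [mulOp_ae (stiff p) (strain p Φ) j, strain_ae Φ j] with x h1 h2
  rw [← h2]; exact h1

theorem stiff_strain_eq (j : Fin 2) (v d : E3) :
    stiff p j (d + strainMat p.l v) = !₂[Q p j v d, M p j v d, N p j v d] := by
  ext i; fin_cases i <;> simp [stiff, diag3_apply, strainMat_apply, Q, M, N] <;> ring_nf <;> simp

theorem formA_eq (Φ B : Hd p) : formA Φ B = inner ℝ (stress p Φ) (strain p B) := by
  rw [← ip_eq_inner]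
  refine Finset.sum_congr rfl fun j _ => integral_congr_ae ?_
  filter_upwards [stress_ae Φ j, strain_ae B j] with x h1 h2
  have := (p.k_pos j).ne'; have := (p.lam_pos j).ne'; have := (p.σ_pos j).ne'
  rw [h1, h2, stiff_strain_eq, E3.inner_eq]
  simp [strainMat_apply, Q, M, N]
  field_simp
  ring

theorem normD_sq (Φ : Hd p) : normD Φ = ‖stress p Φ‖ := by
  have : ‖stress p Φ‖ ^ 2 = ∑ j, ∫ x in Ioo (p.lo j) (p.hi j),
    ((Q p j (toHv Φ j x) (dX Φ j x)) ^ 2 + (N p j (toHv Φ j x) (dX Φ j x)) ^ 2 +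
      (M p j (toHv Φ j x) (dX Φ j x)) ^ 2) := by
    rw [Hv.norm_sq_eq]
    refine Finset.sum_congr rfl fun j _ => integral_congr_ae ?_
    filter_upwards [stress_ae Φ j] with x h1
    rw [h1, stiff_strain_eq, E3.norm_sq_eq]
    simp; ring
  rw [normD, ← this, Real.sqrt_sq (norm_nonneg _)]

/-- `formA` as a bounded bilinear form. -/
def aForm (p : Params) : Hd p →L[ℝ] Hd p →L[ℝ] ℝ :=
  (innerSL ℝ (E := Hv p)).bilinearComp (stress p) (strain p)

theorem aForm_apply (Φ B : Hd p) : aForm p Φ B = inner ℝ (stress p Φ) (strain p B) := rfl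

theorem formA_eq_aForm (Φ B : Hd p) : formA Φ B = aForm p Φ B := formA_eq Φ B

theorem aForm_symm (Φ B : Hd p) : aForm p Φ B = aForm p B Φ := by
  rw [aForm_apply, aForm_apply, real_inner_comm (strain p Φ)]
  exact inner_mulOp_adjoint (fun j v w => diag3_symm _ _ _ v w) _ _

/-- `ipR` as a bounded bilinear form. -/
def rForm (p : Params) : Hv p →L[ℝ] Hv p →L[ℝ] ℝ := (innerSL ℝ (E := Hv p)).comp (Rop p)

theorem rForm_apply (Φ Ψ : Hv p) : rForm p Φ Ψ = inner ℝ (Rop p Φ) Ψ := rfl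

theorem ipR_eq_rForm (Φ Ψ : Hv p) : ipR Φ Ψ = rForm p Φ Ψ := ipR_eq Φ Ψ

theorem rForm_symm (Φ Ψ : Hv p) : rForm p Φ Ψ = rForm p Ψ Φ := Rop_symm Φ Ψ

theorem exists_rForm_ge (p : Params) : ∃ c : ℝ, 0 < c ∧ ∀ Φ : Hv p, c * ‖Φ‖ ^ 2 ≤ rForm p Φ Φ := by
  refine ⟨min (min (p.ρ 0) (p.ρ 1)) (min (p.β 0) (p.β 1)),
    lt_min (lt_min (p.ρ_pos 0) (p.ρ_pos 1)) (lt_min (p.β_pos 0) (p.β_pos 1)),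
    fun Φ => inner_mulOp_ge (fun j v => ?_) Φ⟩
  have h1 : min (min (p.ρ 0) (p.ρ 1)) (min (p.β 0) (p.β 1)) ≤ p.ρ j := by
    fin_cases j <;> simp
  have h2 : min (min (p.ρ 0) (p.ρ 1)) (min (p.β 0) (p.β 1)) ≤ p.β j := by
    fin_cases j <;> simp
  exact inner_diag3_ge h1 h2 h1 v

theorem exists_stress_ge (p : Params) : ∃ c : ℝ, 0 < c ∧ ∀ Φ : Hd p,
    c * ‖strain p Φ‖ ^ 2 ≤ aForm p Φ Φ := by
  refine ⟨min (min (p.k 0) (p.k 1)) (min (min (p.lam 0) (p.lam 1)) (min (p.σ 0) (p.σ 1))),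
    lt_min (lt_min (p.k_pos 0) (p.k_pos 1)) (lt_min (lt_min (p.lam_pos 0) (p.lam_pos 1))
      (lt_min (p.σ_pos 0) (p.σ_pos 1))), fun Φ => inner_mulOp_ge (fun j v => ?_) (strain p Φ)⟩
  refine inner_diag3_ge ?_ ?_ ?_ v <;> fin_cases j <;> simp

/-- The representative solves the linear ODE w' = strain − S w, with S = `strainMat p.l` and w = 0
at the left end, so Gronwall bounds sup |w| by the L² norm of the strain, first on (0, L₀) and then
across the interface. The condition at 0 already excludes non-trivial motions of zero strain. -/
theorem exists_norm_le_strain (p : Params) : ∃ C : ℝ, 0 < C ∧ ∀ Φ : Hd p, ‖Φ‖ ≤ C * ‖strain p Φ‖ := by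
  obtain ⟨CI, hCI0, hCI⟩ := exists_integral_norm_le p
  obtain ⟨CK, hCK0, hCK⟩ := exists_norm_le_of_bound p
  set κ : ℝ := ‖strainMat p.l‖ with hκ
  have hκ0 : 0 ≤ κ := norm_nonneg _
  -- The sum of the two Gronwall factors serves as one constant for both parts.
  set X : ℝ := Real.exp (κ * (p.hi 0 - p.lo 0)) + Real.exp (κ * (p.hi 1 - p.lo 1)) with hX
  have hX0 : 0 < X := by positivity
  have step : ∀ (Φ : Hd p) (j : Fin 2), ∀ x ∈ Icc (p.lo j) (p.hi j),
      ‖rep Φ j x‖ ≤ (‖rep Φ j (p.lo j)‖ + CI * ‖strain p Φ‖) * X := by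
    intro Φ j x hx
    have hc := (continuousOn_rep Φ j)
    have key := le_mul_exp_of_le_add_integral (φ := fun x => ‖rep Φ j x‖)
      (c := ‖rep Φ j (p.lo j)‖ + CI * ‖strain p Φ‖) hκ0 hc.norm (fun x hx => ?_) x hx
    · refine key.trans (mul_le_mul_of_nonneg_left ?_ (by positivity))
      have e1 : Real.exp (κ * (x - p.lo j)) ≤ Real.exp (κ * (p.hi j - p.lo j)) :=
        Real.exp_le_exp.2 (mul_le_mul_of_nonneg_left (by linarith [hx.2]) hκ0)
      refine e1.trans ?_
      fin_cases j
      · exact le_add_of_nonneg_right (Real.exp_pos _).le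
      · exact le_add_of_nonneg_left (Real.exp_pos _).le
    · have sub : uIcc (p.lo j) x ⊆ Icc (p.lo j) (p.hi j) := by
        rw [uIcc_of_le hx.1]; exact Icc_subset_Icc_right hx.2
      have e : rep Φ j x = rep Φ j (p.lo j) + ((∫ y in p.lo j..x, strain p Φ j y) -
          ∫ y in p.lo j..x, strainMat p.l (rep Φ j y)) := by
        have ci : IntervalIntegrable (fun y => strainMat p.l (rep Φ j y)) volume (p.lo j) x :=
          ((strainMat p.l).continuous.comp_continuousOn (hc.mono sub)).intervalIntegrable
        rw [← intervalIntegral.integral_sub (L2.intervalIntegrable _ hx) ci]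
        rw [rep, primFun_eq]
        congr 1
        refine L2.intervalIntegral_congr (b := p.hi j) ?_ hx
        filter_upwards [strain_ae Φ j, rep_ae Φ j] with y h1 h2
        rw [h1, h2]; exact (add_sub_cancel_right _ _).symm
      have n1 : ‖∫ y in p.lo j..x, strain p Φ j y‖ ≤ CI * ‖strain p Φ‖ := by
        refine le_trans ?_ (hCI (strain p Φ) j)
        rw [intervalIntegral.integral_of_le hx.1]
        refine (norm_integral_le_integral_norm _).trans ?_
        rw [integral_Ioc_eq_integral_Ioo]
        exact setIntegral_mono_set (L2.integrable _).norm
          (Eventually.of_forall fun _ => norm_nonneg _) (Ioo_subset_Ioo_right hx.2).eventuallyLE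
      have n2 : ‖∫ y in p.lo j..x, strainMat p.l (rep Φ j y)‖ ≤ κ * ∫ y in p.lo j..x, ‖rep Φ j y‖ := by
        rw [← intervalIntegral.integral_const_mul]
        refine intervalIntegral.norm_integral_le_of_norm_le hx.1 (Eventually.of_forall fun y _ =>
          (strainMat p.l).le_opNorm _) ((hc.mono sub).norm.intervalIntegrable.const_mul κ)
      calc ‖rep Φ j x‖ ≤ ‖rep Φ j (p.lo j)‖ + (‖∫ y in p.lo j..x, strain p Φ j y‖ +
            ‖∫ y in p.lo j..x, strainMat p.l (rep Φ j y)‖) := by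
            rw [e]; exact (norm_add_le _ _).trans (add_le_add_right (norm_sub_le _ _) _)
        _ ≤ _ := by linarith
  set D : ℝ := (CI * X + CI) * X + CI * X with hD
  have hD0 : 0 ≤ D := by positivity
  have sup : ∀ (Φ : Hd p) (j : Fin 2), ∀ x ∈ Icc (p.lo j) (p.hi j),
      ‖rep Φ j x‖ ≤ D * ‖strain p Φ‖ := by
    intro Φ
    have h0 : ∀ x ∈ Icc (p.lo 0) (p.hi 0), ‖rep Φ 0 x‖ ≤ CI * X * ‖strain p Φ‖ := fun x hx => by
      have := step Φ 0 x hx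
      have e : rep Φ 0 (p.lo 0) = 0 := primFun_zero _
      rw [e, norm_zero, zero_add] at this
      linarith
    intro j x hx
    have hs := norm_nonneg (strain p Φ)
    fin_cases j
    · refine (h0 x hx).trans (mul_le_mul_of_nonneg_right ?_ hs)
      rw [hD]; exact le_add_of_nonneg_left (by positivity)
    · have h1 := step Φ 1 x hx
      have h2 : ‖rep Φ 1 (p.lo 1)‖ ≤ CI * X * ‖strain p Φ‖ := by
        have e : rep Φ 1 (p.lo 1) = rep Φ 0 (p.hi 0) := (primFun_interface _).symm
        rw [e]; exact h0 _ (p.hi_mem 0)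
      refine h1.trans ?_
      have h3 : (‖rep Φ 1 (p.lo 1)‖ + CI * ‖strain p Φ‖) * X ≤
          (CI * X * ‖strain p Φ‖ + CI * ‖strain p Φ‖) * X := by gcongr
      refine h3.trans ?_
      rw [hD]
      have : 0 ≤ CI * X * ‖strain p Φ‖ := by positivity
      nlinarith
  set m : ℝ := ‖(mulOp (p := p) fun _ => strainMat p.l)‖ with hm
  have hm0 : 0 ≤ m := norm_nonneg _
  refine ⟨CK * D + (1 + m * (CK * D)), by positivity, fun Φ => ?_⟩
  have h1 : ‖toHv Φ‖ ≤ CK * D * ‖strain p Φ‖ := by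
    rw [mul_assoc]
    refine hCK _ _ (by positivity) fun j => ?_
    filter_upwards [rep_ae Φ j, ae_mem_Icc p j] with x a b
    rw [a]; exact sup Φ j x b
  have h2 : ‖dX Φ‖ ≤ (1 + m * (CK * D)) * ‖strain p Φ‖ := by
    have e : dX Φ = strain p Φ - mulOp (fun _ => strainMat p.l) (toHv Φ) := by
      rw [strain_apply, add_sub_cancel_right]
    have n := (mulOp (p := p) fun _ => strainMat p.l).le_opNorm (toHv Φ)
    have n2 := norm_sub_le (strain p Φ) (mulOp (fun _ => strainMat p.l) (toHv Φ))
    rw [← e] at n2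
    have n3 := mul_le_mul_of_nonneg_left h1 hm0
    nlinarith
  have := Hd.norm_le Φ
  nlinarith

theorem exists_aForm_ge (p : Params) : ∃ c : ℝ, 0 < c ∧ ∀ Φ : Hd p, c * ‖Φ‖ ^ 2 ≤ aForm p Φ Φ := by
  obtain ⟨c, hc, h⟩ := exists_stress_ge p
  obtain ⟨C, hC, h'⟩ := exists_norm_le_strain p
  refine ⟨c / C ^ 2, by positivity, fun Φ => le_trans ?_ (h Φ)⟩
  have : ‖Φ‖ ^ 2 ≤ C ^ 2 * ‖strain p Φ‖ ^ 2 := by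
    rw [← mul_pow]; exact pow_le_pow_left₀ (norm_nonneg _) (h' Φ) 2
  calc c / C ^ 2 * ‖Φ‖ ^ 2 ≤ c / C ^ 2 * (C ^ 2 * ‖strain p Φ‖ ^ 2) := by gcongr
    _ = c * ‖strain p Φ‖ ^ 2 := by field_simp

theorem exists_norm_le_normD (p : Params) : ∃ C : ℝ, 0 < C ∧ ∀ Φ : Hd p, ‖Φ‖ ≤ C * normD Φ := by
  obtain ⟨C, hC, h⟩ := exists_norm_le_strain p
  refine ⟨C * (‖mulOp (p := p) (stiffInv p)‖ + 1), by positivity, fun Φ => (h Φ).trans ?_⟩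
  rw [mul_assoc]
  refine mul_le_mul_of_nonneg_left ?_ hC.le
  have e : strain p Φ = mulOp (stiffInv p) (stress p Φ) :=
    (mulOp_mulOp (A := stiffInv p) (A' := stiff p) stiffInv_stiff (strain p Φ)).symm
  rw [normD_sq]
  calc ‖strain p Φ‖ = ‖mulOp (stiffInv p) (stress p Φ)‖ := by rw [← e]
    _ ≤ ‖mulOp (p := p) (stiffInv p)‖ * ‖stress p Φ‖ := (mulOp (p := p) (stiffInv p)).le_opNorm _
    _ ≤ _ := by gcongr; linarith

theorem exists_norm_le_normV (p : Params) : ∃ C : ℝ, 0 < C ∧ ∀ V : Hv p, ‖V‖ ≤ C * normV V := by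
  obtain ⟨c, hc, h⟩ := exists_rForm_ge p
  refine ⟨√c⁻¹, by positivity, fun V => ?_⟩
  rw [normV, ipR_eq_rForm, ← Real.sqrt_mul (by positivity)]
  refine Real.le_sqrt_of_sq_le ?_
  rw [inv_mul_eq_div, le_div_iff₀ hc]
  linarith [h V]

theorem exists_normD_le (p : Params) : ∃ C : ℝ, 0 < C ∧ ∀ Φ : Hd p, normD Φ ≤ C * ‖Φ‖ :=
  ⟨‖stress p‖ + 1, by positivity, fun Φ => by
    rw [normD_sq]
    refine ((stress p).le_opNorm Φ).trans ?_
    gcongr; linarith⟩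

theorem exists_normV_le (p : Params) : ∃ C : ℝ, 0 < C ∧ ∀ V : Hv p, normV V ≤ C * ‖V‖ := by
  refine ⟨√(‖rForm p‖ + 1), by positivity, fun V => ?_⟩
  rw [normV, ipR_eq_rForm]
  refine Real.sqrt_le_iff.2 ⟨by positivity, ?_⟩
  rw [mul_pow, Real.sq_sqrt (by positivity)]
  have h1 := (le_abs_self _).trans ((rForm p).le_opNorm₂ V V)
  nlinarith [sq_nonneg ‖V‖]

end Forms
attribute [irreducible] aForm rForm stress strain Rop RopInv toHvL dXL

end Bresse

namespace Bresse

/-! ### The Lax–Milgram theorem and density by orthogonality -/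

section Hilbert

variable {E : Type*} [NormedAddCommGroup E] [InnerProductSpace ℝ E] [CompleteSpace E]

theorem exists_eq_of_coercive (b : E →L[ℝ] E →L[ℝ] ℝ) {c : ℝ} (hc : 0 < c)
    (h : ∀ x, c * ‖x‖ ^ 2 ≤ b x x) (ℓ : E →L[ℝ] ℝ) : ∃ x, ∀ y, b x y = ℓ y := by
  have co : IsCoercive b := ⟨c, hc, fun u => by
    have := h u; rw [pow_two, ← mul_assoc] at this; exact this⟩
  refine ⟨co.continuousLinearEquivOfBilin.symm ((InnerProductSpace.toDual ℝ E).symm ℓ),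
    fun B => ?_⟩
  rw [← co.continuousLinearEquivOfBilin_apply, ContinuousLinearEquiv.apply_symm_apply,
    InnerProductSpace.toDual_symm_apply]

theorem exists_norm_sub_lt_of_orthogonal {S : E → Prop} (h0 : S 0)
    (hadd : ∀ x y, S x → S y → S (x + y)) (hsmul : ∀ (c : ℝ) x, S x → S (c • x))
    (h : ∀ x, (∀ y, S y → inner ℝ y x = 0) → x = 0) (x : E) {ε : ℝ} (hε : 0 < ε) :
    ∃ y, S y ∧ ‖y - x‖ < ε := by
  let K : Submodule ℝ E :=
    { carrier := {x | S x}
      zero_mem' := h0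
      add_mem' := fun {x y} hx hy => hadd x y hx hy
      smul_mem' := fun c x hx => hsmul c x hx }
  have hK : Dense (K : Set E) := by
    rw [Submodule.dense_iff_topologicalClosure_eq_top, Submodule.topologicalClosure_eq_top_iff,
      Submodule.eq_bot_iff]
    exact fun x hx => h x fun y hy => Submodule.inner_right_of_mem_orthogonal (show y ∈ K from hy) hx
  obtain ⟨y, hy, hd⟩ := Metric.dense_iff.1 hK x ε hε
  exact ⟨y, hd, by rw [← dist_eq_norm]; exact hy⟩

end Hilbert

/-! ### The weak form of A, its domain, and density -/

section WeakForm

variable {p : Params}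

/-- `A Φ = v` in the weak sense. -/
def WeakA (Φ : Hd p) (v : Hv p) : Prop := ∀ B : Hd p, aForm p Φ B = inner ℝ v (toHv B)

theorem inner_strain (s : Hv p) (B : Hd p) : inner ℝ s (strain p B) =
    inner ℝ s (dX B) + inner ℝ (mulOp (fun _ => strainMatT p.l) s) (toHv B) := by
  rw [strain_apply, inner_add_right, inner_mulOp_adjoint (A' := fun _ => strainMat p.l)
    (fun j v w => (inner_strainMat p.l v w).symm)]

theorem inner_toHv (g : Hv p) (B : Hd p) : inner ℝ g (toHv B) = -inner ℝ (prim p g) (dX B) := by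
  have := inner_prim_add g (dX B)
  rw [tot_dX, inner_zero_right, ← toHv_eq_prim] at this
  linarith

/-- Shifting all terms onto the derivative of the test function leaves stress + prim(v − Sᵀ stress),
with Sᵀ = `strainMatT p.l`, orthogonal to every function of zero total integral, hence constant. As
primitives are continuous at L₀, so is the stress; these are the transmission conditions in D(A). -/
theorem weakA_iff (Φ : Hd p) (v : Hv p) : WeakA Φ v ↔ ∃ c : E3, stress p Φ =
    cst p c - prim p (v - mulOp (fun _ => strainMatT p.l) (stress p Φ)) := by
  have key : ∀ B : Hd p, aForm p Φ B - inner ℝ v (toHv B) = inner ℝ (stress p Φ +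
      prim p (v - mulOp (fun _ => strainMatT p.l) (stress p Φ))) (dX B) := by
    intro B
    rw [aForm_apply, inner_strain, inner_add_left]
    have := inner_toHv (v - mulOp (fun _ => strainMatT p.l) (stress p Φ)) B
    rw [inner_sub_left] at this
    linarith
  constructor
  · intro h
    obtain ⟨c, hc⟩ := exists_eq_cst (s := stress p Φ +
      prim p (v - mulOp (fun _ => strainMatT p.l) (stress p Φ))) (fun g hg => by
        have := key (mkHd g hg)
        rw [dX_mkHd] at this
        rw [← this, h, sub_self])
    exact ⟨c, eq_sub_of_add_eq hc⟩
  · rintro ⟨c, hc⟩ B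
    have := key B
    rw [eq_sub_iff_add_eq.1 hc, inner_cst, tot_dX, inner_zero_right] at this
    linarith

theorem opA_eq (j : Fin 2) (v d s : E3) : opA p j v d s =
    -(stiff p j (s + strainMat p.l d)) + strainMatT p.l (stiff p j (d + strainMat p.l v)) := by
  rw [stiff_strain_eq, stiff_strain_eq]
  ext i; fin_cases i <;> simp [opA, strainMatT_apply]; ring

theorem forces_eq {j i : Fin 2} {v d v' d' : E3}
    (h : stiff p j (d + strainMat p.l v) = stiff p i (d' + strainMat p.l v')) :
    Q p j v d = Q p i v' d' ∧ N p j v d = N p i v' d' ∧ M p j v d = M p i v' d' := by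
  rw [stiff_strain_eq, stiff_strain_eq] at h
  have h0 := congrArg (fun z : E3 => z 0) h
  have h1 := congrArg (fun z : E3 => z 1) h
  have h2 := congrArg (fun z : E3 => z 2) h
  exact ⟨by simpa using h0, by simpa using h2, by simpa using h1⟩

/-- By `weakA_iff` the stress has a continuous representative; inverting the stiffness gives an
absolutely continuous representative of Φ_x, and continuity of the stress at L₀ matches the forces.
-/
theorem WeakA.inDomA {Φ : Hd p} {v : Hv p} (h : WeakA Φ v) : ∃ S, InDomA Φ S ∧
    ∀ j, ∀ᵐ x ∂(p.vol j), opA p j (toHv Φ j x) (dX Φ j x) (S j x) = v j x := by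
  obtain ⟨c, hc⟩ := (weakA_iff Φ v).1 h
  set g := v - mulOp (fun _ => strainMatT p.l) (stress p Φ) with hg
  -- Solved for Φ_xx from the relation that the x-derivative of the stress is −g, the stress being
  -- the stiffness applied to Φ_x + S Φ with S = `strainMat p.l`.
  set S : Hv p := mulOp (stiffInv p) (-g) - mulOp (fun _ => strainMat p.l) (dX Φ) with hS
  have hSae : ∀ j, ∀ᵐ x ∂(p.vol j), S j x = stiffInv p j (-(g j x)) - strainMat p.l (dX Φ j x) := by
    intro j
    filter_upwards [Hv.sub_ae (mulOp (stiffInv p) (-g)) (mulOp (fun _ => strainMat p.l) (dX Φ)) j,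
      mulOp_ae (stiffInv p) (-g) j, mulOp_ae (fun _ => strainMat p.l) (dX Φ) j, Hv.neg_ae g j]
      with x h1 h2 h3 h4
    rw [hS, h1, h2, h3, h4]
  have hst : ∀ j, ∀ᵐ x ∂(p.vol j), stiff p j (dX Φ j x + strainMat p.l (toHv Φ j x)) =
      c - primFun g j x := by
    intro j
    filter_upwards [stress_ae Φ j, Hv.sub_ae (cst p c) (prim p g) j, cst_ae (p := p) c j,
      prim_ae g j] with x h1 h2 h3 h4
    rw [← h1, hc, h2, h3, h4]
  set gr : Fin 2 → ℝ → E3 := fun j x =>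
    stiffInv p j (c - primFun g j x) - strainMat p.l (rep Φ j x) with hgr
  have hgrst : ∀ j x, stiff p j (gr j x + strainMat p.l (rep Φ j x)) = c - primFun g j x := by
    intro j x
    rw [hgr, sub_add_cancel, stiff_stiffInv]
  have hmatch : stiff p 0 (gr 0 p.L₀ + strainMat p.l (rep Φ 0 p.L₀)) =
      stiff p 1 (gr 1 p.L₀ + strainMat p.l (rep Φ 1 p.L₀)) := by
    rw [hgrst, hgrst]
    congr 1
    exact primFun_interface g
  obtain ⟨m1, m2, m3⟩ := forces_eq hmatch
  refine ⟨S, ⟨rep Φ, gr, isH1Rep_rep Φ, fun j => ⟨?_, fun x hx => ?_⟩, m1, m2, m3⟩, fun j => ?_⟩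
  · filter_upwards [hst j, rep_ae Φ j] with x h1 h2
    simp only [hgr]
    rw [← h1, stiffInv_stiff, h2, add_sub_cancel_right]
  · have i1 := L2.intervalIntegrable (g j) hx
    have i2 := L2.intervalIntegrable (dX Φ j) hx
    have e1 : ∫ y in p.lo j..x, S j y = -(stiffInv p j (∫ y in p.lo j..x, g j y)) -
        strainMat p.l (∫ y in p.lo j..x, dX Φ j y) := by
      rw [L2.intervalIntegral_congr (hSae j) hx,
        ← (stiffInv p j).intervalIntegral_comp_comm i1,
        ← (strainMat p.l).intervalIntegral_comp_comm i2, ← intervalIntegral.integral_neg,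
        ← intervalIntegral.integral_sub]
      · simp only [map_neg]
      · exact ((stiffInv p j).integrable_comp i1.1 |> fun h => ⟨h, (stiffInv p j).integrable_comp i1.2⟩ :
          IntervalIntegrable (fun y => stiffInv p j (g j y)) volume (p.lo j) x).neg
      · exact ⟨(strainMat p.l).integrable_comp i2.1, (strainMat p.l).integrable_comp i2.2⟩
    have er : rep Φ j x = rep Φ j (p.lo j) + ∫ y in p.lo j..x, dX Φ j y := primFun_eq _ _ _
    simp only [hgr]
    rw [e1, primFun_eq, er]
    simp only [map_sub, map_add]
    abel
  · filter_upwards [hSae j, stress_ae Φ j, Hv.sub_ae v (mulOp (fun _ => strainMatT p.l)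
      (stress p Φ)) j, mulOp_ae (fun _ => strainMatT p.l) (stress p Φ) j] with x h1 h2 h3 h4
    rw [opA_eq, h1, sub_add_cancel, stiff_stiffInv, neg_neg, ← h2, hg, h3, h4, sub_add_cancel]

/-- On each part H² regularity makes the stress a primitive of −g, and the matching of Q, N, M glues
the two parts into the single expression of `weakA_iff`. -/
theorem InDomA.weakA {Φ : Hd p} {S v : Hv p} (h : InDomA Φ S)
    (hv : ∀ j, ∀ᵐ x ∂(p.vol j), opA p j (toHv Φ j x) (dX Φ j x) (S j x) = v j x) : WeakA Φ v := by
  obtain ⟨w, gr, hw, hg, m1, m2, m3⟩ := h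
  rw [weakA_iff]
  set g := v - mulOp (fun _ => strainMatT p.l) (stress p Φ) with hgdef
  set s : Fin 2 → ℝ → E3 := fun j x => stiff p j (gr j x + strainMat p.l (w j x)) with hs
  have hgae : ∀ j, ∀ᵐ x ∂(p.vol j), g j x = -(stiff p j (S j x + strainMat p.l (dX Φ j x))) := by
    intro j
    filter_upwards [hv j, stress_ae Φ j, Hv.sub_ae v (mulOp (fun _ => strainMatT p.l)
      (stress p Φ)) j, mulOp_ae (fun _ => strainMatT p.l) (stress p Φ) j] with x h1 h2 h3 h4
    rw [hgdef, h3, h4, ← h1, opA_eq, h2, add_sub_cancel_right]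
  have hprim : ∀ j, ∀ x ∈ Icc (p.lo j) (p.hi j), s j x = s j (p.lo j) - ∫ y in p.lo j..x, g j y := by
    intro j x hx
    have i1 := L2.intervalIntegrable (S j) hx
    have i2 := L2.intervalIntegrable (dX Φ j) hx
    have i3 : IntervalIntegrable (fun y => strainMat p.l (dX Φ j y)) volume (p.lo j) x :=
      ⟨(strainMat p.l).integrable_comp i2.1, (strainMat p.l).integrable_comp i2.2⟩
    have e1 : ∫ y in p.lo j..x, g j y = -(stiff p j ((∫ y in p.lo j..x, S j y) +
        strainMat p.l (∫ y in p.lo j..x, dX Φ j y))) := by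
      rw [L2.intervalIntegral_congr (hgae j) hx, intervalIntegral.integral_neg,
        (stiff p j).intervalIntegral_comp_comm (i1.add i3), intervalIntegral.integral_add i1 i3,
        (strainMat p.l).intervalIntegral_comp_comm i2]
    rw [e1]
    simp only [hs]
    rw [(hg j).2 x hx, (hw j).2 x hx]
    simp only [map_add]
    abel
  have hmatch : s 0 (p.hi 0) = s 1 (p.lo 1) := by
    simp only [hs]
    rw [stiff_strain_eq, stiff_strain_eq]
    have e0 : p.hi 0 = p.L₀ := rfl
    have e1 : p.lo 1 = p.L₀ := rfl
    rw [e0, e1, m1, m2, m3]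
  have hsp : ∀ j, ∀ x ∈ Icc (p.lo j) (p.hi j), s j x = s 0 (p.lo 0) - primFun g j x := by
    have h0 : ∀ x ∈ Icc (p.lo 0) (p.hi 0), s 0 x = s 0 (p.lo 0) - primFun g 0 x := fun x hx => by
      rw [hprim 0 x hx, primFun_eq, primFun_zero, zero_add]
    intro j x hx
    fin_cases j
    · exact h0 x hx
    · change s 1 x = s 0 (p.lo 0) - primFun g 1 x
      rw [hprim 1 x hx, ← hmatch, h0 _ (p.hi_mem 0), primFun_interface, primFun_eq g 1 x]
      abel
  refine ⟨s 0 (p.lo 0), Hv.ext_ae fun j => ?_⟩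
  filter_upwards [stress_ae Φ j, Hv.sub_ae (cst p (s 0 (p.lo 0))) (prim p g) j,
    cst_ae (p := p) (s 0 (p.lo 0)) j, prim_ae g j, (hw j).1, (hg j).1, ae_mem_Icc p j]
    with x h1 h2 h3 h4 h5 h6 h7
  rw [h1, h2, h3, h4, ← hsp j x h7, h5, h6]

theorem exists_functional_rep (ℓ : Hd p →L[ℝ] ℝ) : ∃ Ψ : Hd p, ∀ B, aForm p Ψ B = ℓ B := by
  obtain ⟨c, hc, h⟩ := exists_aForm_ge p
  exact exists_eq_of_coercive (E := Hd p) (aForm p) hc h ℓ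

theorem exists_weakA (v : Hv p) : ∃ Φ : Hd p, WeakA Φ v := by
  obtain ⟨Φ, hΦ⟩ := exists_functional_rep ((innerSL ℝ v).comp (toHvL p))
  refine ⟨Φ, fun B => ?_⟩
  rw [hΦ, ContinuousLinearMap.comp_apply, innerSL_apply_apply, toHvL_apply]

theorem WeakA.zero : WeakA (0 : Hd p) 0 := fun B => by simp

theorem WeakA.add {Φ Ψ : Hd p} {v w : Hv p} (h : WeakA Φ v) (h' : WeakA Ψ w) :
    WeakA (Φ + Ψ) (v + w) := fun B => by
  rw [map_add, inner_add_left, ← h B, ← h' B]; rfl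

theorem WeakA.smul {Φ : Hd p} {v : Hv p} (c : ℝ) (h : WeakA Φ v) :
    WeakA (c • Φ) (c • v) := fun B => by
  rw [map_smul, real_inner_smul_left, ← h B]; rfl

theorem WeakA.sub {Φ Ψ : Hd p} {v w : Hv p} (h : WeakA Φ v) (h' : WeakA Ψ w) :
    WeakA (Φ - Ψ) (v - w) := fun B => by
  rw [map_sub, inner_sub_left, ← h B, ← h' B]; rfl

/-- Let Ψ be orthogonal to the domain and let Ξ represent ⟨Ψ, ·⟩ with respect to a. If AΦ = Ξ, then
the squared H_v norm of Ξ is a(Φ, Ξ) = ⟨Ψ, Φ⟩ = 0; hence Ξ = 0 and Ψ = 0. -/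
theorem dense_domain (Φ₀ : Hd p) {ε : ℝ} (hε : 0 < ε) : ∃ Φ : Hd p, (∃ v, WeakA Φ v) ∧
    ‖Φ - Φ₀‖ < ε := by
  refine exists_norm_sub_lt_of_orthogonal (E := Hd p) ⟨0, WeakA.zero⟩
    (fun _ _ ⟨v, hv⟩ ⟨w, hw⟩ => ⟨v + w, hv.add hw⟩) (fun c _ ⟨v, hv⟩ => ⟨c • v, hv.smul c⟩)
    (fun Ψ hΨ => ?_) Φ₀ hε
  obtain ⟨Ξ, hΞ⟩ := exists_functional_rep (innerSL ℝ Ψ)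
  have h0 : Ξ = 0 := by
    refine toHv_injective (inner_self_eq_zero (𝕜 := ℝ) |>.1 ?_)
    obtain ⟨Φ, hΦ⟩ := exists_weakA (toHv Ξ)
    rw [← hΦ Ξ, aForm_symm, hΞ, innerSL_apply_apply, real_inner_comm]
    exact hΨ Φ ⟨_, hΦ⟩
  have := hΞ Ψ
  rw [h0, map_zero, innerSL_apply_apply] at this
  exact inner_self_eq_zero (𝕜 := ℝ) |>.1 this.symm

/-- Orthogonality to H_d says that Φ = 0 solves AΦ = v weakly, so by `weakA_iff` the primitive of v
is constant. -/
theorem eq_zero_of_forall_inner_toHv {v : Hv p} (h : ∀ B : Hd p, inner ℝ v (toHv B) = 0) :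
    v = 0 := by
  have hw : WeakA (0 : Hd p) v := fun B => by rw [map_zero, h B]; rfl
  obtain ⟨c, hc⟩ := (weakA_iff _ _).1 hw
  rw [map_zero, map_zero, sub_zero] at hc
  exact eq_zero_of_prim_eq_cst (sub_eq_zero.1 hc.symm).symm

theorem dense_toHv (V : Hv p) {ε : ℝ} (hε : 0 < ε) : ∃ Φ : Hd p, ‖toHv Φ - V‖ < ε := by
  obtain ⟨_, ⟨Φ, rfl⟩, hΦ⟩ := exists_norm_sub_lt_of_orthogonal (E := Hv p)
    (S := fun v => ∃ Φ : Hd p, toHv Φ = v) ⟨0, rfl⟩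
    (fun _ _ ⟨Φ, hΦ⟩ ⟨Ψ, hΨ⟩ => ⟨Φ + Ψ, by rw [toHv_add, hΦ, hΨ]⟩)
    (fun c _ ⟨Φ, hΦ⟩ => ⟨c • Φ, by rw [toHv_smul, hΦ]⟩)
    (fun v hv => eq_zero_of_forall_inner_toHv fun B => by
      rw [real_inner_comm]; exact hv _ ⟨B, rfl⟩) V hε
  exact ⟨Φ, hΦ⟩

theorem eq_of_forall_inner_toHv {v w : Hv p}
    (h : ∀ B : Hd p, inner ℝ v (toHv B) = inner ℝ w (toHv B)) : v = w :=
  sub_eq_zero.1 <| eq_zero_of_forall_inner_toHv fun B => by rw [inner_sub_left, h, sub_self]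

end WeakForm
end Bresse

namespace Bresse

/-! ### Minimisation of uniformly convex functionals -/

section Convex

variable {E F : Type*} [NormedAddCommGroup E] [NormedSpace ℝ E] [CompleteSpace E]
  [NormedAddCommGroup F] [InnerProductSpace ℝ F]

/-- The midpoint inequality makes a minimising sequence Cauchy, so the minimum is reached without
weak topologies. -/
theorem exists_isMinOn_of_midpoint {J : E → ℝ} (hJ : Continuous J) {m c : ℝ} (hm : ∀ x, m ≤ J x)
    (hc : 0 < c) (h : ∀ x y, c * ‖x - y‖ ^ 2 ≤ J x + J y - 2 * J ((1 / 2 : ℝ) • (x + y))) :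
    ∃ x, ∀ y, J x ≤ J y := by
  have hbdd : BddBelow (range J) := ⟨m, by rintro _ ⟨x, rfl⟩; exact hm x⟩
  set I := sInf (range J) with hI
  have hIle : ∀ x, I ≤ J x := fun x => csInf_le hbdd ⟨x, rfl⟩
  have hex : ∀ n : ℕ, ∃ x, J x < I + 1 / ((n : ℝ) + 1) := fun n => by
    obtain ⟨_, ⟨x, rfl⟩, hx⟩ := exists_lt_of_csInf_lt (range_nonempty J)
      (show I < I + 1 / ((n : ℝ) + 1) from lt_add_of_pos_right _ (by positivity))
    exact ⟨x, hx⟩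
  choose x hx using hex
  have key : ∀ N n k : ℕ, N ≤ n → N ≤ k → ‖x n - x k‖ ^ 2 ≤ 2 / c * (1 / ((N : ℝ) + 1)) := by
    intro N n k hn hk
    have h1 := h (x n) (x k)
    have h2 := hIle ((1 / 2 : ℝ) • (x n + x k))
    have h3 : 1 / ((n : ℝ) + 1) ≤ 1 / ((N : ℝ) + 1) := by gcongr
    have h4 : 1 / ((k : ℝ) + 1) ≤ 1 / ((N : ℝ) + 1) := by gcongr
    have h5 : c * ‖x n - x k‖ ^ 2 ≤ 2 * (1 / ((N : ℝ) + 1)) := by linarith [hx n, hx k]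
    rw [div_mul_eq_mul_div, le_div_iff₀ hc]
    linarith
  have hcau : CauchySeq x := by
    refine Metric.cauchySeq_iff'.2 fun ε hε => ?_
    obtain ⟨N, hN⟩ := exists_nat_one_div_lt (show 0 < c / 2 * ε ^ 2 by positivity)
    refine ⟨N, fun n hn => ?_⟩
    have h1 := key N n N hn le_rfl
    rw [dist_eq_norm]
    have h2 : ‖x n - x N‖ ^ 2 < ε ^ 2 := by
      refine h1.trans_lt ?_
      calc 2 / c * (1 / ((N : ℝ) + 1)) < 2 / c * (c / 2 * ε ^ 2) := by gcongr
        _ = ε ^ 2 := by field_simp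
    exact lt_of_pow_lt_pow_left₀ 2 hε.le h2
  obtain ⟨z, hz⟩ := cauchySeq_tendsto_of_complete hcau
  refine ⟨z, fun y => le_trans ?_ (hIle y)⟩
  have l1 : Tendsto (fun n : ℕ => I + 1 / ((n : ℝ) + 1)) atTop (𝓝 (I + 0)) :=
    tendsto_const_nhds.add tendsto_one_div_add_atTop_nhds_zero_nat
  rw [add_zero] at l1
  exact le_of_tendsto_of_tendsto ((hJ.tendsto z).comp hz) l1
    (Eventually.of_forall fun n => (hx n).le)

/-- Euler equation of `½ a(x,x) + ψ(x) - ℓ(x)` for a convex `ψ ≥ 0` with subgradient `ι* g`. -/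
theorem exists_eq_of_convex_potential (a : E →L[ℝ] E →L[ℝ] ℝ) (symm : ∀ x y, a x y = a y x)
    {c : ℝ} (hc : 0 < c) (coer : ∀ x, c * ‖x‖ ^ 2 ≤ a x x) (ι : E →L[ℝ] F) {g : E → F}
    (hg : Continuous g) {ψ : E → ℝ} (hψ : ∀ x, 0 ≤ ψ x)
    (hsub : ∀ x y, ψ x + inner ℝ (g x) (ι (y - x)) ≤ ψ y) (ℓ : E →L[ℝ] ℝ) :
    ∃ x, ∀ y, a x y + inner ℝ (g x) (ι y) = ℓ y := by
  -- The subgradient inequalities at x and at y squeeze ψ(y) between two functions of y that tend to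
  -- ψ(x).
  have hψc : Continuous ψ := by
    rw [continuous_iff_continuousAt]
    intro x
    have lim : ∀ G : E → F, Continuous G → Tendsto (fun y => ψ x + inner ℝ (G y) (ι (y - x)))
        (𝓝 x) (𝓝 (ψ x)) := fun G hG => by
      have : Continuous fun y => ψ x + inner ℝ (G y) (ι (y - x)) := by fun_prop
      have h := this.tendsto x
      simpa using h
    refine tendsto_of_tendsto_of_tendsto_of_le_of_le (lim (fun _ => g x) continuous_const)
      (lim g hg) (fun y => hsub x y) fun y => ?_
    have := hsub y x
    rw [← neg_sub y x, map_neg, inner_neg_right] at this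
    simp only
    linarith
  set J : E → ℝ := fun x => 1 / 2 * a x x + ψ x - ℓ x with hJ
  have hJc : Continuous J := by
    have : Continuous fun x => a x x := by fun_prop
    exact ((continuous_const.mul this).add hψc).sub ℓ.continuous
  -- The lower bound is Young's inequality for ℓ. The constant c/4 comes from the parallelogram
  -- identity for ½a, the convex term ψ contributing with the right sign.
  obtain ⟨x, hx⟩ := exists_isMinOn_of_midpoint (J := J) hJc (m := -(‖ℓ‖ ^ 2 / (2 * c)))
    (c := c / 4) (fun x => by
      have h1 := coer x
      have h2 : ℓ x ≤ ‖ℓ‖ * ‖x‖ := (le_abs_self _).trans (ℓ.le_opNorm x)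
      have h3 : ‖ℓ‖ * ‖x‖ ≤ c / 2 * ‖x‖ ^ 2 + ‖ℓ‖ ^ 2 / (2 * c) := by
        have : 0 ≤ (c * ‖x‖ - ‖ℓ‖) ^ 2 / (2 * c) := by positivity
        have e : (c * ‖x‖ - ‖ℓ‖) ^ 2 / (2 * c) =
            c / 2 * ‖x‖ ^ 2 + ‖ℓ‖ ^ 2 / (2 * c) - ‖ℓ‖ * ‖x‖ := by field_simp; ring
        linarith
      simp only [hJ]
      linarith [hψ x]) (by positivity) (fun x y => by
      have h1 := coer (x - y)
      set m := (1 / 2 : ℝ) • (x + y) with hm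
      have h2 := hsub m x
      have h3 := hsub m y
      have e1 : x - m = (1 / 2 : ℝ) • (x - y) := by rw [hm]; module
      have e2 : y - m = -((1 / 2 : ℝ) • (x - y)) := by rw [hm]; module
      rw [e1] at h2
      rw [e2, map_neg, inner_neg_right] at h3
      have e3 : a m m = 1 / 4 * (a x x + 2 * a x y + a y y) := by
        rw [hm]
        simp only [map_smul, map_add, smul_apply, add_apply,
          smul_eq_mul, symm y x]
        ring
      have e4 : a (x - y) (x - y) = a x x - 2 * a x y + a y y := by
        simp only [map_sub, sub_apply, symm y x]
        ring
      have e5 : ℓ m = 1 / 2 * (ℓ x + ℓ y) := by rw [hm, map_smul, map_add, smul_eq_mul]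
      simp only [hJ]
      rw [e3, e5]
      rw [e4] at h1
      linarith)
  -- Minimality at x against x + εy, with the subgradient taken at the moved point, is divided by ε
  -- > 0; continuity of g permits ε → 0. Replacing y by −y then gives equality.
  have half : ∀ y, ℓ y ≤ a x y + inner ℝ (g x) (ι y) := by
    intro y
    have hε : ∀ ε : ℝ, 0 < ε → ℓ y ≤ a x y + ε / 2 * a y y + inner ℝ (g (x + ε • y)) (ι y) := by
      intro ε hε
      have h1 := hx (x + ε • y)
      have h2 := hsub (x + ε • y) x
      have e1 : x - (x + ε • y) = -(ε • y) := by abel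
      rw [e1, map_neg, inner_neg_right, map_smul, real_inner_smul_right] at h2
      have e2 : a (x + ε • y) (x + ε • y) = a x x + 2 * ε * a x y + ε ^ 2 * a y y := by
        simp only [map_smul, map_add, smul_apply, add_apply,
          smul_eq_mul, symm y x]
        ring
      simp only [hJ, e2] at h1
      rw [map_add ℓ, map_smul ℓ, smul_eq_mul] at h1
      have h3 : ε * ℓ y ≤ ε * (a x y + ε / 2 * a y y + inner ℝ (g (x + ε • y)) (ι y)) := by
        linarith
      exact le_of_mul_le_mul_left h3 hε
    have hcont : Continuous fun ε : ℝ => a x y + ε / 2 * a y y + inner ℝ (g (x + ε • y)) (ι y) := by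
      fun_prop
    have lim := (hcont.tendsto 0).mono_left (nhdsWithin_le_nhds (s := Ioi (0 : ℝ)))
    simp only [zero_div, zero_mul, add_zero, zero_smul] at lim
    exact ge_of_tendsto lim (eventually_nhdsWithin_of_forall hε)
  refine ⟨x, fun y => le_antisymm ?_ (half y)⟩
  have := half (-y)
  simp only [map_neg, inner_neg_right] at this
  linarith

end Convex

/-! ### Reduction of the second order equation to a first order system -/

section SecondOrder

variable {D H : Type} [NormedAddCommGroup D] [NormedSpace ℝ D] [CompleteSpace D]
  [NormedAddCommGroup H] [InnerProductSpace ℝ H] [CompleteSpace H]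

/-- Strong solvability of `R v' + A x + g + F(ι x) = P`, `x' = v`, for a Lipschitz `F` and a
monotone damping relation `g ∈ 𝒟 v`. -/
theorem exists_second_order_evolution (ι : D →L[ℝ] H) (a : D →L[ℝ] D →L[ℝ] ℝ)
    (asymm : ∀ x y, a x y = a y x) {ca : ℝ} (hca : 0 < ca) (acoer : ∀ x, ca * ‖x‖ ^ 2 ≤ a x x)
    (r : H →L[ℝ] H →L[ℝ] ℝ) (rsymm : ∀ x y, r x y = r y x) {cr : ℝ} (hcr : 0 < cr)
    (rcoer : ∀ x, cr * ‖x‖ ^ 2 ≤ r x x) (R Ri : H →L[ℝ] H) (hRi : ∀ v, R (Ri v) = v)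
    (hr : ∀ v w, r v w = inner ℝ (R v) w) {Dm : H → H → Prop}
    (mono : ∀ v g v' g', Dm v g → Dm v' g' → 0 ≤ inner ℝ (g - g') (v - v'))
    (res : ∀ s : ℝ, 0 < s → ∀ ℓ : D →L[ℝ] ℝ, ∃ x g, Dm (ι x) g ∧
      ∀ y, s * a x y + s⁻¹ * r (ι x) (ι y) + inner ℝ g (ι y) = ℓ y)
    {F : H → H} {L : NNReal} (hF : LipschitzWith L F) {T : ℝ} (hT : 0 < T) {P : ℝ → H}
    (hP : Continuous P) {m : ℝ → ℝ} (hm : Monotone m)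
    (hPm : ∀ s t, s ≤ t → ‖P t - P s‖ ≤ m t - m s) {x₀ x₁ : D} {v₀ g₀ : H}
    (h₀ : ∀ y, a x₀ y = inner ℝ v₀ (ι y)) (hg₀ : Dm (ι x₁) g₀) :
    ∃ (x w : ℝ → D) (v z g : ℝ → H), ContinuousOn x (Icc 0 T) ∧ ContinuousOn v (Icc 0 T) ∧
      IntervalIntegrable w volume 0 T ∧ IntervalIntegrable z volume 0 T ∧
      (∀ t ∈ Icc 0 T, x t = x₀ + ∫ s in (0 : ℝ)..t, w s) ∧
      (∀ t ∈ Icc 0 T, v t = ι x₁ + ∫ s in (0 : ℝ)..t, z s) ∧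
      ∀ᵐ t ∂(volume.restrict (Ioc 0 T)), ι (w t) = v t ∧ Dm (v t) (g t) ∧
        ∀ y, a (x t) y = inner ℝ (P t - F (ι (x t)) - g t - R (z t)) (ι y) := by
  let b : (D × H) →L[ℝ] (D × H) →L[ℝ] ℝ :=
    a.bilinearComp (ContinuousLinearMap.fst ℝ D H) (ContinuousLinearMap.fst ℝ D H) +
      r.bilinearComp (ContinuousLinearMap.snd ℝ D H) (ContinuousLinearMap.snd ℝ D H)
  have hb : ∀ u u' : D × H, b u u' = a u.1 u'.1 + r u.2 u'.2 := fun _ _ => rfl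
  -- The graph of (x, v) ↦ (−v, R⁻¹(Ax + g)): v must come from some w in D, q is Ax in the weak
  -- sense, and g is a value of the damping.
  let G : D × H → D × H → Prop := fun u y => ∃ (w : D) (g q : H), ι w = u.2 ∧ y.1 = -w ∧
    Dm u.2 g ∧ (∀ y, a u.1 y = inner ℝ q (ι y)) ∧ R y.2 = q + g
  let B : D × H → D × H := fun u => (0, Ri (F (ι u.1)))
  have hB : LipschitzWith (‖Ri‖₊ * (L * ‖ι‖₊)) B := by
    have h1 : LipschitzWith (‖Ri‖₊ * (L * ‖ι‖₊)) fun u : D × H => Ri (F (ι u.1)) := by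
      have := Ri.lipschitz.comp (hF.comp (ι.lipschitz.comp (LipschitzWith.prod_fst (α := D) (β := H))))
      rwa [mul_one] at this
    have := (LipschitzWith.const (α := D × H) (0 : D)).prodMk h1
    rwa [max_eq_right (zero_le)] at this
  let f : ℝ → D × H := fun t => (0, Ri (P t))
  obtain ⟨u, w, hu, hw, hut, hG⟩ := exists_strong_evolution_of_form b
    (fun u u' => by rw [hb, hb, asymm, rsymm]) (lt_min hca hcr) (fun u => by
      rw [hb]
      have h1 := acoer u.1
      have h2 := rcoer u.2
      have h3 : ‖u‖ ^ 2 ≤ ‖u.1‖ ^ 2 + ‖u.2‖ ^ 2 := by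
        rcases max_choice ‖u.1‖ ‖u.2‖ with h | h
        · rw [Prod.norm_def, h]; nlinarith [norm_nonneg u.2]
        · rw [Prod.norm_def, h]; nlinarith [norm_nonneg u.1]
      have h4 := mul_le_mul_of_nonneg_left h3 (lt_min hca hcr).le
      have h5 := mul_le_mul_of_nonneg_right (min_le_left ca cr) (sq_nonneg ‖u.1‖)
      have h6 := mul_le_mul_of_nonneg_right (min_le_right ca cr) (sq_nonneg ‖u.2‖)
      linarith) (G := G) (by
      rintro u y u' y' ⟨w, g, q, h1, h2, h3, h4, h5⟩ ⟨w', g', q', h1', h2', h3', h4', h5'⟩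
      have hm := mono _ _ _ _ h3 h3'
      -- The elastic part is skew for the energy form: the contributions of w and of q cancel, and
      -- only the damping remains.
      have e1 : b (y - y') (u - u') = inner ℝ (g - g') (u.2 - u'.2) := by
        rw [hb, hr]
        simp only [Prod.fst_sub, Prod.snd_sub]
        rw [map_sub R, h5, h5', h2, h2', asymm]
        have : a (u.1 - u'.1) (-w - -w') = -inner ℝ (q - q') (u.2 - u'.2) := by
          have e : -w - -w' = -(w - w') := by abel
          rw [e, map_neg, map_sub a, sub_apply, h4, h4', map_sub ι, h1, h1',
            inner_sub_left]
        rw [this, ← inner_neg_left, ← inner_add_left]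
        congr 1
        abel
      rw [e1]; exact hm) (fun s hs z => by
      -- The unknown is the velocity x. The first equation makes the displacement z.1 + s x, and
      -- inserting this in the second leaves the elliptic problem of `res`.
      obtain ⟨x, g, hx, hy⟩ := res s hs (s⁻¹ • ((r z.2).comp ι) - a z.1)
      refine ⟨(z.1 + s • x, ι x), (-x, s⁻¹ • (z.2 - ι x)),
        ⟨x, g, R (s⁻¹ • (z.2 - ι x)) - g, rfl, rfl, hx, fun y => ?_, by abel⟩, ?_⟩
      · have := hy y
        simp only [sub_apply, smul_apply,
          ContinuousLinearMap.comp_apply, smul_eq_mul] at this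
        simp only [map_add, map_smul, add_apply,
          smul_apply, smul_eq_mul]
        rw [inner_sub_left, real_inner_smul_left, ← hr, map_sub, sub_apply]
        linarith
      · ext1
        · simp
        · simp [hs.ne']) hB hT (f := f)
      (continuous_const.prodMk (Ri.continuous.comp hP))
      (m := fun t => ‖Ri‖ * m t) (fun s t hst => mul_le_mul_of_nonneg_left (hm hst) (norm_nonneg _))
      (fun s t hst => by
        have e : f t - f s = (0, Ri (P t - P s)) := by
          simp only [f, Prod.mk_sub_mk, sub_zero, map_sub]
        rw [e, Prod.norm_mk, norm_zero, max_eq_right (norm_nonneg _), ← mul_sub]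
        exact (Ri.le_opNorm _).trans (mul_le_mul_of_nonneg_left (hPm s t hst) (norm_nonneg _)))
      (u₀ := (x₀, ι x₁)) (w₀ := (-x₁, Ri (v₀ + g₀))) ⟨x₁, g₀, v₀, rfl, rfl, hg₀, h₀, hRi _⟩
  have hwi : IntervalIntegrable w volume 0 T := by
    rw [intervalIntegrable_iff_integrableOn_Ioc_of_le hT.le]
    exact hw.integrable (by norm_num)
  have hfc : Continuous f := continuous_const.prodMk (Ri.continuous.comp hP)
  have hi : IntervalIntegrable (fun s => f s - B (u s) - w s) volume 0 T := by
    have : ContinuousOn (fun s => f s - B (u s)) (Icc 0 T) :=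
      hfc.continuousOn.sub (hB.continuous.comp_continuousOn hu)
    rw [← uIcc_of_le hT.le] at this
    exact this.intervalIntegrable.sub hwi
  have sub : ∀ t ∈ Icc (0 : ℝ) T, IntervalIntegrable (fun s => f s - B (u s) - w s) volume 0 t :=
    fun t ht => hi.mono_set (by
      rw [uIcc_of_le ht.1, uIcc_of_le hT.le]; exact Icc_subset_Icc_right ht.2)
  let fst := ContinuousLinearMap.fst ℝ D H
  let snd := ContinuousLinearMap.snd ℝ D H
  let y : ℝ → D × H := fun s => f s - B (u s) - w s
  have hy : ∀ t, y t = f t - B (u t) - w t := fun _ => rfl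
  have hex : ∃ g : ℝ → H, ∀ᵐ t ∂(volume.restrict (Ioc 0 T)), ι (fst (y t)) = snd (u t) ∧
      Dm (snd (u t)) (g t) ∧ ∀ z, a (fst (u t)) z =
        inner ℝ (P t - F (ι (fst (u t))) - g t - R (snd (y t))) (ι z) := by
    classical
    refine ⟨fun t => if h : G (u t) (w t) then h.choose_spec.choose else 0, ?_⟩
    filter_upwards [hG] with t ht
    rw [dif_pos ht]
    obtain ⟨q, h1, h2, h3, h4, h5⟩ := ht.choose_spec.choose_spec
    generalize ht.choose_spec.choose = g at *
    refine ⟨?_, h3, fun z => ?_⟩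
    · refine Eq.trans ?_ h1
      congr 1
      change (0 - 0 - (w t).1 : D) = _
      simpa using (neg_eq_iff_eq_neg.2 h2)
    · refine (h4 z).trans ?_
      congr 1
      change q = P t - F (ι (u t).1) - g - R (Ri (P t) - Ri (F (ι (u t).1)) - (w t).2)
      rw [map_sub, map_sub, hRi, hRi, h5]
      abel
  obtain ⟨g, hg⟩ := hex
  refine ⟨fun t => fst (u t), fun t => fst (y t), fun t => snd (u t), fun t => snd (y t), g,
    fst.continuous.comp_continuousOn hu, snd.continuous.comp_continuousOn hu,
    ⟨fst.integrable_comp hi.1, fst.integrable_comp hi.2⟩,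
    ⟨snd.integrable_comp hi.1, snd.integrable_comp hi.2⟩, fun t ht => ?_, fun t ht => ?_, hg⟩
  · simp only [hy]
    rw [fst.intervalIntegral_comp_comm (sub t ht), hut t ht, map_add]
    rfl
  · simp only [hy]
    rw [snd.intervalIntegral_comp_comm (sub t ht), hut t ht, map_add]
    rfl

end SecondOrder
end Bresse

namespace Bresse

variable {p : Params}

/-! ### The damping operator and its convex potential -/

section Damping

/-- `g = Γ(V)` as an element of `H_v`. -/
def IsDamp (γ : ℝ → ℝ) (V g : Hv p) : Prop :=
  ∀ j, ∀ᵐ x ∂(p.vol j), g j x = damping γ j (V j x)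

theorem inner_damping_zero (γ : ℝ → ℝ) (v b : E3) : inner ℝ (damping γ 0 v) b = γ (v 1) * b 1 := by
  rw [E3.inner_eq]; simp [damping]

theorem inner_damping_one (γ : ℝ → ℝ) (v b : E3) : inner ℝ (damping γ 1 v) b = 0 := by
  simp [damping]

theorem IsDamp.integrable {γ : ℝ → ℝ} {V g : Hv p} (h : IsDamp γ V g) (B : Hv p) :
    Integrable (fun x => γ (V 0 x 1) * B 0 x 1) (p.vol 0) := by
  refine (L2.integrable_inner (𝕜 := ℝ) (g 0) (B 0)).congr ?_
  filter_upwards [h 0] with x hx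
  rw [hx, inner_damping_zero]

theorem IsDamp.inner_eq {γ : ℝ → ℝ} {V g : Hv p} (h : IsDamp γ V g) (B : Hv p) :
    inner ℝ g B = ∫ x, γ (V 0 x 1) * B 0 x 1 ∂(p.vol 0) := by
  rw [← ip_eq_inner, ip, Fin.sum_univ_two]
  have h0 : ∫ x in Ioo (p.lo 0) (p.hi 0), inner ℝ (g 0 x) (B 0 x) =
      ∫ x, γ (V 0 x 1) * B 0 x 1 ∂(p.vol 0) := by
    refine integral_congr_ae ?_
    filter_upwards [h 0] with x hx
    rw [hx, inner_damping_zero]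
  have h1 : ∫ x in Ioo (p.lo 1) (p.hi 1), inner ℝ (g 1 x) (B 1 x) = 0 := by
    refine integral_eq_zero_of_ae ?_
    filter_upwards [h 1] with x hx
    rw [hx, inner_damping_one]; rfl
  rw [h0, h1, add_zero]

theorem IsDamp.inner_sub_nonneg {γ : ℝ → ℝ} (hγ : Monotone γ) {V g V' g' : Hv p}
    (h : IsDamp γ V g) (h' : IsDamp γ V' g') : 0 ≤ inner ℝ (g - g') (V - V') := by
  rw [inner_sub_left, h.inner_eq, h'.inner_eq, ← integral_sub (h.integrable _) (h'.integrable _)]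
  refine integral_nonneg_of_ae ?_
  filter_upwards [Hv.sub_ae V V' 0] with x hx
  rw [hx]
  simp only [Pi.zero_apply, PiLp.sub_apply]
  rcases le_total (V 0 x 1) (V' 0 x 1) with hle | hle
  · nlinarith [hγ hle]
  · nlinarith [hγ hle]

theorem mul_self_nonneg_of_monotone {γ : ℝ → ℝ} (hγ : Monotone γ) (h0 : γ 0 = 0) (s : ℝ) :
    0 ≤ γ s * s := by
  rcases le_total 0 s with h | h
  · exact mul_nonneg (h0 ▸ hγ h) h
  · exact mul_nonneg_of_nonpos_of_nonpos (h0 ▸ hγ h) h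

theorem IsDamp.inner_self_nonneg {γ : ℝ → ℝ} (hγ : Monotone γ) (h0 : γ 0 = 0) {V g : Hv p}
    (h : IsDamp γ V g) : 0 ≤ inner ℝ g V := by
  rw [h.inner_eq]
  exact integral_nonneg fun x => mul_self_nonneg_of_monotone hγ h0 _

theorem continuous_damping {γ : ℝ → ℝ} (hγ : Continuous γ) (j : Fin 2) :
    Continuous (damping γ j) := by
  fin_cases j
  · refine (PiLp.continuous_toLp 2 _).comp (continuous_pi fun i => ?_)
    fin_cases i
    · exact continuous_const
    · exact hγ.comp (PiLp.continuous_apply 2 _ 1)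
    · exact continuous_const
  · exact continuous_const

theorem integrable_comp_toHv {κ : E3 → ℝ} (hκ : Continuous κ) (W : Hd p) (j : Fin 2) :
    Integrable (fun x => κ (toHv W j x)) (p.vol j) := by
  obtain ⟨C, -, hC⟩ := exists_sup_bound p
  obtain ⟨M, hM⟩ := (isCompact_closedBall (0 : E3) (C * ‖W‖)).exists_bound_of_continuousOn
    hκ.continuousOn
  refine Integrable.of_bound (hκ.comp_aestronglyMeasurable (Lp.aestronglyMeasurable _)) M ?_
  filter_upwards [(hC W j).2] with x hx
  exact hM _ (by rwa [mem_closedBall_zero_iff])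

/-- `Γ(W)` for `W ∈ H_d`. -/
def damp {γ : ℝ → ℝ} (hγ : Continuous γ) (W : Hd p) : Hv p :=
  mkHv (fun j x => damping γ j (rep W j x)) fun j =>
    memLp_of_continuousOn ((continuous_damping hγ j).comp_continuousOn (continuousOn_rep W j))

theorem isDamp_damp {γ : ℝ → ℝ} (hγ : Continuous γ) (W : Hd p) : IsDamp γ (toHv W) (damp hγ W) := by
  intro j
  filter_upwards [rep_ae W j, mkHv_ae (fun j x => damping γ j (rep W j x)) (fun j =>
    memLp_of_continuousOn ((continuous_damping hγ j).comp_continuousOn (continuousOn_rep W j))) j]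
    with x h1 h2
  rw [damp, h2, h1]

/-- Functions near W₀ in H_d take their values in one fixed ball, on which γ is uniformly
continuous. -/
theorem continuous_damp {γ : ℝ → ℝ} (hγ : Continuous γ) : Continuous (damp (p := p) hγ) := by
  obtain ⟨C, hC0, hC⟩ := exists_sup_bound p
  obtain ⟨K, hK0, hK⟩ := exists_norm_le_of_bound p
  rw [Metric.continuous_iff]
  intro W₀ ε hε
  have huc : ∀ j, ∃ δ > 0, ∀ a ∈ Metric.closedBall (0 : E3) (C * (‖W₀‖ + 1)),
      ∀ b ∈ Metric.closedBall (0 : E3) (C * (‖W₀‖ + 1)), dist a b < δ →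
        dist (damping γ j a) (damping γ j b) < ε / (K + 1) := fun j =>
    Metric.uniformContinuousOn_iff.1 ((isCompact_closedBall (0 : E3)
      (C * (‖W₀‖ + 1))).uniformContinuousOn_of_continuous (continuous_damping hγ j).continuousOn)
      _ (by positivity)
  choose δ hδ0 hδ using huc
  refine ⟨min 1 (min (δ 0) (δ 1) / C), lt_min one_pos (div_pos (lt_min (hδ0 0) (hδ0 1)) hC0),
    fun W hW => ?_⟩
  rw [dist_eq_norm] at hW ⊢
  have hW1 : ‖W - W₀‖ < 1 := hW.trans_le (min_le_left _ _)
  have hW2 : ∀ j, C * ‖W - W₀‖ < δ j := fun j => by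
    have h1 := hW.trans_le (min_le_right _ _)
    rw [lt_div_iff₀ hC0] at h1
    have h2 : min (δ 0) (δ 1) ≤ δ j := by
      fin_cases j
      · exact min_le_left _ _
      · exact min_le_right _ _
    linarith
  have hWn : ‖W‖ ≤ ‖W₀‖ + 1 := by linarith [norm_le_norm_add_norm_sub W₀ W, norm_sub_rev W W₀]
  refine (hK _ (ε / (K + 1)) (by positivity) fun j => ?_).trans_lt ?_
  · filter_upwards [isDamp_damp hγ W j, isDamp_damp hγ W₀ j, Hv.sub_ae (damp hγ W) (damp hγ W₀) j,
      (hC W j).2, (hC W₀ j).2, (hC (W - W₀) j).2, Hv.sub_ae (toHv W) (toHv W₀) j]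
      with x h1 h2 h3 h4 h5 h6 h7
    rw [h3, h1, h2, ← dist_eq_norm]
    refine (hδ j _ ?_ _ ?_ ?_).le
    · rw [mem_closedBall_zero_iff]
      exact h4.trans (mul_le_mul_of_nonneg_left hWn hC0.le)
    · rw [mem_closedBall_zero_iff]
      exact h5.trans (mul_le_mul_of_nonneg_left (by linarith) hC0.le)
    · rw [dist_eq_norm, ← h7, ← toHv_sub]
      exact h6.trans_lt (hW2 j)
  · rw [← mul_div_assoc, div_lt_iff₀ (by positivity)]
    nlinarith

theorem continuous_primitive {γ : ℝ → ℝ} (hγ : Continuous γ) :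
    Continuous fun s : ℝ => ∫ r in (0 : ℝ)..s, γ r :=
  intervalIntegral.continuous_primitive (fun _ _ => hγ.intervalIntegrable _ _) 0

theorem le_primitive_sub {γ : ℝ → ℝ} (hγ : Continuous γ) (hm : Monotone γ) (a b : ℝ) :
    (∫ r in (0 : ℝ)..a, γ r) + γ a * (b - a) ≤ ∫ r in (0 : ℝ)..b, γ r := by
  have h1 : (∫ r in (0 : ℝ)..a, γ r) + ∫ r in a..b, γ r = ∫ r in (0 : ℝ)..b, γ r :=
    intervalIntegral.integral_add_adjacent_intervals (hγ.intervalIntegrable _ _)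
      (hγ.intervalIntegrable _ _)
  have h2 : γ a * (b - a) ≤ ∫ r in a..b, γ r := by
    have hc : ∀ c d : ℝ, ∫ _ in c..d, γ a = γ a * (d - c) := fun c d => by
      rw [intervalIntegral.integral_const, smul_eq_mul, mul_comm]
    rcases le_total a b with hab | hab
    · rw [← hc]
      exact intervalIntegral.integral_mono_on hab (by simp) (hγ.intervalIntegrable _ _)
        fun x hx => hm hx.1
    · rw [intervalIntegral.integral_symm, ← neg_sub a b, mul_neg, ← hc b a]
      exact neg_le_neg (intervalIntegral.integral_mono_on hab (hγ.intervalIntegrable _ _)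
        (by simp) fun x hx => hm hx.2)
  linarith

attribute [irreducible] damp

theorem exists_form_eq {E F : Type*} [NormedAddCommGroup E] [NormedSpace ℝ E]
    [NormedAddCommGroup F] [NormedSpace ℝ F] (a : E →L[ℝ] E →L[ℝ] ℝ) (r : F →L[ℝ] F →L[ℝ] ℝ)
    (ι : E →L[ℝ] F) (s t : ℝ) : ∃ b : E →L[ℝ] E →L[ℝ] ℝ,
      ∀ x y, b x y = s * a x y + t * r (ι x) (ι y) :=
  ⟨s • a + t • r.bilinearComp ι ι, fun _ _ => rfl⟩

/-- The potential `∫₀^{L₀} G(ψ)`, `G' = γ`, of the damping. -/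
def dampPot (γ : ℝ → ℝ) (W : Hd p) : ℝ :=
  ∫ x, (∫ r in (0 : ℝ)..(toHv W 0 x 1), γ r) ∂(p.vol 0)

theorem dampPot_nonneg {γ : ℝ → ℝ} (hγ : Continuous γ) (hm : Monotone γ) (h0 : γ 0 = 0)
    (W : Hd p) : 0 ≤ dampPot γ W := by
  refine integral_nonneg fun x => ?_
  have := le_primitive_sub hγ hm 0 (toHv W 0 x 1)
  rw [h0, zero_mul, add_zero, intervalIntegral.integral_same] at this
  exact this

theorem dampPot_add_le {γ : ℝ → ℝ} (hγ : Continuous γ) (hm : Monotone γ) (W W' : Hd p) :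
    dampPot γ W + inner ℝ (damp hγ W) (toHvL p (W' - W)) ≤ dampPot γ W' := by
  have hGE : Continuous fun a : E3 => ∫ r in (0 : ℝ)..a 1, γ r :=
    (continuous_primitive hγ).comp (PiLp.continuous_apply 2 _ 1)
  rw [toHvL_apply, (isDamp_damp hγ W).inner_eq, dampPot,
    ← integral_add (integrable_comp_toHv hGE W 0) ((isDamp_damp hγ W).integrable _)]
  refine integral_mono_ae ((integrable_comp_toHv hGE W 0).add
    ((isDamp_damp hγ W).integrable _)) (integrable_comp_toHv hGE W' 0) ?_
  filter_upwards [Hv.sub_ae (toHv W') (toHv W) 0] with x hx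
  rw [toHv_sub, hx]
  exact le_primitive_sub hγ hm _ _

/-- The equation is the Euler equation of the quadratic functional of s a + s⁻¹ r plus `dampPot`
minus ℓ. Coercivity comes from a alone, and `damp` is a subgradient of `dampPot` because γ is
non-decreasing. -/
theorem exists_resolvent {γ : ℝ → ℝ} (hγ : Continuous γ) (hm : Monotone γ) (h0 : γ 0 = 0) {s : ℝ}
    (hs : 0 < s) (ℓ : Hd p →L[ℝ] ℝ) : ∃ (x : Hd p) (g : Hv p), IsDamp γ (toHvL p x) g ∧
      ∀ y, s * aForm p x y + s⁻¹ * rForm p (toHvL p x) (toHvL p y) + inner ℝ g (toHvL p y) = ℓ y := by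
  obtain ⟨ca, hca, hac⟩ := exists_aForm_ge p
  obtain ⟨cr, hcr, hrc⟩ := exists_rForm_ge p
  obtain ⟨a, ha⟩ := exists_form_eq (E := Hd p) (F := Hv p) (aForm p) (rForm p) (toHvL p) s s⁻¹
  have hsymm : ∀ x y, a x y = a y x := fun x y =>
    (ha x y).trans ((congrArg₂ (fun u v => s * u + s⁻¹ * v) (aForm_symm x y)
      (rForm_symm (toHvL p x) (toHvL p y))).trans (ha y x).symm)
  have hcoer : ∀ x, (s * ca) * ‖x‖ ^ 2 ≤ a x x := fun x => by
    rw [ha x x]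
    have h1 := mul_le_mul_of_nonneg_left (hac x) hs.le
    have h2 := hrc (toHvL p x)
    have h3 : 0 ≤ s⁻¹ * rForm p (toHvL p x) (toHvL p x) :=
      mul_nonneg (inv_nonneg.2 hs.le) (le_trans (by positivity) h2)
    linarith
  have hc := continuous_damp (p := p) hγ
  have hsub := dampPot_add_le (p := p) hγ hm
  have hd := isDamp_damp (p := p) hγ
  obtain ⟨x, hx⟩ := exists_eq_of_convex_potential (E := Hd p) (F := Hv p) a hsymm (mul_pos hs hca)
    hcoer (toHvL p) hc (dampPot_nonneg hγ hm h0) hsub ℓ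
  refine ⟨x, damp hγ x, ?_, fun y => ?_⟩
  · rw [toHvL_apply]; exact hd x
  · have e := ha x y
    have e2 := hx y
    linarith

end Damping

/-! ### Superposition operators and truncation of the feedback -/

section Nemytskii

variable {C : NNReal} {φ : Fin 2 → E3 → E3}

theorem memLp_comp_lipschitz (hφ : ∀ j, LipschitzWith C (φ j)) (u : Hv p) (j : Fin 2) :
    MemLp (fun x => φ j (u j x)) 2 (p.vol j) := by
  have h1 : MemLp (fun x => φ j (u j x) - φ j 0) 2 (p.vol j) := by
    have : LipschitzWith C fun a => φ j a - φ j 0 := by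
      simpa using (hφ j).sub (LipschitzWith.const (φ j 0))
    exact this.comp_memLp (by simp) (Lp.memLp (u j))
  have h2 := h1.add (memLp_const (φ j 0))
  refine h2.congr_norm ?_ ?_
  · exact (hφ j).continuous.comp_aestronglyMeasurable (Lp.aestronglyMeasurable _)
  · exact Eventually.of_forall fun x => by simp

/-- Superposition operator of Lipschitz functions. -/
def nem (hφ : ∀ j, LipschitzWith C (φ j)) (u : Hv p) : Hv p :=
  mkHv (fun j x => φ j (u j x)) (memLp_comp_lipschitz hφ u)

theorem nem_ae (hφ : ∀ j, LipschitzWith C (φ j)) (u : Hv p) (j : Fin 2) :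
    ∀ᵐ x ∂(p.vol j), nem hφ u j x = φ j (u j x) := mkHv_ae _ (memLp_comp_lipschitz hφ u) j

theorem Hv.norm_le_of_ae {u v : Hv p} {c : ℝ} (hc : 0 ≤ c)
    (h : ∀ j, ∀ᵐ x ∂(p.vol j), ‖u j x‖ ≤ c * ‖v j x‖) : ‖u‖ ≤ c * ‖v‖ := by
  have h1 : ∀ j, ‖u j‖ ≤ c * ‖v j‖ := fun j => Lp.norm_le_mul_norm_of_ae_le_mul (h j)
  have h2 : ‖u‖ ^ 2 ≤ (c * ‖v‖) ^ 2 := by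
    rw [mul_pow, PiLp.norm_sq_eq_of_L2, PiLp.norm_sq_eq_of_L2, Finset.mul_sum]
    refine Finset.sum_le_sum fun j _ => ?_
    rw [← mul_pow]
    exact pow_le_pow_left₀ (norm_nonneg _) (h1 j) 2
  exact (sq_le_sq₀ (norm_nonneg _) (by positivity)).1 h2

theorem lipschitzWith_nem (hφ : ∀ j, LipschitzWith C (φ j)) :
    LipschitzWith C (nem (p := p) hφ) := by
  refine LipschitzWith.of_dist_le_mul fun u v => ?_
  rw [dist_eq_norm, dist_eq_norm]
  refine Hv.norm_le_of_ae C.2 fun j => ?_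
  filter_upwards [Hv.sub_ae (nem hφ u) (nem hφ v) j, Hv.sub_ae u v j, nem_ae hφ u j, nem_ae hφ v j]
    with x h1 h2 h3 h4
  rw [h1, h2, h3, h4]
  exact (hφ j).norm_sub_le _ _

attribute [irreducible] nem

/-- Coordinatewise truncation. -/
def clip (K s : ℝ) : ℝ := max (-K) (min s K)

theorem abs_clip_sub_le (K s t : ℝ) : |clip K s - clip K t| ≤ |s - t| := by
  refine (abs_max_sub_max_le_max _ _ _ _).trans ?_
  rw [sub_self, abs_zero, max_eq_right (abs_nonneg _)]
  refine (abs_min_sub_min_le_max _ _ _ _).trans ?_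
  rw [sub_self, abs_zero, max_eq_left (abs_nonneg _)]

theorem clip_eq {K s : ℝ} (h : |s| ≤ K) : clip K s = s := by
  rw [abs_le] at h
  rw [clip, min_eq_left h.2, max_eq_right h.1]

theorem abs_clip_le {K : ℝ} (hK : 0 ≤ K) (s : ℝ) : |clip K s| ≤ K :=
  abs_le.2 ⟨le_max_left _ _, max_le (by linarith) (min_le_right _ _)⟩

def clip3 (K : ℝ) (a : E3) : E3 := !₂[clip K (a 0), clip K (a 1), clip K (a 2)]

theorem clip3_eq {K : ℝ} {a : E3} (h : ‖a‖ ≤ K) : clip3 K a = a := by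
  ext i
  fin_cases i <;> exact clip_eq ((E3.abs_apply_le a _).trans h)

theorem norm_clip3_sub_le (K : ℝ) (a b : E3) : ‖clip3 K a - clip3 K b‖ ≤ ‖a - b‖ := by
  refine (sq_le_sq₀ (norm_nonneg _) (norm_nonneg _)).1 ?_
  rw [E3.norm_sq_eq, E3.norm_sq_eq]
  have h : ∀ i, (clip K (a i) - clip K (b i)) ^ 2 ≤ (a i - b i) ^ 2 := fun i =>
    sq_le_sq.2 (abs_clip_sub_le K _ _)
  exact add_le_add (add_le_add (h 0) (h 1)) (h 2)

theorem norm_clip3_le {K : ℝ} (hK : 0 ≤ K) (a : E3) : ‖clip3 K a‖ ≤ 2 * K := by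
  refine (sq_le_sq₀ (norm_nonneg _) (by positivity)).1 ?_
  rw [E3.norm_sq_eq]
  have h : ∀ i, clip K (a i) ^ 2 ≤ K ^ 2 := fun i =>
    sq_le_sq.2 ((abs_clip_le hK _).trans (le_abs_self K))
  have : clip3 K a 0 ^ 2 + clip3 K a 1 ^ 2 + clip3 K a 2 ^ 2 ≤ K ^ 2 + K ^ 2 + K ^ 2 :=
    add_le_add (add_le_add (h 0) (h 1)) (h 2)
  nlinarith

/-- The feedback is composed with componentwise clipping, which is nonexpansive, fixes the ball of
radius K and has bounded range. -/
theorem exists_truncated_feedback {f g h : Fin 2 → E3 → ℝ} (hf : ∀ j, LipOnBalls (f j))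
    (hg : ∀ j, LipOnBalls (g j)) (hh : ∀ j, LipOnBalls (h j)) {K : ℝ} (hK : 0 ≤ K) :
    ∃ (φ : Fin 2 → E3 → E3) (C : NNReal), (∀ j, LipschitzWith C (φ j)) ∧
      ∀ j a, ‖a‖ ≤ K → φ j a = feedback f g h j a := by
  -- The radius 2K accommodates the corners of the cube of half-side K, whose norm is √3 K.
  choose Cf hCf using fun j => hf j (2 * K)
  choose Cg hCg using fun j => hg j (2 * K)
  choose Ch hCh using fun j => hh j (2 * K)
  let C : ℝ := ∑ j, (|Cf j| + |Ch j| + |Cg j|)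
  have hC : ∀ j, |Cf j| + |Ch j| + |Cg j| ≤ C := fun j =>
    Finset.single_le_sum (f := fun j => |Cf j| + |Ch j| + |Cg j|) (fun i _ => by positivity)
      (Finset.mem_univ j)
  refine ⟨fun j a => feedback f g h j (clip3 K a), C.toNNReal, fun j => ?_, fun j a ha => by
    simp only [clip3_eq ha]⟩
  refine LipschitzWith.of_dist_le_mul fun a b => ?_
  rw [dist_eq_norm, dist_eq_norm]
  have ha := norm_clip3_le hK a
  have hb := norm_clip3_le hK b
  have hab := norm_clip3_sub_le K a b
  set a' := clip3 K a
  set b' := clip3 K b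
  have h0 : ∀ (k : E3 → ℝ) (c : ℝ), (∀ a b : E3, ‖a‖ ≤ 2 * K → ‖b‖ ≤ 2 * K →
      |k a - k b| ≤ c * ‖a - b‖) → |k a' - k b'| ≤ |c| * ‖a - b‖ := fun k c hk =>
    (hk a' b' ha hb).trans (mul_le_mul (le_abs_self c) hab (norm_nonneg _) (abs_nonneg c))
  have h1 := h0 _ _ (hCf j)
  have h2 := h0 _ _ (hCh j)
  have h3 := h0 _ _ (hCg j)
  have h4 : ‖feedback f g h j a' - feedback f g h j b'‖ ≤
      |f j a' - f j b'| + |h j a' - h j b'| + |g j a' - g j b'| := by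
    refine (sq_le_sq₀ (norm_nonneg _) (by positivity)).1 ?_
    rw [E3.norm_sq_eq]
    have e : ∀ x y z : ℝ, x ^ 2 + y ^ 2 + z ^ 2 ≤ (|x| + |y| + |z|) ^ 2 := fun x y z => by
      nlinarith [sq_abs x, sq_abs y, sq_abs z, mul_nonneg (abs_nonneg x) (abs_nonneg y),
        mul_nonneg (abs_nonneg x) (abs_nonneg z), mul_nonneg (abs_nonneg y) (abs_nonneg z)]
    exact e _ _ _
  refine h4.trans ?_
  rw [Real.coe_toNNReal _ (le_trans (by positivity) (hC j))]
  nlinarith [mul_le_mul_of_nonneg_right (hC j) (norm_nonneg (a - b))]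

end Nemytskii

/-- The initial velocity is taken in H_d, where `damp` supplies the square integrable damping at
time zero that `exists_second_order_evolution` asks for. -/
theorem exists_evolution {γ : ℝ → ℝ} (hγ : Continuous γ) (hm : Monotone γ) (h0 : γ 0 = 0)
    {C : NNReal} {φ : Fin 2 → E3 → E3} (hφ : ∀ j, LipschitzWith C (φ j)) {T : ℝ} (hT : 0 < T)
    {P : ℝ → Hv p} (hP : Continuous P) {m : ℝ → ℝ} (hmm : Monotone m)
    (hPm : ∀ s t, s ≤ t → ‖P t - P s‖ ≤ m t - m s) {Φ₀ Φ₁ : Hd p} {v₀ : Hv p} (h₀ : WeakA Φ₀ v₀) :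
    ∃ (Φ W : ℝ → Hd p) (V Z g : ℝ → Hv p), ContinuousOn Φ (Icc 0 T) ∧ ContinuousOn V (Icc 0 T) ∧
      IntervalIntegrable W volume 0 T ∧ IntervalIntegrable Z volume 0 T ∧
      (∀ t ∈ Icc 0 T, Φ t = Φ₀ + ∫ s in (0 : ℝ)..t, W s) ∧
      (∀ t ∈ Icc 0 T, V t = toHv Φ₁ + ∫ s in (0 : ℝ)..t, Z s) ∧
      ∀ᵐ t ∂(volume.restrict (Ioc 0 T)), toHv (W t) = V t ∧ IsDamp γ (V t) (g t) ∧
        WeakA (Φ t) (P t - nem hφ (toHv (Φ t)) - g t - Rop p (Z t)) := by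
  obtain ⟨ca, hca, hac⟩ := exists_aForm_ge p
  obtain ⟨cr, hcr, hrc⟩ := exists_rForm_ge p
  have hres := fun s hs ℓ => exists_resolvent (p := p) hγ hm h0 (s := s) hs ℓ
  have hRi := Rop_RopInv (p := p)
  have hr := rForm_apply (p := p)
  have rs := rForm_symm (p := p)
  have as := aForm_symm (p := p)
  have hι := toHvL_apply (p := p)
  unfold WeakA at *
  simp only [← hι] at *
  exact exists_second_order_evolution (D := Hd p) (H := Hv p) (toHvL p) (aForm p) as hca hac
    (rForm p) rs hcr hrc (Rop p) (RopInv p) hRi hr (Dm := IsDamp γ)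
    (fun v g v' g' h h' => h.inner_sub_nonneg hm h') hres (lipschitzWith_nem hφ) hT hP hmm hPm h₀
    (g₀ := damp hγ Φ₁) (by rw [toHvL_apply]; exact isDamp_damp hγ Φ₁)

end Bresse

namespace Bresse

/-! ### Energy and testing identities for abstract second order equations -/

section Abstract

variable {D H : Type*} [NormedAddCommGroup D] [NormedSpace ℝ D]
  [NormedAddCommGroup H] [InnerProductSpace ℝ H]

/-- The equation is tested with w, whose image under ι is v. The product rule differentiates both
quadratic forms, and by symmetry the cross terms add up to 2⟨q, v⟩. -/
theorem energy_identity [CompleteSpace D] [CompleteSpace H] (ι : D →L[ℝ] H) (A : D →L[ℝ] D →L[ℝ] ℝ) (asymm : ∀ x y, A x y = A y x)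
    (r : H →L[ℝ] H →L[ℝ] ℝ) (rsymm : ∀ x y, r x y = r y x) {x w : ℝ → D} {v z q : ℝ → H}
    {a b : ℝ} (hab : a ≤ b) (hw : IntervalIntegrable w volume a b)
    (hz : IntervalIntegrable z volume a b) (hx : ∀ t ∈ Icc a b, x t = x a + ∫ s in a..t, w s)
    (hv : ∀ t ∈ Icc a b, v t = v a + ∫ s in a..t, z s)
    (h : ∀ᵐ t ∂(volume.restrict (Ioc a b)), ι (w t) = v t ∧
      ∀ y, A (x t) y + r (z t) (ι y) = inner ℝ (q t) (ι y)) :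
    IntervalIntegrable (fun t => inner ℝ (q t) (v t)) volume a b ∧
      2 * ∫ t in a..b, inner ℝ (q t) (v t) =
        (A (x b) (x b) + r (v b) (v b)) - (A (x a) (x a) + r (v a) (v a)) := by
  obtain ⟨i1, e1⟩ := integral_bilinear_primitive A hab hw hw hx hx
  obtain ⟨i2, e2⟩ := integral_bilinear_primitive r hab hz hz hv hv
  have key : ∀ᵐ t ∂(volume.restrict (Ioc a b)), (A (w t) (x t) + A (x t) (w t)) +
      (r (z t) (v t) + r (v t) (z t)) = 2 * inner ℝ (q t) (v t) := by
    filter_upwards [h] with t ht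
    have := ht.2 (w t)
    rw [ht.1] at this
    rw [asymm (w t), rsymm (v t), ← this]
    ring
  have hi : IntervalIntegrable (fun t => 2 * inner ℝ (q t) (v t)) volume a b := by
    refine (i1.add i2).congr_ae ?_
    rw [uIoc_of_le hab]
    exact key
  have he : ∫ t in a..b, 2 * inner ℝ (q t) (v t) =
      (A (x b) (x b) - A (x a) (x a)) + (r (v b) (v b) - r (v a) (v a)) := by
    rw [← e1, ← e2, ← intervalIntegral.integral_add i1 i2]
    refine intervalIntegral.integral_congr_ae_restrict ?_
    rw [uIoc_of_le hab]
    filter_upwards [key] with t ht using ht.symm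
  constructor
  · have := hi.const_mul (1 / 2 : ℝ)
    refine this.congr fun t _ => ?_
    ring
  · rw [← intervalIntegral.integral_const_mul, he]
    ring

/-- This is the product rule for r(v, β), with r(v', β) eliminated by testing the equation with y.
-/
theorem testing_identity [CompleteSpace H] (ι : D →L[ℝ] H) (A : D →L[ℝ] D →L[ℝ] ℝ)
    (r : H →L[ℝ] H →L[ℝ] ℝ) {x y : ℝ → D} {v z q β β' : ℝ → H}
    {a b : ℝ} (hab : a ≤ b) (hz : IntervalIntegrable z volume a b)
    (hβ' : IntervalIntegrable β' volume a b)
    (hv : ∀ t ∈ Icc a b, v t = v a + ∫ s in a..t, z s)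
    (hβ : ∀ t ∈ Icc a b, β t = β a + ∫ s in a..t, β' s)
    (hy : ∀ᵐ t ∂(volume.restrict (Ioc a b)), ι (y t) = β t)
    (h : ∀ᵐ t ∂(volume.restrict (Ioc a b)), ∀ y, A (x t) y + r (z t) (ι y) = inner ℝ (q t) (ι y)) :
    IntervalIntegrable (fun t => inner ℝ (q t) (β t) - A (x t) (y t) + r (v t) (β' t)) volume a b ∧
      ∫ t in a..b, (inner ℝ (q t) (β t) - A (x t) (y t) + r (v t) (β' t)) =
        r (v b) (β b) - r (v a) (β a) := by
  obtain ⟨i2, e2⟩ := integral_bilinear_primitive r hab hz hβ' hv hβ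
  have key : ∀ᵐ t ∂(volume.restrict (Ioc a b)), r (z t) (β t) + r (v t) (β' t) =
      inner ℝ (q t) (β t) - A (x t) (y t) + r (v t) (β' t) := by
    filter_upwards [h, hy] with t ht hyt
    have := ht (y t)
    rw [hyt] at this
    rw [← this]
    ring
  constructor
  · refine i2.congr_ae ?_
    rw [uIoc_of_le hab]
    exact key
  · rw [← e2]
    refine intervalIntegral.integral_congr_ae_restrict ?_
    rw [uIoc_of_le hab]
    filter_upwards [key] with t ht using ht.symm

theorem intervalIntegrable_inner {q v : ℝ → H} {T : ℝ} (hT : 0 ≤ T)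
    (hq : IntervalIntegrable q volume 0 T) (hv : ContinuousOn v (Icc 0 T)) :
    IntervalIntegrable (fun t => inner ℝ (q t) (v t)) volume 0 T := by
  obtain ⟨M, hM⟩ := isCompact_Icc.exists_bound_of_continuousOn hv
  rw [intervalIntegrable_iff_integrableOn_Ioc_of_le hT] at hq ⊢
  have hvm : AEStronglyMeasurable v (volume.restrict (Ioc 0 T)) :=
    (hv.mono Ioc_subset_Icc_self).aestronglyMeasurable measurableSet_Ioc
  refine Integrable.mono' (hq.norm.mul_const M) (hq.aestronglyMeasurable.inner hvm) ?_
  filter_upwards [ae_restrict_mem measurableSet_Ioc] with t ht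
  exact (norm_inner_le_norm _ _).trans
    (mul_le_mul_of_nonneg_left (hM t ⟨ht.1.le, ht.2⟩) (norm_nonneg _))

end Abstract

/-! ### Extension of identities from interior intervals to [0,T] -/

section Extension

/-- Strong solutions are absolutely continuous only on compact subintervals of (0,T). Continuity of
φ and of the integral up to the endpoints carries the identity to [0,T]. -/
theorem sub_eq_integral_of_interior {φ h : ℝ → ℝ} {T : ℝ} (hT : 0 < T)
    (hφ : ContinuousOn φ (Icc 0 T)) (hh : IntervalIntegrable h volume 0 T)
    (H : ∀ a b, 0 < a → a < b → b < T → φ b - φ a = ∫ t in a..b, h t) :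
    ∀ t ∈ Icc 0 T, φ t - φ 0 = ∫ s in (0 : ℝ)..t, h s := by
  set F : ℝ → ℝ := fun t => φ t - ∫ s in (0 : ℝ)..t, h s with hF
  have hsub : ∀ s ∈ Icc 0 T, IntervalIntegrable h volume 0 s := fun s hs =>
    hh.mono_set (by rw [uIcc_of_le hs.1, uIcc_of_le hT.le]; exact Icc_subset_Icc_right hs.2)
  have hFc : ContinuousOn F (Icc 0 T) := by
    refine hφ.sub ?_
    have := intervalIntegral.continuousOn_primitive_interval (μ := volume) (f := h) (a := 0) (b := T)
      (by rw [uIcc_of_le hT.le]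
          exact (intervalIntegrable_iff_integrableOn_Icc_of_le hT.le).1 hh)
    rwa [uIcc_of_le hT.le] at this
  have hFe : ∀ a b, 0 < a → a < b → b < T → F b = F a := fun a b ha hab hb => by
    have h1 := intervalIntegral.integral_add_adjacent_intervals (hsub a ⟨ha.le, (hab.trans hb).le⟩)
      ((hsub a ⟨ha.le, (hab.trans hb).le⟩).symm.trans (hsub b ⟨(ha.trans hab).le, hb.le⟩))
    have h2 := H a b ha hab hb
    simp only [hF]
    linarith
  have hF0 : ∀ b ∈ Ioo 0 T, F b = F 0 := fun b hb => by
    have l1 : Tendsto F (𝓝[Ioo 0 b] 0) (𝓝 (F 0)) :=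
      (hFc 0 ⟨le_rfl, hT.le⟩).mono_left (nhdsWithin_mono _ fun x hx => ⟨hx.1.le, (hx.2.trans hb.2).le⟩)
    have l2 : Tendsto F (𝓝[Ioo 0 b] 0) (𝓝 (F b)) :=
      tendsto_const_nhds.congr' (eventually_nhdsWithin_of_forall fun a ha =>
        hFe a b ha.1 ha.2 hb.2)
    have : (𝓝[Ioo 0 b] (0 : ℝ)).NeBot := left_nhdsWithin_Ioo_neBot hb.1
    exact tendsto_nhds_unique l2 l1
  have hFT : F T = F 0 := by
    have l1 : Tendsto F (𝓝[Ioo 0 T] T) (𝓝 (F T)) :=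
      (hFc T ⟨hT.le, le_rfl⟩).mono_left (nhdsWithin_mono _ Ioo_subset_Icc_self)
    have l2 : Tendsto F (𝓝[Ioo 0 T] T) (𝓝 (F 0)) :=
      tendsto_const_nhds.congr' (eventually_nhdsWithin_of_forall fun a ha => (hF0 a ha).symm)
    have : (𝓝[Ioo 0 T] T).NeBot := right_nhdsWithin_Ioo_neBot hT
    exact tendsto_nhds_unique l1 l2
  intro t ht
  have : F t = F 0 := by
    rcases ht.1.eq_or_lt with h | h
    · rw [← h]
    rcases ht.2.eq_or_lt with h' | h'
    · rw [h', hFT]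
    · exact hF0 t ⟨h, h'⟩
  simp only [hF, intervalIntegral.integral_same] at this
  linarith

/-- The dissipation rate k is not known beforehand to be integrable up to the endpoints. It is
non-negative and its integrals over interior intervals are bounded by means of φ and ∫|h|, so
integrability follows by exhaustion. -/
theorem integrable_of_nonneg_of_interior {φ h k : ℝ → ℝ} {T : ℝ} (hT : 0 < T)
    (hφ : ContinuousOn φ (Icc 0 T)) (hh : IntervalIntegrable h volume 0 T)
    (hk : ∀ᵐ t ∂(volume.restrict (Ioo 0 T)), 0 ≤ k t)
    (H : ∀ a b, 0 < a → a < b → b < T → IntervalIntegrable (fun t => h t - k t) volume a b ∧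
      φ b - φ a = ∫ t in a..b, (h t - k t)) :
    IntervalIntegrable k volume 0 T ∧ ∀ t ∈ Icc 0 T, φ t - φ 0 = ∫ s in (0 : ℝ)..t, (h s - k s) := by
  have hsub : ∀ a b, 0 < a → a < b → b < T → IntervalIntegrable h volume a b := fun a b ha hab hb =>
    hh.mono_set (by
      rw [uIcc_of_le hab.le, uIcc_of_le hT.le]; exact Icc_subset_Icc ha.le hb.le)
  have hki : ∀ a b, 0 < a → a < b → b < T → IntervalIntegrable k volume a b :=
    fun a b ha hab hb => by
      refine ((hsub a b ha hab hb).sub (H a b ha hab hb).1).congr fun t _ => ?_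
      simp
  obtain ⟨M, hM⟩ := isCompact_Icc.exists_bound_of_continuousOn hφ
  have hkI : IntervalIntegrable k volume 0 T := by
    rw [intervalIntegrable_iff_integrableOn_Ioc_of_le hT.le]
    -- The shift by 3 gives u n ≤ T/3, hence u n < T − u n for every n.
    set u : ℕ → ℝ := fun n => T / ((n : ℝ) + 3) with hu
    have hu0 : ∀ n, 0 < u n := fun n => by positivity
    have hu1 : ∀ n, u n < T - u n := fun n => by
      have h1 : T / ((n : ℝ) + 3) ≤ T / 3 := by gcongr; linarith [Nat.cast_nonneg (α := ℝ) n]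
      simp only [hu]
      linarith
    have hut : Tendsto u atTop (𝓝 0) :=
      tendsto_const_nhds.div_atTop (tendsto_atTop_add_const_right _ _ tendsto_natCast_atTop_atTop)
    refine integrableOn_Ioc_of_intervalIntegral_norm_bounded (l := atTop) (a := u)
      (b := fun n => T - u n) (I := (∫ t in Ioc 0 T, ‖h t‖) + 2 * M) (fun n => ?_) hut
      (by simpa using tendsto_const_nhds.sub hut) (Eventually.of_forall fun n => ?_)
    · have := hki (u n) (T - u n) (hu0 n) (hu1 n) (by linarith [hu0 n])
      exact (intervalIntegrable_iff_integrableOn_Ioc_of_le (hu1 n).le).1 this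
    · have hlt : T - u n < T := by linarith [hu0 n]
      have i1 := hsub _ _ (hu0 n) (hu1 n) hlt
      have i2 := hki _ _ (hu0 n) (hu1 n) hlt
      have e := (H _ _ (hu0 n) (hu1 n) hlt).2
      rw [intervalIntegral.integral_sub i1 i2] at e
      have e1 : ∫ x in Ioc (u n) (T - u n), ‖k x‖ = ∫ t in u n..(T - u n), k t := by
        rw [intervalIntegral.integral_of_le (hu1 n).le]
        refine setIntegral_congr_ae measurableSet_Ioc ?_
        have := (ae_restrict_iff' measurableSet_Ioo).1 hk
        filter_upwards [this] with t ht hmem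
        exact Real.norm_of_nonneg (ht ⟨(hu0 n).trans hmem.1, hmem.2.trans_lt hlt⟩)
      have e2 : ∫ t in u n..(T - u n), h t ≤ ∫ t in Ioc 0 T, ‖h t‖ := by
        rw [intervalIntegral.integral_of_le (hu1 n).le]
        refine (Real.le_norm_self _).trans ((norm_integral_le_integral_norm _).trans ?_)
        exact setIntegral_mono_set ((intervalIntegrable_iff_integrableOn_Ioc_of_le hT.le).1 hh).norm
          (Eventually.of_forall fun _ => norm_nonneg _)
          (Ioc_subset_Ioc (hu0 n).le hlt.le).eventuallyLE
      have m1 := hM (u n) ⟨(hu0 n).le, ((hu1 n).trans hlt).le⟩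
      have m2 := hM (T - u n) ⟨((hu0 n).trans (hu1 n)).le, hlt.le⟩
      rw [Real.norm_eq_abs, abs_le] at m1 m2
      rw [e1]
      linarith [m1.1, m1.2, m2.1, m2.2]
  exact ⟨hkI, sub_eq_integral_of_interior hT hφ (hh.sub hkI) fun a b ha hab hb =>
    (H a b ha hab hb).2⟩

end Extension

/-! ### The linear equation with a given source -/

section Linear

variable {p : Params}

/-- `Φ_t = V`, `R V_t + A Φ = q` on `(0,T)`, with `W = Φ_t` in `H_d` and `Z = V_t`. -/
structure LinEv (T : ℝ) (q : ℝ → Hv p) (Φ : ℝ → Hd p) (V : ℝ → Hv p) (W : ℝ → Hd p)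
    (Z : ℝ → Hv p) : Prop where
  disp : ∀ a b : ℝ, 0 < a → a < b → b < T →
    IntervalIntegrable W volume a b ∧ Φ b = Φ a + ∫ t in a..b, W t
  vel : ∀ a b : ℝ, 0 < a → a < b → b < T →
    IntervalIntegrable Z volume a b ∧ V b = V a + ∫ t in a..b, Z t
  eqn : ∀ᵐ t ∂(timeMeasure T), toHv (W t) = V t ∧ WeakA (Φ t) (q t - Rop p (Z t))

theorem LinEv.sub {T : ℝ} {q q' : ℝ → Hv p} {Φ Φ' W W' : ℝ → Hd p} {V V' Z Z' : ℝ → Hv p}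
    (h : LinEv T q Φ V W Z) (h' : LinEv T q' Φ' V' W' Z') :
    LinEv T (fun t => q t - q' t) (fun t => Φ t - Φ' t) (fun t => V t - V' t) (fun t => W t - W' t)
      (fun t => Z t - Z' t) where
  disp a b ha hab hb := by
    obtain ⟨i, e⟩ := h.disp a b ha hab hb
    obtain ⟨i', e'⟩ := h'.disp a b ha hab hb
    refine ⟨i.sub i', ?_⟩
    rw [intervalIntegral.integral_sub i i', e, e']
    abel
  vel a b ha hab hb := by
    obtain ⟨i, e⟩ := h.vel a b ha hab hb
    obtain ⟨i', e'⟩ := h'.vel a b ha hab hb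
    refine ⟨i.sub i', ?_⟩
    rw [intervalIntegral.integral_sub i i', e, e']
    abel
  eqn := by
    filter_upwards [h.eqn, h'.eqn] with t ht ht'
    refine ⟨by rw [toHv_sub, ht.1, ht'.1], ?_⟩
    have := ht.2.sub ht'.2
    rwa [show q t - q' t - Rop p (Z t - Z' t) = q t - Rop p (Z t) - (q' t - Rop p (Z' t)) by
      rw [map_sub]; abel]

/-- Twice the quadratic energy. -/
def quadE (Φ : Hd p) (V : Hv p) : ℝ := aForm p Φ Φ + rForm p V V

theorem ae_Ioc_of_ae {P : ℝ → Prop} {T a b : ℝ} (ha : 0 < a) (hb : b < T)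
    (h : ∀ᵐ t ∂(timeMeasure T), P t) : ∀ᵐ t ∂(volume.restrict (Ioc a b)), P t :=
  ae_mono (Measure.restrict_mono (fun x (hx : x ∈ Ioc a b) =>
    (⟨ha.trans hx.1, hx.2.trans_lt hb⟩ : x ∈ Ioo 0 T)) le_rfl) h

theorem primitive_on_Icc {E : Type*} [NormedAddCommGroup E] [NormedSpace ℝ E] {T : ℝ}
    {u f : ℝ → E} (h : ∀ a b : ℝ, 0 < a → a < b → b < T →
      IntervalIntegrable f volume a b ∧ u b = u a + ∫ t in a..b, f t) {a b : ℝ} (ha : 0 < a)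
    (hb : b < T) : ∀ t ∈ Icc a b, u t = u a + ∫ s in a..t, f s := fun t ht => by
  rcases ht.1.eq_or_lt with h' | h'
  · rw [← h', intervalIntegral.integral_same, add_zero]
  · exact (h a t ha h' (ht.2.trans_lt hb)).2

theorem weakA_rForm {Φ : Hd p} {q z : Hv p} (h : WeakA Φ (q - Rop p z)) (y : Hd p) :
    aForm p Φ y + rForm p z (toHvL p y) = inner ℝ q (toHvL p y) := by
  rw [h y, rForm_apply, toHvL_apply, inner_sub_left, sub_add_cancel]

theorem LinEv.energy {T : ℝ} {q : ℝ → Hv p} {Φ W : ℝ → Hd p} {V Z : ℝ → Hv p}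
    (h : LinEv T q Φ V W Z) {a b : ℝ} (ha : 0 < a) (hab : a < b) (hb : b < T) :
    IntervalIntegrable (fun t => inner ℝ (q t) (V t)) volume a b ∧
      2 * ∫ t in a..b, inner ℝ (q t) (V t) = quadE (Φ b) (V b) - quadE (Φ a) (V a) := by
  refine energy_identity (D := Hd p) (H := Hv p) (toHvL p) (aForm p) aForm_symm (rForm p)
    rForm_symm hab.le (h.disp a b ha hab hb).1 (h.vel a b ha hab hb).1
    (primitive_on_Icc h.disp ha hb) (primitive_on_Icc h.vel ha hb) (ae_Ioc_of_ae ha hb ?_)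
  filter_upwards [h.eqn] with t ht
  exact ⟨by rw [toHvL_apply, ht.1], weakA_rForm ht.2⟩

theorem continuousOn_quadE {T : ℝ} {Φ : ℝ → Hd p} {V : ℝ → Hv p} (hΦ : ContinuousOn Φ (Icc 0 T))
    (hV : ContinuousOn V (Icc 0 T)) : ContinuousOn (fun t => quadE (Φ t) (V t)) (Icc 0 T) := by
  have h1 : ContinuousOn (fun t => aForm p (Φ t) (Φ t)) (Icc 0 T) :=
    ((aForm p).continuous.comp_continuousOn hΦ).clm_apply hΦ
  have h2 : ContinuousOn (fun t => rForm p (V t) (V t)) (Icc 0 T) :=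
    ((rForm p).continuous.comp_continuousOn hV).clm_apply hV
  exact h1.add h2

/-- The part g of the source, whose power has a sign, is kept apart from q; the integrability of its
power is then a conclusion and not a hypothesis. -/
theorem LinEv.energy_le {T : ℝ} (hT : 0 < T) {q g : ℝ → Hv p} {Φ W : ℝ → Hd p} {V Z : ℝ → Hv p}
    (h : LinEv T (fun t => q t - g t) Φ V W Z) (hΦ : ContinuousOn Φ (Icc 0 T))
    (hV : ContinuousOn V (Icc 0 T)) (hq : IntervalIntegrable q volume 0 T)
    (hg : ∀ᵐ t ∂(timeMeasure T), 0 ≤ inner ℝ (g t) (V t)) :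
    IntervalIntegrable (fun t => inner ℝ (g t) (V t)) volume 0 T ∧ ∀ t ∈ Icc 0 T,
      quadE (Φ t) (V t) = quadE (Φ 0) (V 0) + (2 * ∫ s in (0 : ℝ)..t, inner ℝ (q s) (V s)) -
        2 * ∫ s in (0 : ℝ)..t, inner ℝ (g s) (V s) := by
  have hqV := intervalIntegrable_inner hT.le hq hV
  obtain ⟨hi, he⟩ := integrable_of_nonneg_of_interior hT
    (φ := fun t => 1 / 2 * quadE (Φ t) (V t)) (continuousOn_const.mul (continuousOn_quadE hΦ hV))
    hqV hg (fun a b ha hab hb => by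
      obtain ⟨h1, h2⟩ := h.energy ha hab hb
      simp only [inner_sub_left] at h1 h2
      refine ⟨h1, ?_⟩
      rw [← mul_sub, ← h2]
      ring)
  refine ⟨hi, fun t ht => ?_⟩
  have hsub : ∀ f : ℝ → ℝ, IntervalIntegrable f volume 0 T → IntervalIntegrable f volume 0 t :=
    fun f hf => hf.mono_set (by
      rw [uIcc_of_le ht.1, uIcc_of_le hT.le]; exact Icc_subset_Icc_right ht.2)
  have := he t ht
  rw [intervalIntegral.integral_sub (hsub _ hqV) (hsub _ hi)] at this
  linarith

theorem exists_le_quadE (p : Params) : ∃ c : ℝ, 0 < c ∧ ∀ (Φ : Hd p) (V : Hv p),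
    ‖Φ‖ ≤ c * √(quadE Φ V) ∧ ‖V‖ ≤ c * √(quadE Φ V) := by
  obtain ⟨ca, hca, ha⟩ := exists_aForm_ge p
  obtain ⟨cr, hcr, hr⟩ := exists_rForm_ge p
  have hm := lt_min hca hcr
  refine ⟨√(1 / min ca cr), Real.sqrt_pos.2 (by positivity), fun Φ V => ?_⟩
  have h1 := ha Φ
  have h2 := hr V
  have h3 := mul_le_mul_of_nonneg_right (min_le_left ca cr) (sq_nonneg ‖Φ‖)
  have h4 := mul_le_mul_of_nonneg_right (min_le_right ca cr) (sq_nonneg ‖V‖)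
  have h5 : 0 ≤ min ca cr * ‖Φ‖ ^ 2 := by positivity
  have h6 : 0 ≤ min ca cr * ‖V‖ ^ 2 := by positivity
  rw [← Real.sqrt_mul (by positivity)]
  constructor <;> refine Real.le_sqrt_of_sq_le ?_ <;>
    rw [div_mul_eq_mul_div, one_mul, le_div_iff₀ hm, quadE] <;> linarith

theorem quadE_nonneg (Φ : Hd p) (V : Hv p) : 0 ≤ quadE Φ V := by
  obtain ⟨ca, hca, ha⟩ := exists_aForm_ge p
  obtain ⟨cr, hcr, hr⟩ := exists_rForm_ge p
  exact add_nonneg (le_trans (by positivity) (ha Φ)) (le_trans (by positivity) (hr V))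

theorem exists_form_le {E : Type*} [NormedAddCommGroup E] [NormedSpace ℝ E]
    (b : E →L[ℝ] E →L[ℝ] ℝ) : ∃ C : ℝ, 0 ≤ C ∧ ∀ x, b x x ≤ C * ‖x‖ ^ 2 :=
  ⟨‖b‖, b.opNorm_nonneg, fun x => by
    rw [pow_two, ← mul_assoc]
    exact (le_abs_self _).trans (b.le_opNorm₂ x x)⟩

theorem exists_quadE_le (p : Params) : ∃ c : ℝ, 0 < c ∧ ∀ (Φ : Hd p) (V : Hv p),
    √(quadE Φ V) ≤ c * (‖Φ‖ + ‖V‖) := by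
  obtain ⟨A, hA, h1⟩ := exists_form_le (aForm p)
  obtain ⟨R, hR, h2⟩ := exists_form_le (rForm p)
  refine ⟨√(A + R) + 1, by positivity, fun Φ V => ?_⟩
  have hΦ := norm_nonneg Φ
  have hV := norm_nonneg V
  have h3 : quadE Φ V ≤ (A + R) * (‖Φ‖ + ‖V‖) ^ 2 := by
    have := h1 Φ
    have := h2 V
    have e1 : A * ‖Φ‖ ^ 2 ≤ A * (‖Φ‖ + ‖V‖) ^ 2 := by gcongr; linarith
    have e2 : R * ‖V‖ ^ 2 ≤ R * (‖Φ‖ + ‖V‖) ^ 2 := by gcongr; linarith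
    rw [quadE]
    linarith
  refine (Real.sqrt_le_sqrt h3).trans ?_
  rw [Real.sqrt_mul (by positivity), Real.sqrt_sq (by positivity)]
  nlinarith

end Linear
end Bresse

namespace Bresse

variable {p : Params}

/-- AΦ is exhibited as an explicit element of H_v, built from Φ_x and Φ_xx by the matrix form
`opA_eq` of the operator. -/
theorem InDomA.exists_weakA {Φ : Hd p} {S : Hv p} (h : InDomA Φ S) : ∃ v, WeakA Φ v ∧
    ∀ j, ∀ᵐ x ∂(p.vol j), opA p j (toHv Φ j x) (dX Φ j x) (S j x) = v j x := by
  have hv : ∀ j, ∀ᵐ x ∂(p.vol j), opA p j (toHv Φ j x) (dX Φ j x) (S j x) =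
      (mulOp (fun _ => strainMatT p.l) (stress p Φ) -
        mulOp (stiff p) (S + mulOp (fun _ => strainMat p.l) (dX Φ)) : Hv p) j x := by
    intro j
    filter_upwards [Hv.sub_ae (mulOp (fun _ => strainMatT p.l) (stress p Φ))
        (mulOp (stiff p) (S + mulOp (fun _ => strainMat p.l) (dX Φ))) j,
      mulOp_ae (fun _ => strainMatT p.l) (stress p Φ) j, stress_ae Φ j,
      mulOp_ae (stiff p) (S + mulOp (fun _ => strainMat p.l) (dX Φ)) j,
      Hv.add_ae S (mulOp (fun _ => strainMat p.l) (dX Φ)) j,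
      mulOp_ae (fun _ => strainMat p.l) (dX Φ) j] with x h1 h2 h3 h4 h5 h6
    rw [h1, h2, h3, h4, h5, h6, opA_eq]
    abel
  exact ⟨_, h.weakA hv, hv⟩

variable {C : NNReal} {φ : Fin 2 → E3 → E3}

/-- Strong solutions of the problem with a Lipschitz feedback `φ`. -/
structure TruncSol (γ : ℝ → ℝ) (hφ : ∀ j, LipschitzWith C (φ j)) (T : ℝ) (P : ℝ → Hv p)
    (Φ : ℝ → Hd p) (V : ℝ → Hv p) : Prop where
  cont : ContinuousOn Φ (Icc 0 T)
  cont_vel : ContinuousOn V (Icc 0 T)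
  deriv : ∀ t ∈ Icc 0 T, HasDerivWithinAt (fun s => toHv (Φ s)) (V t) (Icc 0 T) t
  ex : ∃ (W : ℝ → Hd p) (Z g : ℝ → Hv p),
    LinEv T (fun t => (P t - nem hφ (toHv (Φ t))) - g t) Φ V W Z ∧
      ∀ᵐ t ∂(timeMeasure T), IsDamp γ (V t) (g t)

theorem TruncSol.restrict {γ : ℝ → ℝ} {hφ : ∀ j, LipschitzWith C (φ j)} {T : ℝ} {P : ℝ → Hv p}
    {Φ : ℝ → Hd p} {V : ℝ → Hv p} (h : TruncSol γ hφ T P Φ V) {T' : ℝ} (hT' : T' ≤ T) :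
    TruncSol γ hφ T' P Φ V := by
  obtain ⟨W, Z, g, hl, hg⟩ := h.ex
  have hs : Icc 0 T' ⊆ Icc 0 T := Icc_subset_Icc_right hT'
  have hm : timeMeasure T' ≤ timeMeasure T :=
    Measure.restrict_mono (Ioo_subset_Ioo_right hT') le_rfl
  exact ⟨h.cont.mono hs, h.cont_vel.mono hs, fun t ht => (h.deriv t (hs ht)).mono hs, W, Z, g,
    ⟨fun a b ha hab hb => hl.disp a b ha hab (hb.trans_le hT'),
      fun a b ha hab hb => hl.vel a b ha hab (hb.trans_le hT'), ae_mono hm hl.eqn⟩, ae_mono hm hg⟩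

/-! ### Strong solutions as solutions of a truncated problem -/

section Strong

variable {f g h : Fin 2 → E3 → ℝ} {γ : ℝ → ℝ} {T : ℝ} {P : ℝ → Hv p} {Φ₀ : Hd p} {Φ₁ : Hv p}
  {Φ : ℝ → Hd p} {V : ℝ → Hv p}

theorem integral_vel (hV : ContinuousOn V (Icc 0 T))
    (hd : ∀ t ∈ Icc 0 T, HasDerivWithinAt (fun s => toHv (Φ s)) (V t) (Icc 0 T) t) {a b : ℝ}
    (ha : 0 ≤ a) (hab : a ≤ b) (hb : b ≤ T) :
    IntervalIntegrable V volume a b ∧ ∫ t in a..b, V t = toHv (Φ b) - toHv (Φ a) := by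
  have hs : Icc a b ⊆ Icc 0 T := Icc_subset_Icc ha hb
  have hi : IntervalIntegrable V volume a b := by
    have := hV.mono hs
    rw [← uIcc_of_le hab] at this
    exact this.intervalIntegrable
  refine ⟨hi, intervalIntegral.integral_eq_sub_of_hasDerivAt_of_le hab
    (fun t ht => ((hd t (hs ht)).mono hs).continuousWithinAt) (fun t ht => ?_) hi⟩
  exact (hd t (hs (Ioo_subset_Icc_self ht))).hasDerivAt
    (Icc_mem_nhds (ha.trans_lt ht.1) (ht.2.trans_le hb))

theorem toHv_integral {W : ℝ → Hd p} {a b : ℝ} (h : IntervalIntegrable W volume a b) :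
    IntervalIntegrable (fun t => toHv (W t)) volume a b ∧
      toHv (∫ t in a..b, W t) = ∫ t in a..b, toHv (W t) := by
  simp only [← toHvL_apply]
  exact ⟨⟨(toHvL p).integrable_comp h.1, (toHvL p).integrable_comp h.2⟩,
    ((toHvL p).intervalIntegral_comp_comm h).symm⟩

/-- As long as the values stay where φ equals the feedback, the two equations coincide. The damping
is recovered as the remainder of the equation and is therefore in H_v for almost every t. -/
theorem IsStrong.truncSol (hs : IsStrong p f g h γ T P Φ₀ Φ₁ Φ V) (hφ : ∀ j, LipschitzWith C (φ j))
    {K : ℝ} (hK : ∀ t ∈ Icc 0 T, ∀ j, ∀ᵐ x ∂(p.vol j), ‖toHv (Φ t) j x‖ ≤ K)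
    (heq : ∀ j a, ‖a‖ ≤ K → φ j a = feedback f g h j a) : TruncSol γ hφ T P Φ V := by
  obtain ⟨W, hW⟩ := hs.ac
  obtain ⟨Z, hZ, hae⟩ := hs.eqn
  -- W and V are densities of the same H_v-valued function.
  have hvel : ∀ᵐ t ∂(timeMeasure T), toHv (W t) = V t := by
    refine ae_eq_of_primitive_eq fun a b ha hab hb => ?_
    obtain ⟨i1, e1⟩ := hW a b ha hab hb
    obtain ⟨i2, e2⟩ := integral_vel hs.mem.cont_vel hs.mem.deriv ha.le hab.le hb.le
    obtain ⟨i3, e3⟩ := toHv_integral i1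
    refine ⟨i3, i2, ?_⟩
    rw [e2, ← e3, e1, toHv_add, add_sub_cancel_left]
  have key : ∀ᵐ t ∂(timeMeasure T), ∃ d : Hv p, IsDamp γ (V t) d ∧
      WeakA (Φ t) ((P t - nem hφ (toHv (Φ t))) - d - Rop p (Z t)) := by
    filter_upwards [hae, ae_restrict_mem measurableSet_Ioo] with t ⟨S, hS, hx⟩ hmem
    obtain ⟨v, hv, hva⟩ := hS.exists_weakA
    refine ⟨P t - nem hφ (toHv (Φ t)) - v - Rop p (Z t), fun j => ?_, ?_⟩
    · filter_upwards [hx j, hva j, Hv.sub_ae (P t - nem hφ (toHv (Φ t)) - v) (Rop p (Z t)) j,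
        Hv.sub_ae (P t - nem hφ (toHv (Φ t))) v j, Hv.sub_ae (P t) (nem hφ (toHv (Φ t))) j,
        nem_ae hφ (toHv (Φ t)) j, Rop_ae (Z t) j, hK t (Ioo_subset_Icc_self hmem) j]
        with x h1 h2 h3 h4 h5 h6 h7 h8
      rw [h3, h4, h5, h6, h7, ← h1, h2, heq j _ h8]
      abel
    · convert hv using 1
      abel
  classical
  refine ⟨hs.mem.cont, hs.mem.cont_vel, hs.mem.deriv, W, Z,
    fun t => if h : ∃ d : Hv p, IsDamp γ (V t) d ∧
      WeakA (Φ t) ((P t - nem hφ (toHv (Φ t))) - d - Rop p (Z t)) then h.choose else 0,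
    ⟨hW, hZ, ?_⟩, ?_⟩
  · filter_upwards [hvel, key] with t h1 h2
    rw [dif_pos h2]
    exact ⟨h1, h2.choose_spec.2⟩
  · filter_upwards [key] with t h2
    rw [dif_pos h2]
    exact h2.choose_spec.1

theorem TruncSol.isStrong {hφ : ∀ j, LipschitzWith C (φ j)} (hs : TruncSol γ hφ T P Φ V)
    {K : ℝ} (hK : ∀ t ∈ Icc 0 T, ∀ j, ∀ᵐ x ∂(p.vol j), ‖toHv (Φ t) j x‖ ≤ K)
    (heq : ∀ j a, ‖a‖ ≤ K → φ j a = feedback f g h j a) :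
    IsStrong p f g h γ T P (Φ 0) (V 0) Φ V := by
  obtain ⟨W, Z, d, hl, hd⟩ := hs.ex
  refine ⟨⟨hs.cont, hs.cont_vel, hs.deriv, rfl, rfl⟩, ⟨W, hl.disp⟩, Z, hl.vel, ?_⟩
  filter_upwards [hl.eqn, hd, ae_restrict_mem measurableSet_Ioo] with t h1 h2 hmem
  obtain ⟨S, hS, hx⟩ := h1.2.inDomA
  refine ⟨S, hS, fun j => ?_⟩
  filter_upwards [hx j, h2 j, Hv.sub_ae (P t - nem hφ (toHv (Φ t)) - d t) (Rop p (Z t)) j,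
    Hv.sub_ae (P t - nem hφ (toHv (Φ t))) (d t) j, Hv.sub_ae (P t) (nem hφ (toHv (Φ t))) j,
    nem_ae hφ (toHv (Φ t)) j, Rop_ae (Z t) j, hK t (Ioo_subset_Icc_self hmem) j]
    with x h1 h2 h3 h4 h5 h6 h7 h8
  rw [h1, h3, h4, h5, h6, h7, ← h2, heq j _ h8]
  abel

end Strong

/-! ### Continuous dependence on the data -/

section Comparison

variable {γ : ℝ → ℝ} {hφ : ∀ j, LipschitzWith C (φ j)} {T : ℝ}

theorem continuousOn_nem (hφ : ∀ j, LipschitzWith C (φ j)) {Φ : ℝ → Hd p} {s : Set ℝ}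
    (h : ContinuousOn Φ s) : ContinuousOn (fun t => nem hφ (toHv (Φ t))) s := by
  have h1 : ContinuousOn (fun t => toHv (Φ t)) s := by
    simp only [← toHvL_apply]
    exact (toHvL p).continuous.comp_continuousOn h
  exact (lipschitzWith_nem hφ).continuous.comp_continuousOn h1

/-- In the energy balance of the difference the damping has a favourable sign by monotonicity, the
truncated feedback is Lipschitz, and the loads enter linearly. The quadratic Gronwall inequality for
the square root of the energy then gives a bound by the L¹ norm of the loads. -/
theorem exists_comparison (p : Params) (hm : Monotone γ) (hφ : ∀ j, LipschitzWith C (φ j))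
    (hT : 0 < T) : ∃ M : ℝ, 0 < M ∧ ∀ (P P' : ℝ → Hv p) (Φ Φ' : ℝ → Hd p) (V V' : ℝ → Hv p),
      TruncSol γ hφ T P Φ V → TruncSol γ hφ T P' Φ' V' → IntervalIntegrable P volume 0 T →
      IntervalIntegrable P' volume 0 T → ∀ t ∈ Icc 0 T,
        ‖Φ t - Φ' t‖ + ‖V t - V' t‖ ≤
          M * (‖Φ 0 - Φ' 0‖ + ‖V 0 - V' 0‖ + ∫ s in (0 : ℝ)..T, ‖P s - P' s‖) := by
  obtain ⟨c, hc, hle⟩ := exists_le_quadE p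
  obtain ⟨k, hk, hge⟩ := exists_quadE_le p
  -- One factor c bounds the displacement by the square root of the energy, the other bounds the
  -- velocity.
  set L : ℝ := C * c * c with hL
  have hL0 : 0 ≤ L := by positivity
  refine ⟨2 * c * Real.exp (2 * L * T) * (k + 2 * c), by positivity,
    fun P P' Φ Φ' V V' h h' hP hP' => ?_⟩
  obtain ⟨W, Z, g, hl, hg⟩ := h.ex
  obtain ⟨W', Z', g', hl', hg'⟩ := h'.ex
  set q : ℝ → Hv p := fun t => (P t - P' t) - (nem hφ (toHv (Φ t)) - nem hφ (toHv (Φ' t))) with hq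
  have hqi : IntervalIntegrable q volume 0 T := by
    refine (hP.sub hP').sub ?_
    have := (continuousOn_nem hφ h.cont).sub (continuousOn_nem hφ h'.cont)
    rw [← uIcc_of_le hT.le] at this
    exact this.intervalIntegrable
  have hlin : LinEv T (fun t => q t - (g t - g' t)) (fun t => Φ t - Φ' t) (fun t => V t - V' t)
      (fun t => W t - W' t) (fun t => Z t - Z' t) := by
    convert hl.sub hl' using 2 with t
    simp only [hq]
    abel
  have hcont := h.cont.sub h'.cont
  have hcontV := h.cont_vel.sub h'.cont_vel
  have hge0 : ∀ᵐ t ∂(timeMeasure T), 0 ≤ inner ℝ (g t - g' t) (V t - V' t) := by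
    filter_upwards [hg, hg'] with t h1 h2 using h1.inner_sub_nonneg hm h2
  obtain ⟨hgi, hE⟩ := hlin.energy_le hT hcont hcontV hqi hge0
  set e : ℝ → ℝ := fun t => √(quadE (Φ t - Φ' t) (V t - V' t)) with he
  have hesq : ∀ t, e t ^ 2 = quadE (Φ t - Φ' t) (V t - V' t) := fun t =>
    Real.sq_sqrt (quadE_nonneg _ _)
  have hec : ContinuousOn e (Icc 0 T) := (continuousOn_quadE hcont hcontV).sqrt
  have hψi : IntervalIntegrable (fun s => c * ‖P s - P' s‖) volume 0 T :=
    ((hP.sub hP').norm).const_mul c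
  have hgron := le_of_sq_le_add_integral (φ := e) (ψ := fun s => c * ‖P s - P' s‖) (T := T)
    (L := L) (φ₀ := e 0) hL0 (Real.sqrt_nonneg _) hec (fun t _ => Real.sqrt_nonneg _) hψi
    (fun t => by positivity) (fun t ht => by
      rw [hesq, hesq, hE t ht]
      have hsub : ∀ f : ℝ → ℝ, IntervalIntegrable f volume 0 T → IntervalIntegrable f volume 0 t :=
        fun f hf => hf.mono_set (by
          rw [uIcc_of_le ht.1, uIcc_of_le hT.le]; exact Icc_subset_Icc_right ht.2)
      have i1 := hsub _ (intervalIntegrable_inner hT.le hqi hcontV)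
      have n1 : 0 ≤ ∫ s in (0 : ℝ)..t, inner ℝ (g s - g' s) (V s - V' s) := by
        rw [intervalIntegral.integral_of_le ht.1, integral_Ioc_eq_integral_Ioo]
        exact integral_nonneg_of_ae (ae_mono (Measure.restrict_mono
          (Ioo_subset_Ioo_right ht.2) le_rfl) hge0)
      have i2 : IntervalIntegrable (fun s => 2 * L * e s ^ 2 + 2 * (c * ‖P s - P' s‖) * e s)
          volume 0 t := by
        refine hsub _ (IntervalIntegrable.add ?_ ?_)
        · have := (hec.pow 2).const_mul (2 * L)
          rw [← uIcc_of_le hT.le] at this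
          exact this.intervalIntegrable
        · have := hec
          rw [← uIcc_of_le hT.le] at this
          exact (hψi.const_mul 2).mul_continuousOn this
      have hmono : 2 * ∫ s in (0 : ℝ)..t, inner ℝ (q s) (V s - V' s) ≤
          ∫ s in (0 : ℝ)..t, (2 * L * e s ^ 2 + 2 * (c * ‖P s - P' s‖) * e s) := by
        rw [← intervalIntegral.integral_const_mul]
        refine intervalIntegral.integral_mono_on ht.1 (i1.const_mul 2) i2 fun s hs => ?_
        have a1 := (hle (Φ s - Φ' s) (V s - V' s)).1
        have a2 := (hle (Φ s - Φ' s) (V s - V' s)).2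
        have a3 : ‖nem hφ (toHv (Φ s)) - nem hφ (toHv (Φ' s))‖ ≤ C * (c * e s) := by
          refine ((lipschitzWith_nem hφ).norm_sub_le _ _).trans ?_
          rw [← toHv_sub]
          exact mul_le_mul_of_nonneg_left ((norm_toHv_le _).trans a1) C.2
        have a4 : inner ℝ (q s) (V s - V' s) ≤ ‖q s‖ * ‖V s - V' s‖ := real_inner_le_norm _ _
        have a5 : ‖q s‖ ≤ ‖P s - P' s‖ + C * (c * e s) := (norm_sub_le _ _).trans (by gcongr)
        have a6 : ‖q s‖ * ‖V s - V' s‖ ≤ (‖P s - P' s‖ + C * (c * e s)) * (c * e s) :=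
          mul_le_mul a5 a2 (norm_nonneg _) ((norm_nonneg _).trans a5)
        rw [hL]
        nlinarith
      linarith)
  intro t ht
  have b1 := hgron t ht
  have b2 := hle (Φ t - Φ' t) (V t - V' t)
  have b3 : e 0 ≤ k * (‖Φ 0 - Φ' 0‖ + ‖V 0 - V' 0‖) := hge _ _
  rw [intervalIntegral.integral_const_mul] at b1
  have b4 : 0 ≤ ∫ s in (0 : ℝ)..T, ‖P s - P' s‖ :=
    intervalIntegral.integral_nonneg hT.le fun _ _ => norm_nonneg _
  set I := ∫ s in (0 : ℝ)..T, ‖P s - P' s‖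
  set N := ‖Φ 0 - Φ' 0‖ + ‖V 0 - V' 0‖ with hN
  have hN0 : 0 ≤ N := by positivity
  have b5 : e 0 + 2 * (c * I) ≤ (k + 2 * c) * (N + I) := by nlinarith
  have b6 : e t ≤ Real.exp (2 * L * T) * ((k + 2 * c) * (N + I)) :=
    b1.trans (mul_le_mul_of_nonneg_left b5 (Real.exp_pos _).le)
  have b7 := mul_le_mul_of_nonneg_left b6 hc.le
  calc ‖Φ t - Φ' t‖ + ‖V t - V' t‖ ≤ c * e t + c * e t := add_le_add b2.1 b2.2
    _ ≤ _ := by linarith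

end Comparison

end Bresse

namespace Bresse

variable {p : Params} {C : NNReal} {φ : Fin 2 → E3 → E3}

/-! ### The potential energy along solutions -/

section Potential

/-- `∑ⱼ ∫ potⱼ(Φʲ)`. -/
def potE (pot : Fin 2 → E3 → ℝ) (Φ : Hd p) : ℝ := ∑ j, ∫ x, pot j (toHv Φ j x) ∂(p.vol j)

theorem energy_eq (pot : Fin 2 → E3 → ℝ) (Φ : Hd p) (V : Hv p) :
    energy pot Φ V = 1 / 2 * quadE Φ V + potE pot Φ := by
  rw [energy, ipR_eq_rForm, formA_eq_aForm, quadE, potE, add_comm (rForm p V V)]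

/-- Mean value inequality for F − ⟨G b, ·⟩ on the segment from b to a, which stays in the ball where
the gradient of F is known. -/
theorem abs_sub_sub_inner_le {E : Type*} [NormedAddCommGroup E] [InnerProductSpace ℝ E]
    [CompleteSpace E] {F : E → ℝ} {G : E → E} {K : ℝ}
    (hF : ∀ a, ‖a‖ ≤ K → HasGradientAt F (G a) a) (hG : LipschitzWith C G) {a b : E}
    (ha : ‖a‖ ≤ K) (hb : ‖b‖ ≤ K) : |F a - F b - inner ℝ (G b) (a - b)| ≤ C * ‖a - b‖ ^ 2 := by
  have hseg : ∀ y ∈ segment ℝ b a, ‖y‖ ≤ K ∧ ‖y - b‖ ≤ ‖a - b‖ := fun y hy => by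
    refine ⟨?_, ?_⟩
    · have := (convex_closedBall (0 : E) K).segment_subset (mem_closedBall_zero_iff.2 hb)
        (mem_closedBall_zero_iff.2 ha) hy
      exact mem_closedBall_zero_iff.1 this
    · obtain ⟨s, hs, rfl⟩ := (segment_eq_image' ℝ b a ▸ hy : y ∈ (fun θ : ℝ => b + θ • (a - b)) '' Icc 0 1)
      simp only [add_sub_cancel_left, norm_smul, Real.norm_eq_abs, abs_of_nonneg hs.1]
      exact mul_le_of_le_one_left (norm_nonneg _) hs.2
  have hd : ∀ y ∈ segment ℝ b a, HasFDerivWithinAt (fun z => F z - inner ℝ (G b) z)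
      (innerSL ℝ (G y - G b)) (segment ℝ b a) y := fun y hy => by
    have h1 := (hF y (hseg y hy).1).hasFDerivAt
    have h2 := (innerSL ℝ (G b)).hasFDerivAt (x := y)
    have h3 := (h1.sub h2).hasFDerivWithinAt (s := segment ℝ b a)
    have e : (InnerProductSpace.toDual ℝ E) (G y) - innerSL ℝ (G b) = innerSL ℝ (G y - G b) := by
      rw [map_sub]; rfl
    rw [← e]
    exact h3
  have hbd := Convex.norm_image_sub_le_of_norm_hasFDerivWithin_le (C := C * ‖a - b‖) hd
    (fun y hy => by
      rw [innerSL_apply_norm]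
      exact (hG.norm_sub_le _ _).trans (mul_le_mul_of_nonneg_left (hseg y hy).2 C.2))
    (convex_segment b a) (left_mem_segment ℝ b a) (right_mem_segment ℝ b a)
  rw [Real.norm_eq_abs] at hbd
  calc |F a - F b - inner ℝ (G b) (a - b)| = |F a - inner ℝ (G b) a - (F b - inner ℝ (G b) b)| := by
        rw [inner_sub_right]; congr 1; ring
    _ ≤ C * ‖a - b‖ * ‖a - b‖ := hbd
    _ = C * ‖a - b‖ ^ 2 := by ring

variable {pot : Fin 2 → E3 → ℝ} (hφ : ∀ j, LipschitzWith C (φ j)) {K : ℝ}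

theorem abs_potE_sub_le (hc : ∀ j, Continuous (pot j))
    (hpot : ∀ j a, ‖a‖ ≤ K → HasGradientAt (pot j) (φ j a) a) {Φ Ψ : Hd p}
    (hΦ : ∀ j, ∀ᵐ x ∂(p.vol j), ‖toHv Φ j x‖ ≤ K) (hΨ : ∀ j, ∀ᵐ x ∂(p.vol j), ‖toHv Ψ j x‖ ≤ K) :
    |potE pot Φ - potE pot Ψ - inner ℝ (nem hφ (toHv Ψ)) (toHv Φ - toHv Ψ)| ≤
      C * ‖toHv Φ - toHv Ψ‖ ^ 2 := by
  have hI : ∀ j, Integrable (fun x => inner ℝ (nem hφ (toHv Ψ) j x) ((toHv Φ - toHv Ψ) j x)) (p.vol j) :=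
    fun j => L2.integrable_inner (𝕜 := ℝ) (nem hφ (toHv Ψ) j) ((toHv Φ - toHv Ψ) j)
  have hsq : ∀ j, Integrable (fun x => ‖(toHv Φ - toHv Ψ) j x‖ ^ 2) (p.vol j) := fun j =>
    (Lp.memLp ((toHv Φ - toHv Ψ) j)).integrable_norm_pow (by norm_num)
  rw [← ip_eq_inner, ip, potE, potE, ← Finset.sum_sub_distrib, ← Finset.sum_sub_distrib,
    Hv.norm_sq_eq, Finset.mul_sum]
  refine (Finset.abs_sum_le_sum_abs _ _).trans (Finset.sum_le_sum fun j _ => ?_)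
  have i1 := integrable_comp_toHv (hc j) Φ j
  have i2 := integrable_comp_toHv (hc j) Ψ j
  rw [← integral_sub i1 i2]
  have e : ∫ x in Ioo (p.lo j) (p.hi j), inner ℝ (nem hφ (toHv Ψ) j x) ((toHv Φ - toHv Ψ) j x) =
      ∫ x, inner ℝ (nem hφ (toHv Ψ) j x) ((toHv Φ - toHv Ψ) j x) ∂(p.vol j) := rfl
  have i3 : Integrable (fun x => pot j (toHv Φ j x) - pot j (toHv Ψ j x)) (p.vol j) := i1.sub i2
  rw [e, ← integral_sub i3 (hI j), ← integral_const_mul]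
  refine (norm_integral_le_integral_norm _).trans
    (integral_mono_ae (i3.sub (hI j)).norm ((hsq j).const_mul _) ?_)
  filter_upwards [hΦ j, hΨ j, nem_ae hφ (toHv Ψ) j, Hv.sub_ae (toHv Φ) (toHv Ψ) j]
    with x h1 h2 h3 h4
  simp only [Real.norm_eq_abs, Pi.sub_apply]
  rw [h3, h4]
  exact abs_sub_sub_inner_le (hpot j) (hφ j) h1 h2

/-- The curve is differentiable only in H_v, whereas the potential is controlled only on bounded
functions. This is enough for a chain rule, because the remainder in `abs_potE_sub_le` is quadratic
in the H_v norm. -/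
theorem potE_sub_eq_integral (hc : ∀ j, Continuous (pot j))
    (hpot : ∀ j a, ‖a‖ ≤ K → HasGradientAt (pot j) (φ j a) a) {T : ℝ} (hT : 0 ≤ T)
    {Φ : ℝ → Hd p} {V : ℝ → Hv p} (hΦ : ContinuousOn Φ (Icc 0 T)) (hV : ContinuousOn V (Icc 0 T))
    (hd : ∀ t ∈ Icc 0 T, HasDerivWithinAt (fun s => toHv (Φ s)) (V t) (Icc 0 T) t)
    (hK : ∀ t ∈ Icc 0 T, ∀ j, ∀ᵐ x ∂(p.vol j), ‖toHv (Φ t) j x‖ ≤ K) :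
    potE pot (Φ T) - potE pot (Φ 0) = ∫ t in (0 : ℝ)..T, inner ℝ (nem hφ (toHv (Φ t))) (V t) := by
  have hder : ∀ t ∈ Icc 0 T, HasDerivWithinAt (fun s => potE pot (Φ s))
      (inner ℝ (nem hφ (toHv (Φ t))) (V t)) (Icc 0 T) t := fun t ht => by
    set F := nem hφ (toHv (Φ t)) with hF
    have h1 : HasDerivWithinAt (fun s => inner ℝ F (toHv (Φ s))) (inner ℝ F (V t)) (Icc 0 T) t := by
      have := (innerSL ℝ F).hasFDerivAt.comp_hasDerivWithinAt t (hd t ht)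
      exact this
    have h2 : HasDerivWithinAt (fun s => potE pot (Φ s) - inner ℝ F (toHv (Φ s))) 0 (Icc 0 T) t := by
      rw [hasDerivWithinAt_iff_isLittleO]
      simp only [smul_zero, sub_zero]
      have o1 : (fun s => toHv (Φ s) - toHv (Φ t)) =O[𝓝[Icc 0 T] t] fun s => s - t :=
        (hd t ht).hasFDerivWithinAt.isBigO_sub
      have o2 : (fun s => ‖toHv (Φ s) - toHv (Φ t)‖ ^ 2) =o[𝓝[Icc 0 T] t] fun s => s - t := by
        have o3 : (fun s => ‖toHv (Φ s) - toHv (Φ t)‖ * ‖toHv (Φ s) - toHv (Φ t)‖)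
            =o[𝓝[Icc 0 T] t] fun s => (s - t) * 1 := by
          refine o1.norm_left.mul_isLittleO ?_
          rw [Asymptotics.isLittleO_one_iff]
          have l := (hd t ht).continuousWithinAt.sub (continuousWithinAt_const (b := toHv (Φ t)))
          have := l.norm.tendsto
          simpa using this
        simpa [pow_two] using o3
      refine Asymptotics.IsBigO.trans_isLittleO (Asymptotics.IsBigO.of_bound C ?_) o2
      filter_upwards [self_mem_nhdsWithin] with s hs
      have := abs_potE_sub_le hφ hc hpot (hK s hs) (hK t ht)
      rw [Real.norm_eq_abs, Real.norm_of_nonneg (sq_nonneg _)]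
      convert this using 2
      rw [inner_sub_right]
      ring
    have h3 := h2.add h1
    rw [zero_add] at h3
    refine h3.congr_of_mem (fun s _ => ?_) ht
    simp
  symm
  refine intervalIntegral.integral_eq_sub_of_hasDerivAt_of_le hT
    (fun t ht => (hder t ht).continuousWithinAt)
    (fun t ht => (hder t (Ioo_subset_Icc_self ht)).hasDerivAt (Icc_mem_nhds ht.1 ht.2)) ?_
  have : ContinuousOn (fun t => inner ℝ (nem hφ (toHv (Φ t))) (V t)) (Icc 0 T) :=
    (continuousOn_nem hφ hΦ).inner hV
  rw [← uIcc_of_le hT] at this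
  exact this.intervalIntegrable

end Potential

/-! ### The energy identity and a priori bounds -/

section Energy

variable {γ : ℝ → ℝ} {hφ : ∀ j, LipschitzWith C (φ j)} {T K : ℝ} {pot : Fin 2 → E3 → ℝ}
  {P : ℝ → Hv p} {Φ : ℝ → Hd p} {V : ℝ → Hv p}

theorem intervalIntegrable_of_memLp {E : Type*} [NormedAddCommGroup E] {f : ℝ → E} (hT : 0 < T)
    (h : MemLp f 2 (timeMeasure T)) : IntervalIntegrable f volume 0 T := by
  rw [intervalIntegrable_iff_integrableOn_Ioo_of_le hT.le]
  have : IsFiniteMeasure (timeMeasure T) := by unfold timeMeasure; infer_instance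
  exact h.integrable (by norm_num)

/-- The quadratic energy balance and the chain rule for the potential are added; the feedback terms
cancel. -/
theorem TruncSol.energy (hs : TruncSol γ hφ T P Φ V) (hm : Monotone γ) (h0 : γ 0 = 0) (hT : 0 < T)
    (hP : IntervalIntegrable P volume 0 T) (hc : ∀ j, Continuous (pot j))
    (hpot : ∀ j a, ‖a‖ ≤ K → HasGradientAt (pot j) (φ j a) a)
    (hK : ∀ t ∈ Icc 0 T, ∀ j, ∀ᵐ x ∂(p.vol j), ‖toHv (Φ t) j x‖ ≤ K) :
    IntervalIntegrable (fun s => ∫ x in Ioo 0 p.L₀, γ (V s 0 x 1) * V s 0 x 1) volume 0 T ∧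
    (∀ᵐ s ∂(timeMeasure T), Integrable (fun x => γ (V s 0 x 1) * V s 0 x 1) (p.vol 0)) ∧
    ∀ t ∈ Icc 0 T, Bresse.energy pot (Φ t) (V t) + dissipation γ V t =
      Bresse.energy pot (Φ 0) (V 0) + work P V t := by
  obtain ⟨W, Z, g, hl, hg⟩ := hs.ex
  have hnem : IntervalIntegrable (fun t => nem hφ (toHv (Φ t))) volume 0 T := by
    have := continuousOn_nem hφ hs.cont
    rw [← uIcc_of_le hT.le] at this
    exact this.intervalIntegrable
  obtain ⟨hgi, hE⟩ := hl.energy_le hT hs.cont hs.cont_vel (hP.sub hnem) (by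
    filter_upwards [hg] with t ht using ht.inner_self_nonneg hm h0)
  have hgV : ∀ᵐ s ∂(timeMeasure T), inner ℝ (g s) (V s) =
      ∫ x in Ioo 0 p.L₀, γ (V s 0 x 1) * V s 0 x 1 := by
    filter_upwards [hg] with t ht using ht.inner_eq _
  refine ⟨?_, ?_, fun t ht => ?_⟩
  · rw [intervalIntegrable_iff_integrableOn_Ioo_of_le hT.le] at hgi ⊢
    exact hgi.congr hgV
  · filter_upwards [hg] with t ht using ht.integrable _
  · have hsub : ∀ {f : ℝ → ℝ}, IntervalIntegrable f volume 0 T → IntervalIntegrable f volume 0 t :=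
      fun hf => hf.mono_set (by
        rw [uIcc_of_le ht.1, uIcc_of_le hT.le]; exact Icc_subset_Icc_right ht.2)
    have hst : Icc 0 t ⊆ Icc 0 T := Icc_subset_Icc_right ht.2
    have e1 := hE t ht
    have e2 := potE_sub_eq_integral hφ hc hpot ht.1 (hs.cont.mono hst) (hs.cont_vel.mono hst)
      (fun s hs' => (hs.deriv s (hst hs')).mono hst) fun s hs' => hK s (hst hs')
    have e3 : ∫ s in (0 : ℝ)..t, inner ℝ (P s - nem hφ (toHv (Φ s))) (V s) =
        work P V t - ∫ s in (0 : ℝ)..t, inner ℝ (nem hφ (toHv (Φ s))) (V s) := by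
      simp only [inner_sub_left, work, ip_eq_inner]
      exact intervalIntegral.integral_sub (hsub (intervalIntegrable_inner hT.le hP hs.cont_vel))
        (hsub (intervalIntegrable_inner hT.le hnem hs.cont_vel))
    have e4 : ∫ s in (0 : ℝ)..t, inner ℝ (g s) (V s) = dissipation γ V t := by
      rw [dissipation]
      refine intervalIntegral.integral_congr_ae_restrict ?_
      rw [uIoc_of_le ht.1]
      rw [← restrict_Ioo_eq_restrict_Ioc]
      exact ae_mono (Measure.restrict_mono (Ioo_subset_Ioo_right ht.2) le_rfl) hgV
    rw [energy_eq, energy_eq]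
    rw [e3, e4] at e1
    linarith

theorem exists_neg_le_potE (p : Params) {pot : Fin 2 → E3 → ℝ} (hc : ∀ j, Continuous (pot j))
    (hb : ∃ δ > 0, ∀ j a, -δ ≤ pot j a) : ∃ m : ℝ, 0 ≤ m ∧ ∀ Φ : Hd p, -m ≤ potE pot Φ := by
  obtain ⟨δ, hδ, hb⟩ := hb
  refine ⟨∑ j, δ * (p.vol j).real univ, Finset.sum_nonneg fun j _ => by positivity, fun Φ => ?_⟩
  rw [potE, ← Finset.sum_neg_distrib]
  refine Finset.sum_le_sum fun j _ => ?_
  have : ∫ _, -δ ∂(p.vol j) ≤ ∫ x, pot j (toHv Φ j x) ∂(p.vol j) :=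
    integral_mono (integrable_const _) (integrable_comp_toHv (hc j) Φ j) fun x => hb j _
  rw [integral_const, smul_eq_mul] at this
  linarith

theorem dissipation_nonneg (hm : Monotone γ) (h0 : γ 0 = 0) {t : ℝ} (ht : 0 ≤ t) :
    0 ≤ dissipation γ V t :=
  intervalIntegral.integral_nonneg ht fun _ _ => integral_nonneg fun _ =>
    mul_self_nonneg_of_monotone hm h0 _

/-- The lower bound on the potential leaves an inequality for the quadratic energy alone, to which
the quadratic Gronwall lemma applies with L = 0. The constant depends neither on T nor on any
truncation. -/
theorem exists_apriori_bound (p : Params) {pot : Fin 2 → E3 → ℝ} (hc : ∀ j, Continuous (pot j))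
    (hb : ∃ δ > 0, ∀ j a, -δ ≤ pot j a) : ∃ M : ℝ, 0 ≤ M ∧ ∀ (T e₀ I : ℝ) (P : ℝ → Hv p)
      (Φ : ℝ → Hd p) (V : ℝ → Hv p), 0 < T → IntervalIntegrable P volume 0 T →
      ContinuousOn Φ (Icc 0 T) → ContinuousOn V (Icc 0 T) →
      (∀ t ∈ Icc 0 T, Bresse.energy pot (Φ t) (V t) ≤ e₀ + work P V t) → 0 ≤ e₀ →
      ∫ s in (0 : ℝ)..T, ‖P s‖ ≤ I →
      ∀ t ∈ Icc 0 T, ‖Φ t‖ ≤ M * (1 + e₀ + I) ∧ ‖V t‖ ≤ M * (1 + e₀ + I) := by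
  obtain ⟨m, hm, hpm⟩ := exists_neg_le_potE p hc hb
  obtain ⟨c, hcp, hle⟩ := exists_le_quadE p
  refine ⟨c * (2 + 2 * m + 2 * c), by positivity, fun T e₀ I P Φ V hT hP hΦ hV hE he hI => ?_⟩
  set e : ℝ → ℝ := fun t => √(quadE (Φ t) (V t)) with hedef
  have hesq : ∀ t, e t ^ 2 = quadE (Φ t) (V t) := fun t => Real.sq_sqrt (quadE_nonneg _ _)
  have hec : ContinuousOn e (Icc 0 T) := (continuousOn_quadE hΦ hV).sqrt
  have hψi : IntervalIntegrable (fun s => c * ‖P s‖) volume 0 T := hP.norm.const_mul c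
  have hE0 : 0 ≤ 2 * (e₀ + m) := by positivity
  have hgron := le_of_sq_le_add_integral (φ := e) (ψ := fun s => c * ‖P s‖) (T := T)
    (L := 0) (φ₀ := √(2 * (e₀ + m))) le_rfl (Real.sqrt_nonneg _) hec
    (fun t _ => Real.sqrt_nonneg _) hψi (fun t => by positivity) (fun t ht => by
      rw [hesq, Real.sq_sqrt hE0]
      have h1 := hE t ht
      rw [energy_eq] at h1
      have h2 := hpm (Φ t)
      have hsub : ∀ {f : ℝ → ℝ}, IntervalIntegrable f volume 0 T → IntervalIntegrable f volume 0 t :=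
        fun hf => hf.mono_set (by
          rw [uIcc_of_le ht.1, uIcc_of_le hT.le]; exact Icc_subset_Icc_right ht.2)
      have h3 : 2 * work P V t ≤ ∫ s in (0 : ℝ)..t, (2 * 0 * e s ^ 2 + 2 * (c * ‖P s‖) * e s) := by
        rw [work, ← intervalIntegral.integral_const_mul]
        simp only [ip_eq_inner]
        refine intervalIntegral.integral_mono_on ht.1
          ((hsub (intervalIntegrable_inner hT.le hP hV)).const_mul 2) (hsub ?_) fun s hs => ?_
        · simp only [mul_zero, zero_mul, zero_add]
          have := hec
          rw [← uIcc_of_le hT.le] at this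
          exact (hψi.const_mul 2).mul_continuousOn this
        · have a2 := (hle (Φ s) (V s)).2
          have a4 : inner ℝ (P s) (V s) ≤ ‖P s‖ * ‖V s‖ := real_inner_le_norm _ _
          have a5 := mul_le_mul_of_nonneg_left a2 (norm_nonneg (P s))
          nlinarith
      linarith)
  intro t ht
  have b1 := hgron t ht
  rw [mul_zero, zero_mul, Real.exp_zero, one_mul, intervalIntegral.integral_const_mul] at b1
  have b2 : √(2 * (e₀ + m)) ≤ 1 + 2 * (e₀ + m) := by
    rw [Real.sqrt_le_left (by positivity)]
    nlinarith
  have hI0 : 0 ≤ I := le_trans (intervalIntegral.integral_nonneg hT.le fun _ _ => norm_nonneg _) hI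
  have b3 : e t ≤ (2 + 2 * m + 2 * c) * (1 + e₀ + I) := by
    have := mul_le_mul_of_nonneg_left hI hcp.le
    have n1 := mul_nonneg hm he
    have n2 := mul_nonneg hm hI0
    have n3 := mul_nonneg hcp.le he
    nlinarith
  have b4 := hle (Φ t) (V t)
  have b5 := mul_le_mul_of_nonneg_left b3 hcp.le
  constructor
  · exact b4.1.trans (by rw [mul_assoc]; exact b5)
  · exact b4.2.trans (by rw [mul_assoc]; exact b5)

end Energy

end Bresse

namespace Bresse

/-! ### Solutions of the truncated problem and the continuation argument -/

variable {p : Params}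

theorem hasDerivWithinAt_of_eq_integral {E : Type*} [NormedAddCommGroup E] [NormedSpace ℝ E]
    [CompleteSpace E] {u v : ℝ → E} {u₀ : E} {T : ℝ} (hT : 0 ≤ T) (hv : ContinuousOn v (Icc 0 T))
    (h : ∀ t ∈ Icc 0 T, u t = u₀ + ∫ s in (0 : ℝ)..t, v s) :
    ∀ t ∈ Icc 0 T, HasDerivWithinAt u (v t) (Icc 0 T) t := by
  intro t ht
  set v' : ℝ → E := IccExtend hT ((Icc 0 T).domRestrict v) with hv'
  have hc : Continuous v' := (continuousOn_iff_continuous_domRestrict.1 hv).Icc_extend'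
  have he : ∀ s ∈ Icc 0 T, v' s = v s := fun s hs => IccExtend_of_mem hT _ hs
  have h1 : HasDerivAt (fun t => u₀ + ∫ s in (0 : ℝ)..t, v' s) (v' t) t :=
    ((hc.integral_hasStrictDerivAt 0 t).hasDerivAt).const_add u₀
  rw [← he t ht]
  refine h1.hasDerivWithinAt.congr_of_mem (fun s hs => ?_) ht
  rw [h s hs]
  congr 1
  refine intervalIntegral.integral_congr fun r hr => ?_
  rw [uIcc_of_le hs.1] at hr
  exact (he r ⟨hr.1, hr.2.trans hs.2⟩).symm

theorem primitive_of_zero {E : Type*} [NormedAddCommGroup E] [NormedSpace ℝ E] {u f : ℝ → E}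
    {u₀ : E} {T : ℝ} (hf : IntervalIntegrable f volume 0 T)
    (h : ∀ t ∈ Icc 0 T, u t = u₀ + ∫ s in (0 : ℝ)..t, f s) {a b : ℝ} (ha : 0 < a)
    (hab : a < b) (hb : b < T) :
    IntervalIntegrable f volume a b ∧ u b = u a + ∫ t in a..b, f t := by
  have hT : 0 < T := ha.trans (hab.trans hb)
  have hsub : ∀ s ∈ Icc 0 T, IntervalIntegrable f volume 0 s := fun s hs =>
    hf.mono_set (by rw [uIcc_of_le hs.1, uIcc_of_le hT.le]; exact Icc_subset_Icc_right hs.2)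
  have ma : a ∈ Icc 0 T := ⟨ha.le, (hab.trans hb).le⟩
  have mb : b ∈ Icc 0 T := ⟨(ha.trans hab).le, hb.le⟩
  have i := (hsub a ma).symm.trans (hsub b mb)
  refine ⟨i, ?_⟩
  rw [h a ma, h b mb, ← intervalIntegral.integral_add_adjacent_intervals (hsub a ma) i, add_assoc]

theorem exists_truncSol {γ : ℝ → ℝ} (hγ : Continuous γ) (hm : Monotone γ) (h0 : γ 0 = 0)
    {C : NNReal} {φ : Fin 2 → E3 → E3} (hφ : ∀ j, LipschitzWith C (φ j)) {T : ℝ} (hT : 0 < T)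
    {P : ℝ → Hv p} (hP : Continuous P) {m : ℝ → ℝ} (hmm : Monotone m)
    (hPm : ∀ s t, s ≤ t → ‖P t - P s‖ ≤ m t - m s) {Φ₀ Φ₁ : Hd p} {v₀ : Hv p} (h₀ : WeakA Φ₀ v₀) :
    ∃ (Φ : ℝ → Hd p) (V : ℝ → Hv p), TruncSol γ hφ T P Φ V ∧ Φ 0 = Φ₀ ∧ V 0 = toHv Φ₁ := by
  obtain ⟨Φ, W, V, Z, g, hΦ, hV, hW, hZ, eΦ, eV, hae⟩ :=
    exists_evolution hγ hm h0 hφ hT hP hmm hPm (Φ₁ := Φ₁) h₀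
  have hm0 : (0 : ℝ) ∈ Icc 0 T := ⟨le_rfl, hT.le⟩
  have hae' : ∀ᵐ t ∂(timeMeasure T), toHv (W t) = V t ∧ IsDamp γ (V t) (g t) ∧
      WeakA (Φ t) (P t - nem hφ (toHv (Φ t)) - g t - Rop p (Z t)) :=
    ae_mono (Measure.restrict_mono Ioo_subset_Ioc_self le_rfl) hae
  have hder : ∀ t ∈ Icc 0 T, toHv (Φ t) = toHv Φ₀ + ∫ s in (0 : ℝ)..t, V s := fun t ht => by
    have hi : IntervalIntegrable W volume 0 t := hW.mono_set (by
      rw [uIcc_of_le ht.1, uIcc_of_le hT.le]; exact Icc_subset_Icc_right ht.2)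
    rw [eΦ t ht, toHv_add, (toHv_integral hi).2]
    congr 1
    refine intervalIntegral.integral_congr_ae_restrict ?_
    rw [uIoc_of_le ht.1]
    filter_upwards [ae_mono (Measure.restrict_mono (Ioc_subset_Ioc_right ht.2) le_rfl) hae]
      with s hs using hs.1
  refine ⟨Φ, V, ⟨hΦ, hV, hasDerivWithinAt_of_eq_integral hT.le hV hder, W, Z, g,
    ⟨fun a b => primitive_of_zero hW eΦ, fun a b => primitive_of_zero hZ eV, ?_⟩, ?_⟩, ?_, ?_⟩
  · filter_upwards [hae'] with t ht using ⟨ht.1, ht.2.2⟩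
  · filter_upwards [hae'] with t ht using ht.2.1
  · rw [eΦ 0 hm0, intervalIntegral.integral_same, add_zero]
  · rw [eV 0 hm0, intervalIntegral.integral_same, add_zero]

/-- At the first time when the norm reaches K, all earlier values are at most B by hypothesis, hence
so is this one by continuity, contrary to B < K. -/
theorem norm_le_of_forall_lt {E : Type*} [NormedAddCommGroup E] {u : ℝ → E} {T B K : ℝ}
    (hu : ContinuousOn u (Icc 0 T)) (h0 : ‖u 0‖ < K) (hBK : B < K)
    (h : ∀ s ∈ Ioc 0 T, (∀ r ∈ Icc 0 s, ‖u r‖ ≤ K) → ‖u s‖ ≤ B) :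
    ∀ t ∈ Icc 0 T, ‖u t‖ ≤ K := by
  by_contra! hcon
  obtain ⟨t, ht, hlt⟩ := hcon
  have hcl : IsCompact (Icc 0 T ∩ (fun t => ‖u t‖) ⁻¹' Ici K) :=
    isCompact_Icc.of_isClosed_subset (hu.norm.preimage_isClosed_of_isClosed isClosed_Icc isClosed_Ici)
      inter_subset_left
  obtain ⟨s, ⟨hs, hKs⟩, hmin⟩ := hcl.exists_isLeast ⟨t, ht, hlt.le⟩
  have hs0 : 0 < s := by
    rcases hs.1.eq_or_lt with h' | h'
    · rw [← h'] at hKs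
      exact absurd hKs (not_le.2 h0)
    · exact h'
  have hbefore : ∀ r ∈ Icc 0 T, r < s → ‖u r‖ < K := fun r hr hrs => by
    by_contra! hc
    exact absurd (hmin ⟨hr, hc⟩) (not_le.2 hrs)
  have hB : ∀ r ∈ Ioo 0 s, ‖u r‖ ≤ B := fun r hr =>
    h r ⟨hr.1, (hr.2.trans_le hs.2).le⟩ fun r' hr' =>
      (hbefore r' ⟨hr'.1, hr'.2.trans (hr.2.trans_le hs.2).le⟩ (hr'.2.trans_lt hr.2)).le
  have lim : Tendsto (fun r => ‖u r‖) (𝓝[Ioo 0 s] s) (𝓝 ‖u s‖) :=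
    ((hu s hs).mono (fun r hr => ⟨hr.1.le, (hr.2.trans_le hs.2).le⟩)).norm
  have : (𝓝[Ioo 0 s] s).NeBot := right_nhdsWithin_Ioo_neBot hs0
  have hle : ‖u s‖ ≤ B := le_of_tendsto lim (eventually_nhdsWithin_of_forall hB)
  exact absurd (hle.trans_lt hBK) (not_lt.2 hKs)

/-! ### Existence of strong solutions -/

section Existence

variable {f g h : Fin 2 → E3 → ℝ} {γ : ℝ → ℝ} {pot : Fin 2 → E3 → ℝ}

theorem continuous_pot (hpot : ∀ j a, HasGradientAt (pot j) (feedback f g h j a) a) (j : Fin 2) :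
    Continuous (pot j) :=
  continuous_iff_continuousAt.2 fun a => (hpot j a).continuousAt

/-- The a priori bound B depends on the data only. The feedback is truncated beyond the level K₀ >
B, and the solution of the truncated problem never exceeds K₀, so it solves the original problem. -/
theorem exists_isStrong (hf : ∀ j, LipOnBalls (f j)) (hg : ∀ j, LipOnBalls (g j))
    (hh : ∀ j, LipOnBalls (h j)) (hpot : ∀ j a, HasGradientAt (pot j) (feedback f g h j a) a)
    (hbelow : ∃ δ > 0, ∀ j a, -δ ≤ pot j a) (hγ : Continuous γ) (hm : Monotone γ) (h0 : γ 0 = 0)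
    {T : ℝ} (hT : 0 < T) {P : ℝ → Hv p} (hP : Continuous P) {m : ℝ → ℝ} (hmm : Monotone m)
    (hPm : ∀ s t, s ≤ t → ‖P t - P s‖ ≤ m t - m s) {Φ₀ : Hd p} {v₀ : Hv p} (h₀ : WeakA Φ₀ v₀)
    (Φ₁ : Hd p) : ∃ Φ V, IsStrong p f g h γ T P Φ₀ (toHv Φ₁) Φ V := by
  have hc := continuous_pot hpot
  obtain ⟨S, hS0, hS⟩ := exists_sup_bound p
  obtain ⟨M, hM0, hM⟩ := exists_apriori_bound p hc hbelow
  set e₀ := |Bresse.energy pot Φ₀ (toHv Φ₁)| with he₀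
  set I := ∫ s in (0 : ℝ)..T, ‖P s‖ with hI
  set B := M * (1 + e₀ + I) with hB
  set K₀ := max B ‖Φ₀‖ + 1 with hK₀
  have hBK : B < K₀ := (le_max_left _ _).trans_lt (lt_add_one _)
  have hΦK : ‖Φ₀‖ < K₀ := (le_max_right _ _).trans_lt (lt_add_one _)
  have hK0 : 0 < K₀ := (norm_nonneg _).trans_lt hΦK
  obtain ⟨φ, C, hφ, heq⟩ := exists_truncated_feedback hf hg hh (K := S * K₀) (by positivity)
  obtain ⟨Φ, V, hs, hΦ0, hV0⟩ := exists_truncSol hγ hm h0 hφ hT hP hmm hPm (Φ₁ := Φ₁) h₀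
  have hsup : ∀ Ψ : Hd p, ‖Ψ‖ ≤ K₀ → ∀ j, ∀ᵐ x ∂(p.vol j), ‖toHv Ψ j x‖ ≤ S * K₀ := fun Ψ hΨ j => by
    filter_upwards [(hS Ψ j).2] with x hx
    exact hx.trans (mul_le_mul_of_nonneg_left hΨ hS0.le)
  have hbd : ∀ t ∈ Icc 0 T, ‖Φ t‖ ≤ K₀ := by
    -- On [0, s] the truncation is inactive, so the energy identity there holds with the original
    -- potential and gives the bound B.
    refine norm_le_of_forall_lt hs.cont (by rw [hΦ0]; exact hΦK) hBK fun s hs' hr => ?_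
    have hrs := hs.restrict hs'.2
    have hPi : ∀ a b, IntervalIntegrable P volume a b := fun a b => hP.intervalIntegrable a b
    have hen := (hrs.energy hm h0 hs'.1 (hPi _ _) hc (K := S * K₀)
      (fun j a ha => by rw [heq j a ha]; exact hpot j a) fun r hr' => hsup _ (hr r hr')).2.2
    refine (hM s e₀ I P Φ V hs'.1 (hPi _ _) hrs.cont hrs.cont_vel (fun t ht => ?_) (abs_nonneg _)
      ?_ s ⟨hs'.1.le, le_rfl⟩).1
    · have h1 := hen t ht
      have h2 := dissipation_nonneg (V := V) hm h0 ht.1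
      rw [hΦ0, hV0] at h1
      have h3 := le_abs_self (Bresse.energy pot Φ₀ (toHv Φ₁))
      linarith
    · exact intervalIntegral.integral_mono_interval le_rfl hs'.1.le hs'.2
        (Eventually.of_forall fun _ => norm_nonneg _) (hPi _ _).norm
  have := hs.isStrong (f := f) (g := g) (h := h) (K := S * K₀) (fun t ht => hsup _ (hbd t ht)) heq
  rw [hΦ0, hV0] at this
  exact ⟨Φ, V, this⟩

theorem IsStrong.congr_load {T : ℝ} {P P' : ℝ → Hv p} {Φ₀ : Hd p} {Φ₁ : Hv p} {Φ : ℝ → Hd p}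
    {V : ℝ → Hv p} (hs : IsStrong p f g h γ T P Φ₀ Φ₁ Φ V)
    (hP : ∀ᵐ t ∂(timeMeasure T), P t = P' t) : IsStrong p f g h γ T P' Φ₀ Φ₁ Φ V := by
  obtain ⟨Z, hZ, hae⟩ := hs.eqn
  refine ⟨hs.mem, hs.ac, Z, hZ, ?_⟩
  filter_upwards [hae, hP] with t h1 h2
  rwa [← h2]

/-- Such a load agrees almost everywhere with a primitive of P_t, whose variation is bounded by
∫‖P_t‖. Evaluation at the projection onto [0,T] extends it to a continuous load on the line. -/
theorem exists_isStrong_of_timeDeriv (hf : ∀ j, LipOnBalls (f j)) (hg : ∀ j, LipOnBalls (g j))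
    (hh : ∀ j, LipOnBalls (h j)) (hpot : ∀ j a, HasGradientAt (pot j) (feedback f g h j a) a)
    (hbelow : ∃ δ > 0, ∀ j a, -δ ≤ pot j a) (hγ : Continuous γ) (hm : Monotone γ) (h0 : γ 0 = 0)
    {T : ℝ} (hT : 0 < T) {P Pt : ℝ → Hv p} {P₀ : Hv p} (hPt : MemLp Pt 2 (timeMeasure T))
    (hP : HasTimeDeriv T P Pt P₀) {Φ₀ : Hd p} {v₀ : Hv p} (h₀ : WeakA Φ₀ v₀)
    (Φ₁ : Hd p) : ∃ Φ V, IsStrong p f g h γ T P Φ₀ (toHv Φ₁) Φ V := by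
  have hi := intervalIntegrable_of_memLp hT hPt
  set pr : ℝ → ℝ := fun t => (projIcc 0 T hT.le t : ℝ) with hpr
  have hprm : ∀ t, pr t ∈ Icc 0 T := fun t => (projIcc 0 T hT.le t).2
  have hprc : Continuous pr := continuous_subtype_val.comp continuous_projIcc
  have hprmono : Monotone pr := fun s t hst => monotone_projIcc hT.le hst
  have hsub : ∀ s ∈ Icc 0 T, IntervalIntegrable Pt volume 0 s := fun s hs =>
    hi.mono_set (by rw [uIcc_of_le hs.1, uIcc_of_le hT.le]; exact Icc_subset_Icc_right hs.2)
  have hco : ContinuousOn (fun t => P₀ + ∫ s in (0 : ℝ)..t, Pt s) (Icc 0 T) := by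
    refine continuousOn_const.add ?_
    have := intervalIntegral.continuousOn_primitive_interval (μ := volume) (f := Pt) (a := 0)
      (b := T) (by rw [uIcc_of_le hT.le]
                   exact (intervalIntegrable_iff_integrableOn_Icc_of_le hT.le).1 hi)
    rwa [uIcc_of_le hT.le] at this
  have hint : ∀ {F : Type} [NormedAddCommGroup F] [NormedSpace ℝ F] {G : ℝ → F},
      (∀ s ∈ Icc 0 T, IntervalIntegrable G volume 0 s) → ∀ s t,
      ∫ r in (0 : ℝ)..pr t, G r = (∫ r in (0 : ℝ)..pr s, G r) + ∫ r in pr s..pr t, G r :=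
    fun hG s t => (intervalIntegral.integral_add_adjacent_intervals (hG _ (hprm s))
      ((hG _ (hprm s)).symm.trans (hG _ (hprm t)))).symm
  obtain ⟨Φ, V, hs⟩ := exists_isStrong hf hg hh hpot hbelow hγ hm h0 hT
    (P := fun t => P₀ + ∫ s in (0 : ℝ)..pr t, Pt s) (hco.comp_continuous hprc hprm)
    (m := fun t => ∫ s in (0 : ℝ)..pr t, ‖Pt s‖)
    (fun s t hst => by
      have := hint (fun s hs => (hsub s hs).norm) s t
      simp only
      rw [this]
      have := intervalIntegral.integral_nonneg (μ := volume) (f := fun r => ‖Pt r‖) (hprmono hst)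
        fun _ _ => norm_nonneg _
      linarith)
    (fun s t hst => by
      rw [hint hsub s t, hint (fun s hs => (hsub s hs).norm) s t, add_sub_cancel_left,
        ← add_assoc, add_sub_cancel_left]
      exact intervalIntegral.norm_integral_le_integral_norm (hprmono hst)) h₀ Φ₁
  refine ⟨Φ, V, hs.congr_load ?_⟩
  have hP' : ∀ᵐ t ∂(timeMeasure T), P t = P₀ + ∫ s in (0 : ℝ)..t, Pt s := hP
  filter_upwards [hP', ae_restrict_mem measurableSet_Ioo] with t h1 h2
  rw [h1]
  simp only [hpr, projIcc_of_mem hT.le (Ioo_subset_Icc_self h2)]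

end Existence

end Bresse

namespace Bresse

variable {p : Params}

/-- The standing assumptions on the nonlinearities. -/
structure Assumptions (f g h : Fin 2 → E3 → ℝ) (pot : Fin 2 → E3 → ℝ) (γ : ℝ → ℝ) : Prop where
  hf : ∀ j, LipOnBalls (f j)
  hg : ∀ j, LipOnBalls (g j)
  hh : ∀ j, LipOnBalls (h j)
  hpot : ∀ j a, HasGradientAt (pot j) (feedback f g h j a) a
  below : ∃ δ > 0, ∀ j a, -δ ≤ pot j a
  cont : Continuous γ
  mono : Monotone γ
  zero : γ 0 = 0

/-! ### Approximation of square integrable loads -/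

section Loads

variable {T : ℝ}

instance : IsFiniteMeasure (timeMeasure T) := by unfold timeMeasure; infer_instance

instance : (timeMeasure T).Regular := by unfold timeMeasure; infer_instance

theorem intervalIntegral_eq_timeMeasure {E : Type*} [NormedAddCommGroup E] [NormedSpace ℝ E]
    (hT : 0 ≤ T) (u : ℝ → E) : ∫ t in (0 : ℝ)..T, u t = ∫ t, u t ∂(timeMeasure T) := by
  rw [intervalIntegral.integral_of_le hT, integral_Ioc_eq_integral_Ioo, timeMeasure]

theorem tendsto_integral_norm_of_L2 {E : Type*} [NormedAddCommGroup E] (hT : 0 < T)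
    {P : ℝ → E} {Pn : ℕ → ℝ → E} (hP : MemLp P 2 (timeMeasure T))
    (hPn : ∀ n, MemLp (Pn n) 2 (timeMeasure T))
    (h : Tendsto (fun n => eLpNorm (fun t => Pn n t - P t) 2 (timeMeasure T)) atTop (𝓝 0)) :
    Tendsto (fun n => ∫ s in (0 : ℝ)..T, ‖Pn n s - P s‖) atTop (𝓝 0) := by
  have h1 : Tendsto (fun n => eLpNorm (fun t => Pn n t - P t) 1 (timeMeasure T)) atTop (𝓝 0) := by
    have hc : Tendsto (fun n => eLpNorm (fun t => Pn n t - P t) 2 (timeMeasure T) *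
        timeMeasure T univ ^ (1 / (1 : ENNReal).toReal - 1 / (2 : ENNReal).toReal)) atTop
        (𝓝 (0 * timeMeasure T univ ^ (1 / (1 : ENNReal).toReal - 1 / (2 : ENNReal).toReal))) := by
      refine ENNReal.Tendsto.mul_const h (Or.inr ?_)
      exact ENNReal.rpow_ne_top_of_nonneg (by norm_num) (measure_ne_top _ _)
    rw [zero_mul] at hc
    exact tendsto_of_tendsto_of_tendsto_of_le_of_le tendsto_const_nhds hc (fun _ => zero_le)
      fun n => eLpNorm_le_eLpNorm_mul_rpow_measure_univ (by norm_num) ((hPn n).sub hP).1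
  have h2 := (ENNReal.tendsto_toReal ENNReal.zero_ne_top).comp h1
  rw [ENNReal.toReal_zero] at h2
  refine h2.congr fun n => ?_
  have hm : AEStronglyMeasurable (fun s => Pn n s - P s) (timeMeasure T) := ((hPn n).sub hP).1
  rw [intervalIntegral_eq_timeMeasure hT.le, Function.comp_apply, eLpNorm_one_eq_lintegral_enorm,
    integral_norm_eq_lintegral_enorm hm]

/-- Continuous functions of compact support are dense in L²; a uniformly close smooth function is
Lipschitz on [0,T], and composition with the projection onto [0,T] makes it globally Lipschitz, with
m linear. -/
theorem exists_regular_load {E : Type*} [NormedAddCommGroup E] [NormedSpace ℝ E] [CompleteSpace E]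
    (hT : 0 < T) {P : ℝ → E} (hP : MemLp P 2 (timeMeasure T)) {ε : ℝ} (hε : 0 < ε) :
    ∃ Q : ℝ → E, Continuous Q ∧ (∃ m : ℝ → ℝ, Monotone m ∧
      ∀ s t, s ≤ t → ‖Q t - Q s‖ ≤ m t - m s) ∧ MemLp Q 2 (timeMeasure T) ∧
      eLpNorm (fun t => Q t - P t) 2 (timeMeasure T) ≤ ENNReal.ofReal ε := by
  obtain ⟨c, hcs, hce, hcc, hcm⟩ := hP.exists_hasCompactSupport_eLpNorm_sub_le (by norm_num)
    (ε := ENNReal.ofReal (ε / 2)) (by simpa using hε)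
  set B : ℝ := (timeMeasure T univ ^ (1 / (2 : ENNReal).toReal)).toReal with hB
  have hB0 : 0 ≤ B := ENNReal.toReal_nonneg
  -- B is the factor between the uniform norm and the L² norm on (0,T); B + 1 avoids a division by
  -- zero.
  obtain ⟨q, hq, hqc⟩ := (hcs.uniformContinuous_of_continuous hcc).exists_contDiff_dist_le
    (ε := ε / 2 / (B + 1)) (by positivity)
  obtain ⟨L, hL⟩ := hq.contDiffOn.exists_lipschitzOnWith (by simp) (convex_Icc 0 T) isCompact_Icc
  set pr : ℝ → ℝ := fun t => (projIcc 0 T hT.le t : ℝ) with hpr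
  have hprm : ∀ t, pr t ∈ Icc 0 T := fun t => (projIcc 0 T hT.le t).2
  have hprL : LipschitzWith 1 pr := LipschitzWith.projIcc hT.le
  have hQL : LipschitzWith L fun t => q (pr t) := by
    refine LipschitzWith.of_dist_le_mul fun s t => (hL.dist_le_mul _ (hprm s) _ (hprm t)).trans ?_
    refine mul_le_mul_of_nonneg_left ?_ L.2
    simpa using hprL.dist_le_mul s t
  have hQc : ∀ᵐ t ∂(timeMeasure T), ‖q (pr t) - c t‖ ≤ ε / 2 / (B + 1) := by
    filter_upwards [ae_restrict_mem measurableSet_Ioo] with t ht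
    rw [hpr]
    simp only [projIcc_of_mem hT.le (Ioo_subset_Icc_self ht)]
    rw [← dist_eq_norm]
    exact (hqc t).le
  have hQm : MemLp (fun t => q (pr t)) 2 (timeMeasure T) := by
    have h1 : MemLp (fun t => q (pr t) - c t) 2 (timeMeasure T) :=
      MemLp.of_bound (hQL.continuous.sub hcc).aestronglyMeasurable _ hQc
    have := h1.add hcm
    refine this.ae_eq (Eventually.of_forall fun t => ?_)
    simp
  refine ⟨fun t => q (pr t), hQL.continuous, ⟨fun t => L * t, fun s t hst =>
    mul_le_mul_of_nonneg_left hst L.2, fun s t hst => ?_⟩, hQm, ?_⟩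
  · have := hQL.dist_le_mul t s
    rw [dist_eq_norm, Real.dist_eq, abs_of_nonneg (sub_nonneg.2 hst)] at this
    rw [← mul_sub]
    exact this
  · have e1 : (fun t => q (pr t) - P t) = (fun t => q (pr t) - c t) - (P - c) := by
      ext t; simp
    rw [e1]
    refine (eLpNorm_sub_le (hQL.continuous.sub hcc).aestronglyMeasurable (hP.sub hcm).1
      (by norm_num)).trans ?_
    have e2 : eLpNorm (fun t => q (pr t) - c t) 2 (timeMeasure T) ≤ ENNReal.ofReal (ε / 2) := by
      refine (eLpNorm_le_of_ae_bound hQc).trans ?_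
      have e3 : timeMeasure T univ ^ ((2 : ENNReal).toReal)⁻¹ = ENNReal.ofReal B := by
        rw [hB, ENNReal.ofReal_toReal]
        · rw [one_div]
        · exact ENNReal.rpow_ne_top_of_nonneg (by norm_num) (measure_ne_top _ _)
      rw [e3, ← ENNReal.ofReal_mul hB0]
      refine ENNReal.ofReal_le_ofReal ?_
      rw [← mul_div_assoc, div_le_iff₀ (by positivity)]
      nlinarith
    calc _ ≤ ENNReal.ofReal (ε / 2) + ENNReal.ofReal (ε / 2) := add_le_add e2 hce
      _ = ENNReal.ofReal ε := by rw [← ENNReal.ofReal_add (by positivity) (by positivity)]; congr 1; ring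

end Loads

/-! ### Comparison of strong solutions and uniqueness of generalized ones -/

variable {f g h : Fin 2 → E3 → ℝ} {pot : Fin 2 → E3 → ℝ} {γ : ℝ → ℝ} {T : ℝ}

theorem exists_norm_bound {Φ : ℝ → Hd p} (h : ContinuousOn Φ (Icc 0 T)) :
    ∃ K : ℝ, 0 ≤ K ∧ ∀ t ∈ Icc 0 T, ‖Φ t‖ ≤ K := by
  obtain ⟨K, hK⟩ := isCompact_Icc.exists_bound_of_continuousOn h
  exact ⟨max K 0, le_max_right _ _, fun t ht => (hK t ht).trans (le_max_left _ _)⟩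

theorem sup_le_of_norm_le {S K : ℝ} (hS0 : 0 < S) (hS : ∀ (Φ : Hd p) (j : Fin 2),
    (∀ x ∈ Icc (p.lo j) (p.hi j), ‖rep Φ j x‖ ≤ S * ‖Φ‖) ∧
      ∀ᵐ x ∂(p.vol j), ‖toHv Φ j x‖ ≤ S * ‖Φ‖) {Ψ : Hd p} (hΨ : ‖Ψ‖ ≤ K) (j : Fin 2) :
    ∀ᵐ x ∂(p.vol j), ‖toHv Ψ j x‖ ≤ S * K := by
  filter_upwards [(hS Ψ j).2] with x hx
  exact hx.trans (mul_le_mul_of_nonneg_left hΨ hS0.le)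

/-- For every bound `K` there is a Lipschitz feedback which agrees with the given one along all
`Φ ∈ H_d` of norm at most `K`. -/
theorem Assumptions.exists_trunc (p : Params) (A : Assumptions f g h pot γ) {K : ℝ} (hK : 0 ≤ K) :
    ∃ (k : ℝ) (φ : Fin 2 → E3 → E3) (C : NNReal), (∀ j, LipschitzWith C (φ j)) ∧
      (∀ j a, ‖a‖ ≤ k → φ j a = feedback f g h j a) ∧
      (∀ j a, ‖a‖ ≤ k → HasGradientAt (pot j) (φ j a) a) ∧
      ∀ Ψ : Hd p, ‖Ψ‖ ≤ K → ∀ j, ∀ᵐ x ∂(p.vol j), ‖toHv Ψ j x‖ ≤ k := by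
  obtain ⟨S, hS0, hS⟩ := exists_sup_bound p
  obtain ⟨φ, C, hφ, heq⟩ := exists_truncated_feedback A.hf A.hg A.hh (K := S * K) (by positivity)
  exact ⟨S * K, φ, C, hφ, heq, fun j a ha => by rw [heq j a ha]; exact A.hpot j a,
    fun Ψ hΨ j => sup_le_of_norm_le hS0 hS hΨ j⟩

theorem Assumptions.energy_strong (A : Assumptions f g h pot γ) (hT : 0 < T) {P : ℝ → Hv p}
    {Φ₀ : Hd p} {Φ₁ : Hv p} {Φ : ℝ → Hd p} {V : ℝ → Hv p} (hP : MemLp P 2 (timeMeasure T))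
    (hs : IsStrong p f g h γ T P Φ₀ Φ₁ Φ V) :
    IntervalIntegrable (fun s => ∫ x in Ioo 0 p.L₀, γ (V s 0 x 1) * V s 0 x 1) volume 0 T ∧
    (∀ᵐ s ∂(timeMeasure T), Integrable (fun x => γ (V s 0 x 1) * V s 0 x 1) (p.vol 0)) ∧
    ∀ t ∈ Icc 0 T, energy pot (Φ t) (V t) + dissipation γ V t =
      energy pot Φ₀ Φ₁ + work P V t := by
  obtain ⟨K, hK0, hK⟩ := exists_norm_bound hs.mem.cont
  obtain ⟨k, φ, C, hφ, heq, hgr, hsup⟩ := A.exists_trunc p hK0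
  have hb := fun t ht => hsup _ (hK t ht)
  have := (hs.truncSol hφ hb heq).energy A.mono A.zero hT (intervalIntegrable_of_memLp hT hP)
    (continuous_pot A.hpot) hgr hb
  rwa [hs.mem.init, hs.mem.init_vel] at this

/-- Solutions bounded by K in H_d solve one and the same truncated problem, so the constant depends
on the pair only through K. -/
theorem Assumptions.exists_comparison (p : Params) (A : Assumptions f g h pot γ) (hT : 0 < T) {K : ℝ} (hK : 0 ≤ K) :
    ∃ M : ℝ, 0 < M ∧ ∀ (P P' : ℝ → Hv p) (Φ₀ Φ₀' : Hd p) (Φ₁ Φ₁' : Hv p) (Φ Φ' : ℝ → Hd p)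
      (V V' : ℝ → Hv p), IsStrong p f g h γ T P Φ₀ Φ₁ Φ V → IsStrong p f g h γ T P' Φ₀' Φ₁' Φ' V' →
      MemLp P 2 (timeMeasure T) → MemLp P' 2 (timeMeasure T) →
      (∀ t ∈ Icc 0 T, ‖Φ t‖ ≤ K) → (∀ t ∈ Icc 0 T, ‖Φ' t‖ ≤ K) → ∀ t ∈ Icc 0 T,
        ‖Φ t - Φ' t‖ + ‖V t - V' t‖ ≤
          M * (‖Φ₀ - Φ₀'‖ + ‖Φ₁ - Φ₁'‖ + ∫ s in (0 : ℝ)..T, ‖P s - P' s‖) := by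
  obtain ⟨k, φ, C, hφ, heq, hgr, hsup⟩ := A.exists_trunc p hK
  obtain ⟨M, hM0, hM⟩ := Bresse.exists_comparison p A.mono hφ hT
  refine ⟨M, hM0, fun P P' Φ₀ Φ₀' Φ₁ Φ₁' Φ Φ' V V' hs hs' hP hP' hb hb' t ht => ?_⟩
  have := hM P P' Φ Φ' V V' (hs.truncSol hφ (fun t ht => hsup _ (hb t ht)) heq)
    (hs'.truncSol hφ (fun t ht => hsup _ (hb' t ht)) heq) (intervalIntegrable_of_memLp hT hP)
    (intervalIntegrable_of_memLp hT hP') t ht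
  rwa [hs.mem.init, hs.mem.init_vel, hs'.mem.init, hs'.mem.init_vel] at this

theorem Assumptions.continuous_potE (p : Params) (A : Assumptions f g h pot γ) : Continuous (potE (p := p) pot) := by
  rw [continuous_iff_continuousAt]
  intro Ψ
  obtain ⟨k, φ, C, hφ, heq, hgr, hsup⟩ := A.exists_trunc p (K := ‖Ψ‖ + 1) (by positivity)
  have hc : Continuous fun Φ : Hd p => ‖nem hφ (toHv Ψ)‖ * ‖Φ - Ψ‖ + C * ‖Φ - Ψ‖ ^ 2 := by
    have : Continuous fun Φ : Hd p => ‖Φ - Ψ‖ := (continuous_id.sub continuous_const).norm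
    exact (continuous_const.mul this).add (continuous_const.mul (this.pow 2))
  have l1 := hc.tendsto Ψ
  simp only [sub_self, norm_zero, mul_zero, ne_eq, OfNat.ofNat_ne_zero, not_false_eq_true,
    zero_pow, add_zero] at l1
  refine tendsto_iff_norm_sub_tendsto_zero.2 (tendsto_of_tendsto_of_tendsto_of_le_of_le'
    tendsto_const_nhds l1 (Eventually.of_forall fun _ => norm_nonneg _) ?_)
  filter_upwards [Metric.ball_mem_nhds Ψ one_pos] with Φ hΦ
  rw [mem_ball_iff_norm] at hΦ
  have hΦn : ‖Φ‖ ≤ ‖Ψ‖ + 1 := by linarith [norm_le_norm_add_norm_sub Ψ Φ, norm_sub_rev Φ Ψ]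
  have h1 := abs_potE_sub_le hφ (continuous_pot A.hpot) hgr (hsup Φ hΦn) (hsup Ψ (by linarith))
  have h2 : |inner ℝ (nem hφ (toHv Ψ)) (toHv Φ - toHv Ψ)| ≤ ‖nem hφ (toHv Ψ)‖ * ‖Φ - Ψ‖ :=
    (abs_real_inner_le_norm _ _).trans (mul_le_mul_of_nonneg_left
      (by rw [← toHv_sub]; exact norm_toHv_le _) (norm_nonneg _))
  have h3 : (C : ℝ) * ‖toHv Φ - toHv Ψ‖ ^ 2 ≤ C * ‖Φ - Ψ‖ ^ 2 := by
    rw [← toHv_sub]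
    exact mul_le_mul_of_nonneg_left (pow_le_pow_left₀ (norm_nonneg _) (norm_toHv_le _) 2) C.2
  rw [Real.norm_eq_abs]
  have h4 := abs_add_le (potE pot Φ - potE pot Ψ - inner ℝ (nem hφ (toHv Ψ)) (toHv Φ - toHv Ψ))
    (inner ℝ (nem hφ (toHv Ψ)) (toHv Φ - toHv Ψ))
  rw [sub_add_cancel] at h4
  linarith

theorem Assumptions.tendsto_energy (A : Assumptions f g h pot γ) {Φn : ℕ → Hd p} {Vn : ℕ → Hv p}
    {Φ : Hd p} {V : Hv p} (hΦ : Tendsto Φn atTop (𝓝 Φ)) (hV : Tendsto Vn atTop (𝓝 V)) :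
    Tendsto (fun n => energy pot (Φn n) (Vn n)) atTop (𝓝 (energy pot Φ V)) := by
  simp only [energy_eq, quadE]
  have h1 : Continuous fun Φ : Hd p => aForm p Φ Φ := (aForm p).continuous.clm_apply continuous_id
  have h2 : Continuous fun V : Hv p => rForm p V V := (rForm p).continuous.clm_apply continuous_id
  exact ((((h1.tendsto Φ).comp hΦ).add ((h2.tendsto V).comp hV)).const_mul _).add
    (((A.continuous_potE p).tendsto Φ).comp hΦ)

/-- Uniform convergence on `[0,T]` in `H_d × H_v`. -/
def UnifConv (T : ℝ) (Φn : ℕ → ℝ → Hd p) (Vn : ℕ → ℝ → Hv p) (Φ : ℝ → Hd p) (V : ℝ → Hv p) : Prop :=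
  ∀ ε > 0, ∀ᶠ n in atTop, ∀ t ∈ Icc 0 T, ‖Φn n t - Φ t‖ + ‖Vn n t - V t‖ < ε

theorem unifConv_iff {Φn : ℕ → ℝ → Hd p} {Vn : ℕ → ℝ → Hv p} {Φ : ℝ → Hd p} {V : ℝ → Hv p} :
    UnifConv T Φn Vn Φ V ↔ ∀ ε > 0, ∀ᶠ n in atTop, ∀ t ∈ Icc 0 T,
      normD (Φn n t - Φ t) + normV (Vn n t - V t) < ε := by
  obtain ⟨a, ha, h1⟩ := exists_norm_le_normD p
  obtain ⟨b, hb, h2⟩ := exists_norm_le_normV p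
  obtain ⟨c, hc, h3⟩ := exists_normD_le p
  obtain ⟨d, hd, h4⟩ := exists_normV_le p
  constructor
  · intro h ε hε
    filter_upwards [h (ε / (c + d)) (by positivity)] with n hn t ht
    have := hn t ht
    rw [lt_div_iff₀ (by positivity)] at this
    have e1 := h3 (Φn n t - Φ t)
    have e2 := h4 (Vn n t - V t)
    nlinarith [norm_nonneg (Φn n t - Φ t), norm_nonneg (Vn n t - V t)]
  · intro h ε hε
    filter_upwards [h (ε / (a + b)) (by positivity)] with n hn t ht
    have := hn t ht
    rw [lt_div_iff₀ (by positivity)] at this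
    have e1 := h1 (Φn n t - Φ t)
    have e2 := h2 (Vn n t - V t)
    have e3 : 0 ≤ normD (Φn n t - Φ t) := Real.sqrt_nonneg _
    have e4 : 0 ≤ normV (Vn n t - V t) := Real.sqrt_nonneg _
    nlinarith

theorem UnifConv.tendsto {Φn : ℕ → ℝ → Hd p} {Vn : ℕ → ℝ → Hv p} {Φ : ℝ → Hd p} {V : ℝ → Hv p}
    (h : UnifConv T Φn Vn Φ V) {t : ℝ} (ht : t ∈ Icc 0 T) :
    Tendsto (fun n => Φn n t) atTop (𝓝 (Φ t)) ∧ Tendsto (fun n => Vn n t) atTop (𝓝 (V t)) := by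
  constructor <;> rw [Metric.tendsto_atTop'] <;> intro ε hε <;>
    obtain ⟨N, hN⟩ := eventually_atTop.1 (h ε hε) <;> refine ⟨N, fun n hn => ?_⟩ <;>
    have := hN n hn.le t ht <;> rw [dist_eq_norm]
  · linarith [norm_nonneg (Vn n t - V t)]
  · linarith [norm_nonneg (Φn n t - Φ t)]

theorem UnifConv.eventually_le {Φn : ℕ → ℝ → Hd p} {Vn : ℕ → ℝ → Hv p} {Φ : ℝ → Hd p}
    {V : ℝ → Hv p} (h : UnifConv T Φn Vn Φ V) {K : ℝ} (hK : ∀ t ∈ Icc 0 T, ‖Φ t‖ ≤ K) :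
    ∀ᶠ n in atTop, ∀ t ∈ Icc 0 T, ‖Φn n t‖ ≤ K + 1 := by
  filter_upwards [h 1 one_pos] with n hn t ht
  have := hn t ht
  have h1 := hK t ht
  linarith [norm_nonneg (Vn n t - V t), norm_le_norm_add_norm_sub (Φ t) (Φn n t),
    norm_sub_rev (Φ t) (Φn n t)]

/-- Two sequences of strong solutions with asymptotically equal data have the same limit. -/
theorem Assumptions.generalized_unique (A : Assumptions f g h pot γ) (hT : 0 < T) {P : ℝ → Hv p}
    (hP : MemLp P 2 (timeMeasure T)) {Φ₀ : Hd p} {Φ₁ : Hv p} {Φ Φ' : ℝ → Hd p} {V V' : ℝ → Hv p}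
    (hs : IsGeneralized p f g h γ T P Φ₀ Φ₁ Φ V) (hs' : IsGeneralized p f g h γ T P Φ₀ Φ₁ Φ' V') :
    EqOn Φ' Φ (Icc 0 T) ∧ EqOn V' V (Icc 0 T) := by
  obtain ⟨Φn, Vn, Pn, Φ₀n, Φ₁n, hPn, hsn, hPl, hun⟩ := hs.approx
  obtain ⟨Φm, Vm, Pm, Φ₀m, Φ₁m, hPm, hsm, hPl', hum⟩ := hs'.approx
  rw [← unifConv_iff] at hun hum
  obtain ⟨K, hK0, hK⟩ := exists_norm_bound hs.mem.cont
  obtain ⟨K', hK0', hK'⟩ := exists_norm_bound hs'.mem.cont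
  -- Both approximating sequences eventually lie within distance 1 of their limits, so this radius
  -- contains them.
  obtain ⟨M, hM0, hM⟩ := A.exists_comparison p hT (K := max K K' + 1) (by positivity)
  have hmem0 : (0 : ℝ) ∈ Icc 0 T := ⟨le_rfl, hT.le⟩
  have c1 := tendsto_integral_norm_of_L2 hT hP hPn hPl
  have c2 := tendsto_integral_norm_of_L2 hT hP hPm hPl'
  have i0 : Tendsto (fun n => ‖Φ₀n n - Φ₀m n‖) atTop (𝓝 0) := by
    have l1 := (hun.tendsto hmem0).1.sub (hum.tendsto hmem0).1
    rw [hs.mem.init, hs'.mem.init, sub_self] at l1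
    have := l1.norm
    rw [norm_zero] at this
    exact this.congr fun n => by rw [(hsn n).mem.init, (hsm n).mem.init]
  have i1 : Tendsto (fun n => ‖Φ₁n n - Φ₁m n‖) atTop (𝓝 0) := by
    have l1 := (hun.tendsto hmem0).2.sub (hum.tendsto hmem0).2
    rw [hs.mem.init_vel, hs'.mem.init_vel, sub_self] at l1
    have := l1.norm
    rw [norm_zero] at this
    exact this.congr fun n => by rw [(hsn n).mem.init_vel, (hsm n).mem.init_vel]
  have rhs : Tendsto (fun n => M * (‖Φ₀n n - Φ₀m n‖ + ‖Φ₁n n - Φ₁m n‖ +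
      ((∫ s in (0 : ℝ)..T, ‖Pn n s - P s‖) + ∫ s in (0 : ℝ)..T, ‖Pm n s - P s‖))) atTop (𝓝 0) := by
    have := (((i0.add i1).add (c1.add c2)).const_mul M)
    rwa [add_zero, add_zero, mul_zero] at this
  have key : ∀ t ∈ Icc 0 T, ‖Φ t - Φ' t‖ + ‖V t - V' t‖ ≤ 0 := fun t ht => by
    have lhs : Tendsto (fun n => ‖Φn n t - Φm n t‖ + ‖Vn n t - Vm n t‖) atTop
        (𝓝 (‖Φ t - Φ' t‖ + ‖V t - V' t‖)) :=
      ((hun.tendsto ht).1.sub (hum.tendsto ht).1).norm.add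
        ((hun.tendsto ht).2.sub (hum.tendsto ht).2).norm
    refine le_of_tendsto_of_tendsto lhs rhs ?_
    filter_upwards [hun.eventually_le hK, hum.eventually_le hK'] with n b1 b2
    refine (hM _ _ _ _ _ _ _ _ _ _ (hsn n) (hsm n) (hPn n) (hPm n)
      (fun t ht => (b1 t ht).trans (by gcongr; exact le_max_left _ _))
      (fun t ht => (b2 t ht).trans (by gcongr; exact le_max_right _ _)) t ht).trans ?_
    have j1 := ((intervalIntegrable_of_memLp hT (hPn n)).sub (intervalIntegrable_of_memLp hT hP)).norm
    have j2 := ((intervalIntegrable_of_memLp hT (hPm n)).sub (intervalIntegrable_of_memLp hT hP)).norm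
    have j3 := ((intervalIntegrable_of_memLp hT (hPn n)).sub
      (intervalIntegrable_of_memLp hT (hPm n))).norm
    have : ∫ s in (0 : ℝ)..T, ‖Pn n s - Pm n s‖ ≤
        (∫ s in (0 : ℝ)..T, ‖Pn n s - P s‖) + ∫ s in (0 : ℝ)..T, ‖Pm n s - P s‖ := by
      rw [← intervalIntegral.integral_add j1 j2]
      refine intervalIntegral.integral_mono_on hT.le j3 (j1.add j2) fun s _ => ?_
      have e : Pn n s - Pm n s = (Pn n s - P s) - (Pm n s - P s) := by abel
      rw [e]
      exact norm_sub_le _ _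
    gcongr
  refine ⟨fun t ht => ?_, fun t ht => ?_⟩
  · have := key t ht
    have h1 : ‖Φ t - Φ' t‖ = 0 :=
      le_antisymm (by linarith [norm_nonneg (V t - V' t)]) (norm_nonneg _)
    exact (sub_eq_zero.1 (norm_eq_zero.1 h1)).symm
  · have := key t ht
    have h1 : ‖V t - V' t‖ = 0 :=
      le_antisymm (by linarith [norm_nonneg (Φ t - Φ' t)]) (norm_nonneg _)
    exact (sub_eq_zero.1 (norm_eq_zero.1 h1)).symm

end Bresse

namespace Bresse

variable {p : Params}

/-! ### Uniform limits of curves -/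

section Limits

theorem exists_unif_limit {E : Type*} [NormedAddCommGroup E] [CompleteSpace E] {un : ℕ → ℝ → E} {s : Set ℝ} (hc : ∀ n, ContinuousOn (un n) s)
    {ε : ℕ → ℝ} (hε : Tendsto ε atTop (𝓝 0))
    (h : ∀ n m, ∀ t ∈ s, ‖un n t - un m t‖ ≤ ε n + ε m) :
    ∃ u : ℝ → E, ContinuousOn u s ∧ ∀ n, ∀ t ∈ s, ‖un n t - u t‖ ≤ ε n := by
  have hlim : ∀ t, ∃ l, t ∈ s → Tendsto (fun n => un n t) atTop (𝓝 l) := by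
    intro t
    by_cases ht : t ∈ s
    · have : CauchySeq fun n => un n t := by
        rw [Metric.cauchySeq_iff]
        intro r hr
        obtain ⟨N, hN⟩ := eventually_atTop.1 (hε.eventually (gt_mem_nhds (half_pos hr)))
        refine ⟨N, fun m hm n hn => ?_⟩
        rw [dist_eq_norm]
        linarith [h m n t ht, hN m hm, hN n hn]
      obtain ⟨l, hl⟩ := cauchySeq_tendsto_of_complete this
      exact ⟨l, fun _ => hl⟩
    · exact ⟨0, fun h => absurd h ht⟩
  choose u hu using hlim
  have hle : ∀ n, ∀ t ∈ s, ‖un n t - u t‖ ≤ ε n := fun n t ht => by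
    have l1 := (tendsto_const_nhds (x := un n t)).sub (hu t ht)
    have l2 := (tendsto_const_nhds (x := ε n)).add hε
    rw [add_zero] at l2
    exact le_of_tendsto_of_tendsto l1.norm l2 (Eventually.of_forall fun m => h n m t ht)
  refine ⟨u, ?_, hle⟩
  refine TendstoUniformlyOn.continuousOn (F := un) (p := atTop) ?_ (Frequently.of_forall hc)
  rw [Metric.tendstoUniformlyOn_iff]
  intro r hr
  filter_upwards [hε.eventually (gt_mem_nhds hr)] with n hn t ht
  rw [dist_comm, dist_eq_norm]
  exact (hle n t ht).trans_lt hn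

theorem eq_integral_of_tendsto {E : Type*} [NormedAddCommGroup E] [NormedSpace ℝ E] {T : ℝ} {un vn : ℕ → ℝ → E} {u v : ℝ → E} {ε : ℕ → ℝ}
    (hε : Tendsto ε atTop (𝓝 0)) (hvc : ∀ n, ContinuousOn (vn n) (Icc 0 T))
    (hv : ContinuousOn v (Icc 0 T)) (hu : ∀ t ∈ Icc 0 T, Tendsto (fun n => un n t) atTop (𝓝 (u t)))
    (hvn : ∀ n, ∀ t ∈ Icc 0 T, ‖vn n t - v t‖ ≤ ε n)
    (h : ∀ n, ∀ t ∈ Icc 0 T, un n t = un n 0 + ∫ s in (0 : ℝ)..t, vn n s) :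
    ∀ t ∈ Icc 0 T, u t = u 0 + ∫ s in (0 : ℝ)..t, v s := by
  intro t ht
  have hsub : uIcc 0 t ⊆ Icc 0 T := by rw [uIcc_of_le ht.1]; exact Icc_subset_Icc_right ht.2
  have hi : IntervalIntegrable v volume 0 t := (hv.mono hsub).intervalIntegrable
  have hin : ∀ n, IntervalIntegrable (vn n) volume 0 t := fun n =>
    ((hvc n).mono hsub).intervalIntegrable
  have l1 : Tendsto (fun n => ∫ s in (0 : ℝ)..t, vn n s) atTop (𝓝 (∫ s in (0 : ℝ)..t, v s)) := by
    rw [tendsto_iff_norm_sub_tendsto_zero]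
    have l2 : Tendsto (fun n => ε n * |t - 0|) atTop (𝓝 0) := by
      have := hε.mul_const |t - 0|
      rwa [zero_mul] at this
    refine squeeze_zero (fun _ => norm_nonneg _) (fun n => ?_) l2
    rw [← intervalIntegral.integral_sub (hin n) hi]
    refine intervalIntegral.norm_integral_le_of_norm_le_const fun s hs => hvn n s (hsub ?_)
    exact uIoc_subset_uIcc hs
  have l3 := (hu 0 ⟨le_rfl, ht.1.trans ht.2⟩).add l1
  exact tendsto_nhds_unique (hu t ht) (l3.congr fun n => (h n t ht).symm)

theorem tendsto_unique {E : Type*} [NormedAddCommGroup E] {u : ℕ → E} {a b : E}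
    (h : Tendsto u atTop (𝓝 a)) (h' : Tendsto u atTop (𝓝 b)) : a = b := tendsto_nhds_unique h h'

theorem tendsto_inv_succ : Tendsto (fun n : ℕ => 1 / ((n : ℝ) + 1)) atTop (𝓝 0) :=
  tendsto_one_div_add_atTop_nhds_zero_nat

end Limits

/-! ### Existence of generalized solutions -/

variable {f g h : Fin 2 → E3 → ℝ} {pot : Fin 2 → E3 → ℝ} {γ : ℝ → ℝ} {T : ℝ}

theorem continuous_toHv : Continuous (toHv : Hd p → Hv p) :=
  (toHvL p).continuous.congr fun Φ => toHvL_apply Φ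

theorem tendsto_of_norm_sub_lt {E : Type*} [NormedAddCommGroup E] {un : ℕ → E} {u : E}
    (h : ∀ n : ℕ, ‖un n - u‖ < 1 / ((n : ℝ) + 1)) :
    Tendsto (fun n => ‖un n - u‖) atTop (𝓝 0) :=
  squeeze_zero (fun _ => norm_nonneg _) (fun n => (h n).le) tendsto_inv_succ

theorem exists_upper_bound {u : ℕ → ℝ} {a : ℝ} (h : Tendsto u atTop (𝓝 a)) :
    ∃ C : ℝ, 0 ≤ C ∧ ∀ n, u n ≤ C := by
  obtain ⟨C, hC⟩ := h.bddAbove_range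
  exact ⟨max C 0, le_max_right _ _, fun n => (hC (mem_range_self n)).trans (le_max_left _ _)⟩

theorem integral_norm_sub_le {E : Type*} [NormedAddCommGroup E] (hT : 0 < T)
    {P Q R : ℝ → E} (hP : IntervalIntegrable P volume 0 T)
    (hQ : IntervalIntegrable Q volume 0 T) (hR : IntervalIntegrable R volume 0 T) :
    ∫ s in (0 : ℝ)..T, ‖P s - Q s‖ ≤
      (∫ s in (0 : ℝ)..T, ‖P s - R s‖) + ∫ s in (0 : ℝ)..T, ‖Q s - R s‖ := by
  have j1 := (hP.sub hR).norm
  have j2 := (hQ.sub hR).norm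
  rw [← intervalIntegral.integral_add j1 j2]
  refine intervalIntegral.integral_mono_on hT.le (hP.sub hQ).norm (j1.add j2) fun s _ => ?_
  have e : P s - Q s = (P s - R s) - (Q s - R s) := by abel
  rw [e]
  exact norm_sub_le _ _

theorem dissipation_nonneg_of_monotone (hm : Monotone γ) (h0 : γ 0 = 0) (V : ℝ → Hv p) {t : ℝ}
    (ht : 0 ≤ t) : 0 ≤ dissipation γ V t :=
  intervalIntegral.integral_nonneg ht fun _ _ => integral_nonneg fun _ =>
    mul_self_nonneg_of_monotone hm h0 _

/-- A common bound for strong solutions with bounded data. -/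
theorem Assumptions.exists_bound (A : Assumptions f g h pot γ) (p : Params) :
    ∃ M : ℝ, 0 ≤ M ∧ ∀ (T e I : ℝ) (P : ℝ → Hv p) (Φ₀ : Hd p) (Φ₁ : Hv p) (Φ : ℝ → Hd p)
      (V : ℝ → Hv p), 0 < T → MemLp P 2 (timeMeasure T) → IsStrong p f g h γ T P Φ₀ Φ₁ Φ V →
      |energy pot Φ₀ Φ₁| ≤ e → ∫ s in (0 : ℝ)..T, ‖P s‖ ≤ I →
      ∀ t ∈ Icc 0 T, ‖Φ t‖ ≤ M * (1 + e + I) ∧ ‖V t‖ ≤ M * (1 + e + I) := by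
  obtain ⟨M, hM0, hM⟩ := exists_apriori_bound p (continuous_pot A.hpot) A.below
  refine ⟨M, hM0, fun T e I P Φ₀ Φ₁ Φ V hT hP hs he hI => ?_⟩
  obtain ⟨_, _, hE⟩ := A.energy_strong hT hP hs
  refine hM T e I P Φ V hT (intervalIntegrable_of_memLp hT hP) hs.mem.cont hs.mem.cont_vel
    (fun t ht => ?_) ((abs_nonneg _).trans he) hI
  have h1 := hE t ht
  have h2 := dissipation_nonneg_of_monotone A.mono A.zero V ht.1
  linarith [le_abs_self (energy pot Φ₀ Φ₁)]

/-- Convergent data have bounded energies and loads, so all approximating strong solutions lie in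
one ball and share one comparison constant. The sequence is then uniformly Cauchy with the rate ε n
+ ε k. -/
theorem Assumptions.exists_generalized (A : Assumptions f g h pot γ) (hT : 0 < T) {P : ℝ → Hv p}
    (hP : MemLp P 2 (timeMeasure T)) (Φ₀ : Hd p) (Φ₁ : Hv p) :
    ∃ Φ V, IsGeneralized p f g h γ T P Φ₀ Φ₁ Φ V := by
  have hpos : ∀ n : ℕ, 0 < 1 / ((n : ℝ) + 1) := fun n => by positivity
  choose Φ₀n hdom hΦ₀n using fun n => dense_domain Φ₀ (hpos n)
  choose v₀ hv₀ using hdom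
  choose Φ₁n hΦ₁n using fun n => dense_toHv Φ₁ (hpos n)
  choose Pn hPc hPm hPn hPl using fun n => exists_regular_load hT hP (hpos n)
  choose m hmm hm using hPm
  choose Φn Vn hs using fun n => exists_isStrong A.hf A.hg A.hh A.hpot A.below A.cont A.mono A.zero
    hT (hPc n) (hmm n) (hm n) (hv₀ n) (Φ₁n n)
  have hPlim : Tendsto (fun n => eLpNorm (fun t => Pn n t - P t) 2 (timeMeasure T)) atTop (𝓝 0) := by
    have l := (ENNReal.continuous_ofReal.tendsto 0).comp tendsto_inv_succ
    rw [ENNReal.ofReal_zero] at l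
    exact tendsto_of_tendsto_of_tendsto_of_le_of_le tendsto_const_nhds l (fun _ => zero_le) hPl
  have c0 := tendsto_of_norm_sub_lt hΦ₀n
  have c1 := tendsto_of_norm_sub_lt hΦ₁n
  have c2 := tendsto_integral_norm_of_L2 hT hP hPn hPlim
  have hPi := intervalIntegrable_of_memLp hT hP
  have hPni := fun n => intervalIntegrable_of_memLp hT (hPn n)
  have d0 : Tendsto Φ₀n atTop (𝓝 Φ₀) := tendsto_iff_norm_sub_tendsto_zero.2 c0
  have d1 : Tendsto (fun n => toHv (Φ₁n n)) atTop (𝓝 Φ₁) := tendsto_iff_norm_sub_tendsto_zero.2 c1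
  obtain ⟨e, he0, he⟩ := exists_upper_bound (A.tendsto_energy d0 d1).abs
  obtain ⟨I, hI0, hI⟩ := exists_upper_bound c2
  obtain ⟨M, hM0, hM⟩ := A.exists_bound p
  set J := I + ∫ s in (0 : ℝ)..T, ‖P s‖ with hJ
  have hJ0 : 0 ≤ J := add_nonneg hI0 (intervalIntegral.integral_nonneg hT.le fun _ _ => norm_nonneg _)
  have hbd : ∀ n, ∀ t ∈ Icc 0 T, ‖Φn n t‖ ≤ M * (1 + e + J) := fun n t ht => by
    refine (hM T e J (Pn n) _ _ (Φn n) (Vn n) hT (hPn n) (hs n) (he n) ?_ t ht).1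
    rw [hJ]
    refine le_trans ?_ (add_le_add_left (hI n) _)
    have i1 := ((hPni n).sub hPi).norm
    rw [← intervalIntegral.integral_add i1 hPi.norm]
    refine intervalIntegral.integral_mono_on hT.le (hPni n).norm (i1.add hPi.norm) fun s _ => ?_
    have := norm_add_le (Pn n s - P s) (P s)
    rwa [sub_add_cancel] at this
  obtain ⟨N, hN0, hN⟩ := A.exists_comparison p hT (K := M * (1 + e + J)) (by positivity)
  set ε : ℕ → ℝ := fun n => N * (‖Φ₀n n - Φ₀‖ + ‖toHv (Φ₁n n) - Φ₁‖ +
    ∫ s in (0 : ℝ)..T, ‖Pn n s - P s‖) with hεdef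
  have hε : Tendsto ε atTop (𝓝 0) := by
    have := ((c0.add c1).add c2).const_mul N
    rwa [add_zero, add_zero, mul_zero] at this
  have hcmp : ∀ n k, ∀ t ∈ Icc 0 T, ‖Φn n t - Φn k t‖ + ‖Vn n t - Vn k t‖ ≤ ε n + ε k :=
    fun n k t ht => by
      refine (hN _ _ _ _ _ _ _ _ _ _ (hs n) (hs k) (hPn n) (hPn k) (hbd n) (hbd k) t ht).trans ?_
      rw [hεdef, ← mul_add]
      refine mul_le_mul_of_nonneg_left ?_ hN0.le
      have t0 := norm_sub_le_norm_sub_add_norm_sub (Φ₀n n) Φ₀ (Φ₀n k)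
      have t1 := norm_sub_le_norm_sub_add_norm_sub (toHv (Φ₁n n)) Φ₁ (toHv (Φ₁n k))
      rw [norm_sub_rev Φ₀] at t0
      rw [norm_sub_rev Φ₁] at t1
      linarith [integral_norm_sub_le hT (hPni n) (hPni k) hPi]
  obtain ⟨Φ, hΦc, hΦ⟩ := exists_unif_limit (fun n => (hs n).mem.cont) hε fun n k t ht => by
    linarith [hcmp n k t ht, norm_nonneg (Vn n t - Vn k t)]
  obtain ⟨V, hVc, hV⟩ := exists_unif_limit (fun n => (hs n).mem.cont_vel) hε fun n k t ht => by
    linarith [hcmp n k t ht, norm_nonneg (Φn n t - Φn k t)]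
  have lΦ : ∀ t ∈ Icc 0 T, Tendsto (fun n => Φn n t) atTop (𝓝 (Φ t)) := fun t ht =>
    tendsto_iff_norm_sub_tendsto_zero.2 (squeeze_zero (fun _ => norm_nonneg _)
      (fun n => hΦ n t ht) hε)
  have lV : ∀ t ∈ Icc 0 T, Tendsto (fun n => Vn n t) atTop (𝓝 (V t)) := fun t ht =>
    tendsto_iff_norm_sub_tendsto_zero.2 (squeeze_zero (fun _ => norm_nonneg _)
      (fun n => hV n t ht) hε)
  have hmem0 : (0 : ℝ) ∈ Icc 0 T := ⟨le_rfl, hT.le⟩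
  have hint := eq_integral_of_tendsto (un := fun n t => toHv (Φn n t)) (u := fun t => toHv (Φ t))
    hε (fun n => (hs n).mem.cont_vel) hVc
    (fun t ht => (continuous_toHv.tendsto (Φ t)).comp (lΦ t ht)) hV
    fun n t ht => by
      rw [(integral_vel (hs n).mem.cont_vel (hs n).mem.deriv le_rfl ht.1 ht.2).2]
      abel
  refine ⟨Φ, V, ⟨hΦc, hVc, hasDerivWithinAt_of_eq_integral hT.le hVc hint, ?_, ?_⟩, Φn, Vn, Pn,
    Φ₀n, fun n => toHv (Φ₁n n), hPn, hs, hPlim, unifConv_iff.1 fun r hr => ?_⟩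
  · exact tendsto_unique (lΦ 0 hmem0) (d0.congr fun n => ((hs n).mem.init).symm)
  · exact tendsto_unique (lV 0 hmem0) (d1.congr fun n => ((hs n).mem.init_vel).symm)
  · filter_upwards [hε.eventually (gt_mem_nhds (half_pos hr))] with n hn t ht
    linarith [hΦ n t ht, hV n t ht]

theorem normD_zero : normD (0 : Hd p) = 0 := by
  obtain ⟨c, hc, h⟩ := exists_normD_le p
  have := h 0
  rw [norm_zero, mul_zero] at this
  exact le_antisymm this (Real.sqrt_nonneg _)

theorem normV_zero : normV (0 : Hv p) = 0 := by
  obtain ⟨c, hc, h⟩ := exists_normV_le p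
  have := h 0
  rw [norm_zero, mul_zero] at this
  exact le_antisymm this (Real.sqrt_nonneg _)

theorem IsStrong.isGeneralized {P : ℝ → Hv p} {Φ₀ : Hd p} {Φ₁ : Hv p} {Φ : ℝ → Hd p}
    {V : ℝ → Hv p} (hs : IsStrong p f g h γ T P Φ₀ Φ₁ Φ V) (hP : MemLp P 2 (timeMeasure T)) :
    IsGeneralized p f g h γ T P Φ₀ Φ₁ Φ V := by
  refine ⟨hs.mem, fun _ => Φ, fun _ => V, fun _ => P, fun _ => Φ₀, fun _ => Φ₁, fun _ => hP,
    fun _ => hs, ?_, fun ε hε => Eventually.of_forall fun n t ht => ?_⟩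
  · have e : (fun t => P t - P t) = (0 : ℝ → Hv p) := funext fun t => sub_self _
    simp only [e, eLpNorm_zero]
    exact tendsto_const_nhds
  · rw [sub_self, sub_self, normD_zero, normV_zero, add_zero]
    exact hε

theorem IsStrong.congr {P : ℝ → Hv p} {Φ₀ : Hd p} {Φ₁ : Hv p} {Φ Φ' : ℝ → Hd p}
    {V V' : ℝ → Hv p} (hs : IsStrong p f g h γ T P Φ₀ Φ₁ Φ V) (h' : InSolClass T Φ₀ Φ₁ Φ' V')
    (hΦ : EqOn Φ' Φ (Icc 0 T)) (hV : EqOn V' V (Icc 0 T)) :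
    IsStrong p f g h γ T P Φ₀ Φ₁ Φ' V' := by
  obtain ⟨W, hW⟩ := hs.ac
  obtain ⟨Z, hZ, hae⟩ := hs.eqn
  refine ⟨h', ⟨W, fun a b ha hab hb => ?_⟩, Z, fun a b ha hab hb => ?_, ?_⟩
  · rw [hΦ ⟨ha.le, (hab.trans hb).le⟩, hΦ ⟨(ha.trans hab).le, hb.le⟩]
    exact hW a b ha hab hb
  · rw [hV ⟨ha.le, (hab.trans hb).le⟩, hV ⟨(ha.trans hab).le, hb.le⟩]
    exact hZ a b ha hab hb
  · filter_upwards [hae, ae_restrict_mem measurableSet_Ioo] with t h1 ht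
    rw [hΦ (Ioo_subset_Icc_self ht), hV (Ioo_subset_Icc_self ht)]
    exact h1

/-- A strong solution with these data exists, is generalized by the constant sequence, and equals
the given solution by uniqueness. -/
theorem Assumptions.strong_of_generalized (A : Assumptions f g h pot γ) (hT : 0 < T) {P : ℝ → Hv p}
    (hP : MemLp P 2 (timeMeasure T)) {Φ₀ : Hd p} {Φ₁ : Hv p} {Φ : ℝ → Hd p} {V : ℝ → Hv p}
    (hg : IsGeneralized p f g h γ T P Φ₀ Φ₁ Φ V) (h₀ : ∃ S, InDomA Φ₀ S)
    (h₁ : ∃ Φ₁' : Hd p, toHv Φ₁' = Φ₁) (hPt : ∃ (Pt : ℝ → Hv p) (P₀ : Hv p),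
      MemLp Pt 2 (timeMeasure T) ∧ HasTimeDeriv T P Pt P₀) :
    IsStrong p f g h γ T P Φ₀ Φ₁ Φ V := by
  obtain ⟨S, hS⟩ := h₀
  obtain ⟨Φ₁, rfl⟩ := h₁
  obtain ⟨Pt, P₀, hPt, hd⟩ := hPt
  obtain ⟨v₀, hv₀, -⟩ := hS.exists_weakA
  obtain ⟨Φ', V', hs⟩ := exists_isStrong_of_timeDeriv A.hf A.hg A.hh A.hpot A.below A.cont A.mono
    A.zero hT hPt hd hv₀ Φ₁
  obtain ⟨e1, e2⟩ := A.generalized_unique hT hP (hs.isGeneralized hP) hg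
  exact hs.congr hg.mem e1 e2

end Bresse

namespace Bresse

variable {p : Params}

/-! ### Sequential criteria for continuity and semicontinuity -/

section Sequential

variable {X Y : Type*} [PseudoMetricSpace X] [TopologicalSpace Y]

/-- Convergence in H_v yields pointwise convergence only along subsequences; this criterion, like
the next one, is adapted to that. -/
theorem continuous_of_subseq {F : X → Y} (h : ∀ (un : ℕ → X) (u : X), Tendsto un atTop (𝓝 u) →
    ∃ ns : ℕ → ℕ, Tendsto (fun k => F (un (ns k))) atTop (𝓝 (F u))) : Continuous F := by
  refine continuous_iff_seqContinuous.2 fun un u hu => ?_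
  refine tendsto_of_subseq_tendsto fun ns hns => ?_
  obtain ⟨ms, hms⟩ := h (fun k => un (ns k)) u (hu.comp hns)
  exact ⟨ms, hms⟩

theorem lowerSemicontinuous_of_subseq {G : X → ENNReal} (h : ∀ (un : ℕ → X) (u : X),
    Tendsto un atTop (𝓝 u) → ∃ ns : ℕ → ℕ, G u ≤ liminf (fun k => G (un (ns k))) atTop) :
    LowerSemicontinuous G := by
  refine lowerSemicontinuous_iff_isClosed_preimage.2 fun y => IsSeqClosed.isClosed ?_
  intro un u hun hu
  obtain ⟨ns, hns⟩ := h un u hu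
  refine hns.trans (liminf_le_of_le (by isBoundedDefault) fun b hb => ?_)
  obtain ⟨k, hk⟩ := hb.exists
  exact hk.trans (hun _)

theorem aemeasurable_comp_of_lowerSemicontinuous {G : X → ENNReal} (hG : LowerSemicontinuous G)
    {u : ℝ → X} {μ : Measure ℝ} (hu : AEStronglyMeasurable u μ) :
    AEMeasurable (fun t => G (u t)) μ := by
  borelize X
  exact hG.measurable.comp_aemeasurable hu.aemeasurable

theorem hasFDerivAt_of_quadratic {E F : Type*} [NormedAddCommGroup E] [NormedSpace ℝ E]
    [NormedAddCommGroup F] [NormedSpace ℝ F] {φ : E → F} {φ' : E →L[ℝ] F} {x : E} {C : ℝ}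
    (h : ∀ y, ‖φ y - φ x - φ' (y - x)‖ ≤ C * ‖y - x‖ ^ 2) : HasFDerivAt φ φ' x := by
  refine HasFDerivAt.of_isLittleO ?_
  have h1 : (fun y => φ y - φ x - φ' (y - x)) =O[𝓝 x] fun y => ‖y - x‖ ^ 2 :=
    Asymptotics.IsBigO.of_bound C (Eventually.of_forall fun y => by
      rw [Real.norm_eq_abs, abs_of_nonneg (sq_nonneg _)]; exact h y)
  refine h1.trans_isLittleO ?_
  have h2 : Tendsto (fun y : E => y - x) (𝓝 x) (𝓝 0) :=
    (continuous_sub_right x).tendsto' x 0 (sub_self x)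
  exact (Asymptotics.isLittleO_norm_pow_id one_lt_two).comp_tendsto h2

end Sequential

theorem Hv.integrable_norm_sq (b : Hv p) (j : Fin 2) :
    Integrable (fun x => ‖b j x‖ ^ 2) (p.vol j) :=
  (memLp_two_iff_integrable_sq_norm (Lp.memLp (b j)).1).1 (Lp.memLp (b j))

/-- Dominated convergence in `H_v`. -/
theorem Hv.tendsto_of_ae {un : ℕ → Hv p} {u b : Hv p} {c : ℝ}
    (hb : ∀ n j, ∀ᵐ x ∂(p.vol j), ‖un n j x - u j x‖ ≤ c * ‖b j x‖)
    (h : ∀ j, ∀ᵐ x ∂(p.vol j), Tendsto (fun n => un n j x) atTop (𝓝 (u j x))) :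
    Tendsto un atTop (𝓝 u) := by
  have h1 : ∀ j, Tendsto (fun n => ∫ x in Ioo (p.lo j) (p.hi j), ‖(un n - u) j x‖ ^ 2) atTop
      (𝓝 0) := by
    intro j
    have hz : (0 : ℝ) = ∫ x, (0 : ℝ) ∂(p.vol j) := by simp
    rw [hz]
    refine tendsto_integral_of_dominated_convergence (fun x => c ^ 2 * ‖b j x‖ ^ 2)
      (fun n => ((Lp.memLp ((un n - u) j)).1.norm.pow 2)) ((Hv.integrable_norm_sq b j).const_mul _)
      (fun n => ?_) ?_
    · filter_upwards [hb n j, Hv.sub_ae (un n) u j] with x h1 h2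
      rw [h2, Real.norm_eq_abs, abs_of_nonneg (sq_nonneg _), ← mul_pow]
      exact pow_le_pow_left₀ (norm_nonneg _) h1 2
    · filter_upwards [h j, ae_all_iff.2 fun n => Hv.sub_ae (un n) u j] with x h1 h2
      have h3 := (h1.sub_const (u j x)).norm.pow 2
      rw [sub_self, norm_zero, zero_pow two_ne_zero] at h3
      exact h3.congr fun n => by rw [h2 n]
  have h2 : Tendsto (fun n => ‖un n - u‖ ^ 2) atTop (𝓝 0) := by
    have := (h1 0).add (h1 1)
    rw [add_zero] at this
    exact this.congr fun n => by rw [Hv.norm_sq_eq, Fin.sum_univ_two]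
  refine tendsto_iff_norm_sub_tendsto_zero.2 ?_
  have h3 := h2.sqrt
  rw [Real.sqrt_zero] at h3
  exact h3.congr fun n => Real.sqrt_sq (norm_nonneg _)

theorem Hv.exists_subseq_ae_part {un : ℕ → Hv p} {u : Hv p} (h : Tendsto un atTop (𝓝 u))
    (j : Fin 2) : ∃ ns : ℕ → ℕ, StrictMono ns ∧
      ∀ᵐ x ∂(p.vol j), Tendsto (fun k => un (ns k) j x) atTop (𝓝 (u j x)) := by
  have hc : Continuous fun v : Hv p => v j := PiLp.continuous_apply 2 _ j
  exact (tendstoInMeasure_of_tendsto_Lp ((hc.tendsto u).comp h)).exists_seq_tendsto_ae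

theorem Hv.exists_subseq_ae {un : ℕ → Hv p} {u : Hv p} (h : Tendsto un atTop (𝓝 u)) :
    ∃ ns : ℕ → ℕ, StrictMono ns ∧
      ∀ j, ∀ᵐ x ∂(p.vol j), Tendsto (fun k => un (ns k) j x) atTop (𝓝 (u j x)) := by
  obtain ⟨n1, hn1, h1⟩ := Hv.exists_subseq_ae_part h 0
  obtain ⟨n2, hn2, h2⟩ := Hv.exists_subseq_ae_part (h.comp hn1.tendsto_atTop) 1
  refine ⟨fun k => n1 (n2 k), hn1.comp hn2, fun j => ?_⟩
  fin_cases j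
  · filter_upwards [h1] with x hx
    exact hx.comp hn2.tendsto_atTop
  · exact h2

/-! ### Superposition operators (u, b) ↦ κ(u)b -/

section Superposition

variable {κ : E3 → E3 →L[ℝ] E3} {C : ℝ}

theorem memLp_superpos (hκ : Continuous κ) (hC : ∀ v, ‖κ v‖ ≤ C) (u b : Hv p) (j : Fin 2) :
    MemLp (fun x => κ (u j x) (b j x)) 2 (p.vol j) := by
  refine MemLp.of_le_mul (c := C) (Lp.memLp (b j)) ?_ (Eventually.of_forall fun x => ?_)
  · have hc : Continuous fun z : E3 × E3 => κ z.1 z.2 :=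
      (hκ.comp continuous_fst).clm_apply continuous_snd
    exact hc.comp_aestronglyMeasurable ((Lp.memLp (u j)).1.prodMk (Lp.memLp (b j)).1)
  · exact (ContinuousLinearMap.le_opNorm _ _).trans
      (mul_le_mul_of_nonneg_right (hC _) (norm_nonneg _))

/-- The superposition operator `(u, b) ↦ κ(u) b`. -/
def superpos (hκ : Continuous κ) (hC : ∀ v, ‖κ v‖ ≤ C) (u b : Hv p) : Hv p :=
  mkHv (fun j x => κ (u j x) (b j x)) (memLp_superpos hκ hC u b)

theorem superpos_ae (hκ : Continuous κ) (hC : ∀ v, ‖κ v‖ ≤ C) (u b : Hv p) (j : Fin 2) :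
    ∀ᵐ x ∂(p.vol j), superpos hκ hC u b j x = κ (u j x) (b j x) :=
  mkHv_ae _ (memLp_superpos hκ hC u b) j

attribute [irreducible] superpos

theorem norm_superpos_le (hκ : Continuous κ) (hC : ∀ v, ‖κ v‖ ≤ C) (u b : Hv p) :
    ‖superpos hκ hC u b‖ ≤ C * ‖b‖ := by
  refine Hv.norm_le_of_ae ((κ 0).opNorm_nonneg.trans (hC 0)) fun j => ?_
  filter_upwards [superpos_ae hκ hC u b j] with x hx
  rw [hx]
  exact (ContinuousLinearMap.le_opNorm _ _).trans (mul_le_mul_of_nonneg_right (hC _) (norm_nonneg _))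

theorem superpos_sub (hκ : Continuous κ) (hC : ∀ v, ‖κ v‖ ≤ C) (u b b' : Hv p) :
    superpos hκ hC u (b - b') = superpos hκ hC u b - superpos hκ hC u b' := by
  refine Hv.ext_ae fun j => ?_
  filter_upwards [superpos_ae hκ hC u b j, superpos_ae hκ hC u b' j,
    superpos_ae hκ hC u (b - b') j, Hv.sub_ae b b' j,
    Hv.sub_ae (superpos hκ hC u b) (superpos hκ hC u b') j] with x h1 h2 h3 h4 h5
  rw [h3, h4, h5, h1, h2, map_sub]

/-- κ(u_n)(b_n − b) is small because κ is bounded, and κ(u_n)b converges to κ(u)b by dominated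
convergence along a subsequence. -/
theorem continuous_superpos (hκ : Continuous κ) (hC : ∀ v, ‖κ v‖ ≤ C) :
    Continuous fun z : Hv p × Hv p => superpos hκ hC z.1 z.2 := by
  refine continuous_of_subseq fun zn z hz => ?_
  have hu : Tendsto (fun n => (zn n).1) atTop (𝓝 z.1) := (continuous_fst.tendsto z).comp hz
  have hb : Tendsto (fun n => (zn n).2) atTop (𝓝 z.2) := (continuous_snd.tendsto z).comp hz
  obtain ⟨ns, hns, hae⟩ := Hv.exists_subseq_ae hu
  refine ⟨ns, ?_⟩
  have l1 : Tendsto (fun k => superpos hκ hC (zn (ns k)).1 z.2) atTop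
      (𝓝 (superpos hκ hC z.1 z.2)) := by
    refine Hv.tendsto_of_ae (b := z.2) (c := 2 * C) (fun n j => ?_) fun j => ?_
    · filter_upwards [superpos_ae hκ hC (zn (ns n)).1 z.2 j, superpos_ae hκ hC z.1 z.2 j]
        with x h1 h2
      rw [h1, h2]
      have e1 := (ContinuousLinearMap.le_opNorm (κ ((zn (ns n)).1 j x)) (z.2 j x)).trans
        (mul_le_mul_of_nonneg_right (hC _) (norm_nonneg _))
      have e2 := (ContinuousLinearMap.le_opNorm (κ (z.1 j x)) (z.2 j x)).trans
        (mul_le_mul_of_nonneg_right (hC _) (norm_nonneg _))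
      refine (norm_sub_le _ _).trans ?_
      linarith
    · filter_upwards [hae j, superpos_ae hκ hC z.1 z.2 j,
        ae_all_iff.2 fun k => superpos_ae hκ hC (zn (ns k)).1 z.2 j] with x h1 h2 h3
      rw [h2]
      have h4 : Continuous fun v => κ v (z.2 j x) := hκ.clm_apply continuous_const
      exact ((h4.tendsto _).comp h1).congr fun k => (h3 k).symm
  have l2 : Tendsto (fun k => superpos hκ hC (zn (ns k)).1 ((zn (ns k)).2 - z.2)) atTop (𝓝 0) := by
    have l3 := ((tendsto_iff_norm_sub_tendsto_zero.1 hb).comp hns.tendsto_atTop).const_mul C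
    rw [mul_zero] at l3
    exact squeeze_zero_norm (fun k => norm_superpos_le hκ hC _ _) l3
  have l4 := l2.add l1
  rw [zero_add] at l4
  refine l4.congr fun k => ?_
  rw [superpos_sub, sub_add_cancel]

end Superposition

/-! ### Integral functionals on the damped part -/

section Functionals

/-- Fatou's lemma along an almost everywhere convergent subsequence. Semicontinuity also supplies
the measurability in time of integrals that depend only on L² classes. -/
theorem lowerSemicontinuous_lintegral_part {ψ : E3 × E3 → ENNReal} (hψ : Continuous ψ) :
    LowerSemicontinuous fun z : Hv p × Hv p => ∫⁻ x, ψ (z.1 0 x, z.2 0 x) ∂(p.vol 0) := by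
  refine lowerSemicontinuous_of_subseq fun zn z hz => ?_
  have hu : Tendsto (fun n => (zn n).1) atTop (𝓝 z.1) := (continuous_fst.tendsto z).comp hz
  have hb : Tendsto (fun n => (zn n).2) atTop (𝓝 z.2) := (continuous_snd.tendsto z).comp hz
  obtain ⟨n1, hn1, h1⟩ := Hv.exists_subseq_ae_part hu 0
  obtain ⟨n2, hn2, h2⟩ := Hv.exists_subseq_ae_part (hb.comp hn1.tendsto_atTop) 0
  refine ⟨fun k => n1 (n2 k), ?_⟩
  refine le_trans (lintegral_mono_ae ?_) (lintegral_liminf_le' fun k => ?_)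
  · filter_upwards [h1, h2] with x e1 e2
    exact ((hψ.tendsto _).comp ((e1.comp hn2.tendsto_atTop).prodMk_nhds e2)).liminf_eq.ge
  · exact hψ.measurable.comp_aemeasurable
      (((Lp.memLp ((zn (n1 (n2 k))).1 0)).1.prodMk (Lp.memLp ((zn (n1 (n2 k))).2 0)).1).aemeasurable)

theorem tendsto_integral_part_of_bounded {ψ : E3 × E3 → ℝ} (hψ : Continuous ψ) {C : ℝ}
    (hC : ∀ z, |ψ z| ≤ C) {un : ℕ → Hv p} {u : Hv p} (hu : Tendsto un atTop (𝓝 u)) (b : Hv p) :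
    Tendsto (fun n => ∫ x, ψ (un n 0 x, b 0 x) ∂(p.vol 0)) atTop
      (𝓝 (∫ x, ψ (u 0 x, b 0 x) ∂(p.vol 0))) := by
  have hc : Continuous fun v : Hv p => ∫ x, ψ (v 0 x, b 0 x) ∂(p.vol 0) := by
    refine continuous_of_subseq fun vn v hv => ?_
    obtain ⟨ns, hns, hae⟩ := Hv.exists_subseq_ae_part hv 0
    refine ⟨ns, tendsto_integral_of_dominated_convergence (fun _ => C) (fun n => ?_)
      (integrable_const C) (fun n => Eventually.of_forall fun x => hC _) ?_⟩
    · exact hψ.comp_aestronglyMeasurable ((Lp.memLp (vn (ns n) 0)).1.prodMk (Lp.memLp (b 0)).1)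
    · filter_upwards [hae] with x hx
      exact (hψ.tendsto _).comp (hx.prodMk_nhds tendsto_const_nhds)
  exact (hc.tendsto u).comp hu

end Functionals

end Bresse

namespace Bresse

/-! ### The dissipation rate -/

variable {p : Params} {γ : ℝ → ℝ} {T : ℝ}

/-- The dissipation rate `(γ(v), v)` as an extended non-negative number. -/
def dissRate (γ : ℝ → ℝ) (V : Hv p) : ENNReal :=
  ∫⁻ x, ENNReal.ofReal (γ (V 0 x 1) * V 0 x 1) ∂(p.vol 0)

theorem continuous_shear : Continuous fun v : E3 => v 1 := PiLp.continuous_apply 2 _ 1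

theorem aestronglyMeasurable_shear (V : Hv p) : AEStronglyMeasurable (fun x => V 0 x 1) (p.vol 0) :=
  continuous_shear.comp_aestronglyMeasurable (Lp.memLp (V 0)).1

theorem aestronglyMeasurable_power (hγ : Continuous γ) (V B : Hv p) :
    AEStronglyMeasurable (fun x => γ (V 0 x 1) * B 0 x 1) (p.vol 0) :=
  (hγ.comp_aestronglyMeasurable (aestronglyMeasurable_shear V)).mul (aestronglyMeasurable_shear B)

theorem aemeasurable_lintegral_part {ψ : E3 × E3 → ENNReal} (hψ : Continuous ψ) {μ : Measure ℝ}
    {V B : ℝ → Hv p} (hV : AEStronglyMeasurable V μ) (hB : AEStronglyMeasurable B μ) :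
    AEMeasurable (fun t => ∫⁻ x, ψ (V t 0 x, B t 0 x) ∂(p.vol 0)) μ :=
  aemeasurable_comp_of_lowerSemicontinuous (lowerSemicontinuous_lintegral_part hψ) (hV.prodMk hB)

theorem continuous_power (hγ : Continuous γ) : Continuous fun z : E3 × E3 => γ (z.1 1) * z.2 1 :=
  (hγ.comp (continuous_shear.comp continuous_fst)).mul (continuous_shear.comp continuous_snd)

theorem lowerSemicontinuous_dissRate (hγ : Continuous γ) :
    LowerSemicontinuous (dissRate (p := p) γ) := by
  have h := lowerSemicontinuous_lintegral_part (p := p)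
    (ENNReal.continuous_ofReal.comp (continuous_power hγ))
  have hd : Continuous fun V : Hv p => (V, V) := continuous_id.prodMk continuous_id
  exact h.comp hd

theorem aemeasurable_dissRate (hγ : Continuous γ) {μ : Measure ℝ} {V : ℝ → Hv p}
    (hV : AEStronglyMeasurable V μ) : AEMeasurable (fun t => dissRate γ (V t)) μ :=
  aemeasurable_comp_of_lowerSemicontinuous (lowerSemicontinuous_dissRate hγ) hV

theorem le_liminf_of_lowerSemicontinuous {X : Type*} [TopologicalSpace X] {G : X → ENNReal}
    (hG : LowerSemicontinuous G) {un : ℕ → X} {u : X} (h : Tendsto un atTop (𝓝 u)) :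
    G u ≤ liminf (fun n => G (un n)) atTop := by
  refine le_of_forall_lt fun c hc => ?_
  obtain ⟨d, hcd, hd⟩ := exists_between hc
  exact hcd.trans_le (le_liminf_of_le (by isBoundedDefault)
    ((h.eventually (hG u d hd)).mono fun _ hn => hn.le))

theorem lintegral_dissRate_le_liminf (hγ : Continuous γ) {μ : Measure ℝ} {V : ℝ → Hv p}
    {Vn : ℕ → ℝ → Hv p} (hVn : ∀ n, AEStronglyMeasurable (Vn n) μ)
    (h : ∀ᵐ t ∂μ, Tendsto (fun n => Vn n t) atTop (𝓝 (V t))) :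
    ∫⁻ t, dissRate γ (V t) ∂μ ≤ liminf (fun n => ∫⁻ t, dissRate γ (Vn n t) ∂μ) atTop := by
  refine le_trans (lintegral_mono_ae ?_)
    (lintegral_liminf_le' fun n => aemeasurable_dissRate hγ (hVn n))
  filter_upwards [h] with t ht
  exact le_liminf_of_lowerSemicontinuous (lowerSemicontinuous_dissRate hγ) ht

theorem integrable_power_self (hγ : Continuous γ) (hm : Monotone γ) (h0 : γ 0 = 0) {V : Hv p} :
    (dissRate γ V < ⊤ ↔ Integrable (fun x => γ (V 0 x 1) * V 0 x 1) (p.vol 0)) ∧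
    ∫ x, γ (V 0 x 1) * V 0 x 1 ∂(p.vol 0) = (dissRate γ V).toReal := by
  have hn : 0 ≤ᵐ[p.vol 0] fun x => γ (V 0 x 1) * V 0 x 1 :=
    Eventually.of_forall fun x => mul_self_nonneg_of_monotone hm h0 _
  refine ⟨⟨fun h => ⟨aestronglyMeasurable_power hγ V V, ?_⟩, fun h => ?_⟩,
    integral_eq_lintegral_of_nonneg_ae hn (aestronglyMeasurable_power hγ V V)⟩
  · rwa [hasFiniteIntegral_iff_ofReal hn]
  · exact (hasFiniteIntegral_iff_ofReal hn).1 h.2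

theorem aestronglyMeasurable_timeMeasure {E : Type*} [NormedAddCommGroup E] {V : ℝ → E}
    (hV : ContinuousOn V (Icc 0 T)) : AEStronglyMeasurable V (timeMeasure T) :=
  (hV.mono Ioo_subset_Icc_self).aestronglyMeasurable measurableSet_Ioo

theorem timeMeasure_mono {s t : ℝ} (h : s ≤ t) : timeMeasure s ≤ timeMeasure t :=
  Measure.restrict_mono (Ioo_subset_Ioo_right h) le_rfl

/-- A divergent Bochner integral has the default value 0; finiteness of the total dissipation
excludes this for almost every time, so the real and the extended integrals agree. -/
theorem ofReal_dissipation (hγ : Continuous γ) (hm : Monotone γ) (h0 : γ 0 = 0)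
    {V : ℝ → Hv p} (hV : AEStronglyMeasurable V (timeMeasure T))
    (hfin : ∫⁻ t, dissRate γ (V t) ∂(timeMeasure T) < ⊤) {t : ℝ} (ht : t ∈ Icc 0 T) :
    ENNReal.ofReal (dissipation γ V t) = ∫⁻ s, dissRate γ (V s) ∂(timeMeasure t) := by
  have hmeas := timeMeasure_mono ht.2
  have hfin' : ∫⁻ s, dissRate γ (V s) ∂(timeMeasure t) < ⊤ :=
    (lintegral_mono' hmeas le_rfl).trans_lt hfin
  have ham := aemeasurable_dissRate hγ (hV.mono_measure hmeas)
  have e : dissipation γ V t = ∫ s, (dissRate γ (V s)).toReal ∂(timeMeasure t) := by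
    rw [dissipation, intervalIntegral_eq_timeMeasure ht.1]
    exact integral_congr_ae (Eventually.of_forall fun s => (integrable_power_self hγ hm h0).2)
  rw [e, integral_toReal ham (ae_lt_top' ham hfin'.ne), ENNReal.ofReal_toReal hfin'.ne]

theorem lintegral_dissRate_lt_top (hγ : Continuous γ) (hm : Monotone γ) (h0 : γ 0 = 0)
    (hT : 0 < T) {V : ℝ → Hv p}
    (hi : IntervalIntegrable (fun s => ∫ x in Ioo 0 p.L₀, γ (V s 0 x 1) * V s 0 x 1) volume 0 T)
    (hx : ∀ᵐ s ∂(timeMeasure T), Integrable (fun x => γ (V s 0 x 1) * V s 0 x 1) (p.vol 0)) :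
    ∫⁻ t, dissRate γ (V t) ∂(timeMeasure T) < ⊤ := by
  rw [intervalIntegrable_iff_integrableOn_Ioo_of_le hT.le] at hi
  have hn : 0 ≤ᵐ[timeMeasure T] fun s => ∫ x in Ioo 0 p.L₀, γ (V s 0 x 1) * V s 0 x 1 :=
    Eventually.of_forall fun s => integral_nonneg fun x => mul_self_nonneg_of_monotone hm h0 _
  refine lt_of_le_of_lt (lintegral_mono_ae ?_) ((hasFiniteIntegral_iff_ofReal hn).1 hi.2)
  filter_upwards [hx] with s hs
  have h1 := (integrable_power_self hγ hm h0 (V := V s)).1.2 hs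
  have h2 : ∫ x in Ioo 0 p.L₀, γ (V s 0 x 1) * V s 0 x 1 = (dissRate γ (V s)).toReal :=
    (integrable_power_self hγ hm h0).2
  rw [h2, ENNReal.ofReal_toReal h1.ne]

theorem dampingIntegrable_self (hm : Monotone γ) (h0 : γ 0 = 0) {V : ℝ → Hv p}
    (hfin : ∫⁻ t, dissRate γ (V t) ∂(timeMeasure T) < ⊤) : DampingIntegrable γ T V V := by
  refine lt_of_eq_of_lt (lintegral_congr fun t => lintegral_congr fun x => ?_) hfin
  exact Real.enorm_of_nonneg (mul_self_nonneg_of_monotone hm h0 _)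

/-! ### Pointwise bounds on γ by γ(s)s -/

section Pointwise

theorem abs_eq_mul_of_monotone (hm : Monotone γ) (h0 : γ 0 = 0) (s : ℝ) :
    |γ s| * |s| = γ s * s := by
  rw [← abs_mul, abs_of_nonneg (mul_self_nonneg_of_monotone hm h0 s)]

/-- By compactness for |s| ≤ 1, and by |γ(s)| ≤ |γ(s)||s| = γ(s)s beyond. Finite dissipation thus
makes γ(ψ_t) integrable without a growth condition. -/
theorem exists_abs_le_add (hγ : Continuous γ) (hm : Monotone γ) (h0 : γ 0 = 0) :
    ∃ c : ℝ, 0 ≤ c ∧ ∀ s, |γ s| ≤ c + γ s * s := by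
  obtain ⟨c, hc⟩ := (isCompact_Icc (a := (-1 : ℝ)) (b := 1)).exists_bound_of_continuousOn
    hγ.continuousOn
  have hc0 : 0 ≤ c := (norm_nonneg _).trans (hc 0 (by norm_num))
  refine ⟨c, hc0, fun s => ?_⟩
  have hn := mul_self_nonneg_of_monotone hm h0 s
  rcases le_total |s| 1 with h | h
  · have := hc s (abs_le.1 h)
    rw [Real.norm_eq_abs] at this
    linarith
  · have := abs_eq_mul_of_monotone hm h0 s
    nlinarith [abs_nonneg (γ s)]

theorem continuous_clip (K : ℝ) : Continuous (clip K) :=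
  continuous_const.max (continuous_id.min continuous_const)

/-- For |s| > K, monotonicity and γ(0) = 0 bound the difference by |γ(s)|, and |s|/K > 1. Hence the
part of γ lost by clipping is small uniformly over functions of bounded dissipation. -/
theorem abs_sub_clip_le (hm : Monotone γ) (h0 : γ 0 = 0) {K : ℝ} (hK : 0 < K) (s : ℝ) :
    |γ s - γ (clip K s)| ≤ γ s * s / K := by
  have hn := mul_self_nonneg_of_monotone hm h0 s
  rcases le_or_gt |s| K with h | h
  · rw [clip_eq h, sub_self, abs_zero]
    positivity
  · rw [le_div_iff₀ hK, ← abs_eq_mul_of_monotone hm h0]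
    refine mul_le_mul ?_ h.le hK.le (abs_nonneg _)
    rcases lt_abs.1 h with h' | h'
    · have e : clip K s = K := by rw [clip, min_eq_right h'.le, max_eq_right (by linarith)]
      rw [e]
      have a1 := hm h'.le
      have a2 := hm hK.le
      rw [h0] at a2
      rw [abs_of_nonneg (by linarith), abs_of_nonneg (by linarith)]
      linarith
    · have e : clip K s = -K := by rw [clip, min_eq_left (by linarith), max_eq_left (by linarith)]
      rw [e]
      have a1 := hm (show s ≤ -K by linarith)
      have a2 := hm (show -K ≤ 0 by linarith)
      rw [h0] at a2
      rw [abs_of_nonpos (by linarith), abs_of_nonpos (by linarith)]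
      linarith

theorem exists_abs_comp_clip_le (hγ : Continuous γ) {K : ℝ} (hK : 0 ≤ K) :
    ∃ c : ℝ, 0 ≤ c ∧ ∀ s, |γ (clip K s)| ≤ c := by
  obtain ⟨c, hc⟩ := (isCompact_Icc (a := -K) (b := K)).exists_bound_of_continuousOn hγ.continuousOn
  exact ⟨c, (norm_nonneg _).trans (hc 0 ⟨by linarith, hK⟩), fun s =>
    hc _ (abs_le.1 (abs_clip_le hK s))⟩

end Pointwise

theorem lintegral_abs_damping_lt_top (hγ : Continuous γ) (hm : Monotone γ) (h0 : γ 0 = 0)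
    {V : ℝ → Hv p} (hfin : ∫⁻ t, dissRate γ (V t) ∂(timeMeasure T) < ⊤) :
    ∫⁻ t in Ioo 0 T, ∫⁻ x in Ioo 0 p.L₀, ‖γ (V t 0 x 1)‖ₑ < ⊤ := by
  obtain ⟨c, hc0, hc⟩ := exists_abs_le_add hγ hm h0
  have h1 : ∀ t, ∫⁻ x in Ioo 0 p.L₀, ‖γ (V t 0 x 1)‖ₑ ≤
      ENNReal.ofReal c * p.vol 0 univ + dissRate γ (V t) := fun t => by
    have e : ENNReal.ofReal c * p.vol 0 univ = ∫⁻ x, ENNReal.ofReal c ∂(p.vol 0) := by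
      rw [lintegral_const]
    rw [e, dissRate, ← lintegral_add_left measurable_const]
    refine lintegral_mono fun x => ?_
    rw [← ENNReal.ofReal_add hc0 (mul_self_nonneg_of_monotone hm h0 _), Real.enorm_eq_ofReal_abs]
    exact ENNReal.ofReal_le_ofReal (hc _)
  refine (lintegral_mono h1).trans_lt ?_
  rw [lintegral_add_left measurable_const, lintegral_const]
  refine ENNReal.add_lt_top.2 ⟨ENNReal.mul_lt_top (ENNReal.mul_lt_top ENNReal.ofReal_lt_top
    (measure_lt_top _ _)) (measure_lt_top (timeMeasure T) _), hfin⟩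

/-! ### The damping paired with a test function -/

section Pairing

/-- The pairing `(γ(v), b)` on the damped part. -/
def pairing (γ : ℝ → ℝ) (V B : Hv p) : ℝ := ∫ x, γ (V 0 x 1) * B 0 x 1 ∂(p.vol 0)

/-- The positive and negative parts have lower integrals that are lower semicontinuous in the pair
(V, B), hence measurable in time. -/
theorem aestronglyMeasurable_pairing (hγ : Continuous γ) {μ : Measure ℝ} {V B : ℝ → Hv p}
    (hV : AEStronglyMeasurable V μ) (hB : AEStronglyMeasurable B μ)
    (hi : ∀ᵐ t ∂μ, Integrable (fun x => γ (V t 0 x 1) * B t 0 x 1) (p.vol 0)) :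
    AEStronglyMeasurable (fun t => pairing γ (V t) (B t)) μ := by
  have h1 := aemeasurable_lintegral_part (ENNReal.continuous_ofReal.comp (continuous_power hγ)) hV hB
  have h2 := aemeasurable_lintegral_part (ENNReal.continuous_ofReal.comp (continuous_power hγ).neg)
    hV hB
  refine ((h1.ennreal_toReal.sub h2.ennreal_toReal).aestronglyMeasurable).congr ?_
  filter_upwards [hi] with t ht
  exact (integral_eq_lintegral_pos_part_sub_lintegral_neg_part ht).symm

theorem integrable_power_of_lintegral (hγ : Continuous γ) {V B : Hv p}
    (h : ∫⁻ x, ‖γ (V 0 x 1) * B 0 x 1‖ₑ ∂(p.vol 0) < ⊤) :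
    Integrable (fun x => γ (V 0 x 1) * B 0 x 1) (p.vol 0) :=
  ⟨aestronglyMeasurable_power hγ V B, h⟩

theorem norm_pairing_le (V B : Hv p) :
    ‖pairing γ V B‖ ≤ (∫⁻ x, ‖γ (V 0 x 1) * B 0 x 1‖ₑ ∂(p.vol 0)).toReal :=
  norm_integral_le_lintegral_norm _ |>.trans_eq (by
    congr 1; exact lintegral_congr fun x => ofReal_norm _)

variable {c β : ℝ}

theorem integrable_power_of_bound (hγ : Continuous γ) (hm : Monotone γ) (h0 : γ 0 = 0) {V B : Hv p}
    (hi : dissRate γ V < ⊤) (hβ : ∀ᵐ x ∂(p.vol 0), |B 0 x 1| ≤ β)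
    (hc : ∀ s, |γ s| ≤ c + γ s * s) :
    Integrable (fun x => γ (V 0 x 1) * B 0 x 1) (p.vol 0) ∧
      |pairing γ V B| ≤ β * (c * (p.vol 0).real univ + (dissRate γ V).toReal) := by
  obtain ⟨h1, h2⟩ := integrable_power_self hγ hm h0 (V := V)
  have h3 := h1.1 hi
  have hb : ∀ᵐ x ∂(p.vol 0), ‖γ (V 0 x 1) * B 0 x 1‖ ≤ β * (c + γ (V 0 x 1) * V 0 x 1) := by
    filter_upwards [hβ] with x hx
    rw [norm_mul, mul_comm]
    exact mul_le_mul hx (hc _) (norm_nonneg _) ((abs_nonneg _).trans hx)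
  have h4 : Integrable (fun x => β * (c + γ (V 0 x 1) * V 0 x 1)) (p.vol 0) :=
    ((integrable_const c).add h3).const_mul β
  refine ⟨h4.mono' (aestronglyMeasurable_power hγ V B) hb, ?_⟩
  refine (norm_integral_le_of_norm_le h4 hb).trans_eq ?_
  rw [integral_const_mul, integral_add (integrable_const c) h3, h2, integral_const, smul_eq_mul,
    mul_comm c]

theorem abs_pairing_sub_clip_le (hγ : Continuous γ) (hm : Monotone γ) (h0 : γ 0 = 0) {V B : Hv p}
    (hi : dissRate γ V < ⊤) (hβ : ∀ᵐ x ∂(p.vol 0), |B 0 x 1| ≤ β) {K : ℝ} (hK : 0 < K)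
    (hi1 : Integrable (fun x => γ (V 0 x 1) * B 0 x 1) (p.vol 0))
    (hi2 : Integrable (fun x => γ (clip K (V 0 x 1)) * B 0 x 1) (p.vol 0)) :
    |pairing γ V B - pairing (fun s => γ (clip K s)) V B| ≤ β / K * (dissRate γ V).toReal := by
  obtain ⟨h1, h2⟩ := integrable_power_self hγ hm h0 (V := V)
  rw [pairing, pairing, ← integral_sub hi1 hi2, ← h2, ← integral_const_mul, ← Real.norm_eq_abs]
  refine norm_integral_le_of_norm_le ((h1.1 hi).const_mul _) ?_
  filter_upwards [hβ] with x hx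
  rw [← sub_mul, norm_mul, Real.norm_eq_abs, Real.norm_eq_abs, mul_comm]
  calc _ ≤ β * (γ (V 0 x 1) * V 0 x 1 / K) :=
        mul_le_mul hx (abs_sub_clip_le hm h0 hK _) (abs_nonneg _) ((abs_nonneg _).trans hx)
    _ = _ := by ring

theorem integrable_power_clip (hγ : Continuous γ) {K : ℝ} (hc : ∀ s, |γ (clip K s)| ≤ c)
    {V B : Hv p} (hβ : ∀ᵐ x ∂(p.vol 0), |B 0 x 1| ≤ β) :
    Integrable (fun x => γ (clip K (V 0 x 1)) * B 0 x 1) (p.vol 0) ∧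
      |pairing (fun s => γ (clip K s)) V B| ≤ c * β * (p.vol 0).real univ := by
  have hb : ∀ᵐ x ∂(p.vol 0), ‖γ (clip K (V 0 x 1)) * B 0 x 1‖ ≤ c * β := by
    filter_upwards [hβ] with x hx
    rw [norm_mul]
    exact mul_le_mul (hc _) hx (abs_nonneg _) ((abs_nonneg _).trans (hc 0))
  refine ⟨(integrable_const (c * β)).mono'
    (aestronglyMeasurable_power (hγ.comp (continuous_clip K)) V B) hb, ?_⟩
  exact norm_integral_le_of_norm_le_const hb

theorem tendsto_pairing_clip (hγ : Continuous γ) {K : ℝ} (hc : ∀ s, |γ (clip K s)| ≤ c)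
    {B : Hv p} (hβ0 : 0 ≤ β) (hβ : ∀ᵐ x ∂(p.vol 0), |B 0 x 1| ≤ β) {Vn : ℕ → Hv p} {V : Hv p}
    (h : Tendsto Vn atTop (𝓝 V)) : Tendsto (fun n => pairing (fun s => γ (clip K s)) (Vn n) B) atTop
      (𝓝 (pairing (fun s => γ (clip K s)) V B)) := by
  have hψ : Continuous fun z : E3 × E3 => γ (clip K (z.1 1)) * clip β (z.2 1) :=
    ((hγ.comp (continuous_clip K)).comp (continuous_shear.comp continuous_fst)).mul
      ((continuous_clip β).comp (continuous_shear.comp continuous_snd))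
  have hb : ∀ z : E3 × E3, |γ (clip K (z.1 1)) * clip β (z.2 1)| ≤ c * β := fun z => by
    rw [abs_mul]
    exact mul_le_mul (hc _) (abs_clip_le hβ0 _) (abs_nonneg _) ((abs_nonneg _).trans (hc 0))
  have e : ∀ W : Hv p, ∫ x, γ (clip K (W 0 x 1)) * clip β (B 0 x 1) ∂(p.vol 0) =
      pairing (fun s => γ (clip K s)) W B := fun W => by
    refine integral_congr_ae ?_
    filter_upwards [hβ] with x hx
    rw [clip_eq hx]
  have := tendsto_integral_part_of_bounded hψ hb h B
  simp only [e] at this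
  exact this

end Pairing

end Bresse

namespace Bresse

/-! ### Limits of work, damping and energy -/

variable {p : Params} {γ : ℝ → ℝ} {T : ℝ}

theorem UnifConv.exists_rate (hT : 0 < T) {Φn : ℕ → ℝ → Hd p} {Vn : ℕ → ℝ → Hv p} {Φ : ℝ → Hd p}
    {V : ℝ → Hv p} (h : UnifConv T Φn Vn Φ V) (hΦn : ∀ n, ContinuousOn (Φn n) (Icc 0 T))
    (hVn : ∀ n, ContinuousOn (Vn n) (Icc 0 T)) (hΦ : ContinuousOn Φ (Icc 0 T))
    (hV : ContinuousOn V (Icc 0 T)) : ∃ ε : ℕ → ℝ, Tendsto ε atTop (𝓝 0) ∧ (∀ n, 0 ≤ ε n) ∧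
      ∀ n, ∀ t ∈ Icc 0 T, ‖Φn n t - Φ t‖ ≤ ε n ∧ ‖Vn n t - V t‖ ≤ ε n := by
  have hc : ∀ n, ContinuousOn (fun t => ‖Φn n t - Φ t‖ + ‖Vn n t - V t‖) (Icc 0 T) := fun n =>
    ((hΦn n).sub hΦ).norm.add ((hVn n).sub hV).norm
  choose τ hτ hmax using fun n => isCompact_Icc.exists_isMaxOn (nonempty_Icc.2 hT.le) (hc n)
  have hpos : ∀ n t, 0 ≤ ‖Φn n t - Φ t‖ + ‖Vn n t - V t‖ := fun n t =>
    add_nonneg (norm_nonneg _) (norm_nonneg _)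
  refine ⟨fun n => ‖Φn n (τ n) - Φ (τ n)‖ + ‖Vn n (τ n) - V (τ n)‖, ?_, fun n => hpos n _,
    fun n t ht => ?_⟩
  · rw [Metric.tendsto_atTop]
    intro r hr
    obtain ⟨N, hN⟩ := eventually_atTop.1 (h r hr)
    refine ⟨N, fun n hn => ?_⟩
    rw [Real.dist_eq, sub_zero, abs_of_nonneg (hpos n _)]
    exact hN n hn _ (hτ n)
  · have := hmax n ht
    simp only [mem_ofPred_eq] at this
    exact ⟨by linarith [norm_nonneg (Vn n t - V t)], by linarith [norm_nonneg (Φn n t - Φ t)]⟩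

theorem exists_bound_of_rate {E : Type*} [NormedAddCommGroup E] {vn : ℕ → ℝ → E} {v : ℝ → E}
    (hv : ContinuousOn v (Icc 0 T)) {ε : ℕ → ℝ} (hε : Tendsto ε atTop (𝓝 0))
    (h : ∀ n, ∀ t ∈ Icc 0 T, ‖vn n t - v t‖ ≤ ε n) :
    ∃ M : ℝ, 0 ≤ M ∧ ∀ n, ∀ t ∈ Icc 0 T, ‖vn n t‖ ≤ M := by
  obtain ⟨M, hM⟩ := isCompact_Icc.exists_bound_of_continuousOn hv
  obtain ⟨e, he0, he⟩ := exists_upper_bound hε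
  refine ⟨max M 0 + e, by positivity, fun n t ht => ?_⟩
  have h1 := norm_le_norm_add_norm_sub (v t) (vn n t)
  rw [norm_sub_rev] at h1
  linarith [h n t ht, he n, hM t ht, le_max_left M 0]

theorem tendsto_integral_of_norm_sub_le {un : ℕ → ℝ → ℝ} {u : ℝ → ℝ} {m : ℕ → ℝ → ℝ} {t : ℝ}
    (ht : t ∈ Icc 0 T) (hun : ∀ n, IntervalIntegrable (un n) volume 0 T)
    (hu : IntervalIntegrable u volume 0 T) (hm : ∀ n, IntervalIntegrable (m n) volume 0 T)
    (h : ∀ n, ∀ᵐ s ∂(timeMeasure T), |un n s - u s| ≤ m n s)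
    (hl : Tendsto (fun n => ∫ s in (0 : ℝ)..T, m n s) atTop (𝓝 0)) :
    Tendsto (fun n => ∫ s in (0 : ℝ)..t, un n s) atTop (𝓝 (∫ s in (0 : ℝ)..t, u s)) := by
  have hT := ht.1.trans ht.2
  have hsub : ∀ {w : ℝ → ℝ}, IntervalIntegrable w volume 0 T → IntervalIntegrable w volume 0 t :=
    fun hw => hw.mono_set (by
      rw [uIcc_of_le ht.1, uIcc_of_le hT]; exact Icc_subset_Icc_right ht.2)
  rw [tendsto_iff_norm_sub_tendsto_zero]
  refine squeeze_zero (fun _ => norm_nonneg _) (fun n => ?_) hl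
  rw [← intervalIntegral.integral_sub (hsub (hun n)) (hsub hu),
    intervalIntegral_eq_timeMeasure ht.1, intervalIntegral_eq_timeMeasure hT]
  have hmi : Integrable (m n) (timeMeasure T) :=
    (intervalIntegrable_iff_integrableOn_Ioo_of_le hT).1 (hm n)
  have hle := timeMeasure_mono ht.2
  have h' : ∀ᵐ s ∂(timeMeasure t), ‖un n s - u s‖ ≤ m n s := ae_mono hle (h n)
  refine (norm_integral_le_of_norm_le (hmi.mono_measure hle) h').trans ?_
  refine integral_mono_measure hle ?_ hmi
  filter_upwards [h n] with s hs
  exact (abs_nonneg _).trans hs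

theorem tendsto_work (hT : 0 < T) {Pn : ℕ → ℝ → Hv p} {P : ℝ → Hv p} {Vn : ℕ → ℝ → Hv p}
    {V : ℝ → Hv p} (hP : MemLp P 2 (timeMeasure T)) (hPn : ∀ n, MemLp (Pn n) 2 (timeMeasure T))
    (hl : Tendsto (fun n => eLpNorm (fun t => Pn n t - P t) 2 (timeMeasure T)) atTop (𝓝 0))
    (hVn : ∀ n, ContinuousOn (Vn n) (Icc 0 T)) (hV : ContinuousOn V (Icc 0 T)) {ε : ℕ → ℝ}
    (hε : Tendsto ε atTop (𝓝 0)) (h : ∀ n, ∀ t ∈ Icc 0 T, ‖Vn n t - V t‖ ≤ ε n) {t : ℝ}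
    (ht : t ∈ Icc 0 T) : Tendsto (fun n => work (Pn n) (Vn n) t) atTop (𝓝 (work P V t)) := by
  obtain ⟨M, hM0, hM⟩ := exists_bound_of_rate hV hε h
  have hPi := intervalIntegrable_of_memLp hT hP
  have hPni := fun n => intervalIntegrable_of_memLp hT (hPn n)
  simp only [work, ip_eq_inner]
  refine tendsto_integral_of_norm_sub_le (m := fun n s => M * ‖Pn n s - P s‖ + ε n * ‖P s‖) ht
    (fun n => intervalIntegrable_inner hT.le (hPni n) (hVn n))
    (intervalIntegrable_inner hT.le hPi hV)
    (fun n => (((hPni n).sub hPi).norm.const_mul M).add (hPi.norm.const_mul _)) (fun n => ?_) ?_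
  · filter_upwards [ae_restrict_mem measurableSet_Ioo] with s hs
    have hs' := Ioo_subset_Icc_self hs
    have e : inner ℝ (Pn n s) (Vn n s) - inner ℝ (P s) (V s) =
        inner ℝ (Pn n s - P s) (Vn n s) + inner ℝ (P s) (Vn n s - V s) := by
      rw [inner_sub_left, inner_sub_right]; ring
    rw [e]
    refine (abs_add_le _ _).trans (add_le_add ?_ ?_)
    · rw [mul_comm]
      exact (abs_real_inner_le_norm _ _).trans
        (mul_le_mul_of_nonneg_left (hM n s hs') (norm_nonneg _))
    · rw [mul_comm]
      exact (abs_real_inner_le_norm _ _).trans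
        (mul_le_mul_of_nonneg_left (h n s hs') (norm_nonneg _))
  · have l := ((tendsto_integral_norm_of_L2 hT hP hPn hl).const_mul M).add
      (hε.mul_const (∫ s in (0 : ℝ)..T, ‖P s‖))
    rw [mul_zero, zero_mul, add_zero] at l
    refine l.congr fun n => ?_
    rw [intervalIntegral.integral_add (((hPni n).sub hPi).norm.const_mul M) (hPi.norm.const_mul _),
      intervalIntegral.integral_const_mul, intervalIntegral.integral_const_mul]

/-- If the dissipation rates have bounded integrals, the damping terms converge when tested with
functions whose shear component is bounded. -/
theorem tendsto_integral_pairing (hγ : Continuous γ) (hm : Monotone γ) (h0 : γ 0 = 0)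
    {Vn : ℕ → ℝ → Hv p} {V B : ℝ → Hv p} (hVn : ∀ n, ContinuousOn (Vn n) (Icc 0 T))
    (hV : ContinuousOn V (Icc 0 T)) (hB : AEStronglyMeasurable B (timeMeasure T)) {β E : ℝ}
    (hβ0 : 0 ≤ β) (hE0 : 0 ≤ E)
    (hβ : ∀ᵐ t ∂(timeMeasure T), ∀ᵐ x ∂(p.vol 0), |B t 0 x 1| ≤ β)
    (hl : ∀ t ∈ Icc 0 T, Tendsto (fun n => Vn n t) atTop (𝓝 (V t)))
    (hE : ∀ n, ∫⁻ t, dissRate γ (Vn n t) ∂(timeMeasure T) ≤ ENNReal.ofReal E) :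
    (∀ n, Integrable (fun t => pairing γ (Vn n t) (B t)) (timeMeasure T)) ∧
    Integrable (fun t => pairing γ (V t) (B t)) (timeMeasure T) ∧
    Tendsto (fun n => ∫ t, pairing γ (Vn n t) (B t) ∂(timeMeasure T)) atTop
      (𝓝 (∫ t, pairing γ (V t) (B t) ∂(timeMeasure T))) := by
  obtain ⟨c, hc0, hc⟩ := exists_abs_le_add hγ hm h0
  have hVm := aestronglyMeasurable_timeMeasure hV
  have hVnm := fun n => aestronglyMeasurable_timeMeasure (hVn n)
  have hl' : ∀ᵐ t ∂(timeMeasure T), Tendsto (fun n => Vn n t) atTop (𝓝 (V t)) := by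
    filter_upwards [ae_restrict_mem measurableSet_Ioo] with t ht using hl t (Ioo_subset_Icc_self ht)
  have hEV : ∫⁻ t, dissRate γ (V t) ∂(timeMeasure T) ≤ ENNReal.ofReal E :=
    (lintegral_dissRate_le_liminf hγ hVnm hl').trans
      (liminf_le_of_le (by isBoundedDefault) fun b hb => by
        obtain ⟨k, hk⟩ := hb.exists
        exact hk.trans (hE _))
  -- Used for the sequence and for its limit alike: replacing γ by its clipped version changes the
  -- damping term by at most βE/K.
  have key : ∀ U : ℝ → Hv p, AEStronglyMeasurable U (timeMeasure T) →
      ∫⁻ t, dissRate γ (U t) ∂(timeMeasure T) ≤ ENNReal.ofReal E →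
      Integrable (fun t => pairing γ (U t) (B t)) (timeMeasure T) ∧
      ∀ K : ℝ, 0 < K → Integrable (fun t => pairing (fun s => γ (clip K s)) (U t) (B t))
        (timeMeasure T) ∧ |(∫ t, pairing γ (U t) (B t) ∂(timeMeasure T)) -
          ∫ t, pairing (fun s => γ (clip K s)) (U t) (B t) ∂(timeMeasure T)| ≤ β / K * E := by
    intro U hU hUE
    have ham := aemeasurable_dissRate hγ hU
    have hfin : ∫⁻ t, dissRate γ (U t) ∂(timeMeasure T) < ⊤ := hUE.trans_lt ENNReal.ofReal_lt_top
    have hlt := ae_lt_top' ham hfin.ne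
    have hdi : Integrable (fun t => (dissRate γ (U t)).toReal) (timeMeasure T) :=
      integrable_toReal_of_lintegral_ne_top ham hfin.ne
    have hdE : ∫ t, (dissRate γ (U t)).toReal ∂(timeMeasure T) ≤ E := by
      rw [integral_toReal ham hlt]
      exact ENNReal.toReal_le_of_le_ofReal hE0 hUE
    have hpb : ∀ᵐ t ∂(timeMeasure T), Integrable (fun x => γ (U t 0 x 1) * B t 0 x 1) (p.vol 0) ∧
        |pairing γ (U t) (B t)| ≤ β * (c * (p.vol 0).real univ + (dissRate γ (U t)).toReal) := by
      filter_upwards [hlt, hβ] with t h1 h2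
      exact integrable_power_of_bound hγ hm h0 h1 h2 hc
    have hint : Integrable (fun t => pairing γ (U t) (B t)) (timeMeasure T) := by
      have hbi : Integrable (fun t => β * (c * (p.vol 0).real univ + (dissRate γ (U t)).toReal))
          (timeMeasure T) := ((integrable_const _).add hdi).const_mul β
      exact hbi.mono' (aestronglyMeasurable_pairing hγ hU hB (hpb.mono fun _ h => h.1))
        (hpb.mono fun _ h => h.2)
    refine ⟨hint, fun K hK => ?_⟩
    obtain ⟨d, hd0, hd⟩ := exists_abs_comp_clip_le hγ hK.le
    have hkb : ∀ᵐ t ∂(timeMeasure T),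
        Integrable (fun x => γ (clip K (U t 0 x 1)) * B t 0 x 1) (p.vol 0) ∧
        |pairing (fun s => γ (clip K s)) (U t) (B t)| ≤ d * β * (p.vol 0).real univ := by
      filter_upwards [hβ] with t h2
      exact integrable_power_clip hγ hd h2
    have hki : Integrable (fun t => pairing (fun s => γ (clip K s)) (U t) (B t)) (timeMeasure T) :=
      (integrable_const _).mono' (aestronglyMeasurable_pairing (γ := fun s => γ (clip K s))
        (hγ.comp (continuous_clip K)) hU hB (hkb.mono fun _ h => h.1)) (hkb.mono fun _ h => h.2)
    refine ⟨hki, ?_⟩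
    rw [← integral_sub hint hki, ← Real.norm_eq_abs]
    refine (norm_integral_le_of_norm_le (hdi.const_mul (β / K)) ?_).trans ?_
    · filter_upwards [hlt, hβ, hpb, hkb] with t h1 h2 h3 h4
      exact abs_pairing_sub_clip_le hγ hm h0 h1 h2 hK h3.1 h4.1
    · rw [integral_const_mul]
      exact mul_le_mul_of_nonneg_left hdE (by positivity)
  refine ⟨fun n => (key _ (hVnm n) (hE n)).1, (key V hVm hEV).1, ?_⟩
  rw [Metric.tendsto_atTop]
  intro r hr
  -- This makes βE/K less than r/3, and the summand 1 keeps K positive when βE = 0.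
  set K : ℝ := 3 * (β * E + 1) / r with hKdef
  have hK : 0 < K := by positivity
  have hKr : β / K * E < r / 3 := by
    rw [hKdef, div_div_eq_mul_div, div_mul_eq_mul_div, div_lt_iff₀ (by positivity)]
    nlinarith [mul_nonneg hβ0 hE0]
  obtain ⟨d, hd0, hd⟩ := exists_abs_comp_clip_le hγ hK.le
  have hconv : Tendsto (fun n => ∫ t, pairing (fun s => γ (clip K s)) (Vn n t) (B t)
      ∂(timeMeasure T)) atTop
      (𝓝 (∫ t, pairing (fun s => γ (clip K s)) (V t) (B t) ∂(timeMeasure T))) := by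
    refine tendsto_integral_of_dominated_convergence (fun _ => d * β * (p.vol 0).real univ)
      (fun n => ((key _ (hVnm n) (hE n)).2 K hK).1.1) (integrable_const _) (fun n => ?_) ?_
    · filter_upwards [hβ] with t h2
      exact (integrable_power_clip hγ hd h2).2
    · filter_upwards [hβ, hl'] with t h2 h3
      exact tendsto_pairing_clip hγ hd hβ0 h2 h3
  obtain ⟨N, hN⟩ := Metric.tendsto_atTop.1 hconv (r / 3) (by positivity)
  refine ⟨N, fun n hn => ?_⟩
  have a1 := ((key _ (hVnm n) (hE n)).2 K hK).2
  have a2 := ((key V hVm hEV).2 K hK).2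
  have a3 := hN n hn
  rw [Real.dist_eq] at a3 ⊢
  rw [abs_le] at a1 a2
  rw [abs_lt] at a3 ⊢
  constructor <;> linarith [a1.1, a1.2, a2.1, a2.2, a3.1, a3.2]

variable {f g h : Fin 2 → E3 → ℝ} {pot : Fin 2 → E3 → ℝ}

/-- The dissipation of strong solutions is controlled by the data. -/
theorem Assumptions.lintegral_dissRate_strong (A : Assumptions f g h pot γ) (hT : 0 < T)
    {P : ℝ → Hv p} {Φ₀ : Hd p} {Φ₁ : Hv p} {Φ : ℝ → Hd p} {V : ℝ → Hv p}
    (hP : MemLp P 2 (timeMeasure T)) (hs : IsStrong p f g h γ T P Φ₀ Φ₁ Φ V) {t : ℝ}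
    (ht : t ∈ Icc 0 T) : ∫⁻ s, dissRate γ (V s) ∂(timeMeasure t) =
      ENNReal.ofReal (energy pot Φ₀ Φ₁ + work P V t - energy pot (Φ t) (V t)) := by
  obtain ⟨h1, h2, h3⟩ := A.energy_strong hT hP hs
  rw [← h3 t ht, add_sub_cancel_left, ofReal_dissipation A.cont A.mono A.zero
    (aestronglyMeasurable_timeMeasure hs.mem.cont_vel)
    (lintegral_dissRate_lt_top A.cont A.mono A.zero hT h1 h2) ht]

/-- Energy and work of the approximating strong solutions converge, but the dissipation is only
lower semicontinuous, which leaves an inequality. -/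
theorem Assumptions.energy_le (A : Assumptions f g h pot γ) (hT : 0 < T) {P : ℝ → Hv p}
    (hP : MemLp P 2 (timeMeasure T)) {Φ₀ : Hd p} {Φ₁ : Hv p} {Φ : ℝ → Hd p} {V : ℝ → Hv p}
    (hg : IsGeneralized p f g h γ T P Φ₀ Φ₁ Φ V) :
    ∫⁻ s, dissRate γ (V s) ∂(timeMeasure T) < ⊤ ∧ ∀ t ∈ Icc 0 T,
      energy pot (Φ t) (V t) + dissipation γ V t ≤ energy pot Φ₀ Φ₁ + work P V t := by
  obtain ⟨Φn, Vn, Pn, Φ₀n, Φ₁n, hPn, hsn, hPl, hun⟩ := hg.approx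
  rw [← unifConv_iff] at hun
  obtain ⟨ε, hε, hε0, hr⟩ := hun.exists_rate hT (fun n => (hsn n).mem.cont)
    (fun n => (hsn n).mem.cont_vel) hg.mem.cont hg.mem.cont_vel
  have hmem0 : (0 : ℝ) ∈ Icc 0 T := ⟨le_rfl, hT.le⟩
  -- The second half, non-negativity, is needed to read the first as an inequality of real numbers,
  -- since `ENNReal.ofReal` annihilates negative values.
  have key : ∀ t ∈ Icc 0 T, ∫⁻ s, dissRate γ (V s) ∂(timeMeasure t) ≤
      ENNReal.ofReal (energy pot Φ₀ Φ₁ + work P V t - energy pot (Φ t) (V t)) ∧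
      0 ≤ energy pot Φ₀ Φ₁ + work P V t - energy pot (Φ t) (V t) := by
    intro t ht
    have l0 := A.tendsto_energy (hun.tendsto hmem0).1 (hun.tendsto hmem0).2
    rw [hg.mem.init, hg.mem.init_vel] at l0
    have l1 := A.tendsto_energy (hun.tendsto ht).1 (hun.tendsto ht).2
    have l2 := tendsto_work hT hP hPn hPl (fun n => (hsn n).mem.cont_vel) hg.mem.cont_vel hε
      (fun n t ht => (hr n t ht).2) ht
    have l3 := (l0.add l2).sub l1
    constructor
    · have hle := timeMeasure_mono ht.2
      refine (lintegral_dissRate_le_liminf A.cont (fun n => (aestronglyMeasurable_timeMeasure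
        (hsn n).mem.cont_vel).mono_measure hle) ?_).trans_eq ?_
      · filter_upwards [ae_restrict_mem measurableSet_Ioo] with s hs
        exact (hun.tendsto ⟨hs.1.le, hs.2.le.trans ht.2⟩).2
      · refine ((ENNReal.continuous_ofReal.tendsto _).comp l3).liminf_eq ▸ ?_
        refine congrArg (fun w => liminf w atTop) (funext fun n => ?_)
        rw [A.lintegral_dissRate_strong hT (hPn n) (hsn n) ht, Function.comp_apply,
          (hsn n).mem.init, (hsn n).mem.init_vel]
    · refine ge_of_tendsto' l3 fun n => ?_
      have e1 := (A.energy_strong hT (hPn n) (hsn n)).2.2 t ht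
      have e2 := dissipation_nonneg_of_monotone A.mono A.zero (Vn n) ht.1
      rw [(hsn n).mem.init, (hsn n).mem.init_vel]
      linarith
  have hfin : ∫⁻ s, dissRate γ (V s) ∂(timeMeasure T) < ⊤ :=
    (key T ⟨hT.le, le_rfl⟩).1.trans_lt ENNReal.ofReal_lt_top
  refine ⟨hfin, fun t ht => ?_⟩
  obtain ⟨k1, k2⟩ := key t ht
  rw [← ofReal_dissipation A.cont A.mono A.zero (aestronglyMeasurable_timeMeasure hg.mem.cont_vel)
    hfin ht, ENNReal.ofReal_le_ofReal_iff k2] at k1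
  linarith

end Bresse

namespace Bresse

variable {p : Params} {γ : ℝ → ℝ} {T : ℝ}

/-! ### Limits of bilinear expressions and splitting of the tested equation -/

section Bilinear

variable {E F : Type*} [NormedAddCommGroup E] [NormedSpace ℝ E] [NormedAddCommGroup F]
  [NormedSpace ℝ F]

theorem intervalIntegrable_bilinear (A : E →L[ℝ] F →L[ℝ] ℝ) {x : ℝ → E} {y : ℝ → F} (hT : 0 ≤ T)
    (hx : ContinuousOn x (Icc 0 T)) (hy : IntervalIntegrable y volume 0 T) :
    IntervalIntegrable (fun t => A (x t) (y t)) volume 0 T := by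
  obtain ⟨M, hM⟩ := isCompact_Icc.exists_bound_of_continuousOn hx
  rw [intervalIntegrable_iff_integrableOn_Ioc_of_le hT] at hy ⊢
  have hxm : AEStronglyMeasurable x (volume.restrict (Ioc 0 T)) :=
    (hx.mono Ioc_subset_Icc_self).aestronglyMeasurable measurableSet_Ioc
  have hc : Continuous fun z : E × F => A z.1 z.2 :=
    (A.continuous.comp continuous_fst).clm_apply continuous_snd
  refine Integrable.mono' (hy.norm.const_mul (‖A‖ * M))
    (hc.comp_aestronglyMeasurable (hxm.prodMk hy.aestronglyMeasurable)) ?_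
  filter_upwards [ae_restrict_mem measurableSet_Ioc] with t ht
  refine (A.le_opNorm₂ _ _).trans (mul_le_mul_of_nonneg_right ?_ (norm_nonneg _))
  exact mul_le_mul_of_nonneg_left (hM t ⟨ht.1.le, ht.2⟩) A.opNorm_nonneg

theorem tendsto_integral_bilinear (A : E →L[ℝ] F →L[ℝ] ℝ) {xn : ℕ → ℝ → E} {x : ℝ → E} {y : ℝ → F}
    (hT : 0 ≤ T) (hxn : ∀ n, ContinuousOn (xn n) (Icc 0 T)) (hx : ContinuousOn x (Icc 0 T))
    (hy : IntervalIntegrable y volume 0 T) {ε : ℕ → ℝ} (hε : Tendsto ε atTop (𝓝 0))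
    (h : ∀ n, ∀ t ∈ Icc 0 T, ‖xn n t - x t‖ ≤ ε n) :
    Tendsto (fun n => ∫ t in (0 : ℝ)..T, A (xn n t) (y t)) atTop
      (𝓝 (∫ t in (0 : ℝ)..T, A (x t) (y t))) := by
  refine tendsto_integral_of_norm_sub_le (m := fun n t => ‖A‖ * ε n * ‖y t‖) ⟨hT, le_rfl⟩
    (fun n => intervalIntegrable_bilinear A hT (hxn n) hy) (intervalIntegrable_bilinear A hT hx hy)
    (fun n => hy.norm.const_mul _) (fun n => ?_) ?_
  · filter_upwards [ae_restrict_mem measurableSet_Ioo] with t ht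
    have e : A (xn n t) (y t) - A (x t) (y t) = A (xn n t - x t) (y t) := by
      rw [map_sub, sub_apply]
    rw [e, ← Real.norm_eq_abs]
    refine (A.le_opNorm₂ _ _).trans (mul_le_mul_of_nonneg_right ?_ (norm_nonneg _))
    exact mul_le_mul_of_nonneg_left (h n t (Ioo_subset_Icc_self ht)) A.opNorm_nonneg
  · have l := (hε.const_mul ‖A‖).mul_const (∫ t in (0 : ℝ)..T, ‖y t‖)
    rw [mul_zero, zero_mul] at l
    refine l.congr fun n => ?_
    rw [intervalIntegral.integral_const_mul]

end Bilinear

theorem intervalIntegral_combination {u₁ u₂ u₃ u₄ u₅ : ℝ → ℝ}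
    (h₁ : IntervalIntegrable u₁ volume 0 T) (h₂ : IntervalIntegrable u₂ volume 0 T)
    (h₃ : IntervalIntegrable u₃ volume 0 T) (h₄ : IntervalIntegrable u₄ volume 0 T)
    (h₅ : IntervalIntegrable u₅ volume 0 T) :
    IntervalIntegrable (fun t => u₁ t - u₂ t - u₃ t - u₄ t + u₅ t) volume 0 T ∧
    ∫ t in (0 : ℝ)..T, (u₁ t - u₂ t - u₃ t - u₄ t + u₅ t) =
      (∫ t in (0 : ℝ)..T, u₁ t) - (∫ t in (0 : ℝ)..T, u₂ t) - (∫ t in (0 : ℝ)..T, u₃ t) -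
        (∫ t in (0 : ℝ)..T, u₄ t) + ∫ t in (0 : ℝ)..T, u₅ t := by
  refine ⟨(((h₁.sub h₂).sub h₃).sub h₄).add h₅, ?_⟩
  rw [intervalIntegral.integral_add (((h₁.sub h₂).sub h₃).sub h₄) h₅,
    intervalIntegral.integral_sub ((h₁.sub h₂).sub h₃) h₄,
    intervalIntegral.integral_sub (h₁.sub h₂) h₃, intervalIntegral.integral_sub h₁ h₂]

theorem testing_identity_sub {D H : Type*} [NormedAddCommGroup D] [NormedSpace ℝ D]
    [NormedAddCommGroup H] [InnerProductSpace ℝ H] [CompleteSpace H] (ι : D →L[ℝ] H)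
    (A : D →L[ℝ] D →L[ℝ] ℝ) (r : H →L[ℝ] H →L[ℝ] ℝ) {x y : ℝ → D} {v z q₁ q₂ d β β' : ℝ → H}
    {π : ℝ → ℝ} {a b : ℝ} (hab : a ≤ b) (hz : IntervalIntegrable z volume a b)
    (hβ' : IntervalIntegrable β' volume a b)
    (hv : ∀ t ∈ Icc a b, v t = v a + ∫ s in a..t, z s)
    (hβ : ∀ t ∈ Icc a b, β t = β a + ∫ s in a..t, β' s)
    (hy : ∀ᵐ t ∂(volume.restrict (Ioc a b)), ι (y t) = β t)
    (h : ∀ᵐ t ∂(volume.restrict (Ioc a b)), ∀ y, A (x t) y + r (z t) (ι y) =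
      inner ℝ (q₁ t - q₂ t - d t) (ι y))
    (hπ : ∀ᵐ t ∂(volume.restrict (Ioc a b)), inner ℝ (d t) (β t) = π t) :
    ∫ t in a..b, (inner ℝ (q₁ t) (ι (y t)) - inner ℝ (q₂ t) (ι (y t)) - π t - A (x t) (y t) +
      r (v t) (β' t)) = r (v b) (β b) - r (v a) (β a) := by
  rw [← (testing_identity ι A r hab hz hβ' hv hβ hy h).2]
  refine intervalIntegral.integral_congr_ae_restrict ?_
  rw [uIoc_of_le hab]
  filter_upwards [hy, hπ] with t h1 h2
  rw [h1, inner_sub_left, inner_sub_left, h2]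

/-! ### The variational identity for strong solutions -/

section Test

variable {B : ℝ → Hd p} {Bt : ℝ → Hv p} {B₀ : Hv p}

theorem IsTest.integrable (h : IsTest T B Bt B₀) (hT : 0 < T) :
    IntervalIntegrable B volume 0 T ∧ IntervalIntegrable Bt volume 0 T ∧
      IntervalIntegrable (fun t => toHv (B t)) volume 0 T := by
  have h1 := intervalIntegrable_of_memLp hT h.mem
  exact ⟨h1, intervalIntegrable_of_memLp hT h.mem_deriv, (toHv_integral h1).1⟩

theorem IsTest.continuousOn (h : IsTest T B Bt B₀) (hT : 0 < T) :
    ContinuousOn (fun t => B₀ + ∫ s in (0 : ℝ)..t, Bt s) (Icc 0 T) := by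
  have hi := (h.integrable hT).2.1
  refine continuousOn_const.add ?_
  have := intervalIntegral.continuousOn_primitive_interval (μ := volume) (f := Bt) (a := 0)
    (b := T) (by rw [uIcc_of_le hT.le]
                 exact (intervalIntegrable_iff_integrableOn_Icc_of_le hT.le).1 hi)
  rwa [uIcc_of_le hT.le] at this

variable {C : NNReal} {φ : Fin 2 → E3 → E3} {hφ : ∀ j, LipschitzWith C (φ j)}

set_option maxHeartbeats 800000 in
-- B agrees almost everywhere with the continuous primitive b of B_t. The product rule for r(V, b)
-- on interior intervals extends to [0,T] by continuity, where b(0) = B₀ and b(T) = 0.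
theorem TruncSol.test_identity {P : ℝ → Hv p} {Φ : ℝ → Hd p} {V : ℝ → Hv p}
    (hs : TruncSol γ hφ T P Φ V) (hT : 0 < T) (hP : IntervalIntegrable P volume 0 T)
    (h : IsTest T B Bt B₀)
    (hp : Integrable (fun t => pairing γ (V t) (toHv (B t))) (timeMeasure T)) :
    (∫ t in (0 : ℝ)..T, inner ℝ (P t) (toHv (B t))) -
      (∫ t in (0 : ℝ)..T, inner ℝ (nem hφ (toHv (Φ t))) (toHv (B t))) -
      (∫ t, pairing γ (V t) (toHv (B t)) ∂(timeMeasure T)) -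
      (∫ t in (0 : ℝ)..T, aForm p (Φ t) (B t)) + (∫ t in (0 : ℝ)..T, rForm p (V t) (Bt t)) =
      -rForm p (V 0) B₀ := by
  obtain ⟨W, Z, d, hl, hd⟩ := hs.ex
  obtain ⟨iB, iBt, ib⟩ := h.integrable hT
  have hbc := h.continuousOn hT
  set b : ℝ → Hv p := fun t => B₀ + ∫ s in (0 : ℝ)..t, Bt s with hb
  have hae : ∀ᵐ t ∂(timeMeasure T), toHv (B t) = b t := h.deriv
  have hnc : ContinuousOn (fun t => nem hφ (toHv (Φ t))) (Icc 0 T) :=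
    (lipschitzWith_nem hφ).continuous.comp_continuousOn (continuous_toHv.comp_continuousOn hs.cont)
  have j1 : IntervalIntegrable (fun t => inner ℝ (P t) (toHv (B t))) volume 0 T := by
    refine (intervalIntegrable_inner hT.le hP hbc).congr_ae ?_
    rw [uIoc_of_le hT.le, ← restrict_Ioo_eq_restrict_Ioc]
    filter_upwards [hae] with t ht
    rw [ht]
  have j2 : IntervalIntegrable (fun t => inner ℝ (nem hφ (toHv (Φ t))) (toHv (B t))) volume 0 T := by
    refine (intervalIntegrable_inner hT.le ib hnc).congr fun t _ => ?_
    exact real_inner_comm _ _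
  have j3 : IntervalIntegrable (fun t => pairing γ (V t) (toHv (B t))) volume 0 T :=
    (intervalIntegrable_iff_integrableOn_Ioo_of_le hT.le).2 hp
  have j4 := intervalIntegrable_bilinear (aForm p) hT.le hs.cont iB
  have j5 := intervalIntegrable_bilinear (rForm p) hT.le hs.cont_vel iBt
  have hφc : ContinuousOn (fun t => rForm p (V t) (b t)) (Icc 0 T) :=
    ((rForm p).continuous.comp_continuousOn hs.cont_vel).clm_apply hbc
  have hsub : ∀ s ∈ Icc 0 T, IntervalIntegrable Bt volume 0 s := fun s hs =>
    iBt.mono_set (by rw [uIcc_of_le hs.1, uIcc_of_le hT.le]; exact Icc_subset_Icc_right hs.2)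
  obtain ⟨j, ej⟩ := intervalIntegral_combination j1 j2 j3 j4 j5
  have H : ∀ r s, 0 < r → r < s → s < T → rForm p (V s) (b s) - rForm p (V r) (b r) =
      ∫ t in r..s, (inner ℝ (P t) (toHv (B t)) - inner ℝ (nem hφ (toHv (Φ t))) (toHv (B t)) -
        pairing γ (V t) (toHv (B t)) - aForm p (Φ t) (B t) + rForm p (V t) (Bt t)) := by
    intro r s hr hrs hsT
    have hβ : ∀ t ∈ Icc r s, b t = b r + ∫ q in r..t, Bt q := fun t ht => by
      have hrt : IntervalIntegrable Bt volume r t := iBt.mono_set (by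
        rw [uIcc_of_le ht.1, uIcc_of_le hT.le]
        exact Icc_subset_Icc hr.le (ht.2.trans hsT.le))
      have e := intervalIntegral.integral_add_adjacent_intervals
        (hsub r ⟨hr.le, (hrs.trans hsT).le⟩) hrt
      simp only [hb]
      rw [← e, add_assoc]
    have hBr : IntervalIntegrable Bt volume r s := iBt.mono_set (by
      rw [uIcc_of_le hrs.le, uIcc_of_le hT.le]; exact Icc_subset_Icc hr.le hsT.le)
    have hy : ∀ᵐ t ∂(volume.restrict (Ioc r s)), toHvL p (B t) = b t := by
      refine ae_Ioc_of_ae hr hsT ?_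
      filter_upwards [hae] with t ht
      rw [toHvL_apply, ht]
    have hq : ∀ᵐ t ∂(volume.restrict (Ioc r s)), ∀ y, aForm p (Φ t) y + rForm p (Z t) (toHvL p y) =
        inner ℝ ((P t - nem hφ (toHv (Φ t))) - d t) (toHvL p y) := by
      refine ae_Ioc_of_ae hr hsT ?_
      filter_upwards [hl.eqn] with t ht
      exact weakA_rForm ht.2
    have hπ : ∀ᵐ t ∂(volume.restrict (Ioc r s)), inner ℝ (d t) (b t) =
        pairing γ (V t) (toHv (B t)) := by
      refine ae_Ioc_of_ae hr hsT ?_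
      filter_upwards [hae, hd] with t h1 h2
      rw [h1, h2.inner_eq, pairing]
    have e := testing_identity_sub (D := Hd p) (H := Hv p) (toHvL p) (aForm p) (rForm p) (x := Φ)
      (y := B) (q₁ := P) (q₂ := fun t => nem hφ (toHv (Φ t))) (d := d) hrs.le
      (hl.vel r s hr hrs hsT).1 hBr (primitive_on_Icc hl.vel hr hsT) hβ hy hq hπ
    simp only [toHvL_apply] at e
    exact e.symm
  have key : rForm p (V T) (b T) - rForm p (V 0) (b 0) = _ :=
    sub_eq_integral_of_interior hT hφc j H T ⟨hT.le, le_rfl⟩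
  have e0 : b 0 = B₀ := by rw [hb]; simp only [intervalIntegral.integral_same, add_zero]
  have eT : b T = 0 := h.final
  have z : rForm p (V T) 0 = 0 := (rForm p (V T)).map_zero
  have e3 := intervalIntegral_eq_timeMeasure hT.le fun t => pairing γ (V t) (toHv (B t))
  rw [e0, eT, z, zero_sub] at key
  rw [key, ej, e3]

end Test

variable {f g h : Fin 2 → E3 → ℝ} {pot : Fin 2 → E3 → ℝ}

/-- One truncation serves the whole approximating sequence and its limit. The damping terms converge
by `tendsto_integral_pairing`, the dissipation of the sequence being bounded by E through the energy
identity; the other terms converge with the solutions and the loads. -/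
theorem Assumptions.identity_of_bounded (A : Assumptions f g h pot γ) (hT : 0 < T) {P : ℝ → Hv p}
    (hP : MemLp P 2 (timeMeasure T)) {Φ₀ : Hd p} {Φ₁ : Hv p} {Φ : ℝ → Hd p} {V : ℝ → Hv p}
    (hg : IsGeneralized p f g h γ T P Φ₀ Φ₁ Φ V) :
    ∃ (φ : Fin 2 → E3 → E3) (C : NNReal) (hφ : ∀ j, LipschitzWith C (φ j)),
      (∀ t ∈ Icc 0 T, ∀ j, ∀ᵐ x ∂(p.vol j), φ j (toHv (Φ t) j x) =
        feedback f g h j (toHv (Φ t) j x)) ∧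
      ∀ (B : ℝ → Hd p) (Bt : ℝ → Hv p) (B₀ : Hv p) (β : ℝ), IsTest T B Bt B₀ → 0 ≤ β →
        (∀ᵐ t ∂(timeMeasure T), ∀ᵐ x ∂(p.vol 0), |toHv (B t) 0 x 1| ≤ β) →
        (∫ t in (0 : ℝ)..T, inner ℝ (P t) (toHv (B t))) -
          (∫ t in (0 : ℝ)..T, inner ℝ (nem hφ (toHv (Φ t))) (toHv (B t))) -
          (∫ t, pairing γ (V t) (toHv (B t)) ∂(timeMeasure T)) -
          (∫ t in (0 : ℝ)..T, aForm p (Φ t) (B t)) + (∫ t in (0 : ℝ)..T, rForm p (V t) (Bt t)) =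
          -rForm p Φ₁ B₀ := by
  obtain ⟨Φn, Vn, Pn, Φ₀n, Φ₁n, hPn, hsn, hPl, hun⟩ := hg.approx
  rw [← unifConv_iff] at hun
  obtain ⟨ε, hε, hε0, hr⟩ := hun.exists_rate hT (fun n => (hsn n).mem.cont)
    (fun n => (hsn n).mem.cont_vel) hg.mem.cont hg.mem.cont_vel
  have hmem0 : (0 : ℝ) ∈ Icc 0 T := ⟨le_rfl, hT.le⟩
  have hmemT : T ∈ Icc 0 T := ⟨hT.le, le_rfl⟩
  obtain ⟨K, hK0, hK⟩ := exists_bound_of_rate hg.mem.cont hε fun n t ht => (hr n t ht).1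
  have hKΦ : ∀ t ∈ Icc 0 T, ‖Φ t‖ ≤ K := fun t ht =>
    le_of_tendsto' (hun.tendsto ht).1.norm fun n => hK n t ht
  obtain ⟨k, φ, C, hφ, heq, hgr, hsup⟩ := A.exists_trunc p hK0
  have hts := fun n => (hsn n).truncSol hφ (fun t ht => hsup _ (hK n t ht)) heq
  refine ⟨φ, C, hφ, fun t ht j => ?_, fun B Bt B₀ β hB hβ0 hβ => ?_⟩
  · filter_upwards [hsup _ (hKΦ t ht) j] with x hx
    exact heq j _ hx
  have hPi := intervalIntegrable_of_memLp hT hP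
  have hPni := fun n => intervalIntegrable_of_memLp hT (hPn n)
  obtain ⟨iB, iBt, ib⟩ := hB.integrable hT
  have hbc := hB.continuousOn hT
  have l0 := A.tendsto_energy (hun.tendsto hmem0).1 (hun.tendsto hmem0).2
  have l1 := A.tendsto_energy (hun.tendsto hmemT).1 (hun.tendsto hmemT).2
  have l2 := tendsto_work hT hP hPn hPl (fun n => (hsn n).mem.cont_vel) hg.mem.cont_vel hε
    (fun n t ht => (hr n t ht).2) hmemT
  obtain ⟨E, hE0, hE⟩ := exists_upper_bound ((l0.add l2).sub l1)
  obtain ⟨hpn, -, hpl⟩ := tendsto_integral_pairing A.cont A.mono A.zero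
    (fun n => (hsn n).mem.cont_vel) hg.mem.cont_vel
    (continuous_toHv.comp_aestronglyMeasurable hB.mem.1) hβ0 hE0 hβ (fun t ht => (hun.tendsto ht).2)
    fun n => by
      rw [A.lintegral_dissRate_strong hT (hPn n) (hsn n) hmemT]
      refine ENNReal.ofReal_le_ofReal ?_
      have := hE n
      rwa [(hsn n).mem.init, (hsn n).mem.init_vel] at this
  have hnc : ∀ {Ψ : ℝ → Hd p}, ContinuousOn Ψ (Icc 0 T) →
      ContinuousOn (fun t => nem hφ (toHv (Ψ t))) (Icc 0 T) := fun hΨ =>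
    (lipschitzWith_nem hφ).continuous.comp_continuousOn (continuous_toHv.comp_continuousOn hΨ)
  have m1 : Tendsto (fun n => ∫ t in (0 : ℝ)..T, inner ℝ (Pn n t) (toHv (B t))) atTop
      (𝓝 (∫ t in (0 : ℝ)..T, inner ℝ (P t) (toHv (B t)))) := by
    have e : ∀ Q : ℝ → Hv p, ∫ t in (0 : ℝ)..T, inner ℝ (Q t) (toHv (B t)) =
        work Q (fun t => B₀ + ∫ s in (0 : ℝ)..t, Bt s) T := fun Q => by
      rw [work, intervalIntegral_eq_timeMeasure hT.le, intervalIntegral_eq_timeMeasure hT.le]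
      refine integral_congr_ae ?_
      filter_upwards [hB.deriv] with t ht
      rw [ht, ip_eq_inner]
    simp only [e]
    exact tendsto_work hT hP hPn hPl (fun n => hbc) hbc (ε := fun _ => 0) tendsto_const_nhds
      (fun n t ht => by rw [sub_self, norm_zero]) hmemT
  have m2 : Tendsto (fun n => ∫ t in (0 : ℝ)..T, inner ℝ (nem hφ (toHv (Φn n t))) (toHv (B t))) atTop
      (𝓝 (∫ t in (0 : ℝ)..T, inner ℝ (nem hφ (toHv (Φ t))) (toHv (B t)))) := by
    have l := hε.const_mul (C : ℝ)
    rw [mul_zero] at l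
    refine tendsto_integral_bilinear (innerSL ℝ) hT.le (fun n => hnc (hsn n).mem.cont)
      (hnc hg.mem.cont) ib l fun n t ht => ?_
    have h1 := (lipschitzWith_nem hφ).dist_le_mul (toHv (Φn n t)) (toHv (Φ t))
    rw [dist_eq_norm, dist_eq_norm, ← toHv_sub] at h1
    exact h1.trans (mul_le_mul_of_nonneg_left ((norm_toHv_le _).trans (hr n t ht).1) C.2)
  have m4 := tendsto_integral_bilinear (aForm p) hT.le (fun n => (hsn n).mem.cont) hg.mem.cont iB hε
    fun n t ht => (hr n t ht).1
  have m5 := tendsto_integral_bilinear (rForm p) hT.le (fun n => (hsn n).mem.cont_vel)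
    hg.mem.cont_vel iBt hε fun n t ht => (hr n t ht).2
  have m6 : Tendsto (fun n => -rForm p (Vn n 0) B₀) atTop (𝓝 (-rForm p Φ₁ B₀)) := by
    have hc : Continuous fun v : Hv p => -rForm p v B₀ :=
      ((rForm p).continuous.clm_apply continuous_const).neg
    have := (hc.tendsto (V 0)).comp (hun.tendsto hmem0).2
    rwa [hg.mem.init_vel] at this
  exact tendsto_nhds_unique ((((m1.sub m2).sub hpl).sub m4).add m5)
    (m6.congr fun n => ((hts n).test_identity hT (hPni n) hB (hpn n)).symm)

end Bresse

namespace Bresse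

variable {p : Params} {T K : ℝ}

/-! ### A smooth truncation of real numbers -/

section Scalar

/-- A smooth bounded truncation. -/
def trunc (K s : ℝ) : ℝ := K * Real.arctan (s / K)

/-- The derivative of `trunc`. -/
def trunc' (K s : ℝ) : ℝ := 1 / (1 + (s / K) ^ 2)

/-- Unlike clipping, the arctangent is differentiable everywhere, so the chain rules in x and in t
have no exceptional points; its derivative lies in [0, 1] and is Lipschitz. -/
theorem hasDerivAt_trunc (hK : 0 < K) (s : ℝ) : HasDerivAt (trunc K) (trunc' K s) s := by
  have h := (((hasDerivAt_id s).div_const K).arctan).const_mul K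
  refine h.congr_deriv ?_
  rw [trunc', id_eq]
  field_simp

theorem trunc'_mem (s : ℝ) : 0 ≤ trunc' K s ∧ trunc' K s ≤ 1 := by
  have h : 1 ≤ 1 + (s / K) ^ 2 := by nlinarith [sq_nonneg (s / K)]
  exact ⟨by rw [trunc']; positivity, by rw [trunc', div_le_one (by linarith)]; exact h⟩

theorem trunc_zero : trunc K 0 = 0 := by simp [trunc]

theorem trunc'_zero : trunc' K 0 = 1 := by simp [trunc']

theorem abs_trunc'_sub_le (hK : 0 < K) (s t : ℝ) : |trunc' K t - trunc' K s| ≤ 1 / K * |t - s| := by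
  have e : 1 / K * |t - s| = |t / K - s / K| := by
    rw [← sub_div, abs_div, abs_of_pos hK]; ring
  rw [e, trunc', trunc']
  set a := t / K
  set b := s / K
  have ha : 0 < 1 + a ^ 2 := by positivity
  have hb : 0 < 1 + b ^ 2 := by positivity
  have e2 : 1 / (1 + a ^ 2) - 1 / (1 + b ^ 2) = (b - a) * ((a + b) / ((1 + a ^ 2) * (1 + b ^ 2))) := by
    field_simp; ring
  have h1 : |(a + b) / ((1 + a ^ 2) * (1 + b ^ 2))| ≤ 1 := by
    rw [abs_div, abs_of_pos (mul_pos ha hb), div_le_one (mul_pos ha hb), abs_le]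
    constructor <;> nlinarith [sq_nonneg (a + 1), sq_nonneg (a - 1), sq_nonneg (b + 1),
      sq_nonneg (b - 1), mul_nonneg (sq_nonneg a) (sq_nonneg b)]
  rw [e2, abs_mul, abs_sub_comm]
  nlinarith [abs_nonneg (a - b)]

theorem exists_trunc_sub_eq (hK : 0 < K) (s t : ℝ) :
    ∃ ξ, |ξ - s| ≤ |t - s| ∧ trunc K t - trunc K s = trunc' K ξ * (t - s) := by
  have key : ∀ a b, a < b → ∃ ξ ∈ Ioo a b, trunc K b - trunc K a = trunc' K ξ * (b - a) := by
    intro a b hab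
    obtain ⟨ξ, hξ, e⟩ := exists_hasDerivAt_eq_slope (trunc K) (trunc' K) hab
      (fun x _ => (hasDerivAt_trunc hK x).continuousAt.continuousWithinAt)
      fun x _ => hasDerivAt_trunc hK x
    refine ⟨ξ, hξ, ?_⟩
    rw [e, div_mul_cancel₀ _ (sub_pos.2 hab).ne']
  rcases lt_trichotomy s t with h | rfl | h
  · obtain ⟨ξ, hξ, e⟩ := key s t h
    refine ⟨ξ, ?_, e⟩
    rw [abs_of_pos (sub_pos.2 hξ.1), abs_of_pos (sub_pos.2 h)]
    linarith [hξ.2]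
  · exact ⟨s, le_rfl, by simp⟩
  · obtain ⟨ξ, hξ, e⟩ := key t s h
    refine ⟨ξ, ?_, by linarith⟩
    rw [abs_sub_comm, abs_sub_comm t, abs_of_pos (sub_pos.2 hξ.2), abs_of_pos (sub_pos.2 h)]
    linarith [hξ.1]

theorem abs_trunc_sub_le (hK : 0 < K) (s t : ℝ) : |trunc K t - trunc K s| ≤ |t - s| := by
  obtain ⟨ξ, -, e⟩ := exists_trunc_sub_eq hK s t
  obtain ⟨h1, h2⟩ := trunc'_mem (K := K) ξ
  rw [e, abs_mul, abs_of_nonneg h1]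
  nlinarith [abs_nonneg (t - s)]

theorem abs_trunc_le (hK : 0 < K) (s : ℝ) : |trunc K s| ≤ |s| := by
  have := abs_trunc_sub_le hK 0 s
  rwa [trunc_zero, sub_zero, sub_zero] at this

theorem abs_trunc_le_two_mul (hK : 0 < K) (s : ℝ) : |trunc K s| ≤ 2 * K := by
  rw [trunc, abs_mul, abs_of_pos hK, mul_comm]
  refine mul_le_mul_of_nonneg_right ?_ hK.le
  have h1 := Real.neg_pi_div_two_lt_arctan (s / K)
  have h2 := Real.arctan_lt_pi_div_two (s / K)
  have := Real.pi_le_four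
  exact abs_le.2 ⟨by linarith, by linarith⟩

theorem abs_trunc_sub_sub_le (hK : 0 < K) (s t : ℝ) :
    |trunc K t - trunc K s - trunc' K s * (t - s)| ≤ 1 / K * |t - s| ^ 2 := by
  obtain ⟨ξ, hξ, e⟩ := exists_trunc_sub_eq hK s t
  have h1 := abs_trunc'_sub_le hK s ξ
  rw [e, ← sub_mul, abs_mul, sq, ← mul_assoc]
  refine mul_le_mul_of_nonneg_right (h1.trans ?_) (abs_nonneg _)
  exact mul_le_mul_of_nonneg_left hξ (by positivity)

theorem tendsto_trunc (s : ℝ) : Tendsto (fun n : ℕ => trunc ((n : ℝ) + 1) s) atTop (𝓝 s) := by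
  rw [tendsto_iff_norm_sub_tendsto_zero]
  have l := tendsto_inv_succ.mul_const (|s| ^ 2)
  rw [zero_mul] at l
  refine squeeze_zero (fun _ => norm_nonneg _) (fun n => ?_) l
  have := abs_trunc_sub_sub_le (K := (n : ℝ) + 1) (by positivity) 0 s
  rwa [trunc_zero, trunc'_zero, sub_zero, sub_zero, one_mul] at this

theorem tendsto_trunc' (s : ℝ) : Tendsto (fun n : ℕ => trunc' ((n : ℝ) + 1) s) atTop (𝓝 1) := by
  rw [tendsto_iff_norm_sub_tendsto_zero]
  have l := tendsto_inv_succ.mul_const |s|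
  rw [zero_mul] at l
  refine squeeze_zero (fun _ => norm_nonneg _) (fun n => ?_) l
  have := abs_trunc'_sub_le (K := (n : ℝ) + 1) (by positivity) 0 s
  rwa [trunc'_zero, sub_zero] at this

end Scalar

/-! ### Componentwise truncation in ℝ³ -/

section Vector

theorem E3.norm_le_mul {a b : E3} {c : ℝ} (hc : 0 ≤ c) (h : ∀ i, |a i| ≤ c * |b i|) :
    ‖a‖ ≤ c * ‖b‖ := by
  refine (sq_le_sq₀ (norm_nonneg _) (by positivity)).1 ?_
  rw [mul_pow, E3.norm_sq_eq, E3.norm_sq_eq]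
  have h1 : ∀ i, a i ^ 2 ≤ c ^ 2 * b i ^ 2 := fun i => by
    rw [← sq_abs (a i), ← sq_abs (b i), ← mul_pow]
    exact pow_le_pow_left₀ (abs_nonneg _) (h i) 2
  linarith [h1 0, h1 1, h1 2]

/-- Componentwise truncation. -/
def trunc3 (K : ℝ) (v : E3) : E3 := !₂[trunc K (v 0), trunc K (v 1), trunc K (v 2)]

/-- The derivative of `trunc3`. -/
def trunc3' (K : ℝ) (v : E3) : E3 →L[ℝ] E3 := diag3 (trunc' K (v 0)) (trunc' K (v 1)) (trunc' K (v 2))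

theorem trunc3_apply (v : E3) (i : Fin 3) : trunc3 K v i = trunc K (v i) := by
  fin_cases i <;> rfl

theorem trunc3'_apply (v b : E3) (i : Fin 3) : trunc3' K v b i = trunc' K (v i) * b i := by
  rw [trunc3', diag3_apply]
  fin_cases i <;> rfl

theorem trunc3_zero : trunc3 K 0 = 0 := by
  ext i; rw [trunc3_apply]; simp [trunc_zero]

theorem norm_trunc3_sub_le (hK : 0 < K) (v w : E3) : ‖trunc3 K w - trunc3 K v‖ ≤ ‖w - v‖ := by
  rw [← one_mul ‖w - v‖]
  refine E3.norm_le_mul zero_le_one fun i => ?_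
  rw [PiLp.sub_apply, PiLp.sub_apply, trunc3_apply, trunc3_apply, one_mul]
  exact abs_trunc_sub_le hK _ _

theorem lipschitzWith_trunc3 (hK : 0 < K) : ∀ _ : Fin 2, LipschitzWith 1 (trunc3 K) := fun _ =>
  LipschitzWith.of_dist_le_mul fun v w => by
    rw [dist_eq_norm, dist_eq_norm, NNReal.coe_one, one_mul]
    exact norm_trunc3_sub_le hK w v

theorem norm_trunc3'_le (v : E3) : ‖trunc3' K v‖ ≤ 1 := by
  refine ContinuousLinearMap.opNorm_le_bound _ zero_le_one fun b => ?_
  refine E3.norm_le_mul zero_le_one fun i => ?_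
  rw [trunc3'_apply, abs_mul]
  obtain ⟨h1, h2⟩ := trunc'_mem (K := K) (v i)
  rw [abs_of_nonneg h1]
  exact mul_le_mul_of_nonneg_right h2 (abs_nonneg _)

theorem continuous_trunc3' (hK : 0 < K) : Continuous (trunc3' K) := by
  refine LipschitzWith.continuous (K := (1 / K).toNNReal) (LipschitzWith.of_dist_le_mul
    fun w v => ?_)
  rw [dist_eq_norm, dist_eq_norm, Real.coe_toNNReal _ (by positivity)]
  refine ContinuousLinearMap.opNorm_le_bound _ (by positivity) fun b => ?_
  refine E3.norm_le_mul (by positivity) fun i => ?_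
  rw [sub_apply, PiLp.sub_apply, trunc3'_apply, trunc3'_apply, ← sub_mul, abs_mul]
  refine mul_le_mul_of_nonneg_right ((abs_trunc'_sub_le hK _ _).trans ?_) (abs_nonneg _)
  exact mul_le_mul_of_nonneg_left (E3.abs_apply_le (w - v) i) (by positivity)

theorem norm_trunc3_sub_sub_le (hK : 0 < K) (v w : E3) :
    ‖trunc3 K w - trunc3 K v - trunc3' K v (w - v)‖ ≤ 1 / K * ‖w - v‖ ^ 2 := by
  rw [sq, ← mul_assoc]
  refine E3.norm_le_mul (by positivity) fun i => ?_
  rw [PiLp.sub_apply, PiLp.sub_apply, trunc3_apply, trunc3_apply, trunc3'_apply, PiLp.sub_apply]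
  refine (abs_trunc_sub_sub_le hK _ _).trans ?_
  rw [sq, ← mul_assoc]
  refine mul_le_mul_of_nonneg_right ?_ (abs_nonneg _)
  exact mul_le_mul_of_nonneg_left (E3.abs_apply_le (w - v) i) (by positivity)

theorem hasFDerivAt_trunc3 (hK : 0 < K) (v : E3) : HasFDerivAt (trunc3 K) (trunc3' K v) v :=
  hasFDerivAt_of_quadratic fun w => norm_trunc3_sub_sub_le hK v w

theorem tendsto_trunc3 (v : E3) : Tendsto (fun n : ℕ => trunc3 ((n : ℝ) + 1) v) atTop (𝓝 v) := by
  have h : Tendsto (fun n : ℕ => WithLp.ofLp (trunc3 ((n : ℝ) + 1) v)) atTop (𝓝 (WithLp.ofLp v)) :=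
    tendsto_pi_nhds.2 fun i => (tendsto_trunc (v i)).congr fun n => (trunc3_apply v i).symm
  exact ((PiLp.continuous_toLp 2 _).tendsto _).comp h

theorem tendsto_trunc3' (v b : E3) :
    Tendsto (fun n : ℕ => trunc3' ((n : ℝ) + 1) v b) atTop (𝓝 b) := by
  have h : Tendsto (fun n : ℕ => WithLp.ofLp (trunc3' ((n : ℝ) + 1) v b)) atTop
      (𝓝 (WithLp.ofLp b)) := tendsto_pi_nhds.2 fun i => by
    have := (tendsto_trunc' (v i)).mul_const (b i)
    rw [one_mul] at this
    exact this.congr fun n => (trunc3'_apply v b i).symm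
  exact ((PiLp.continuous_toLp 2 _).tendsto _).comp h

end Vector

/-! ### Truncation as an operator on H_v -/

section Operators

/-- Truncation in `H_v`. -/
def truncHv (hK : 0 < K) (u : Hv p) : Hv p := nem (φ := fun _ => trunc3 K) (lipschitzWith_trunc3 hK) u

/-- The linearization `b ↦ Θ'(u) b` of the truncation at `u`. -/
def truncHv' (hK : 0 < K) (u b : Hv p) : Hv p :=
  superpos (continuous_trunc3' hK) norm_trunc3'_le u b

theorem truncHv_ae (hK : 0 < K) (u : Hv p) (j : Fin 2) :
    ∀ᵐ x ∂(p.vol j), truncHv hK u j x = trunc3 K (u j x) :=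
  nem_ae (φ := fun _ => trunc3 K) (lipschitzWith_trunc3 hK) u j

theorem truncHv'_ae (hK : 0 < K) (u b : Hv p) (j : Fin 2) :
    ∀ᵐ x ∂(p.vol j), truncHv' hK u b j x = trunc3' K (u j x) (b j x) :=
  superpos_ae (continuous_trunc3' hK) norm_trunc3'_le u b j

theorem continuous_truncHv (hK : 0 < K) : Continuous (truncHv (p := p) hK) :=
  (lipschitzWith_nem (φ := fun _ => trunc3 K) (lipschitzWith_trunc3 hK)).continuous

theorem continuous_truncHv' (hK : 0 < K) :
    Continuous fun z : Hv p × Hv p => truncHv' hK z.1 z.2 :=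
  continuous_superpos (continuous_trunc3' hK) norm_trunc3'_le

theorem norm_truncHv'_le (hK : 0 < K) (u b : Hv p) : ‖truncHv' hK u b‖ ≤ ‖b‖ := by
  have := norm_superpos_le (continuous_trunc3' hK) norm_trunc3'_le u b
  rwa [one_mul] at this

attribute [irreducible] truncHv truncHv'

theorem truncHv_zero (hK : 0 < K) : truncHv hK (0 : Hv p) = 0 := by
  refine Hv.ext_ae fun j => ?_
  filter_upwards [truncHv_ae hK (0 : Hv p) j, Hv.zero_ae (p := p) j] with x h1 h2
  rw [h1, h2, trunc3_zero]

theorem norm_truncHv_sub_le (hK : 0 < K) (u w : Hv p) :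
    ‖truncHv hK w - truncHv hK u‖ ≤ ‖w - u‖ := by
  rw [← one_mul ‖w - u‖]
  refine Hv.norm_le_of_ae zero_le_one fun j => ?_
  filter_upwards [truncHv_ae hK u j, truncHv_ae hK w j, Hv.sub_ae w u j,
    Hv.sub_ae (truncHv hK w) (truncHv hK u) j] with x h1 h2 h3 h4
  rw [h4, h3, h1, h2, one_mul]
  exact norm_trunc3_sub_le hK _ _

theorem norm_truncHv_le (hK : 0 < K) (u : Hv p) : ‖truncHv hK u‖ ≤ ‖u‖ := by
  have := norm_truncHv_sub_le hK 0 u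
  rwa [truncHv_zero, sub_zero, sub_zero] at this

theorem inner_truncHv' (hK : 0 < K) (u b ψ : Hv p) :
    inner ℝ (truncHv' hK u b) ψ = inner ℝ (truncHv' hK u ψ) b := by
  rw [← ip_eq_inner, ← ip_eq_inner]
  refine Finset.sum_congr rfl fun j _ => integral_congr_ae ?_
  filter_upwards [truncHv'_ae hK u b j, truncHv'_ae hK u ψ j] with x h1 h2
  rw [h1, h2, trunc3', diag3_symm, real_inner_comm]

/-- Pairing the truncation with a bounded function gives a differentiable functional. -/
theorem hasFDerivAt_inner_truncHv (hK : 0 < K) {ψ : Hv p} {S : ℝ}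
    (hψ : ∀ j, ∀ᵐ x ∂(p.vol j), ‖ψ j x‖ ≤ S) (u : Hv p) :
    HasFDerivAt (fun w : Hv p => inner ℝ (truncHv hK w) ψ) (innerSL ℝ (truncHv' hK u ψ)) u := by
  -- The pointwise remainder is quadratic in w − u and so is controlled only in L¹; against the
  -- bounded function ψ this is enough.
  refine hasFDerivAt_of_quadratic (C := 1 / K * S) fun w => ?_
  have e : inner ℝ (truncHv hK w) ψ - inner ℝ (truncHv hK u) ψ -
      innerSL ℝ (truncHv' hK u ψ) (w - u) =
      inner ℝ (truncHv hK w - truncHv hK u - truncHv' hK u (w - u)) ψ := by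
    rw [innerSL_apply_apply, ← inner_truncHv', inner_sub_left, inner_sub_left]
  rw [e, ← ip_eq_inner, ip, Hv.norm_sq_eq, Finset.mul_sum]
  refine (norm_sum_le _ _).trans (Finset.sum_le_sum fun j _ => ?_)
  rw [← integral_const_mul]
  refine norm_integral_le_of_norm_le ((Hv.integrable_norm_sq (w - u) j).const_mul _) ?_
  filter_upwards [hψ j, truncHv_ae hK u j, truncHv_ae hK w j, truncHv'_ae hK u (w - u) j,
    Hv.sub_ae w u j, Hv.sub_ae (truncHv hK w) (truncHv hK u) j,
    Hv.sub_ae (truncHv hK w - truncHv hK u) (truncHv' hK u (w - u)) j] with x h1 h2 h3 h4 h5 h6 h7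
  rw [h7, h6, h4, h5, h2, h3]
  refine (norm_inner_le_norm _ _).trans ?_
  have := norm_trunc3_sub_sub_le hK (u j x) (w j x)
  calc _ ≤ 1 / K * ‖w j x - u j x‖ ^ 2 * S := mul_le_mul this h1 (norm_nonneg _) (by positivity)
    _ = _ := by ring

theorem tendsto_truncHv (u : Hv p) :
    Tendsto (fun n : ℕ => truncHv (K := (n : ℝ) + 1) (by positivity) u) atTop (𝓝 u) := by
  refine Hv.tendsto_of_ae (b := u) (c := 2) (fun n j => ?_) fun j => ?_
  · filter_upwards [truncHv_ae (K := (n : ℝ) + 1) (by positivity) u j] with x hx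
    rw [hx]
    have := norm_trunc3_sub_le (K := (n : ℝ) + 1) (by positivity) 0 (u j x)
    rw [trunc3_zero, sub_zero, sub_zero] at this
    linarith [norm_sub_le (trunc3 ((n : ℝ) + 1) (u j x)) (u j x)]
  · filter_upwards [ae_all_iff.2 fun n : ℕ => truncHv_ae (K := (n : ℝ) + 1) (by positivity) u j]
      with x hx
    exact (tendsto_trunc3 (u j x)).congr fun n => (hx n).symm

theorem tendsto_truncHv' (u b : Hv p) :
    Tendsto (fun n : ℕ => truncHv' (K := (n : ℝ) + 1) (by positivity) u b) atTop (𝓝 b) := by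
  refine Hv.tendsto_of_ae (b := b) (c := 2) (fun n j => ?_) fun j => ?_
  · filter_upwards [truncHv'_ae (K := (n : ℝ) + 1) (by positivity) u b j] with x hx
    rw [hx]
    have := (ContinuousLinearMap.le_opNorm (trunc3' ((n : ℝ) + 1) (u j x)) (b j x)).trans
      (mul_le_mul_of_nonneg_right (norm_trunc3'_le _) (norm_nonneg _))
    linarith [norm_sub_le (trunc3' ((n : ℝ) + 1) (u j x) (b j x)) (b j x)]
  · filter_upwards [ae_all_iff.2 fun n : ℕ => truncHv'_ae (K := (n : ℝ) + 1) (by positivity) u b j]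
      with x hx
    exact (tendsto_trunc3' (u j x) (b j x)).congr fun n => (hx n).symm

end Operators

/-! ### Truncation in H_d -/

section SpaceChainRule

theorem integral_truncHv' (hK : 0 < K) (Φ : Hd p) (j : Fin 2) {x : ℝ}
    (hx : x ∈ Icc (p.lo j) (p.hi j)) :
    ∫ y in p.lo j..x, truncHv' hK (toHv Φ) (dX Φ) j y =
      trunc3 K (rep Φ j x) - trunc3 K (rep Φ j (p.lo j)) := by
  have hae : ∀ᵐ y ∂(p.vol j), truncHv' hK (toHv Φ) (dX Φ) j y =
      trunc3' K (rep Φ j y) (dX Φ j y) := by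
    filter_upwards [truncHv'_ae hK (toHv Φ) (dX Φ) j, rep_ae Φ j] with y h1 h2
    rw [h1, h2]
  have hi := L2.intervalIntegrable (truncHv' hK (toHv Φ) (dX Φ) j) hx
  have hi' : IntervalIntegrable (fun y => trunc3' K (rep Φ j y) (dX Φ j y)) volume (p.lo j) x := by
    refine hi.congr_ae ?_
    rw [uIoc_of_le hx.1, ← restrict_Ioo_eq_restrict_Ioc]
    exact ae_mono (Measure.restrict_mono (Ioo_subset_Ioo_right hx.2) le_rfl) hae
  rw [L2.intervalIntegral_congr hae hx]
  exact integral_comp_primitive (hasFDerivAt_trunc3 hK) (lipschitzWith_trunc3 hK 0) hx.1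
    (L2.intervalIntegrable (dX Φ j) hx)
    (fun y hy => (isH1Rep_rep Φ j).2 y ⟨hy.1, hy.2.trans hx.2⟩) hi'

/-- Truncation fixes 0 and is continuous, so the value at the left end and the matching at L₀
survive; the chain rule on each part then identifies the primitive. -/
theorem primFun_truncHv' (hK : 0 < K) (Φ : Hd p) (j : Fin 2) {x : ℝ}
    (hx : x ∈ Icc (p.lo j) (p.hi j)) :
    primFun (truncHv' hK (toHv Φ) (dX Φ)) j x = trunc3 K (rep Φ j x) := by
  have h0 : ∀ x ∈ Icc (p.lo 0) (p.hi 0),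
      primFun (truncHv' hK (toHv Φ) (dX Φ)) 0 x = trunc3 K (rep Φ 0 x) := fun x hx => by
    have e : rep Φ 0 (p.lo 0) = 0 := primFun_zero _
    rw [primFun_eq, primFun_zero, integral_truncHv' hK Φ 0 hx, e, trunc3_zero, sub_zero, zero_add]
  fin_cases j
  · exact h0 x hx
  · have e : rep Φ 0 (p.hi 0) = rep Φ 1 (p.lo 1) := primFun_interface _
    have e1 := primFun_eq (truncHv' hK (toHv Φ) (dX Φ)) 1 x
    have e2 := integral_truncHv' hK Φ 1 hx
    rw [← primFun_interface, h0 _ (p.hi_mem 0), e] at e1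
    refine e1.trans ?_
    rw [e2, add_sub_cancel]
    rfl

/-- Truncation in `H_d`. -/
def truncHd (hK : 0 < K) (Φ : Hd p) : Hd p :=
  mkHd (truncHv' hK (toHv Φ) (dX Φ)) (by
    have e : rep Φ 1 (p.hi 1) = 0 := (primFun_end (dX Φ)).trans (tot_dX Φ)
    rw [← primFun_end, primFun_truncHv' hK Φ 1 (p.hi_mem 1), e, trunc3_zero])

theorem dX_truncHd (hK : 0 < K) (Φ : Hd p) : dX (truncHd hK Φ) = truncHv' hK (toHv Φ) (dX Φ) := rfl

theorem toHv_truncHd (hK : 0 < K) (Φ : Hd p) : toHv (truncHd hK Φ) = truncHv hK (toHv Φ) := by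
  rw [toHv_eq_prim, dX_truncHd]
  refine Hv.ext_ae fun j => ?_
  filter_upwards [prim_ae (truncHv' hK (toHv Φ) (dX Φ)) j, truncHv_ae hK (toHv Φ) j, rep_ae Φ j,
    ae_mem_Icc p j] with x h1 h2 h3 h4
  rw [h1, h2, primFun_truncHv' hK Φ j h4, h3]

attribute [irreducible] truncHd

end SpaceChainRule

end Bresse

namespace Bresse

variable {p : Params} {γ : ℝ → ℝ} {T K : ℝ}

/-! ### The chain rule in time for truncated test functions -/

section TimeChainRule

theorem memLp_truncHv' (hK : 0 < K) {u v : ℝ → Hv p}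
    (hu : ContinuousOn u (Icc 0 T)) (hv : MemLp v 2 (timeMeasure T)) :
    MemLp (fun t => truncHv' hK (u t) (v t)) 2 (timeMeasure T) := by
  refine hv.mono ?_ (Eventually.of_forall fun t => norm_truncHv'_le hK _ _)
  exact (continuous_truncHv' hK).comp_aestronglyMeasurable
    ((aestronglyMeasurable_timeMeasure hu).prodMk hv.1)

/-- The identity is tested with elements of H_d. These are bounded, so `hasFDerivAt_inner_truncHv`
makes each pairing a differentiable Lipschitz functional to which the scalar chain rule applies, and
they separate the points of H_v. -/
theorem truncHv_primitive (hK : 0 < K) {v : ℝ → Hv p} {u₀ : Hv p} (hT : 0 < T)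
    (hv : MemLp v 2 (timeMeasure T))
    (hu : ContinuousOn (fun t => u₀ + ∫ s in (0 : ℝ)..t, v s) (Icc 0 T)) {t : ℝ}
    (ht : t ∈ Icc 0 T) :
    truncHv hK (u₀ + ∫ s in (0 : ℝ)..t, v s) =
      truncHv hK u₀ + ∫ s in (0 : ℝ)..t, truncHv' hK (u₀ + ∫ r in (0 : ℝ)..s, v r) (v s) := by
  obtain ⟨S, hS0, hS⟩ := exists_sup_bound p
  set u : ℝ → Hv p := fun t => u₀ + ∫ s in (0 : ℝ)..t, v s with hudef
  have u0 : u 0 = u₀ := by rw [hudef]; simp only [intervalIntegral.integral_same, add_zero]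
  have hsub : uIcc 0 t ⊆ uIcc 0 T := by
    rw [uIcc_of_le ht.1, uIcc_of_le hT.le]; exact Icc_subset_Icc_right ht.2
  have hvi : IntervalIntegrable v volume 0 t := (intervalIntegrable_of_memLp hT hv).mono_set hsub
  have hGi : IntervalIntegrable (fun s => truncHv' hK (u s) (v s)) volume 0 t :=
    (intervalIntegrable_of_memLp hT (memLp_truncHv' hK hu hv)).mono_set hsub
  refine eq_of_forall_inner_toHv fun ψ => ?_
  have hLip : LipschitzWith ‖toHv ψ‖₊ fun w : Hv p => inner ℝ (truncHv hK w) (toHv ψ) := by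
    refine LipschitzWith.of_dist_le_mul fun w w' => ?_
    rw [Real.dist_eq, ← inner_sub_left, dist_eq_norm, coe_nnnorm, mul_comm]
    exact (abs_real_inner_le_norm _ _).trans
      (mul_le_mul_of_nonneg_right (norm_truncHv_sub_le hK w' w) (norm_nonneg _))
  have e1 : ∀ s, innerSL ℝ (truncHv' hK (u s) (toHv ψ)) (v s) =
      inner ℝ (toHv ψ) (truncHv' hK (u s) (v s)) := fun s => by
    rw [innerSL_apply_apply, inner_truncHv', real_inner_comm]
  have hi2 : IntervalIntegrable (fun s => inner ℝ (toHv ψ) (truncHv' hK (u s) (v s))) volume 0 t :=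
    ⟨(innerSL ℝ (toHv ψ)).integrable_comp hGi.1, (innerSL ℝ (toHv ψ)).integrable_comp hGi.2⟩
  have key := integral_comp_primitive (E := Hv p) (F := ℝ)
    (fun w => hasFDerivAt_inner_truncHv hK (fun j => (hS ψ j).2) w) hLip ht.1 hvi (u := u)
    (fun s _ => by rw [u0]) (by simp only [e1]; exact hi2)
  simp only [e1] at key
  have e2 := (innerSL ℝ (toHv ψ)).intervalIntegral_comp_comm hGi
  simp only [innerSL_apply_apply] at e2
  have e3 := inner_add_left (𝕜 := ℝ) (truncHv hK u₀)
    (∫ s in (0 : ℝ)..t, truncHv' hK (u s) (v s)) (toHv ψ)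
  have e4 := real_inner_comm (toHv ψ) (∫ s in (0 : ℝ)..t, truncHv' hK (u s) (v s))
  rw [u0] at key
  linarith

end TimeChainRule

theorem Hd.norm_sub_le (Φ Ψ : Hd p) : ‖Φ - Ψ‖ ≤ ‖toHv Φ - toHv Ψ‖ + ‖dX Φ - dX Ψ‖ := by
  have h := Hd.norm_le (Φ - Ψ)
  rw [toHv_sub] at h
  exact h

theorem Hd.tendsto {α : Type*} {l : Filter α} {F : α → Hd p} {Φ : Hd p}
    (h1 : Tendsto (fun a => toHv (F a)) l (𝓝 (toHv Φ)))
    (h2 : Tendsto (fun a => dX (F a)) l (𝓝 (dX Φ))) : Tendsto F l (𝓝 Φ) := by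
  rw [tendsto_iff_norm_sub_tendsto_zero] at h1 h2 ⊢
  have h3 := h1.add h2
  rw [add_zero] at h3
  exact squeeze_zero (fun _ => norm_nonneg _) (fun a => Hd.norm_sub_le _ _) h3

theorem continuous_dX : Continuous (dX : Hd p → Hv p) :=
  (dXL p).continuous.congr fun Φ => dXL_apply Φ

theorem continuous_truncHd (hK : 0 < K) : Continuous (truncHd (p := p) hK) := by
  rw [continuous_iff_continuousAt]
  intro Φ
  refine Hd.tendsto ?_ ?_
  · simp only [toHv_truncHd]
    exact ((continuous_truncHv hK).comp continuous_toHv).tendsto Φ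
  · simp only [dX_truncHd]
    exact ((continuous_truncHv' hK).comp (continuous_toHv.prodMk continuous_dX)).tendsto Φ

theorem tendsto_truncHd (Φ : Hd p) :
    Tendsto (fun n : ℕ => truncHd (K := (n : ℝ) + 1) (by positivity) Φ) atTop (𝓝 Φ) := by
  refine Hd.tendsto ?_ ?_
  · simp only [toHv_truncHd]
    exact tendsto_truncHv (toHv Φ)
  · simp only [dX_truncHd]
    exact tendsto_truncHv' (toHv Φ) (dX Φ)

theorem norm_truncHd_le (hK : 0 < K) (Φ : Hd p) : ‖truncHd hK Φ‖ ≤ ‖Φ‖ := by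
  refine (sq_le_sq₀ (norm_nonneg _) (norm_nonneg _)).1 ?_
  rw [Hd.norm_sq, Hd.norm_sq, toHv_truncHd, dX_truncHd]
  exact add_le_add (pow_le_pow_left₀ (norm_nonneg _) (norm_truncHv_le hK _) 2)
    (pow_le_pow_left₀ (norm_nonneg _) (norm_truncHv'_le hK _ _) 2)

theorem shear_truncHd_ae (hK : 0 < K) (Φ : Hd p) : ∀ᵐ x ∂(p.vol 0),
    toHv (truncHd hK Φ) 0 x 1 = trunc K (toHv Φ 0 x 1) := by
  rw [toHv_truncHd]
  filter_upwards [truncHv_ae hK (toHv Φ) 0] with x hx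
  rw [hx, trunc3_apply]

theorem IsTest.trunc {B : ℝ → Hd p} {Bt : ℝ → Hv p} {B₀ : Hv p} (h : IsTest T B Bt B₀) (hT : 0 < T)
    (hK : 0 < K) : IsTest T (fun t => truncHd hK (B t))
      (fun t => truncHv' hK (B₀ + ∫ s in (0 : ℝ)..t, Bt s) (Bt t)) (truncHv hK B₀) where
  mem := h.mem.mono ((continuous_truncHd hK).comp_aestronglyMeasurable h.mem.1)
    (Eventually.of_forall fun t => norm_truncHd_le hK _)
  mem_deriv := memLp_truncHv' hK (h.continuousOn hT) h.mem_deriv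
  deriv := by
    filter_upwards [h.deriv, ae_restrict_mem measurableSet_Ioo] with t h1 ht
    rw [toHv_truncHd, h1]
    exact truncHv_primitive hK hT h.mem_deriv (h.continuousOn hT) (Ioo_subset_Icc_self ht)
  final := by
    rw [← truncHv_primitive hK hT h.mem_deriv (h.continuousOn hT) ⟨hT.le, le_rfl⟩, h.final,
      truncHv_zero]

theorem tendsto_integral_bilinear_of_dominated {E F : Type*} [NormedAddCommGroup E]
    [NormedSpace ℝ E] [NormedAddCommGroup F] [NormedSpace ℝ F] (A : E →L[ℝ] F →L[ℝ] ℝ)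
    {x : ℝ → E} {y : ℝ → F} {yn : ℕ → ℝ → F} (hT : 0 ≤ T)
    (hx : AEStronglyMeasurable x (timeMeasure T))
    (hyn : ∀ n, AEStronglyMeasurable (yn n) (timeMeasure T))
    (hi : Integrable (fun t => ‖x t‖ * ‖y t‖) (timeMeasure T))
    (hb : ∀ n, ∀ᵐ t ∂(timeMeasure T), ‖yn n t‖ ≤ ‖y t‖)
    (hl : ∀ᵐ t ∂(timeMeasure T), Tendsto (fun n => yn n t) atTop (𝓝 (y t))) :
    Tendsto (fun n => ∫ t in (0 : ℝ)..T, A (x t) (yn n t)) atTop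
      (𝓝 (∫ t in (0 : ℝ)..T, A (x t) (y t))) := by
  simp only [intervalIntegral_eq_timeMeasure hT]
  have hc : Continuous fun z : E × F => A z.1 z.2 :=
    (A.continuous.comp continuous_fst).clm_apply continuous_snd
  refine tendsto_integral_of_dominated_convergence (fun t => ‖A‖ * (‖x t‖ * ‖y t‖))
    (fun n => hc.comp_aestronglyMeasurable (hx.prodMk (hyn n))) (hi.const_mul _) (fun n => ?_) ?_
  · filter_upwards [hb n] with t ht
    refine (A.le_opNorm₂ _ _).trans ?_
    rw [mul_assoc]
    exact mul_le_mul_of_nonneg_left (mul_le_mul_of_nonneg_left ht (norm_nonneg _)) A.opNorm_nonneg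
  · filter_upwards [hl] with t ht
    exact ((A (x t)).continuous.tendsto _).comp ht

theorem integrable_norm_mul_norm {E F : Type*} [NormedAddCommGroup E] [NormedAddCommGroup F]
    {x : ℝ → E} {y : ℝ → F} (hT : 0 ≤ T) (hx : ContinuousOn x (Icc 0 T))
    (hy : IntervalIntegrable y volume 0 T) :
    Integrable (fun t => ‖x t‖ * ‖y t‖) (timeMeasure T) :=
  (intervalIntegrable_iff_integrableOn_Ioo_of_le hT).1
    (intervalIntegrable_bilinear (ContinuousLinearMap.mul ℝ ℝ) hT hx.norm hy.norm)

/-- Dominated convergence of the damping term under truncation of the test function. -/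
theorem tendsto_integral_pairing_trunc (hγ : Continuous γ) {V : ℝ → Hv p} {B : ℝ → Hd p}
    (hV : ContinuousOn V (Icc 0 T)) (hB : AEStronglyMeasurable B (timeMeasure T))
    (hd : DampingIntegrable γ T V fun t => toHv (B t)) :
    Tendsto (fun n : ℕ => ∫ t, pairing γ (V t) (toHv (truncHd (K := (n : ℝ) + 1) (by positivity)
      (B t))) ∂(timeMeasure T)) atTop (𝓝 (∫ t, pairing γ (V t) (toHv (B t)) ∂(timeMeasure T))) := by
  have hVm := aestronglyMeasurable_timeMeasure hV
  have hBm : AEStronglyMeasurable (fun t => toHv (B t)) (timeMeasure T) :=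
    continuous_toHv.comp_aestronglyMeasurable hB
  have hψ : Continuous fun z : E3 × E3 => ‖γ (z.1 1) * z.2 1‖ₑ :=
    continuous_enorm.comp (continuous_power hγ)
  have ham := aemeasurable_lintegral_part (p := p) hψ hVm hBm
  have hlt := ae_lt_top' ham (ne_of_lt hd)
  have hpt : ∀ n : ℕ, ∀ t, ∀ᵐ x ∂(p.vol 0), ‖γ (V t 0 x 1) *
      toHv (truncHd (K := (n : ℝ) + 1) (by positivity) (B t)) 0 x 1‖ ≤
      ‖γ (V t 0 x 1) * toHv (B t) 0 x 1‖ := fun n t => by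
    filter_upwards [shear_truncHd_ae (K := (n : ℝ) + 1) (by positivity) (B t)] with x hx
    rw [hx, norm_mul, norm_mul]
    exact mul_le_mul_of_nonneg_left (abs_trunc_le (by positivity) _) (norm_nonneg _)
  refine tendsto_integral_of_dominated_convergence
    (fun t => (∫⁻ x, ‖γ (V t 0 x 1) * toHv (B t) 0 x 1‖ₑ ∂(p.vol 0)).toReal) (fun n => ?_)
    (integrable_toReal_of_lintegral_ne_top ham (ne_of_lt hd)) (fun n => ?_) ?_
  · refine aestronglyMeasurable_pairing hγ hVm (continuous_toHv.comp_aestronglyMeasurable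
      ((continuous_truncHd (by positivity)).comp_aestronglyMeasurable hB)) ?_
    filter_upwards [hlt] with t ht
    exact (integrable_power_of_lintegral hγ ht).mono (aestronglyMeasurable_power hγ _ _) (hpt n t)
  · filter_upwards [hlt] with t ht
    refine (norm_pairing_le _ _).trans (ENNReal.toReal_mono ht.ne (lintegral_mono_ae ?_))
    filter_upwards [hpt n t] with x hx
    rw [enorm_le_iff_norm_le]
    exact hx
  · filter_upwards [hlt] with t ht
    refine tendsto_integral_of_dominated_convergence
      (fun x => ‖γ (V t 0 x 1) * toHv (B t) 0 x 1‖) (fun n => aestronglyMeasurable_power hγ _ _)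
      (integrable_power_of_lintegral hγ ht).norm (fun n => hpt n t) ?_
    filter_upwards [ae_all_iff.2 fun n : ℕ => shear_truncHd_ae (K := (n : ℝ) + 1) (by positivity) (B t)]
      with x hx
    exact ((tendsto_trunc (toHv (B t) 0 x 1)).const_mul _).congr fun n => by rw [hx n]

/-! ### The variational identity for all admissible test functions -/

variable {f g h : Fin 2 → E3 → ℝ} {pot : Fin 2 → E3 → ℝ}

/-- Truncated test functions have bounded shear, so `Assumptions.identity_of_bounded` applies to
them. Truncation increases neither the norms of B and B_t nor |γ(ψ_t) b|, so every term converges by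
dominated convergence, `DampingIntegrable` being the domination of the damping term. -/
theorem Assumptions.identity (A : Assumptions f g h pot γ) (hT : 0 < T) {P : ℝ → Hv p}
    (hP : MemLp P 2 (timeMeasure T)) {Φ₀ : Hd p} {Φ₁ : Hv p} {Φ : ℝ → Hd p} {V : ℝ → Hv p}
    (hg : IsGeneralized p f g h γ T P Φ₀ Φ₁ Φ V) :
    ∃ (φ : Fin 2 → E3 → E3) (C : NNReal) (hφ : ∀ j, LipschitzWith C (φ j)),
      (∀ t ∈ Icc 0 T, ∀ j, ∀ᵐ x ∂(p.vol j), φ j (toHv (Φ t) j x) =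
        feedback f g h j (toHv (Φ t) j x)) ∧
      ∀ (B : ℝ → Hd p) (Bt : ℝ → Hv p) (B₀ : Hv p), IsTest T B Bt B₀ →
        DampingIntegrable γ T V (fun t => toHv (B t)) →
        (∫ t in (0 : ℝ)..T, inner ℝ (P t) (toHv (B t))) -
          (∫ t in (0 : ℝ)..T, inner ℝ (nem hφ (toHv (Φ t))) (toHv (B t))) -
          (∫ t, pairing γ (V t) (toHv (B t)) ∂(timeMeasure T)) -
          (∫ t in (0 : ℝ)..T, aForm p (Φ t) (B t)) + (∫ t in (0 : ℝ)..T, rForm p (V t) (Bt t)) =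
          -rForm p Φ₁ B₀ := by
  obtain ⟨φ, C, hφ, hfb, hid⟩ := A.identity_of_bounded hT hP hg
  refine ⟨φ, C, hφ, hfb, fun B Bt B₀ hB hd => ?_⟩
  obtain ⟨iB, iBt, ib⟩ := hB.integrable hT
  have hbc := hB.continuousOn hT
  have hid' := fun n : ℕ => hid _ _ _ (2 * ((n : ℝ) + 1)) (hB.trunc hT (K := (n : ℝ) + 1)
    (by positivity)) (by positivity) (Eventually.of_forall fun t => by
      filter_upwards [shear_truncHd_ae (K := (n : ℝ) + 1) (by positivity) (B t)] with x hx
      rw [hx]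
      exact abs_trunc_le_two_mul (by positivity) _)
  have hm : ∀ n : ℕ, AEStronglyMeasurable (fun t => truncHd (K := (n : ℝ) + 1) (by positivity)
      (B t)) (timeMeasure T) := fun n =>
    (continuous_truncHd (by positivity)).comp_aestronglyMeasurable hB.mem.1
  have hmv : ∀ n : ℕ, AEStronglyMeasurable (fun t => toHv (truncHd (K := (n : ℝ) + 1)
      (by positivity) (B t))) (timeMeasure T) := fun n =>
    continuous_toHv.comp_aestronglyMeasurable (hm n)
  have hbv : ∀ n : ℕ, ∀ᵐ t ∂(timeMeasure T), ‖toHv (truncHd (K := (n : ℝ) + 1)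
      (by positivity) (B t))‖ ≤ ‖toHv (B t)‖ := fun n => Eventually.of_forall fun t => by
    rw [toHv_truncHd]; exact norm_truncHv_le _ _
  have hlv : ∀ᵐ t ∂(timeMeasure T), Tendsto (fun n : ℕ => toHv (truncHd (K := (n : ℝ) + 1)
      (by positivity) (B t))) atTop (𝓝 (toHv (B t))) := Eventually.of_forall fun t =>
    (continuous_toHv.tendsto _).comp (tendsto_truncHd (B t))
  have hnc := continuousOn_nem hφ hg.mem.cont
  have m1 := tendsto_integral_bilinear_of_dominated (innerSL ℝ) hT.le hP.1 hmv
    ((integrable_norm_mul_norm hT.le hbc (intervalIntegrable_of_memLp hT hP)).congr (by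
      filter_upwards [hB.deriv] with t ht
      rw [ht, mul_comm])) hbv hlv
  have m2 := tendsto_integral_bilinear_of_dominated (innerSL ℝ) hT.le
    (aestronglyMeasurable_timeMeasure hnc) hmv (integrable_norm_mul_norm hT.le hnc ib) hbv hlv
  have m3 := tendsto_integral_pairing_trunc A.cont hg.mem.cont_vel hB.mem.1 hd
  have m4 := tendsto_integral_bilinear_of_dominated (aForm p) hT.le
    (aestronglyMeasurable_timeMeasure hg.mem.cont) hm
    (integrable_norm_mul_norm hT.le hg.mem.cont iB)
    (fun n => Eventually.of_forall fun t => norm_truncHd_le _ _)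
    (Eventually.of_forall fun t => tendsto_truncHd (B t))
  have m5 := tendsto_integral_bilinear_of_dominated (rForm p) hT.le
    (aestronglyMeasurable_timeMeasure hg.mem.cont_vel)
    (fun n : ℕ => (memLp_truncHv' (K := (n : ℝ) + 1) (by positivity) hbc hB.mem_deriv).1)
    (integrable_norm_mul_norm hT.le hg.mem.cont_vel iBt)
    (fun n => Eventually.of_forall fun t => norm_truncHv'_le _ _ _)
    (Eventually.of_forall fun t => tendsto_truncHv' _ (Bt t))
  have m6 := ((rForm p Φ₁).continuous.tendsto B₀).comp (tendsto_truncHv B₀) |>.neg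
  exact tendsto_nhds_unique ((((m1.sub m2).sub m3).sub m4).add m5)
    (m6.congr fun n => (hid' n).symm)

theorem memLp_top_of_continuousOn {E : Type*} [NormedAddCommGroup E] {u : ℝ → E}
    (hu : ContinuousOn u (Icc 0 T)) : MemLp u ⊤ (timeMeasure T) := by
  obtain ⟨M, hM⟩ := isCompact_Icc.exists_bound_of_continuousOn hu
  refine memLp_top_of_bound (aestronglyMeasurable_timeMeasure hu) M ?_
  filter_upwards [ae_restrict_mem measurableSet_Ioo] with t ht using hM t (Ioo_subset_Icc_self ht)

theorem Assumptions.isVariational (A : Assumptions f g h pot γ) (hT : 0 < T) {P : ℝ → Hv p}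
    (hP : MemLp P 2 (timeMeasure T)) {Φ₀ : Hd p} {Φ₁ : Hv p} {Φ : ℝ → Hd p} {V : ℝ → Hv p}
    (hg : IsGeneralized p f g h γ T P Φ₀ Φ₁ Φ V) : IsVariational p f g h γ T P Φ₀ Φ₁ Φ V where
  mem := memLp_top_of_continuousOn hg.mem.cont
  mem_vel := memLp_top_of_continuousOn hg.mem.cont_vel
  deriv := by
    filter_upwards [ae_restrict_mem measurableSet_Ioo] with t ht
    rw [(integral_vel hg.mem.cont_vel hg.mem.deriv le_rfl ht.1.le ht.2.le).2, hg.mem.init]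
    abel
  damping_int := lintegral_abs_damping_lt_top A.cont A.mono A.zero (A.energy_le hT hP hg).1
  eqn B Bt B₀ hB hd := by
    obtain ⟨φ, C, hφ, hfb, hid⟩ := A.identity hT hP hg
    have e := hid B Bt B₀ hB hd
    have e1 : ∫ t in (0 : ℝ)..T, ipR (V t) (Bt t) = ∫ t in (0 : ℝ)..T, rForm p (V t) (Bt t) := by
      simp only [ipR_eq_rForm]
    have e2 : ∫ t in (0 : ℝ)..T, formA (Φ t) (B t) = ∫ t in (0 : ℝ)..T, aForm p (Φ t) (B t) := by
      simp only [formA_eq_aForm]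
    have e3 : ∫ t in (0 : ℝ)..T, ip (P t) (toHv (B t)) =
        ∫ t in (0 : ℝ)..T, inner ℝ (P t) (toHv (B t)) := by
      simp only [ip_eq_inner]
    have e4 : ∫ t in (0 : ℝ)..T, ∑ j, ∫ x in Ioo (p.lo j) (p.hi j),
        inner ℝ (damping γ j (V t j x)) (toHv (B t) j x) =
        ∫ t, pairing γ (V t) (toHv (B t)) ∂(timeMeasure T) := by
      rw [intervalIntegral_eq_timeMeasure hT.le]
      refine integral_congr_ae (Eventually.of_forall fun t => ?_)
      simp only [Fin.sum_univ_two, inner_damping_zero, inner_damping_one, integral_zero, add_zero]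
      rfl
    have e5 : ∫ t in (0 : ℝ)..T, ∑ j, ∫ x in Ioo (p.lo j) (p.hi j),
        inner ℝ (feedback f g h j (toHv (Φ t) j x)) (toHv (B t) j x) =
        ∫ t in (0 : ℝ)..T, inner ℝ (nem hφ (toHv (Φ t))) (toHv (B t)) := by
      refine intervalIntegral.integral_congr fun t ht => ?_
      rw [uIcc_of_le hT.le] at ht
      simp only [← ip_eq_inner, ip]
      refine Finset.sum_congr rfl fun j _ => integral_congr_ae ?_
      filter_upwards [hfb t ht j, nem_ae hφ (toHv (Φ t)) j] with x h1 h2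
      rw [h2, h1]
    rw [e1, e2, e3, e4, e5, ipR_eq_rForm]
    linarith

end Bresse

end

/-! ### The well-posedness theorem -/

theorem mainTheorem1 (p : Bresse.Params) (f g h : Fin 2 → Bresse.E3 → ℝ)
    (hf : ∀ j, Bresse.LipOnBalls (f j)) (hg : ∀ j, Bresse.LipOnBalls (g j))
    (hh : ∀ j, Bresse.LipOnBalls (h j))
    (pot : Fin 2 → Bresse.E3 → ℝ)
    (hpot : ∀ j a, HasGradientAt (pot j) (Bresse.feedback f g h j a) a)
    (hbelow : ∃ δ > 0, ∀ j a, -δ ≤ pot j a)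
    (γ : ℝ → ℝ) (hγ : Continuous γ) (hγmono : Monotone γ) (hγ0 : γ 0 = 0)
    (T : ℝ) (hT : 0 < T)
    (P : ℝ → Bresse.Hv p) (hP : MemLp P 2 (Bresse.timeMeasure T))
    (Φ₀ : Bresse.Hd p) (Φ₁ : Bresse.Hv p) :
    (∃ Φ V, Bresse.IsGeneralized p f g h γ T P Φ₀ Φ₁ Φ V ∧
      ∀ Φ' V', Bresse.IsGeneralized p f g h γ T P Φ₀ Φ₁ Φ' V' →
        EqOn Φ' Φ (Icc 0 T) ∧ EqOn V' V (Icc 0 T)) ∧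
    ∀ Φ V, Bresse.IsGeneralized p f g h γ T P Φ₀ Φ₁ Φ V →
      Bresse.IsVariational p f g h γ T P Φ₀ Φ₁ Φ V ∧
      (Bresse.DampingIntegrable γ T V V ∧ ∀ t ∈ Icc 0 T,
        Bresse.energy pot (Φ t) (V t) + Bresse.dissipation γ V t ≤
          Bresse.energy pot Φ₀ Φ₁ + Bresse.work P V t) ∧
      ((∃ S, Bresse.InDomA Φ₀ S) → (∃ Φ₁' : Bresse.Hd p, Bresse.toHv Φ₁' = Φ₁) →
        (∃ (Pt : ℝ → Bresse.Hv p) (P₀ : Bresse.Hv p),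
          MemLp Pt 2 (Bresse.timeMeasure T) ∧ Bresse.HasTimeDeriv T P Pt P₀) →
        Bresse.IsStrong p f g h γ T P Φ₀ Φ₁ Φ V ∧
        ∀ t ∈ Icc 0 T,
          Bresse.energy pot (Φ t) (V t) + Bresse.dissipation γ V t =
            Bresse.energy pot Φ₀ Φ₁ + Bresse.work P V t) := by
  have A : Bresse.Assumptions f g h pot γ := ⟨hf, hg, hh, hpot, hbelow, hγ, hγmono, hγ0⟩
  obtain ⟨Φ, V, hgen⟩ := A.exists_generalized hT hP Φ₀ Φ₁
  refine ⟨⟨Φ, V, hgen, fun Φ' V' h' => A.generalized_unique hT hP hgen h'⟩, fun Φ V hgen => ?_⟩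
  obtain ⟨hfin, hle⟩ := A.energy_le hT hP hgen
  refine ⟨A.isVariational hT hP hgen, ⟨Bresse.dampingIntegrable_self hγmono hγ0 hfin, hle⟩,
    fun h₀ h₁ hPt => ?_⟩
  have hs := A.strong_of_generalized hT hP hgen h₀ h₁ hPt
  exact ⟨hs, (A.energy_strong hT hP hs).2.2⟩
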